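/- For a finite non-empty set $P\subset\mathbb{R}^d$ and $\epsilon>0$, call a set $K\subseteq\mathbb{R}^d$ *$\epsilon$-heavy* (with respect to $P$) if $|P\cap K|\ge \epsilon|P|$. A finite set $Q\subset\mathbb{R}^d$ is a *weak $\epsilon$-net* for $P$ with respect to convex sets if every $\epsilon$-heavy convex set contains a point of $Q$ (the points of $Q$ need not belong to $P$). Let $f_d(\epsilon)$ be the smallest integer $f>0$ such that every finite non-empty $P\subset\mathbb{R}^d$ has a weak $\epsilon$-net with respect to convex sets consisting of at most $f$ points. **Theorem.** For every $\gamma>0$, $$f_2(\epsilon)=O\left(\frac{1}{\epsilon^{3/2+\gamma}}\right).$$ More precisely, for every $\gamma>0$ there is a constant $C>0$, depending only on $\gamma$, such that $f_2(\epsilon)\le C/\epsilon^{3/2+\gamma}$ for all $0<\epsilon\le 1$, and such that for every $\epsilon>0$ every finite non-empty set $P\subset\mathbb{R}^2$ has a weak $\epsilon$-net with respect to convex sets of cardinality at most $C/\epsilon^{3/2+\gamma}$. -/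

import Mathlib

/-- A set `K` in `ℝ^d` is `ε`-heavy with respect to the finite point set `P` if
`|P ∩ K| ≥ ε |P|`. -/
def IsHeavy {d : ℕ} (P : Finset (EuclideanSpace ℝ (Fin d))) (ε : ℝ)
    (K : Set (EuclideanSpace ℝ (Fin d))) : Prop :=
  ε * (P.card : ℝ) ≤ (((P : Set (EuclideanSpace ℝ (Fin d))) ∩ K).ncard : ℝ)

/-- `Q` is a weak `ε`-net for `P` with respect to convex sets: it pierces every `ε`-heavy
convex set. The points of `Q` need not belong to `P`. -/
def IsWeakNet {d : ℕ} (P : Finset (EuclideanSpace ℝ (Fin d))) (ε : ℝ)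
    (Q : Finset (EuclideanSpace ℝ (Fin d))) : Prop :=
  ∀ K : Set (EuclideanSpace ℝ (Fin d)), Convex ℝ K → IsHeavy P ε K → ∃ q ∈ Q, q ∈ K

/-- `f_d(ε)`: the smallest number `f > 0` such that, for every finite (non-empty) point set `P`
in `ℝ^d`, all `ε`-heavy convex sets can be pierced by at most `f` points of `ℝ^d`.
The value is `⊤` if there is no such number. -/
noncomputable def weakNetNumber (d : ℕ) (ε : ℝ) : ℕ∞ :=
  sInf {f : ℕ∞ | 0 < f ∧ ∀ P : Finset (EuclideanSpace ℝ (Fin d)), P.Nonempty →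
    ∃ Q : Finset (EuclideanSpace ℝ (Fin d)), (Q.card : ℕ∞) ≤ f ∧ IsWeakNet P ε Q}

/-! Write `x = 1/ε` and `n = |P|`. The bound comes from a recursion on `x`. Vertical walls cut the
plane into `m` slabs with at most `2n/m` points each, and the nets of the slabs for the density
parameter `4kx/m` are united. This costs `m` times the bound at `4kx/m`; as the exponent `3/2 + γ`
exceeds 1, a large constant `m` makes the recursion contract (`exists_netBound_step`,
`exists_netBound_rpow`). It remains to pierce, with `O(x^(3/2+γ))` points, the heavy sets `S` that
have many points in each of `k = 2R + 1` slabs. A net for trapezoids takes care of all hulls that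
contain a populous trapezoid. The other sets have many points above the upper chord (or, after
reflection, below the lower chord) of their hull in each of `R` merged slabs
(`exists_rich_pattern`), and the number of wall patterns is constant.

For one pattern, linear programming duality (`exists_piercing_or_measure`) gives either `O(T)`
points on the walls piercing all these hulls, or a probability measure on the hulls for which every
point of the walls in question lies in hulls of mass at most `1/T`. The measure is refuted for `T =
x^(3/2)` in `exists_wall_net`. The points of each slab are partitioned into about `M` classes such
that a hull touches about `√M` of them. So every `S` has, in each slab, about `√M` groups of `g ≈
n/(x√M)` points, each inside one class. The lines through two points of a group are its axes. All
hulls together use at most `n²/M` such pairs, while one hull uses about `g²√M ≈ n²/(x²√M)`. Since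
hulls contain no populous trapezoid, most axes pass above any given point of the hull in another
slab. Look at the heights at which lines through two points of `P` meet the last wall, and count
those between the bottom of the hull and an axis. A segment from a point of the pair to such a
height meets the next wall in one point, so the mass bound applies, and double counting shows that
the typical count grows by a factor of about `T√M/x²` from each slab to the one on its left. For `M`
slightly above `x` this is a positive power of `x`, and after `R` slabs the count would exceed `n²`.
The trapezoid net needed here has about `x√M` points, again about `x^(3/2)`.

The partition is `exists_iterated_partition`. Reweighting gives classes such that each of a few test
lines crosses `O(√r log r)` of them (`exists_partition_lines`). A convex set crossing the slab and
avoiding finitely many fixed points is covered, up to cells of the test lines, by nine segments from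
one point (`exists_nine_segments`), and a segment is controlled by at most three test lines, each
shifted up and down (`exists_three_lines`). Iterating with a large constant `r` reduces the loss to
`r^η` per level. General position is removed by perturbation and compactness
(`NetBound.exists_net`). -/

/-! ### Set families of polynomial growth and their small nets. -/

open Finset in
/-- A family of sets has growth exponent `D` if it has at most `(|X|+1)^D` traces on any finite
set `X`. -/
def PolyGrowth {α : Type*} [DecidableEq α] (𝓡 : Set (Set α)) (D : ℕ) : Prop :=
  ∀ X : Finset α, ∃ 𝒜 : Finset (Finset α), 𝒜.card ≤ (X.card + 1) ^ D ∧
    ∀ R ∈ 𝓡, ∃ T ∈ 𝒜, ∀ a, a ∈ T ↔ a ∈ X ∧ a ∈ R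

/-- Pairwise intersections of members of two families. -/
def interFamily {α : Type*} (𝓡 𝓢 : Set (Set α)) : Set (Set α) :=
  {A | ∃ R ∈ 𝓡, ∃ S ∈ 𝓢, A = R ∩ S}

theorem PolyGrowth.inter {α : Type*} [DecidableEq α] {𝓡 𝓢 : Set (Set α)} {D E : ℕ}
    (h : PolyGrowth 𝓡 D) (h' : PolyGrowth 𝓢 E) : PolyGrowth (interFamily 𝓡 𝓢) (D + E) := by
  intro X
  obtain ⟨A, hA, hA'⟩ := h X
  obtain ⟨B, hB, hB'⟩ := h' X
  refine ⟨(A ×ˢ B).image (fun p => p.1 ∩ p.2), ?_, ?_⟩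
  · refine Finset.card_image_le.trans ?_
    rw [Finset.card_product, pow_add]
    exact Nat.mul_le_mul hA hB
  · rintro _ ⟨R, hR, S, hS, rfl⟩
    obtain ⟨T, hT, hT'⟩ := hA' R hR
    obtain ⟨U, hU, hU'⟩ := hB' S hS
    refine ⟨T ∩ U, Finset.mem_image.2 ⟨(T, U), by simp [hT, hU], rfl⟩, fun a => ?_⟩
    simp only [Finset.mem_inter, hT', hU', Set.mem_inter_iff]; tauto

theorem PolyGrowth.compl {α : Type*} [DecidableEq α] {𝓡 : Set (Set α)} {D : ℕ}
    (h : PolyGrowth 𝓡 D) : PolyGrowth {A | Aᶜ ∈ 𝓡} D := by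
  intro X
  obtain ⟨A, hA, hA'⟩ := h X
  refine ⟨A.image (fun T => X \ T), Finset.card_image_le.trans hA, fun R hR => ?_⟩
  obtain ⟨T, hT, hT'⟩ := hA' _ hR
  refine ⟨X \ T, Finset.mem_image_of_mem _ hT, fun a => ?_⟩
  simp only [Finset.mem_sdiff, hT', Set.mem_compl_iff]; tauto

theorem PolyGrowth.mono {α : Type*} [DecidableEq α] {𝓡 𝓢 : Set (Set α)} {D : ℕ}
    (h : PolyGrowth 𝓡 D) (hs : 𝓢 ⊆ 𝓡) : PolyGrowth 𝓢 D := by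
  intro X
  obtain ⟨A, hA, hA'⟩ := h X
  exact ⟨A, hA, fun R hR => hA' R (hs hR)⟩

/-- Few samples meet a heavy set rarely. -/
theorem card_few_hits {β : Type*} [Fintype β] [DecidableEq β] (R : Finset β) (δ : ℝ) (s k : ℕ)
    (hR : δ * Fintype.card β ≤ R.card) (hk : 2 * ((k : ℝ) + 1) ≤ δ * s) :
    (2 : ℝ) * ((Finset.univ.filter (fun y : Fin s → β =>
      (Finset.univ.filter (fun i => y i ∈ R)).card < k)).card : ℝ) ≤ (Fintype.card β : ℝ) ^ s := by
  set n : ℝ := (Fintype.card β : ℝ) with hn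
  -- Exponential moment: a sample is weighted by 2 to the power minus its number of hits. The total
  -- weight factors over the coordinates, and samples with fewer than `k` hits have large weight.
  have hsum : ∑ y : Fin s → β, ∏ i, (if y i ∈ R then (1/2 : ℝ) else 1)
      = (n - R.card / 2) ^ s := by
    rw [← Fintype.prod_sum (fun (_ : Fin s) (b : β) => if b ∈ R then (1/2 : ℝ) else 1)]
    simp only [Finset.prod_const, Finset.card_univ, Fintype.card_fin]
    congr 1
    have : ∀ b : β, (if b ∈ R then (1/2 : ℝ) else 1) = 1 - (if b ∈ R then (1/2 : ℝ) else 0) :=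
      fun b => by split_ifs <;> norm_num
    simp_rw [this]
    rw [Finset.sum_sub_distrib, ← Finset.sum_filter]
    simp [hn]; ring
  have h1 : ((Finset.univ.filter (fun y : Fin s → β =>
      (Finset.univ.filter (fun i => y i ∈ R)).card < k)).card : ℝ) * (1/2)^k ≤
      ∑ y : Fin s → β, ∏ i, (if y i ∈ R then (1/2 : ℝ) else 1) := by
    rw [← nsmul_eq_mul, ← Finset.sum_const]
    refine (Finset.sum_le_sum (fun y hy => ?_)).trans
      (Finset.sum_le_sum_of_subset_of_nonneg (Finset.filter_subset _ _) ?_)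
    · rw [Finset.prod_ite]
      simp only [Finset.prod_const, one_pow, mul_one]
      exact pow_le_pow_of_le_one (by norm_num) (by norm_num) (Finset.mem_filter.1 hy).2.le
    · intro y _ _
      exact Finset.prod_nonneg fun i _ => by split_ifs <;> norm_num
  have hRn : (R.card : ℝ) ≤ n := by rw [hn]; exact_mod_cast Finset.card_le_univ R
  have hn0 : 0 ≤ n := by positivity
  have h2 : (n - R.card / 2) ^ s ≤ n ^ s * (1/2)^(k+1) := by
    have h3 : n - R.card / 2 ≤ n * Real.exp (-(δ/2)) := by
      have := Real.add_one_le_exp (-(δ/2))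
      nlinarith
    calc (n - R.card / 2) ^ s ≤ (n * Real.exp (-(δ/2))) ^ s :=
          pow_le_pow_left₀ (by linarith [(Nat.cast_nonneg R.card : (0:ℝ) ≤ R.card)]) h3 _
      _ = n ^ s * Real.exp (-(δ * s/2)) := by
          rw [mul_pow, ← Real.exp_nat_mul]; ring_nf
      _ ≤ n ^ s * Real.exp (-((k+1 : ℕ) : ℝ)) := by
          gcongr; push_cast; linarith
      _ ≤ n ^ s * (1/2)^(k+1) := by
          gcongr
          rw [show -((k+1 : ℕ) : ℝ) = ((k+1 : ℕ) : ℝ) * (-1) by ring, Real.exp_nat_mul]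
          gcongr
          rw [Real.exp_neg, one_div]
          gcongr
          linarith [Real.add_one_le_exp (1:ℝ)]
  have h4 : (0:ℝ) < (1/2)^k := by positivity
  rw [hsum] at h1
  have h5 := h1.trans h2
  rw [pow_succ] at h5
  have : ((Finset.univ.filter (fun y : Fin s → β =>
      (Finset.univ.filter (fun i => y i ∈ R)).card < k)).card : ℝ) ≤ n^s * (1/2) := by
    by_contra hcon
    push Not at hcon
    nlinarith
  linarith

/-- Sign patterns prescribed on a set of coordinates. -/
theorem card_prescribed {s : ℕ} (J : Finset (Fin s)) (f : Fin s → Bool) :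
    (Finset.univ.filter (fun τ : Fin s → Bool => ∀ i ∈ J, τ i = f i)).card = 2 ^ (s - J.card) := by
  have : Finset.univ.filter (fun τ : Fin s → Bool => ∀ i ∈ J, τ i = f i) =
      Fintype.piFinset (fun i => if i ∈ J then {f i} else Finset.univ) := by
    ext τ
    simp only [Finset.mem_filter, Finset.mem_univ, true_and, Fintype.mem_piFinset]
    refine forall_congr' fun i => ?_
    by_cases h : i ∈ J <;> simp [h]
  rw [this, Fintype.card_piFinset]
  simp only [apply_ite Finset.card, Finset.card_singleton, Finset.card_univ, Fintype.card_bool]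
  rw [Finset.prod_ite]
  simp only [Finset.prod_const_one, one_mul, Finset.prod_const]
  congr 1
  rw [Finset.filter_not, Finset.card_sdiff]
  simp

/-- Double sampling: a family of polynomial growth has a small net among the points of a finite
type. -/
theorem exists_net_function {β : Type*} [Fintype β] [DecidableEq β] {𝓡 : Set (Set β)} {D : ℕ}
    (hG : PolyGrowth 𝓡 D) (δ : ℝ) (s k : ℕ) (hβ : Nonempty β)
    (hk : 2 * ((k : ℝ) + 1) ≤ δ * s) (hs : 2 * (2 * s + 1) ^ D < 2 ^ k) :
    ∃ x : Fin s → β, ∀ R ∈ 𝓡, δ * Fintype.card β ≤ (Nat.card R : ℝ) → ∃ i, x i ∈ R := by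
  classical
  -- Suppose every sample `x` misses a heavy set `R x`. The pairs `(x, y)` for which `y` meets `R x`
  -- at least `k` times are at least half of all pairs; yet random coordinate swaps of any fixed
  -- pair give such a pair less than half of the time.
  by_contra hcon
  push Not at hcon
  choose R hR hheavy hmiss using hcon
  let B : Finset ((Fin s → β) × (Fin s → β)) :=
    Finset.univ.filter (fun z => k ≤ (Finset.univ.filter (fun i => z.2 i ∈ R z.1)).card)
  set n : ℕ := Fintype.card β with hn
  have hn0 : 0 < n := Fintype.card_pos
  have hlow : n ^ s * n ^ s ≤ 2 * B.card := by
    have hx : ∀ x : Fin s → β, n ^ s ≤ 2 * (Finset.univ.filter (fun y : Fin s → β =>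
        k ≤ (Finset.univ.filter (fun i => y i ∈ R x)).card)).card := by
      intro x
      have h1 := card_few_hits (R x).toFinset δ s k
        (by rw [← Nat.card_eq_card_toFinset]; exact hheavy x) hk
      have h2 := Finset.card_filter_add_card_filter_not (s := (Finset.univ : Finset (Fin s → β)))
        (fun y => (Finset.univ.filter (fun i => y i ∈ (R x).toFinset)).card < k)
      simp only [Set.mem_toFinset, not_lt, Finset.card_univ, Fintype.card_pi, Finset.prod_const,
        Fintype.card_fin] at h1 h2
      have h3 : 2 * (Finset.univ.filter (fun y : Fin s → β =>
        (Finset.univ.filter (fun i => y i ∈ R x)).card < k)).card ≤ n ^ s := by exact_mod_cast h1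
      rw [← hn] at h2
      omega
    have hB : B.card = ∑ x : Fin s → β, (Finset.univ.filter (fun y : Fin s → β =>
        k ≤ (Finset.univ.filter (fun i => y i ∈ R x)).card)).card := by
      simp only [B, Finset.card_filter, ← Finset.univ_product_univ, Finset.sum_product]
    rw [hB, Finset.mul_sum]
    calc n ^ s * n ^ s = ∑ x : Fin s → β, n ^ s := by simp [hn]
      _ ≤ _ := Finset.sum_le_sum fun x _ => hx x
  let sw : (Fin s → Bool) → ((Fin s → β) × (Fin s → β)) → ((Fin s → β) × (Fin s → β)) :=
    fun τ z => (fun i => if τ i then z.2 i else z.1 i, fun i => if τ i then z.1 i else z.2 i)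
  have hsw : ∀ τ, Function.Involutive (sw τ) := by
    intro τ z
    ext i <;> by_cases h : τ i <;> simp [sw, h]
  have hup : ∀ z, 2 * (Finset.univ.filter (fun τ => sw τ z ∈ B)).card < 2 ^ s := by
    intro z
    obtain ⟨𝒜, h𝒜, htr⟩ := hG (Finset.univ.image z.1 ∪ Finset.univ.image z.2)
    have hc : (Finset.univ.image z.1 ∪ Finset.univ.image z.2).card ≤ 2 * s := by
      refine (Finset.card_union_le _ _).trans ?_
      have h1 := Finset.card_image_le (s := Finset.univ) (f := z.1)
      have h2 := Finset.card_image_le (s := Finset.univ) (f := z.2)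
      simp at h1 h2
      omega
    let J : Finset β → Finset (Fin s) := fun T => Finset.univ.filter (fun i => z.1 i ∈ T ∨ z.2 i ∈ T)
    -- If the swapped pair is in `B`, its first half misses the chosen set, so `τ` is forced at
    -- every index where one of the two samples has a point of the trace `T`. There are at least `k`
    -- such indices, so each trace admits at most a `2^(-k)` share of the swaps.
    have hsub : Finset.univ.filter (fun τ => sw τ z ∈ B) ⊆
        (𝒜.filter (fun T => k ≤ (J T).card)).biUnion (fun T => Finset.univ.filter
          (fun τ : Fin s → Bool => ∀ i ∈ J T, τ i = decide (z.1 i ∈ T))) := by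
      intro τ hτ
      simp only [Finset.mem_filter, Finset.mem_univ, true_and, B] at hτ
      obtain ⟨T, hT, hT'⟩ := htr _ (hR (sw τ z).1)
      have hm := hmiss (sw τ z).1
      have m1 : ∀ i, z.1 i ∈ T ↔ z.1 i ∈ R (sw τ z).1 := fun i => by simp [hT']
      have m2 : ∀ i, z.2 i ∈ T ↔ z.2 i ∈ R (sw τ z).1 := fun i => by simp [hT']
      simp only [Finset.mem_biUnion, Finset.mem_filter, Finset.mem_univ, true_and]
      refine ⟨T, ⟨hT, hτ.trans (Finset.card_le_card ?_)⟩, ?_⟩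
      · intro i hi
        simp only [Finset.mem_filter, Finset.mem_univ, true_and, J, m1, m2] at hi ⊢
        by_cases h : τ i
        · left; simpa [sw, h] using hi
        · right; simpa [sw, h] using hi
      · intro i hi
        simp only [Finset.mem_filter, Finset.mem_univ, true_and, J, m1, m2] at hi ⊢
        have := hm i
        by_cases h : τ i
        · have h' : z.2 i ∉ R (sw τ z).1 := by
            intro hh; apply this; convert hh using 1; simp [sw, h]
          simp [h, hi.resolve_right h']
        · have h' : z.1 i ∉ R (sw τ z).1 := by
            intro hh; apply this; convert hh using 1; simp [sw, h]
          simp [h, h']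
    have h1 := (Finset.card_le_card hsub).trans Finset.card_biUnion_le
    have h2 : ∑ T ∈ 𝒜.filter (fun T => k ≤ (J T).card), (Finset.univ.filter
          (fun τ : Fin s → Bool => ∀ i ∈ J T, τ i = decide (z.1 i ∈ T))).card * 2 ^ k ≤
          (2 * s + 1) ^ D * 2 ^ s := by
      calc _ ≤ ∑ T ∈ 𝒜.filter (fun T => k ≤ (J T).card), 2 ^ s := by
            refine Finset.sum_le_sum fun T hT => ?_
            rw [card_prescribed, ← pow_add]
            refine Nat.pow_le_pow_right (by norm_num) ?_
            have h3 := (Finset.mem_filter.1 hT).2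
            have h4 := Finset.card_le_univ (J T)
            simp at h4
            omega
        _ ≤ _ := by
            rw [Finset.sum_const, smul_eq_mul]
            refine Nat.mul_le_mul_right _ ?_
            refine (Finset.card_filter_le _ _).trans (h𝒜.trans ?_)
            exact Nat.pow_le_pow_left (by omega) _
    rw [← Finset.sum_mul] at h2
    have h3 := (Nat.mul_le_mul_right (2 ^ k) h1).trans h2
    have h4 : 0 < 2 ^ s := by positivity
    by_contra hh
    push Not at hh
    have h5 : 2 ^ s * 2 ^ k ≤ 2 ^ s * (2 * (2 * s + 1) ^ D) := by
      have := Nat.mul_le_mul_right (2 ^ k) hh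
      linarith
    have h6 := Nat.le_of_mul_le_mul_left h5 h4
    omega
  have hcount : ∑ z, (Finset.univ.filter (fun τ => sw τ z ∈ B)).card = 2 ^ s * B.card := by
    simp only [Finset.card_filter]
    rw [Finset.sum_comm]
    have : ∀ τ, ∑ z, (if sw τ z ∈ B then 1 else 0) = B.card := by
      intro τ
      have := Equiv.sum_comp (hsw τ).toPerm (fun z => if z ∈ B then 1 else 0)
      simp only [Function.Involutive.coe_toPerm] at this
      refine Eq.trans (Finset.sum_congr rfl fun z _ => ?_) (this.trans (by simp))
      congr
    simp [this]
  have hlt : ∑ z, 2 * (Finset.univ.filter (fun τ => sw τ z ∈ B)).card <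
      ∑ z : (Fin s → β) × (Fin s → β), 2 ^ s :=
    Finset.sum_lt_sum_of_nonempty
      ⟨(fun _ => hβ.some, fun _ => hβ.some), Finset.mem_univ _⟩ (fun z _ => hup z)
  rw [← Finset.mul_sum, hcount] at hlt
  simp only [Finset.sum_const, Finset.card_univ, Fintype.card_prod, Fintype.card_pi,
    Finset.prod_const, Fintype.card_fin, smul_eq_mul, ← hn] at hlt
  have := Nat.mul_le_mul_right (2 ^ s) hlow
  nlinarith

/-- Form used for plane ranges, with the family traced on the subtype of `X`. A range counts as
heavy through any part `Y` of `X` inside it; requiring `Y` nonempty excludes the degenerate case of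
empty `X`. -/
theorem PolyGrowth.exists_net {α : Type*} [DecidableEq α] {𝓡 : Set (Set α)} {D : ℕ}
    (hG : PolyGrowth 𝓡 D) (δ : ℝ) (s k : ℕ)
    (hk : 2 * ((k : ℝ) + 1) ≤ δ * s) (hs : 2 * (2 * s + 1) ^ D < 2 ^ k) (X : Finset α) :
    ∃ A ⊆ X, A.card ≤ s ∧ ∀ R ∈ 𝓡, ∀ Y ⊆ X, (∀ y ∈ Y, y ∈ R) → Y.Nonempty →
      δ * X.card ≤ Y.card → ∃ a ∈ A, a ∈ R := by
  classical
  rcases X.eq_empty_or_nonempty with rfl | hX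
  · refine ⟨∅, by simp, by simp, fun R _ Y hY _ hne _ => ?_⟩
    rw [Finset.subset_empty.1 hY] at hne
    simp at hne
  have hG' : PolyGrowth {A : Set X | ∃ R ∈ 𝓡, A = Subtype.val ⁻¹' R} D := by
    intro Y
    obtain ⟨𝒜, h1, h2⟩ := hG (Y.image Subtype.val)
    rw [Finset.card_image_of_injective _ Subtype.val_injective] at h1
    refine ⟨𝒜.image (fun T => Y.filter (fun y => y.1 ∈ T)), Finset.card_image_le.trans h1, ?_⟩
    rintro _ ⟨R, hR, rfl⟩
    obtain ⟨T, hT, hT'⟩ := h2 R hR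
    refine ⟨_, Finset.mem_image_of_mem _ hT, fun a => ?_⟩
    simp only [Finset.mem_filter, hT', Finset.mem_image, Set.mem_preimage]
    constructor
    · rintro ⟨h, _, h'⟩; exact ⟨h, h'⟩
    · rintro ⟨h, h'⟩; exact ⟨h, ⟨a, h, rfl⟩, h'⟩
  obtain ⟨x, hx⟩ := exists_net_function hG' δ s k hX.to_subtype hk hs
  refine ⟨Finset.univ.image (fun i => (x i).1), ?_, ?_, ?_⟩
  · intro a ha
    obtain ⟨i, _, rfl⟩ := Finset.mem_image.1 ha
    exact (x i).2
  · exact Finset.card_image_le.trans (by simp)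
  · intro R hR Y hY hYR _ hc
    obtain ⟨i, hi⟩ := hx _ ⟨R, hR, rfl⟩ (by
      rw [Fintype.card_coe]
      refine hc.trans ?_
      have : Y.card ≤ Nat.card (Subtype.val ⁻¹' R : Set X) := by
        rw [← Nat.card_eq_finsetCard Y]
        refine Nat.card_le_card_of_injective
          (fun y => ⟨⟨y.1, hY y.2⟩, hYR _ y.2⟩ : Y → (Subtype.val ⁻¹' R : Set X)) ?_
        intro a b hab
        exact Subtype.ext (congrArg (fun z => z.1.1) hab)
      exact_mod_cast this)
    exact ⟨x i, by simp, hi⟩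

/-- The parameters of `exists_net` can be chosen so that the net has size `O(δ^{-1-η})`. -/
theorem exists_net_parameters (D : ℕ) (η : ℝ) (hη : 0 < η) :
    ∃ C : ℝ, 0 < C ∧ ∀ δ : ℝ, 0 < δ → δ ≤ 1 → ∃ s k : ℕ, (s : ℝ) ≤ C * δ ^ (-1 - η) ∧
      2 * ((k : ℝ) + 1) ≤ δ * s ∧ 2 * (2 * s + 1) ^ D < 2 ^ k := by
  -- Since `1/δ ≤ k ^ m`, the quantity `(2s + 1) ^ D` is bounded by a polynomial in `k` of fixed
  -- degree, hence by `2 ^ k` for large `k`. The logarithm of the usual bound for nets is absorbed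
  -- in `δ ^ (-η)`.
  obtain ⟨m, hm⟩ := exists_nat_ge (1 / η)
  have hev : ∀ᶠ k : ℕ in Filter.atTop, 2 * (13 * k ^ (m + 1)) ^ D < 2 ^ k := by
    have h := tendsto_pow_const_div_const_pow_of_one_lt ((m + 1) * D) (r := (2:ℝ)) (by norm_num)
    have h2 := (h.eventually (gt_mem_nhds (show (0:ℝ) < 1 / (2 * 13 ^ D) by positivity)))
    filter_upwards [h2] with k hk
    rw [div_lt_div_iff₀ (by positivity) (by positivity)] at hk
    have : (2 : ℝ) * (13 * k ^ (m + 1)) ^ D < 2 ^ k := by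
      rw [mul_pow, ← pow_mul]; linarith
    exact_mod_cast this
  obtain ⟨K, hK⟩ := Filter.eventually_atTop.1 hev
  refine ⟨7 * (K + 2), by positivity, fun δ hδ hδ1 => ?_⟩
  have hp : 1 ≤ δ ^ (-η) := by
    rw [Real.rpow_neg hδ.le]
    exact (one_le_inv₀ (by positivity)).2 (Real.rpow_le_one hδ.le hδ1 hη.le)
  set k : ℕ := ⌈((K : ℝ) + 1) * δ ^ (-η)⌉₊ with hkdef
  have hk1 : ((K : ℝ) + 1) * δ ^ (-η) ≤ k := Nat.le_ceil _
  have hk2 : (k : ℝ) < ((K : ℝ) + 1) * δ ^ (-η) + 1 := Nat.ceil_lt_add_one (by positivity)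
  have hkK : (K : ℝ) + 1 ≤ k := by nlinarith [(Nat.cast_nonneg K : (0:ℝ) ≤ K)]
  have hkK' : K ≤ k := by exact_mod_cast (by linarith : (K : ℝ) ≤ k)
  have hk1' : (1 : ℝ) ≤ k := by linarith [(Nat.cast_nonneg K : (0:ℝ) ≤ K)]
  set s : ℕ := ⌈2 * ((k : ℝ) + 1) / δ⌉₊ with hsdef
  have hs1 : 2 * ((k : ℝ) + 1) / δ ≤ s := Nat.le_ceil _
  have hs2 : (s : ℝ) < 2 * ((k : ℝ) + 1) / δ + 1 := Nat.ceil_lt_add_one (by positivity)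
  have hdi : 1 ≤ 1 / δ := by rw [le_div_iff₀ hδ]; linarith
  have hs4 : (s : ℝ) ≤ 5 * k / δ := by
    have h1 : 2 * ((k : ℝ) + 1) / δ + 1 ≤ 2 * ((k : ℝ) + 1) / δ + 1 / δ := by linarith
    refine hs2.le.trans (h1.trans ?_)
    rw [← add_div]
    gcongr
    linarith
  refine ⟨s, k, ?_, ?_, ?_⟩
  · refine hs4.trans ?_
    rw [show (-1 - η : ℝ) = -η + (-1) by ring, Real.rpow_add hδ, Real.rpow_neg_one]
    rw [div_eq_mul_inv, ← mul_assoc]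
    have : (5 : ℝ) * k ≤ 7 * (K + 2) * δ ^ (-η) := by
      nlinarith [(Nat.cast_nonneg K : (0:ℝ) ≤ K)]
    gcongr
  · rw [div_le_iff₀ hδ] at hs1; linarith
  · have hd : 1 / δ ≤ (k : ℝ) ^ m := by
      have h1 : δ ^ (-η) ≤ k := by nlinarith [(Nat.cast_nonneg K : (0:ℝ) ≤ K)]
      calc 1 / δ = (δ ^ (-η)) ^ (1 / η) := by
            rw [← Real.rpow_mul hδ.le]
            rw [show -η * (1 / η) = -1 by field_simp, Real.rpow_neg_one, one_div]
        _ ≤ (k : ℝ) ^ (1 / η) := by gcongr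
        _ ≤ (k : ℝ) ^ (m : ℝ) := Real.rpow_le_rpow_of_exponent_le hk1' hm
        _ = _ := Real.rpow_natCast _ _
    have h2 : ((2 * s + 1 : ℕ) : ℝ) ≤ ((13 * k ^ (m + 1) : ℕ) : ℝ) := by
      push_cast
      have h3 : 5 * k / δ = 5 * k * (1 / δ) := by ring
      have h4 : (1:ℝ) ≤ k ^ (m + 1) := one_le_pow₀ hk1'
      have h5 : (k : ℝ) * (1 / δ) ≤ k ^ (m + 1) := by
        rw [pow_succ']; gcongr
      nlinarith
    have h3 : 2 * s + 1 ≤ 13 * k ^ (m + 1) := by exact_mod_cast h2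
    exact lt_of_le_of_lt (Nat.mul_le_mul_left 2 (Nat.pow_le_pow_left h3 D)) (hK k hkK')

/-! ### Half-planes. -/

/-- Open half-planes of `ℝ × ℝ` (the empty set and the whole plane included). -/
def halfPlanes : Set (Set (ℝ × ℝ)) :=
  {H | ∃ a b c : ℝ, H = {p | 0 < a * p.1 + b * p.2 + c}}

theorem convex_halfPlane (a b c : ℝ) : Convex ℝ {p : ℝ × ℝ | 0 < a * p.1 + b * p.2 + c} := by
  intro p hp q hq s t hs ht hst
  simp only [Set.mem_ofPred_eq, Prod.fst_add, Prod.smul_fst, Prod.snd_add, Prod.smul_snd,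
    smul_eq_mul] at *
  rcases hs.eq_or_lt with rfl | hs
  · have : t = 1 := by linarith
    subst this; simpa using hq
  · have : c = (s + t) * c := by rw [hst, one_mul]
    rw [this]
    nlinarith [mul_pos hs hp, mul_nonneg ht hq.le]

theorem convex_halfPlane_compl (a b c : ℝ) :
    Convex ℝ {p : ℝ × ℝ | 0 < a * p.1 + b * p.2 + c}ᶜ := by
  intro p hp q hq s t hs ht hst
  simp only [Set.mem_compl_iff, not_lt, Set.mem_ofPred_eq, Prod.fst_add, Prod.smul_fst,
    Prod.snd_add, Prod.smul_snd, smul_eq_mul] at *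
  have : c = (s + t) * c := by rw [hst, one_mul]
  rw [this]
  nlinarith [mul_nonneg hs (neg_nonneg.2 hp), mul_nonneg ht (neg_nonneg.2 hq)]

/-- By Radon's theorem four points split into two parts with intersecting hulls; a half-plane and
its complement are convex, so no four points are shattered. By Pajor's inequality there are at most
as many traces as shattered sets, here sets of at most three points. -/
theorem polyGrowth_halfPlanes : PolyGrowth halfPlanes 3 := by
  classical
  intro X
  let 𝒜 : Finset (Finset (ℝ × ℝ)) :=
    X.powerset.filter (fun T => ∃ R ∈ halfPlanes, ∀ a, a ∈ T ↔ a ∈ X ∧ a ∈ R)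
  refine ⟨𝒜, ?_, fun R hR => ⟨X.filter (· ∈ R), ?_, by simp⟩⟩
  · refine 𝒜.card_le_card_shatterer.trans ?_
    have hsub : 𝒜.shatterer ⊆ (Finset.range 4).biUnion (fun k => X.powersetCard k) := by
      intro s hs
      rw [Finset.mem_shatterer] at hs
      simp only [Finset.mem_biUnion, Finset.mem_range, Finset.mem_powersetCard]
      refine ⟨s.card, ?_, ?_, rfl⟩
      · by_contra hcon
        have hna : ¬ AffineIndependent ℝ (fun x : s => (x : ℝ × ℝ)) := by
          intro h
          have := h.card_le_finrank_succ
          have h2 : Module.finrank ℝ (vectorSpan ℝ (Set.range (fun x : s => (x : ℝ × ℝ)))) ≤ 2 := by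
            refine (Submodule.finrank_le _).trans ?_
            simp
          rw [Fintype.card_coe] at this
          omega
        obtain ⟨I, z, hz1, hz2⟩ := Convex.radon_partition hna
        obtain ⟨u, hu, hsu⟩ := hs (t := s.filter (fun x => ∃ h : x ∈ s, ⟨x, h⟩ ∈ I))
          (Finset.filter_subset _ _)
        obtain ⟨_, R, ⟨a, b, c, rfl⟩, hR⟩ := Finset.mem_filter.1 hu
        have hX : ∀ x ∈ s, x ∈ X := by
          intro x hx
          obtain ⟨v, hv, hsv⟩ := hs (t := s) subset_rfl
          have : x ∈ s ∩ v := by rw [hsv]; exact hx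
          exact Finset.mem_powerset.1 (Finset.mem_filter.1 hv).1 (Finset.mem_inter.1 this).2
        have key : ∀ x : s, x ∈ I ↔ x.1 ∈ {p : ℝ × ℝ | 0 < a * p.1 + b * p.2 + c} := by
          intro x
          have h1 : x.1 ∈ s ∩ u ↔ x.1 ∈ s.filter (fun x => ∃ h : x ∈ s, ⟨x, h⟩ ∈ I) := by rw [hsu]
          simp only [Finset.mem_inter, hR, Finset.mem_filter, Finset.coe_mem, true_and, hX x.1 x.2,
            exists_true_left, Subtype.coe_eta] at h1
          exact h1.symm
        have c1 := convexHull_min (s := (fun x : s => (x : ℝ × ℝ)) '' I) (by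
          rintro _ ⟨x, hx, rfl⟩; exact (key x).1 hx) (convex_halfPlane a b c) hz1
        have c2 := convexHull_min (s := (fun x : s => (x : ℝ × ℝ)) '' Iᶜ) (by
          rintro _ ⟨x, hx, rfl⟩; exact fun h => hx ((key x).2 h)) (convex_halfPlane_compl a b c) hz2
        exact c2 c1
      · obtain ⟨u, hu, hsu⟩ := hs.exists_superset
        exact hsu.trans (Finset.mem_powerset.1 (Finset.mem_filter.1 hu).1)
    refine (Finset.card_le_card hsub).trans (Finset.card_biUnion_le.trans ?_)
    simp only [Finset.card_powersetCard]
    calc _ ≤ ∑ k ∈ Finset.range 4, X.card ^ k :=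
          Finset.sum_le_sum fun k _ => Nat.choose_le_pow _ _
      _ ≤ _ := by
          simp only [Finset.sum_range_succ, Finset.sum_range_zero]
          ring_nf
          nlinarith [Nat.zero_le X.card, Nat.zero_le (X.card ^ 2)]
  · simp only [𝒜, Finset.mem_filter, Finset.mem_powerset, Finset.filter_subset, true_and]
    exact ⟨R, hR, fun a => Iff.rfl⟩

/-! ### Lines as pairs of slope and intercept, their crossings, and sectors. -/

/-- The value at `x` of the non-vertical line with slope `ℓ.1` and intercept `ℓ.2`. -/
def lineVal (ℓ : ℝ × ℝ) (x : ℝ) : ℝ := ℓ.1 * x + ℓ.2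

/-- Signed vertical distance from the line `ℓ` to the point `p`. -/
def height (ℓ p : ℝ × ℝ) : ℝ := p.2 - lineVal ℓ p.1

/-- Crossing point of two lines. -/
noncomputable def cross (ℓ m : ℝ × ℝ) : ℝ × ℝ :=
  ((m.2 - ℓ.2) / (ℓ.1 - m.1), lineVal ℓ ((m.2 - ℓ.2) / (ℓ.1 - m.1)))

/-- The line through two points with distinct abscissae. -/
noncomputable def through (p q : ℝ × ℝ) : ℝ × ℝ :=
  ((q.2 - p.2) / (q.1 - p.1), p.2 - (q.2 - p.2) / (q.1 - p.1) * p.1)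

/-- The crossing point of the diagonals of the quadrilateral spanned by consecutive crossings of
five lines. -/
noncomputable def diagCross (a b c d e : ℝ × ℝ) : ℝ × ℝ :=
  cross (through (cross a b) (cross c d)) (through (cross b c) (cross d e))

theorem lineVal_through_left (p q : ℝ × ℝ) : lineVal (through p q) p.1 = p.2 := by
  simp [lineVal, through]

theorem lineVal_through_right {p q : ℝ × ℝ} (h : p.1 ≠ q.1) :
    lineVal (through p q) q.1 = q.2 := by
  have : q.1 - p.1 ≠ 0 := sub_ne_zero.2 h.symm
  simp only [lineVal, through]
  field_simp
  ring

theorem eq_cross {ℓ m : ℝ × ℝ} (h : ℓ ≠ m) {p : ℝ × ℝ} (h1 : height ℓ p = 0)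
    (h2 : height m p = 0) : p = cross ℓ m := by
  simp only [height, lineVal] at h1 h2
  have hs : ℓ.1 - m.1 ≠ 0 := by
    intro h0
    apply h
    have : ℓ.1 = m.1 := by linarith
    refine Prod.ext this ?_
    rw [this] at h1; linarith
  have hx : p.1 = (m.2 - ℓ.2) / (ℓ.1 - m.1) := by
    rw [eq_div_iff hs]; linarith
  refine Prod.ext hx ?_
  simp only [cross, lineVal, ← hx]; linarith

theorem lineVal_cross {ℓ m : ℝ × ℝ} (h : ℓ.1 ≠ m.1) :
    lineVal m (cross ℓ m).1 = (cross ℓ m).2 := by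
  have : ℓ.1 - m.1 ≠ 0 := sub_ne_zero.2 h
  simp only [cross, lineVal]
  field_simp
  ring

theorem height_combo (ℓ p q : ℝ × ℝ) {s t : ℝ} (h : s + t = 1) :
    height ℓ (s • p + t • q) = s * height ℓ p + t * height ℓ q := by
  simp only [height, lineVal, Prod.fst_add, Prod.snd_add, Prod.smul_fst, Prod.smul_snd, smul_eq_mul]
  linear_combination ℓ.2 * h

/-- Crossing a line inside a convex set while staying on one side of another line. -/
theorem exists_height_zero {K : Set (ℝ × ℝ)} (hK : Convex ℝ K) (ℓ m : ℝ × ℝ) {p q : ℝ × ℝ}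
    (hp : p ∈ K) (hq : q ∈ K) (h1 : 0 < height ℓ p) (h2 : height ℓ q ≤ 0) (G : Prop)
    (hm : 0 < height m p ↔ G) (hm' : 0 < height m q ↔ G) :
    ∃ z ∈ K, height ℓ z = 0 ∧ (0 < height m z ↔ G) := by
  set a := height ℓ p
  set b := height ℓ q
  have hab : 0 < a - b := by linarith
  have hst : (-b) / (a - b) + a / (a - b) = 1 := by field_simp; ring
  have hs : 0 ≤ (-b) / (a - b) := div_nonneg (by linarith) hab.le
  have ht : 0 < a / (a - b) := div_pos h1 hab
  refine ⟨((-b) / (a - b)) • p + (a / (a - b)) • q, hK hp hq hs ht.le hst, ?_, ?_⟩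
  · rw [height_combo _ _ _ hst]
    field_simp
    ring
  · rw [height_combo _ _ _ hst]
    by_cases hG : G
    · have e1 := hm.2 hG
      have e2 := hm'.2 hG
      refine iff_of_true ?_ hG
      nlinarith [mul_pos ht e2, mul_nonneg hs e1.le]
    · have e1 := not_lt.1 (mt hm.1 hG)
      have e2 := not_lt.1 (mt hm'.1 hG)
      refine iff_of_false ?_ hG
      nlinarith [mul_nonneg ht.le (neg_nonneg.2 e2), mul_nonneg hs (neg_nonneg.2 e1)]

/-- A convex set meeting all four sectors of two lines contains their common point. -/
theorem cross_mem_of_four {K : Set (ℝ × ℝ)} (hK : Convex ℝ K) {ℓ m : ℝ × ℝ} (hne : ℓ ≠ m)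
    {a b c d : ℝ × ℝ} (ha : a ∈ K) (hb : b ∈ K) (hc : c ∈ K) (hd : d ∈ K)
    (a1 : 0 < height ℓ a) (a2 : 0 < height m a) (b1 : 0 < height ℓ b) (b2 : ¬ 0 < height m b)
    (c1 : ¬ 0 < height ℓ c) (c2 : 0 < height m c) (d1 : ¬ 0 < height ℓ d)
    (d2 : ¬ 0 < height m d) : cross ℓ m ∈ K := by
  -- The line `m` is met inside `K` at a point `z` above `ℓ` and at a point `w` not above `ℓ`;
  -- between them on `m` lies the crossing.
  obtain ⟨z, hz, z1, z2⟩ := exists_height_zero hK m ℓ ha hb a2 (not_lt.1 b2) True (by simp [a1])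
    (by simp [b1])
  obtain ⟨w, hw, w1, w2⟩ := exists_height_zero hK m ℓ hc hd c2 (not_lt.1 d2) False (by simpa using c1)
    (by simpa using d1)
  have z2' : 0 < height ℓ z := by simpa using z2
  have w2' : height ℓ w ≤ 0 := by simpa using w2
  obtain ⟨v, hv, v1, -⟩ := exists_height_zero (hK.inter (t := {p | height m p = 0})
    (by
      intro p hp q hq s t hs ht hst
      simp only [Set.mem_ofPred_eq] at *
      rw [height_combo _ _ _ hst, hp, hq]; ring)) ℓ m ⟨hz, z1⟩ ⟨hw, w1⟩ z2' w2' False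
        (by simp [z1]) (by simp [w1])
  rw [← eq_cross hne v1 hv.2]
  exact hv.1

/-- The same with the four sectors described relative to arbitrary reference sides. -/
theorem cross_mem_of_sectors {K : Set (ℝ × ℝ)} (hK : Convex ℝ K) {ℓ m : ℝ × ℝ} (hne : ℓ ≠ m)
    {F G : Prop} {a b c d : ℝ × ℝ} (ha : a ∈ K) (hb : b ∈ K) (hc : c ∈ K) (hd : d ∈ K)
    (a1 : 0 < height ℓ a ↔ F) (a2 : 0 < height m a ↔ G)
    (b1 : 0 < height ℓ b ↔ F) (b2 : ¬ (0 < height m b ↔ G))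
    (c1 : ¬ (0 < height ℓ c ↔ F)) (c2 : 0 < height m c ↔ G)
    (d1 : ¬ (0 < height ℓ d ↔ F)) (d2 : ¬ (0 < height m d ↔ G)) : cross ℓ m ∈ K := by
  by_cases hF : F <;> by_cases hG : G <;>
    simp only [hF, hG, iff_true, iff_false, not_not] at a1 a2 b1 b2 c1 c2 d1 d2
  · exact cross_mem_of_four hK hne ha hb hc hd a1 a2 b1 b2 c1 c2 d1 d2
  · exact cross_mem_of_four hK hne hb ha hd hc b1 b2 a1 a2 d1 d2 c1 c2
  · exact cross_mem_of_four hK hne hc hd ha hb c1 c2 d1 d2 a1 a2 b1 b2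
  · exact cross_mem_of_four hK hne hd hc hb ha d1 d2 c1 c2 b1 b2 a1 a2

/-- Two affine functions on `[0,1]` which change sides in opposite directions. -/
theorem opposite_sides {f₀ f₁ g₀ g₁ : ℝ} {F G : Prop} (a1 : 0 < f₀ ↔ F) (a2 : ¬ (0 < f₁ ↔ F))
    (b1 : ¬ (0 < g₀ ↔ G)) (b2 : 0 < g₁ ↔ G) :
    ∃ t : ℝ, 0 ≤ t ∧ t ≤ 1 ∧
      (((0 < (1 - t) * f₀ + t * f₁ ↔ F) ∧ (0 < (1 - t) * g₀ + t * g₁ ↔ G)) ∨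
       (¬ (0 < (1 - t) * f₀ + t * f₁ ↔ F) ∧ ¬ (0 < (1 - t) * g₀ + t * g₁ ↔ G)) ∨
       ((1 - t) * f₀ + t * f₁ = 0 ∧ (1 - t) * g₀ + t * g₁ = 0)) := by
  -- An affine function changing sign on `[0,1]` is `x - y` times the distance to its zero. Between
  -- the two zeros both functions are on their reference sides or both are off, according to the
  -- order of the zeros.
  have key : ∀ (x y : ℝ) , (x ≤ 0 ∧ 0 < y ∨ 0 < x ∧ y ≤ 0) → ∃ t : ℝ, 0 ≤ t ∧ t ≤ 1 ∧ 
      ∀ u, (1 - u) * x + u * y = (x - y) * (t - u) := by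
    intro x y h
    have hne : x - y ≠ 0 := by rcases h with ⟨h1, h2⟩ | ⟨h1, h2⟩ <;> intro h <;> linarith
    refine ⟨x / (x - y), ?_, ?_, fun u => by field_simp; ring⟩
    · rcases h with ⟨h1, h2⟩ | ⟨h1, h2⟩
      · exact div_nonneg_of_nonpos h1 (by linarith)
      · exact div_nonneg h1.le (by linarith)
    · rcases h with ⟨h1, h2⟩ | ⟨h1, h2⟩
      · rw [div_le_one_of_neg (by linarith)]; linarith
      · rw [div_le_one (by linarith)]; linarith
  have sgn : ∀ (d e : ℝ), 0 < d → 0 < e → (0 < d * e) ∧ ¬ (0 < d * (-e)) ∧ ¬ (0 < (-d) * e) ∧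
      (0 < (-d) * (-e)) := by
    intro d e hd he
    have := mul_pos hd he
    refine ⟨this, ?_, ?_, ?_⟩ <;> simp <;> linarith
  have hf : f₀ ≤ 0 ∧ 0 < f₁ ∨ 0 < f₀ ∧ f₁ ≤ 0 := by
    by_cases hF : F <;> simp [hF] at a1 a2 <;> tauto
  have hg : g₀ ≤ 0 ∧ 0 < g₁ ∨ 0 < g₀ ∧ g₁ ≤ 0 := by
    by_cases hG : G <;> simp [hG] at b1 b2 <;> tauto
  obtain ⟨t, t0, t1, ht⟩ := key _ _ hf
  obtain ⟨u, u0, u1, hu⟩ := key _ _ hg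
  rcases lt_trichotomy t u with h | h | h
  · refine ⟨(t + u) / 2, by linarith, by linarith, Or.inr (Or.inl ?_)⟩
    rw [ht, hu]
    have e : 0 < (u - t) / 2 := by linarith
    rw [show t - (t + u) / 2 = -((u - t) / 2) by ring, show u - (t + u) / 2 = (u - t) / 2 by ring]
    constructor
    · by_cases hF : F <;> simp only [hF, iff_true, iff_false, not_not] at a1 a2 ⊢
      · exact (sgn _ _ (by linarith) e).2.1
      · have := (sgn (-(f₀ - f₁)) _ (by linarith) e).2.2.2
        simpa using this
    · by_cases hG : G <;> simp only [hG, iff_true, iff_false, not_not] at b1 b2 ⊢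
      · have := (sgn (-(g₀ - g₁)) _ (by linarith) e).2.2.1
        simpa using this
      · exact (sgn _ _ (by linarith) e).1
  · exact ⟨t, t0, t1, Or.inr (Or.inr ⟨by rw [ht]; ring, by rw [hu, h]; ring⟩)⟩
  · refine ⟨(t + u) / 2, by linarith, by linarith, Or.inl ?_⟩
    rw [ht, hu]
    have e : 0 < (t - u) / 2 := by linarith
    rw [show t - (t + u) / 2 = (t - u) / 2 by ring, show u - (t + u) / 2 = -((t - u) / 2) by ring]
    constructor
    · by_cases hF : F <;> simp only [hF, iff_true, iff_false, not_not] at a1 a2 ⊢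
      · exact (sgn _ _ (by linarith) e).1
      · have := (sgn (-(f₀ - f₁)) _ (by linarith) e).2.2.1
        simpa using this
    · by_cases hG : G <;> simp only [hG, iff_true, iff_false, not_not] at b1 b2 ⊢
      · have := (sgn (-(g₀ - g₁)) _ (by linarith) e).2.2.2
        simpa using this
      · exact (sgn _ _ (by linarith) e).2.1

/-! ### Covering a convex set by nine segments. -/

/-- The point `q` lies in the same cell of the arrangement `𝓛` as a point of the segment `[u,v]`. -/
def CoveredBy (𝓛 : Finset (ℝ × ℝ)) (u v q : ℝ × ℝ) : Prop :=
  ∃ y ∈ segment ℝ u v, ∀ ℓ ∈ 𝓛, (0 < height ℓ y ↔ 0 < height ℓ q)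

theorem convex_side (ℓ u v : ℝ × ℝ) (G : Prop) :
    Convex ℝ {t : ℝ | (0 ≤ t ∧ t ≤ 1) ∧ (0 < height ℓ ((1 - t) • u + t • v) ↔ G)} := by
  have hh : ∀ t : ℝ, height ℓ ((1 - t) • u + t • v) = (1 - t) * height ℓ u + t * height ℓ v :=
    fun t => height_combo ℓ u v (by ring)
  simp only [hh]
  rintro t ⟨ht, ht'⟩ r ⟨hr, hr'⟩ a b ha hb hab
  have hc : (1 - (a • t + b • r)) * height ℓ u + (a • t + b • r) * height ℓ v =
      a * ((1 - t) * height ℓ u + t * height ℓ v) + b * ((1 - r) * height ℓ u + r * height ℓ v) := by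
    simp only [smul_eq_mul]; linear_combination (-height ℓ u) * hab
  refine ⟨(convex_Icc (0:ℝ) 1) ht hr ha hb hab, ?_⟩
  rw [hc]
  by_cases hG : G
  · simp only [hG, iff_true] at *
    exact (convex_Ioi (0:ℝ)) ht' hr' ha hb hab
  · simp only [hG, iff_false, not_lt] at *
    exact (convex_Iic (0:ℝ)) ht' hr' ha hb hab

/-- If no line cuts both `u` and `v` off from `q`, then for each line the points of `[u, v]` on the
side of `q` form a nonempty interval of parameters. Two such intervals meet, since otherwise `K`
would meet all four sectors of two lines and contain their crossing. Helly's theorem on the line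
then gives a point of `[u, v]` in the cell of `q`. -/
theorem exists_separating {𝓛 : Finset (ℝ × ℝ)} {K : Set (ℝ × ℝ)} (hK : Convex ℝ K)
    (hdbl : ∀ ℓ ∈ 𝓛, ∀ m ∈ 𝓛, ℓ ≠ m → cross ℓ m ∉ K) {u v q : ℝ × ℝ} (hu : u ∈ K) (hv : v ∈ K)
    (hq : q ∈ K) (h : ¬ CoveredBy 𝓛 u v q) :
    ∃ ℓ ∈ 𝓛, ¬ (0 < height ℓ u ↔ 0 < height ℓ q) ∧ ¬ (0 < height ℓ v ↔ 0 < height ℓ q) := by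
  classical
  by_contra hcon
  simp only [not_exists, not_and, not_not] at hcon
  have hag : ∀ ℓ ∈ 𝓛, (0 < height ℓ u ↔ 0 < height ℓ q) ∨ (0 < height ℓ v ↔ 0 < height ℓ q) := by
    intro ℓ hℓ
    by_cases h1 : (0 < height ℓ u ↔ 0 < height ℓ q)
    · exact Or.inl h1
    · exact Or.inr (hcon ℓ hℓ h1)
  let C : ℝ × ℝ → Set ℝ := fun ℓ => {t : ℝ | (0 ≤ t ∧ t ≤ 1) ∧
    (0 < height ℓ ((1 - t) • u + t • v) ↔ 0 < height ℓ q)}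
  have hh : ∀ ℓ (t : ℝ), height ℓ ((1 - t) • u + t • v) = (1 - t) * height ℓ u + t * height ℓ v :=
    fun ℓ t => height_combo ℓ u v (by ring)
  have hmix : ∀ ℓ ∈ 𝓛, ∀ m ∈ 𝓛, (0 < height ℓ u ↔ 0 < height ℓ q) →
      ¬ (0 < height ℓ v ↔ 0 < height ℓ q) → ¬ (0 < height m u ↔ 0 < height m q) →
      (0 < height m v ↔ 0 < height m q) → (C ℓ ∩ C m).Nonempty := by
    intro ℓ hℓ m hm a1 a2 b1 b2
    have hne : ℓ ≠ m := by rintro rfl; exact b1 a1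
    obtain ⟨t, t0, t1, ht⟩ := opposite_sides a1 a2 b1 b2
    simp only [← hh] at ht
    have hy : (1 - t) • u + t • v ∈ K := hK hu hv (by linarith) t0 (by ring)
    rcases ht with ht | ht | ht
    · exact ⟨t, ⟨⟨t0, t1⟩, ht.1⟩, ⟨⟨t0, t1⟩, ht.2⟩⟩
    · exact absurd (cross_mem_of_sectors hK hne hq hu hv hy Iff.rfl Iff.rfl a1 b1 a2 b2 ht.1 ht.2)
        (hdbl ℓ hℓ m hm hne)
    · refine absurd ?_ (hdbl ℓ hℓ m hm hne)
      rw [← eq_cross hne ht.1 ht.2]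
      exact hy
  have hpair : ∀ ℓ ∈ 𝓛, ∀ m ∈ 𝓛, (C ℓ ∩ C m).Nonempty := by
    intro ℓ hℓ m hm
    have e0 : ∀ k, (0 < height k u ↔ 0 < height k q) → (0:ℝ) ∈ C k := by
      intro k hk; exact ⟨⟨le_rfl, zero_le_one⟩, by simpa using hk⟩
    have e1 : ∀ k, (0 < height k v ↔ 0 < height k q) → (1:ℝ) ∈ C k := by
      intro k hk; exact ⟨⟨zero_le_one, le_rfl⟩, by simpa using hk⟩
    by_cases a1 : (0 < height ℓ u ↔ 0 < height ℓ q)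
    · by_cases b1 : (0 < height m u ↔ 0 < height m q)
      · exact ⟨0, e0 _ a1, e0 _ b1⟩
      · have b2 := (hag m hm).resolve_left b1
        by_cases a2 : (0 < height ℓ v ↔ 0 < height ℓ q)
        · exact ⟨1, e1 _ a2, e1 _ b2⟩
        · exact hmix ℓ hℓ m hm a1 a2 b1 b2
    · have a2 := (hag ℓ hℓ).resolve_left a1
      by_cases b2 : (0 < height m v ↔ 0 < height m q)
      · exact ⟨1, e1 _ a2, e1 _ b2⟩
      · have b1 := (hag m hm).resolve_right b2
        rw [Set.inter_comm]
        exact hmix m hm ℓ hℓ b1 b2 a1 a2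
  have hne : (⋂ ℓ ∈ 𝓛, C ℓ).Nonempty := by
    refine Convex.helly_theorem' (𝕜 := ℝ) (fun ℓ _ => convex_side ℓ u v _) ?_
    intro I hI hc
    simp only [Module.finrank_self] at hc
    have h3 : I.card = 0 ∨ I.card = 1 ∨ I.card = 2 := by omega
    rcases h3 with h3 | h3 | h3
    · rw [Finset.card_eq_zero.1 h3]; simp
    · obtain ⟨a, rfl⟩ := Finset.card_eq_one.1 h3
      have ha := hI (Finset.mem_singleton_self a)
      simpa using hpair a ha a ha
    · obtain ⟨a, b, -, rfl⟩ := Finset.card_eq_two.1 h3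
      simpa using hpair a (hI (by simp)) b (hI (by simp))
  obtain ⟨t, ht⟩ := hne
  simp only [Set.mem_iInter] at ht
  by_cases hL : 𝓛.Nonempty
  · obtain ⟨ℓ, hℓ⟩ := hL
    have h01 := (ht ℓ hℓ).1
    exact h ⟨(1 - t) • u + t • v, ⟨1 - t, t, by linarith [h01.2], h01.1, by ring, rfl⟩,
      fun m hm => (ht m hm).2⟩
  · rw [Finset.not_nonempty_iff_eq_empty] at hL
    exact h ⟨u, left_mem_segment _ _ _, by simp [hL]⟩

open Classical in
/-- The lines of `𝓛` separating `u` from `v`. -/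
noncomputable def sepLines (𝓛 : Finset (ℝ × ℝ)) (u v : ℝ × ℝ) : Finset (ℝ × ℝ) :=
  𝓛.filter (fun ℓ => ¬ (0 < height ℓ u ↔ 0 < height ℓ v))

theorem mem_sepLines {𝓛 : Finset (ℝ × ℝ)} {u v ℓ : ℝ × ℝ} :
    ℓ ∈ sepLines 𝓛 u v ↔ ℓ ∈ 𝓛 ∧ ¬ (0 < height ℓ u ↔ 0 < height ℓ v) := by
  simp [sepLines]

/-- A line separating `L` from some point of the segment `[L, w]` also separates `L` from the end
`w`. -/
theorem sepLines_subset_of_coveredBy {𝓛 : Finset (ℝ × ℝ)} {L w q : ℝ × ℝ}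
    (h : CoveredBy 𝓛 L w q) : sepLines 𝓛 L q ⊆ sepLines 𝓛 L w := by
  obtain ⟨y, ⟨a, b, ha, hb, hab, rfl⟩, hy⟩ := h
  intro ℓ hℓ
  rw [mem_sepLines] at hℓ ⊢
  refine ⟨hℓ.1, fun hw => hℓ.2 ?_⟩
  rw [← hy ℓ hℓ.1, height_combo _ _ _ hab]
  by_cases hG : 0 < height ℓ L
  · have := hw.1 hG
    refine iff_of_true hG ?_
    exact (convex_Ioi (0:ℝ)) hG this ha hb hab
  · have := mt hw.2 hG
    refine iff_of_false hG (not_lt.2 ?_)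
    exact (convex_Iic (0:ℝ)) (not_lt.1 hG) (not_lt.1 this) ha hb hab

/-- A finite set is covered by a subset whose members do not cover each other. -/
theorem exists_uncovered_subset (𝓛 : Finset (ℝ × ℝ)) (L : ℝ × ℝ) (U : Finset (ℝ × ℝ)) :
    ∃ W ⊆ U, (∀ w ∈ W, ∀ w' ∈ W, w ≠ w' → ¬ CoveredBy 𝓛 L w w') ∧
      ∀ q ∈ U, ∃ w ∈ W, CoveredBy 𝓛 L w q := by
  classical
  induction U using Finset.strongInduction with
  | H U ih =>
    rcases U.eq_empty_or_nonempty with rfl | hU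
    · exact ⟨∅, by simp, by simp, by simp⟩
    -- Take `u` separated from `L` by the most lines. If some `w` covered `u`, then by maximality
    -- the same lines would separate `w` and `u` from `L`, so both would lie in one cell and `u`
    -- would cover `w`.
    obtain ⟨u, hu, hmax⟩ := U.exists_max_image (fun u => (sepLines 𝓛 L u).card) hU
    have huu : CoveredBy 𝓛 L u u := ⟨u, right_mem_segment _ _ _, fun _ _ => Iff.rfl⟩
    have hss : U.filter (fun q => ¬ CoveredBy 𝓛 L u q) ⊂ U := by
      refine Finset.filter_ssubset.2 ⟨u, hu, by simpa using huu⟩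
    obtain ⟨W, hW, hW1, hW2⟩ := ih _ hss
    refine ⟨insert u W, ?_, ?_, ?_⟩
    · intro w hw
      rcases Finset.mem_insert.1 hw with rfl | hw
      · exact hu
      · exact hss.1 (hW hw)
    · have hnot : ∀ w ∈ W, ¬ CoveredBy 𝓛 L w u := by
        intro w hw hc
        have hwU := Finset.mem_filter.1 (hW hw)
        have heq := Finset.eq_of_subset_of_card_le (sepLines_subset_of_coveredBy hc) (hmax w hwU.1)
        apply hwU.2
        refine ⟨u, right_mem_segment _ _ _, fun ℓ hℓ => ?_⟩
        have := Finset.ext_iff.1 heq ℓ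
        simp only [mem_sepLines, hℓ, true_and] at this
        tauto
      intro w hw w' hw' hne
      rcases Finset.mem_insert.1 hw with rfl | h1 <;> rcases Finset.mem_insert.1 hw' with rfl | h2
      · exact absurd rfl hne
      · exact (Finset.mem_filter.1 (hW h2)).2
      · exact hnot w h1
      · exact hW1 w h1 w' h2 hne
    · intro q hq
      by_cases hc : CoveredBy 𝓛 L u q
      · exact ⟨u, by simp, hc⟩
      · obtain ⟨w, hw, hwc⟩ := hW2 q (by simp [hq, hc])
        exact ⟨w, by simp [hw], hwc⟩

/-- Each member of an uncovered set is isolated by a line. -/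
theorem exists_isolating {𝓛 : Finset (ℝ × ℝ)} {K : Set (ℝ × ℝ)} (hK : Convex ℝ K)
    (hdbl : ∀ ℓ ∈ 𝓛, ∀ m ∈ 𝓛, ℓ ≠ m → cross ℓ m ∉ K) {L u : ℝ × ℝ} (hL : L ∈ K) (hu : u ∈ K)
    (F : Finset (ℝ × ℝ)) (hF : ∀ z ∈ F, z ∈ K ∧ ¬ CoveredBy 𝓛 L z u) (hne : F.Nonempty) :
    ∃ ℓ ∈ 𝓛, ¬ (0 < height ℓ L ↔ 0 < height ℓ u) ∧
      ∀ z ∈ F, ¬ (0 < height ℓ z ↔ 0 < height ℓ u) := by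
  classical
  have hS : (sepLines 𝓛 L u).Nonempty := by
    obtain ⟨z, hz⟩ := hne
    obtain ⟨ℓ, hℓ, h1, -⟩ := exists_separating hK hdbl hL (hF z hz).1 hu (hF z hz).2
    exact ⟨ℓ, mem_sepLines.2 ⟨hℓ, h1⟩⟩
  -- Among the lines cutting `L` off from `u`, take one with the fewest points of `F` on the side of
  -- `u`. If `z` is still there, a line `m` cutting off both `L` and `z` is strictly better: a point
  -- `y` on the side of `u` for `m` but not for `ℓ` would place `u, z, y, L` in the four sectors.
  obtain ⟨ℓ, hℓ, hmin⟩ := Finset.exists_min_image _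
    (fun ℓ => (F.filter (fun z => (0 < height ℓ z ↔ 0 < height ℓ u))).card) hS
  obtain ⟨hℓ1, hℓ2⟩ := mem_sepLines.1 hℓ
  refine ⟨ℓ, hℓ1, hℓ2, fun z hz hside => ?_⟩
  obtain ⟨m, hm, m1, m2⟩ := exists_separating hK hdbl hL (hF z hz).1 hu (hF z hz).2
  have hne' : ℓ ≠ m := by rintro rfl; exact m2 hside
  have hlt : (F.filter (fun z => (0 < height m z ↔ 0 < height m u))).card <
      (F.filter (fun z => (0 < height ℓ z ↔ 0 < height ℓ u))).card := by
    refine Finset.card_lt_card (Finset.ssubset_iff_subset_ne.2 ⟨?_, ?_⟩)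
    · intro y hy
      rw [Finset.mem_filter] at hy ⊢
      refine ⟨hy.1, ?_⟩
      by_contra hcon
      exact hdbl ℓ hℓ1 m hm hne' (cross_mem_of_sectors hK hne' hu (hF z hz).1 (hF y hy.1).1 hL
        Iff.rfl Iff.rfl hside m2 hcon hy.2 hℓ2 m1)
    · intro heq
      have : z ∈ F.filter (fun z => (0 < height m z ↔ 0 < height m u)) := by
        rw [heq]; simp [hz, hside]
      exact m2 (Finset.mem_filter.1 this).2
  exact absurd (hmin m (mem_sepLines.2 ⟨hm, m1⟩)) (not_le.2 hlt)

theorem lineVal_interp {ℓ m : ℝ × ℝ} {a b x : ℝ} (ha : lineVal m a ≤ lineVal ℓ a)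
    (hb : lineVal m b ≤ lineVal ℓ b) (h1 : a ≤ x) (h2 : x ≤ b) : lineVal m x ≤ lineVal ℓ x := by
  simp only [lineVal] at *
  rcases le_total m.1 ℓ.1 with h | h
  · nlinarith [mul_nonneg (sub_nonneg.2 h) (sub_nonneg.2 h1)]
  · nlinarith [mul_nonneg (sub_nonneg.2 h) (sub_nonneg.2 h2)]

theorem lineVal_sub (ℓ : ℝ × ℝ) (a x : ℝ) : lineVal ℓ x = lineVal ℓ a + ℓ.1 * (x - a) := by
  simp only [lineVal]; ring

/-- A chord of a convex set lying below a line. -/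
theorem exists_mem_le_line {K : Set (ℝ × ℝ)} (hK : Convex ℝ K) {a b : ℝ × ℝ} (ha : a ∈ K)
    (hb : b ∈ K) {x : ℝ} (h1 : a.1 ≤ x) (h2 : x ≤ b.1) (ℓ : ℝ × ℝ) (la : a.2 ≤ lineVal ℓ a.1)
    (lb : b.2 ≤ lineVal ℓ b.1) : ∃ y, (x, y) ∈ K ∧ y ≤ lineVal ℓ x := by
  rcases (h1.trans h2).eq_or_lt with h | h
  · have : x = a.1 := by linarith
    subst this
    exact ⟨a.2, ha, la⟩
  · have hd : 0 < b.1 - a.1 := sub_pos.2 h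
    have hst : (b.1 - x) / (b.1 - a.1) + (x - a.1) / (b.1 - a.1) = 1 := by field_simp; ring
    have hs : 0 ≤ (b.1 - x) / (b.1 - a.1) := div_nonneg (by linarith) hd.le
    have ht : 0 ≤ (x - a.1) / (b.1 - a.1) := div_nonneg (by linarith) hd.le
    have hz := hK ha hb hs ht hst
    have hx : (((b.1 - x) / (b.1 - a.1)) • a + ((x - a.1) / (b.1 - a.1)) • b).1 = x := by
      simp only [Prod.fst_add, Prod.smul_fst, smul_eq_mul]; field_simp; ring
    refine ⟨(((b.1 - x) / (b.1 - a.1)) • a + ((x - a.1) / (b.1 - a.1)) • b).2, ?_, ?_⟩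
    · convert hz using 1
      exact Prod.ext hx.symm rfl
    · have hc := height_combo ℓ a b hst
      have e1 : height ℓ a ≤ 0 := by simp only [height]; linarith
      have e2 : height ℓ b ≤ 0 := by simp only [height]; linarith
      have : height ℓ (((b.1 - x) / (b.1 - a.1)) • a + ((x - a.1) / (b.1 - a.1)) • b) ≤ 0 := by
        rw [hc]; nlinarith
      rw [height, hx] at this
      linarith

theorem exists_mem_ge_line {K : Set (ℝ × ℝ)} (hK : Convex ℝ K) {a b : ℝ × ℝ} (ha : a ∈ K)
    (hb : b ∈ K) {x : ℝ} (h1 : a.1 ≤ x) (h2 : x ≤ b.1) (ℓ : ℝ × ℝ) (la : lineVal ℓ a.1 ≤ a.2)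
    (lb : lineVal ℓ b.1 ≤ b.2) : ∃ y, (x, y) ∈ K ∧ lineVal ℓ x ≤ y := by
  have hK' : Convex ℝ {p : ℝ × ℝ | (p.1, -p.2) ∈ K} := by
    intro p hp q hq s t hs ht hst
    have := hK hp hq hs ht hst
    simp only [Set.mem_ofPred_eq]
    convert this using 1
    ext <;> simp; ring
  obtain ⟨y, hy, hy'⟩ := exists_mem_le_line hK' (a := (a.1, -a.2)) (b := (b.1, -b.2))
    (by simpa using ha) (by simpa using hb) h1 h2 (-ℓ) (by simp [lineVal] at *; linarith)
    (by simp [lineVal] at *; linarith)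
  refine ⟨-y, hy, ?_⟩
  simp [lineVal] at *; linarith

theorem mem_of_vertical {K : Set (ℝ × ℝ)} (hK : Convex ℝ K) {x y₁ y₂ y : ℝ} (h1 : (x, y₁) ∈ K)
    (h2 : (x, y₂) ∈ K) (l1 : y₁ ≤ y) (l2 : y ≤ y₂) : (x, y) ∈ K := by
  have : y ∈ segment ℝ y₁ y₂ := by rw [segment_eq_Icc (l1.trans l2)]; exact ⟨l1, l2⟩
  obtain ⟨a, b, ha, hb, hab, rfl⟩ := this
  have := hK h1 h2 ha hb hab
  convert this using 1
  ext
  · simp only [Prod.fst_add, Prod.smul_fst, smul_eq_mul]; rw [← add_mul, hab, one_mul]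
  · simp

/-- A point lying above one chord and below another belongs to the convex set. -/
theorem mem_of_chords {K : Set (ℝ × ℝ)} (hK : Convex ℝ K) {a b c d z : ℝ × ℝ} (ha : a ∈ K)
    (hb : b ∈ K) (hc : c ∈ K) (hd : d ∈ K) (h1 : a.1 ≤ z.1) (h2 : z.1 ≤ b.1) (h3 : c.1 ≤ z.1)
    (h4 : z.1 ≤ d.1) (ℓ m : ℝ × ℝ) (la : a.2 ≤ lineVal ℓ a.1) (lb : b.2 ≤ lineVal ℓ b.1)
    (lz : lineVal ℓ z.1 ≤ z.2) (mc : lineVal m c.1 ≤ c.2) (md : lineVal m d.1 ≤ d.2)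
    (mz : z.2 ≤ lineVal m z.1) : z ∈ K := by
  obtain ⟨y, hy, hy'⟩ := exists_mem_le_line hK ha hb h1 h2 ℓ la lb
  obtain ⟨w, hw, hw'⟩ := exists_mem_ge_line hK hc hd h3 h4 m mc md
  exact mem_of_vertical hK hy hw (hy'.trans lz) (mz.trans hw')

theorem cross_between {ℓ m : ℝ × ℝ} {x x' : ℝ} (h : x < x') (h1 : lineVal ℓ x < lineVal m x)
    (h2 : lineVal m x' < lineVal ℓ x') :
    m.1 < ℓ.1 ∧ x < (cross ℓ m).1 ∧ (cross ℓ m).1 < x' ∧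
      lineVal ℓ (cross ℓ m).1 = (cross ℓ m).2 ∧ lineVal m (cross ℓ m).1 = (cross ℓ m).2 := by
  have hs : m.1 < ℓ.1 := by
    simp only [lineVal] at h1 h2
    by_contra hcon
    push Not at hcon
    nlinarith [mul_nonneg (sub_nonneg.2 hcon) (sub_pos.2 h).le]
  have e1 : lineVal ℓ (cross ℓ m).1 = (cross ℓ m).2 := rfl
  have e2 := lineVal_cross hs.ne'
  refine ⟨hs, ?_, ?_, e1, e2⟩
  · rw [lineVal_sub ℓ x, ← e2, lineVal_sub m x] at e1
    by_contra hcon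
    nlinarith
  · rw [lineVal_sub ℓ x', ← e2, lineVal_sub m x'] at e1
    by_contra hcon
    nlinarith

theorem lineVal_lt_right {ℓ m : ℝ × ℝ} {a x : ℝ} (h : lineVal m a = lineVal ℓ a) (hs : m.1 < ℓ.1)
    (hx : a < x) : lineVal m x < lineVal ℓ x := by
  rw [lineVal_sub m a, lineVal_sub ℓ a, h]
  nlinarith [mul_pos (sub_pos.2 hs) (sub_pos.2 hx)]

theorem lineVal_lt_left {ℓ m : ℝ × ℝ} {a x : ℝ} (h : lineVal m a = lineVal ℓ a) (hs : ℓ.1 < m.1)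
    (hx : x < a) : lineVal m x < lineVal ℓ x := by
  rw [lineVal_sub m a, lineVal_sub ℓ a, h]
  nlinarith [mul_pos (sub_pos.2 hs) (sub_pos.2 hx)]

/-- The slope of a chord of a concave broken line. -/
theorem slope_between {a b m : ℝ × ℝ} {p q r : ℝ} (hs : b.1 < a.1) (hpq : p < q) (hqr : q < r)
    (h : lineVal a q = lineVal b q) (hp : lineVal m p = lineVal a p)
    (hr : lineVal m r = lineVal b r) : b.1 < m.1 ∧ m.1 < a.1 := by
  rw [lineVal_sub a p q, lineVal_sub b r q] at h
  rw [lineVal_sub m p r] at hr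
  have e : m.1 * (r - p) = a.1 * (q - p) + b.1 * (r - q) := by linarith
  constructor
  · by_contra hcon
    push Not at hcon
    nlinarith [mul_pos (sub_pos.2 hs) (sub_pos.2 hpq)]
  · by_contra hcon
    push Not at hcon
    nlinarith [mul_pos (sub_pos.2 hs) (sub_pos.2 hqr)]

/-- Over `u i` the line `ℓ i` is the lowest, so the consecutive crossings `p, q, r, t` are the
vertices of the concave lower envelope, while the chord `LR` stays below all five lines. The
diagonals `pr` and `qt` meet in a point `o` above `LR`. As chords of the envelope they pass below `u
1, u 2` and below `u 2, u 3` respectively, so `o` also lies below a chord of `K`; which one depends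
on the side of `u 2` on which `o` lies. -/
theorem diagCross_mem {K : Set (ℝ × ℝ)} (hK : Convex ℝ K) {L R : ℝ × ℝ} (hL : L ∈ K) (hR : R ∈ K)
    (u ℓ : Fin 5 → ℝ × ℝ) (hx : StrictMono fun i => (u i).1) (hu : ∀ i, u i ∈ K)
    (hLx : L.1 ≤ (u 0).1) (hRx : (u 4).1 ≤ R.1) (h1 : ∀ i, lineVal (ℓ i) (u i).1 ≤ (u i).2)
    (h2 : ∀ i j, i ≠ j → lineVal (ℓ i) (u i).1 < lineVal (ℓ j) (u i).1)
    (hL' : ∀ i, L.2 ≤ lineVal (ℓ i) L.1) (hR' : ∀ i, R.2 ≤ lineVal (ℓ i) R.1) :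
    diagCross (ℓ 0) (ℓ 1) (ℓ 2) (ℓ 3) (ℓ 4) ∈ K := by
  have x01 : (u 0).1 < (u 1).1 := hx (by decide)
  have x12 : (u 1).1 < (u 2).1 := hx (by decide)
  have x23 : (u 2).1 < (u 3).1 := hx (by decide)
  have x34 : (u 3).1 < (u 4).1 := hx (by decide)
  obtain ⟨s01, p1, p2, p3, p4⟩ := cross_between x01 (h2 0 1 (by decide)) (h2 1 0 (by decide))
  obtain ⟨s12, q1, q2, q3, q4⟩ := cross_between x12 (h2 1 2 (by decide)) (h2 2 1 (by decide))
  obtain ⟨s23, r1, r2, r3, r4⟩ := cross_between x23 (h2 2 3 (by decide)) (h2 3 2 (by decide))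
  obtain ⟨s34, t1, t2, t3, t4⟩ := cross_between x34 (h2 3 4 (by decide)) (h2 4 3 (by decide))
  rw [diagCross]
  set p := cross (ℓ 0) (ℓ 1)
  set q := cross (ℓ 1) (ℓ 2)
  set r := cross (ℓ 2) (ℓ 3)
  set t := cross (ℓ 3) (ℓ 4)
  set m := through p r
  set m' := through q t
  have mp : lineVal m p.1 = p.2 := lineVal_through_left _ _
  have mr : lineVal m r.1 = r.2 := lineVal_through_right (by linarith)
  have mq : lineVal m' q.1 = q.2 := lineVal_through_left _ _
  have mt : lineVal m' t.1 = t.2 := lineVal_through_right (by linarith)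
  obtain ⟨m_gt2, m_lt1⟩ := slope_between (m := m) s12 (show p.1 < q.1 by linarith)
    (show q.1 < r.1 by linarith) (q3.trans q4.symm) (mp.trans p4.symm) (mr.trans r3.symm)
  obtain ⟨m'_gt3, m'_lt2⟩ := slope_between (m := m') s23 (show q.1 < r.1 by linarith)
    (show r.1 < t.1 by linarith) (r3.trans r4.symm) (mq.trans q4.symm) (mt.trans t3.symm)
  have hqr : q.1 < r.1 := by linarith
  obtain ⟨-, o1, o2, o3, o4⟩ := cross_between (ℓ := m) (m := m') hqr
    (by
      rw [mq, ← q3]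
      exact lineVal_lt_right (mp.trans p4.symm) m_lt1 (by linarith))
    (by
      rw [mr, ← r3]
      exact lineVal_lt_right (mq.trans q4.symm) m'_lt2 (by linarith))
  set o := cross m m'
  have hLR : L.1 < R.1 := by linarith
  set c := through L R
  have cL : lineVal c L.1 = L.2 := lineVal_through_left _ _
  have cR : lineVal c R.1 = R.2 := lineVal_through_right hLR.ne
  have cl : ∀ i x, L.1 ≤ x → x ≤ R.1 → lineVal c x ≤ lineVal (ℓ i) x := fun i x hx1 hx2 =>
    lineVal_interp (by rw [cL]; exact hL' i) (by rw [cR]; exact hR' i) hx1 hx2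
  have co : lineVal c o.1 ≤ o.2 := by
    rw [← o3]
    refine lineVal_interp (a := p.1) (b := r.1) ?_ ?_ (by linarith) (by linarith)
    · rw [mp, ← p3]; exact cl 0 _ (by linarith) (by linarith)
    · rw [mr, ← r3]; exact cl 2 _ (by linarith) (by linarith)
  rcases le_total o.1 (u 2).1 with h | h
  · refine mem_of_chords hK hL hR (hu 1) (hu 2) (by linarith) (by linarith) (by linarith) h c m
      cL.ge cR.ge co ?_ ?_ o3.ge
    · refine le_trans ?_ (h1 1)
      exact (lineVal_lt_right (mp.trans p4.symm) m_lt1 (by linarith)).le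
    · refine le_trans ?_ (h1 2)
      exact (lineVal_lt_left (mr.trans r3.symm) m_gt2 (by linarith)).le
  · refine mem_of_chords hK hL hR (hu 2) (hu 3) (by linarith) (by linarith) h (by linarith) c m'
      cL.ge cR.ge co ?_ ?_ o4.ge
    · refine le_trans ?_ (h1 2)
      exact (lineVal_lt_right (mq.trans q4.symm) m'_lt2 (by linarith)).le
    · refine le_trans ?_ (h1 3)
      exact (lineVal_lt_left (mt.trans t3.symm) m'_gt3 (by linarith)).le

/-- Five isolated points force the crossing point of the diagonals into the convex set. -/
theorem exists_diagCross_mem {K : Set (ℝ × ℝ)} (hK : Convex ℝ K) {L R : ℝ × ℝ} (hL : L ∈ K)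
    (hR : R ∈ K) (T : Finset (ℝ × ℝ)) (hT : 5 ≤ T.card) (lam : ℝ × ℝ → ℝ × ℝ)
    (hu : ∀ u ∈ T, u ∈ K ∧ L.1 ≤ u.1 ∧ u.1 ≤ R.1) (h1 : ∀ u ∈ T, lineVal (lam u) u.1 ≤ u.2)
    (h2 : ∀ u ∈ T, ∀ v ∈ T, u ≠ v → lineVal (lam u) u.1 < lineVal (lam v) u.1)
    (hL' : ∀ u ∈ T, L.2 ≤ lineVal (lam u) L.1) (hR' : ∀ u ∈ T, R.2 ≤ lineVal (lam u) R.1) :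
    ∃ ℓ : Fin 5 → ℝ × ℝ, (∀ i, ∃ u ∈ T, ℓ i = lam u) ∧
      diagCross (ℓ 0) (ℓ 1) (ℓ 2) (ℓ 3) (ℓ 4) ∈ K := by
  classical
  have hinj : Set.InjOn Prod.fst (T : Set (ℝ × ℝ)) := by
    intro u hu v hv huv
    by_contra hne
    have e1 := h2 u hu v hv hne
    have e2 := h2 v hv u hu (Ne.symm hne)
    rw [huv] at e1
    linarith
  obtain ⟨T', hT', hc⟩ := Finset.exists_subset_card_eq hT
  have hc' : (T'.image Prod.fst).card = 5 := by
    rw [Finset.card_image_of_injOn (hinj.mono (by exact_mod_cast hT')), hc]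
  let e := (T'.image Prod.fst).orderEmbOfFin hc'
  have he : ∀ i, ∃ u ∈ T', u.1 = e i := fun i => by
    simpa using Finset.mem_image.1 (Finset.orderEmbOfFin_mem (T'.image Prod.fst) hc' i)
  choose u hu' hue using he
  have hx : StrictMono fun i => (u i).1 := by
    intro i j hij
    simp only [hue]
    exact e.strictMono hij
  have huT : ∀ i, u i ∈ T := fun i => hT' (hu' i)
  refine ⟨fun i => lam (u i), fun i => ⟨u i, huT i, rfl⟩, ?_⟩
  refine diagCross_mem hK hL hR u (fun i => lam (u i)) hx (fun i => (hu _ (huT i)).1)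
    (hu _ (huT 0)).2.1 (hu _ (huT 4)).2.2 (fun i => h1 _ (huT i)) (fun i j hij => ?_)
    (fun i => hL' _ (huT i)) (fun i => hR' _ (huT i))
  refine h2 _ (huT i) _ (huT j) (fun h => hij ?_)
  exact hx.injective (by simp only [h])

/-- Reflection in the horizontal axis. -/
def reflect (p : ℝ × ℝ) : ℝ × ℝ := (p.1, -p.2)

theorem convex_reflect {K : Set (ℝ × ℝ)} (hK : Convex ℝ K) : Convex ℝ {p | reflect p ∈ K} := by
  intro p hp q hq s t hs ht hst
  have := hK hp hq hs ht hst
  simp only [Set.mem_ofPred_eq]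
  convert this using 1
  ext <;> simp [reflect]; ring

theorem lineVal_neg (ℓ : ℝ × ℝ) (x : ℝ) : lineVal (-ℓ) x = -lineVal ℓ x := by
  simp [lineVal]; ring

theorem cross_neg (ℓ m : ℝ × ℝ) : cross (-ℓ) (-m) = reflect (cross ℓ m) := by
  have h : (-m.2 - -ℓ.2) / (-ℓ.1 - -m.1) = (m.2 - ℓ.2) / (ℓ.1 - m.1) := by
    rw [← neg_div_neg_eq]; congr 1 <;> ring
  simp only [cross, reflect, Prod.fst_neg, Prod.snd_neg, h, lineVal_neg]

theorem through_reflect (p q : ℝ × ℝ) : through (reflect p) (reflect q) = -through p q := by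
  have h : (-q.2 - -p.2) / (q.1 - p.1) = -((q.2 - p.2) / (q.1 - p.1)) := by
    rw [← neg_div]; congr 1; ring
  simp only [through, reflect, h]
  ext <;> simp; ring

theorem diagCross_neg (a b c d e : ℝ × ℝ) :
    diagCross (-a) (-b) (-c) (-d) (-e) = reflect (diagCross a b c d e) := by
  simp only [diagCross, cross_neg, through_reflect]

theorem reflect_reflect (p : ℝ × ℝ) : reflect (reflect p) = p := by simp [reflect]

/-- A convex set avoiding the crossings of `𝓛` and the diagonal crossings is covered by nine
segments from a fixed point. -/
theorem exists_nine_segments {𝓛 : Finset (ℝ × ℝ)} {K : Set (ℝ × ℝ)} (hK : Convex ℝ K)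
    (hdbl : ∀ ℓ ∈ 𝓛, ∀ m ∈ 𝓛, ℓ ≠ m → cross ℓ m ∉ K)
    (hO : ∀ ℓ : Fin 5 → ℝ × ℝ, (∀ i, ℓ i ∈ 𝓛) → diagCross (ℓ 0) (ℓ 1) (ℓ 2) (ℓ 3) (ℓ 4) ∉ K)
    {L R : ℝ × ℝ} (hL : L ∈ K) (hR : R ∈ K) (X : Finset (ℝ × ℝ))
    (hX : ∀ q ∈ X, q ∈ K ∧ L.1 < q.1 ∧ q.1 < R.1) :
    ∃ W : Finset (ℝ × ℝ), W.card ≤ 9 ∧ (∀ w ∈ W, w = R ∨ w ∈ X) ∧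
      ∀ q ∈ X, ∃ w ∈ W, CoveredBy 𝓛 L w q := by
  classical
  obtain ⟨W, hW, hW1, hW2⟩ := exists_uncovered_subset 𝓛 L (X.filter (fun q => ¬ CoveredBy 𝓛 L R q))
  have hWX : ∀ w ∈ W, w ∈ X ∧ ¬ CoveredBy 𝓛 L R w := fun w hw => by simpa using hW hw
  refine ⟨insert R W, ?_, ?_, ?_⟩
  · refine (Finset.card_insert_le _ _).trans ?_
    -- Otherwise `W` has at least nine points, and five of them lie above their isolating lines or
    -- five do not. In the first case the diagonal crossing of those five lines is in `K`; the
    -- second case is its reflection. Hence at most `4 + 4` points, and `R`.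
    by_contra hcon
    have hiso : ∀ w ∈ W, ∃ ℓ ∈ 𝓛, ¬ (0 < height ℓ L ↔ 0 < height ℓ w) ∧
        ∀ z ∈ insert R (W.erase w), ¬ (0 < height ℓ z ↔ 0 < height ℓ w) := by
      intro w hw
      refine exists_isolating hK hdbl hL (hX w (hWX w hw).1).1 _ ?_ (Finset.insert_nonempty _ _)
      intro z hz
      rcases Finset.mem_insert.1 hz with rfl | hz
      · exact ⟨hR, (hWX w hw).2⟩
      · obtain ⟨hz1, hz2⟩ := Finset.mem_erase.1 hz
        exact ⟨(hX z (hWX z hz2).1).1, hW1 z hz2 w hw hz1⟩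
    choose! lam hlam hlamL hlamF using hiso
    have hlamR : ∀ w ∈ W, ¬ (0 < height (lam w) R ↔ 0 < height (lam w) w) := fun w hw =>
      hlamF w hw R (by simp)
    have hlamW : ∀ w ∈ W, ∀ z ∈ W, w ≠ z → ¬ (0 < height (lam w) z ↔ 0 < height (lam w) w) :=
      fun w hw z hz hne => hlamF w hw z (by simp [hz, hne.symm])
    have hsplit := Finset.card_filter_add_card_filter_not (s := W)
      (fun w => 0 < height (lam w) w)
    have h5 : 5 ≤ (W.filter (fun w => 0 < height (lam w) w)).card ∨
        5 ≤ (W.filter (fun w => ¬ 0 < height (lam w) w)).card := by omega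
    rcases h5 with h5 | h5
    · obtain ⟨ℓ, hℓ, hmem⟩ := exists_diagCross_mem hK hL hR _ h5 lam
        (fun u hu => by
          have := hX u (hWX u (Finset.mem_filter.1 hu).1).1
          exact ⟨this.1, this.2.1.le, this.2.2.le⟩)
        (fun u hu => by
          have := (Finset.mem_filter.1 hu).2
          simp only [height] at this; linarith)
        (fun u hu v hv hne => by
          obtain ⟨hu1, hu2⟩ := Finset.mem_filter.1 hu
          obtain ⟨hv1, hv2⟩ := Finset.mem_filter.1 hv
          have := hlamW v hv1 u hu1 hne.symm
          simp only [hv2, iff_true] at this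
          simp only [height] at this hu2
          linarith)
        (fun u hu => by
          obtain ⟨hu1, hu2⟩ := Finset.mem_filter.1 hu
          have := hlamL u hu1
          simp only [hu2, iff_true] at this
          simp only [height] at this
          linarith)
        (fun u hu => by
          obtain ⟨hu1, hu2⟩ := Finset.mem_filter.1 hu
          have := hlamR u hu1
          simp only [hu2, iff_true] at this
          simp only [height] at this
          linarith)
      refine hO ℓ (fun i => ?_) hmem
      obtain ⟨u, hu, he⟩ := hℓ i
      rw [he]; exact hlam u (Finset.mem_filter.1 hu).1
    · set T := W.filter (fun w => ¬ 0 < height (lam w) w)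
      have hTc : (T.image reflect).card = T.card :=
        Finset.card_image_of_injective _ (Function.LeftInverse.injective reflect_reflect)
      have hT : ∀ v ∈ T.image reflect, reflect v ∈ W ∧
          lineVal (lam (reflect v)) v.1 ≥ - v.2 := by
        intro v hv
        obtain ⟨u, hu, rfl⟩ := Finset.mem_image.1 hv
        obtain ⟨hu1, hu2⟩ := Finset.mem_filter.1 hu
        rw [reflect_reflect]
        refine ⟨hu1, ?_⟩
        simp only [height, reflect] at hu2 ⊢; linarith
      have hn : ∀ v ∈ T.image reflect, ¬ 0 < height (lam (reflect v)) (reflect v) := by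
        intro v hv
        have := (hT v hv).2
        simp only [height, reflect] at this ⊢; linarith
      obtain ⟨ℓ, hℓ, hmem⟩ := exists_diagCross_mem (convex_reflect hK) (L := reflect L)
        (R := reflect R) (by simpa [reflect_reflect] using hL) (by simpa [reflect_reflect] using hR)
        (T.image reflect) (by rw [hTc]; exact h5) (fun v => - lam (reflect v))
        (fun v hv => by
          have := hX _ (hWX _ (hT v hv).1).1
          exact ⟨this.1, this.2.1.le, this.2.2.le⟩)
        (fun v hv => by
          have := (hT v hv).2
          rw [lineVal_neg]; linarith)
        (fun v hv v' hv' hne => by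
          have := hlamW _ (hT v' hv').1 _ (hT v hv).1
            (fun h => hne (by rw [← reflect_reflect v, ← h, reflect_reflect]))
          simp only [hn v' hv', iff_false, not_not] at this
          have h2 := (hT v hv).2
          simp only [height, reflect, lineVal_neg] at this h2 ⊢
          linarith)
        (fun v hv => by
          have := hlamL _ (hT v hv).1
          simp only [hn v hv, iff_false, not_not] at this
          simp only [height, reflect, lineVal_neg] at this ⊢
          linarith)
        (fun v hv => by
          have := hlamR _ (hT v hv).1
          simp only [hn v hv, iff_false, not_not] at this
          simp only [height, reflect, lineVal_neg] at this ⊢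
          linarith)
      refine hO (fun i => - ℓ i) (fun i => ?_) ?_
      · obtain ⟨u, hu, he⟩ := hℓ i
        simp only [he, neg_neg]; exact hlam _ (hT u hu).1
      · rw [diagCross_neg]; exact hmem
  · intro w hw
    rcases Finset.mem_insert.1 hw with rfl | hw
    · exact Or.inl rfl
    · exact Or.inr (hWX w hw).1
  · intro q hq
    by_cases hc : CoveredBy 𝓛 L R q
    · exact ⟨R, by simp, hc⟩
    · obtain ⟨w, hw, hwc⟩ := hW2 q (by simp [hq, hc])
      exact ⟨w, by simp [hw], hwc⟩

/-! ### Partitions with small crossing number for lines. -/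

/-- Greedy hitting set: few elements meet all but a `(1-δ)^s` fraction of the heavy sets. -/
theorem exists_hitting {α : Type*} [DecidableEq α] (𝓛 : Finset α) (hne : 𝓛.Nonempty) (w : α → ℝ)
    (hw : ∀ ℓ ∈ 𝓛, 0 < w ℓ) (δ : ℝ) (hδ1 : δ ≤ 1) (𝒜 : Finset (Finset α))
    (h𝒜 : ∀ R ∈ 𝒜, R ⊆ 𝓛 ∧ δ * ∑ ℓ ∈ 𝓛, w ℓ ≤ ∑ ℓ ∈ R, w ℓ) (s : ℕ) :
    ∃ S ⊆ 𝓛, S.card ≤ s ∧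
      ((𝒜.filter (fun R => Disjoint S R)).card : ℝ) ≤ 𝒜.card * (1 - δ) ^ s := by
  induction s with
  | zero => exact ⟨∅, by simp, by simp, by simp⟩
  | succ s ih =>
    obtain ⟨S, hS, hc, hb⟩ := ih
    set 𝒰 := 𝒜.filter (fun R => Disjoint S R) with h𝒰
    -- Averaging: each remaining set carries a `δ` share of the weight, so some element lies in a
    -- `δ` share of the remaining sets.
    have hex : ∃ ℓ ∈ 𝓛, δ * 𝒰.card ≤ (𝒰.filter (fun R => ℓ ∈ R)).card := by
      by_contra hcon
      push Not at hcon
      have h1 : ∑ ℓ ∈ 𝓛, w ℓ * ((𝒰.filter (fun R => ℓ ∈ R)).card : ℝ) <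
          ∑ ℓ ∈ 𝓛, w ℓ * (δ * 𝒰.card) :=
        Finset.sum_lt_sum_of_nonempty hne
          (fun ℓ hℓ => mul_lt_mul_of_pos_left (hcon ℓ hℓ) (hw ℓ hℓ))
      have h2 : ∑ ℓ ∈ 𝓛, w ℓ * ((𝒰.filter (fun R => ℓ ∈ R)).card : ℝ) =
          ∑ R ∈ 𝒰, ∑ ℓ ∈ R, w ℓ := by
        simp only [Finset.card_filter, Nat.cast_sum, Finset.mul_sum]
        rw [Finset.sum_comm]
        refine Finset.sum_congr rfl fun R hR => ?_
        have hRL := (h𝒜 R (Finset.mem_filter.1 hR).1).1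
        rw [← Finset.sum_subset hRL (f := fun ℓ => w ℓ * (((if ℓ ∈ R then 1 else 0) : ℕ) : ℝ))]
        · exact Finset.sum_congr rfl fun ℓ hℓ => by simp [hℓ]
        · intro ℓ _ hℓ; simp [hℓ]
      have h3 : (𝒰.card : ℝ) * (δ * ∑ ℓ ∈ 𝓛, w ℓ) ≤ ∑ R ∈ 𝒰, ∑ ℓ ∈ R, w ℓ := by
        rw [← nsmul_eq_mul]
        exact Finset.card_nsmul_le_sum _ _ _ (fun R hR => (h𝒜 R (Finset.mem_filter.1 hR).1).2)
      rw [h2, ← Finset.sum_mul] at h1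
      linarith
    obtain ⟨ℓ, hℓ, hle⟩ := hex
    refine ⟨insert ℓ S, Finset.insert_subset hℓ hS, (Finset.card_insert_le _ _).trans (by omega), ?_⟩
    have heq : 𝒜.filter (fun R => Disjoint (insert ℓ S) R) = 𝒰.filter (fun R => ¬ ℓ ∈ R) := by
      ext R
      simp only [h𝒰, Finset.mem_filter, Finset.disjoint_insert_left]
      tauto
    have hsplit := Finset.card_filter_add_card_filter_not (s := 𝒰) (fun R => ℓ ∈ R)
    have hsplit' : ((𝒰.filter (fun R => ℓ ∈ R)).card : ℝ) + (𝒰.filter (fun R => ¬ ℓ ∈ R)).card =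
        𝒰.card := by exact_mod_cast hsplit
    rw [heq, pow_succ]
    have : (𝒰.card : ℝ) * (1 - δ) ≤ 𝒜.card * (1 - δ) ^ s * (1 - δ) := by
      gcongr
    linarith

theorem cross_fst_comm (ℓ m : ℝ × ℝ) : (cross ℓ m).1 = (cross m ℓ).1 := by
  simp only [cross]
  rw [← neg_div_neg_eq]; congr 1 <;> ring

/-- Lines in general position with respect to a point set. -/
structure NoTies (𝓛 Y : Finset (ℝ × ℝ)) : Prop where
  off : ∀ ℓ ∈ 𝓛, ∀ p ∈ Y, height ℓ p ≠ 0
  val : ∀ ℓ ∈ 𝓛, ∀ m ∈ 𝓛, ℓ ≠ m → ∀ p ∈ Y, lineVal ℓ p.1 ≠ lineVal m p.1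

/-- `a p` is the lowest line of `S` above `p` and `b p` the highest one below: no line of `S` runs
strictly between them at the abscissa of `p`. -/
theorem exists_above_below {S Y : Finset (ℝ × ℝ)}
    (hab : ∀ p ∈ Y, (∃ ℓ ∈ S, height ℓ p < 0) ∧ ∃ ℓ ∈ S, 0 < height ℓ p)
    (hS : NoTies S Y) :
    ∃ a b : ℝ × ℝ → ℝ × ℝ, ∀ p ∈ Y, a p ∈ S ∧ b p ∈ S ∧ height (a p) p < 0 ∧ 0 < height (b p) p ∧
      ∀ m ∈ S, lineVal (a p) p.1 ≤ lineVal m p.1 ∨ lineVal m p.1 ≤ lineVal (b p) p.1 := by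
  classical
  have : ∀ p ∈ Y, ∃ a b : ℝ × ℝ, a ∈ S ∧ b ∈ S ∧ height a p < 0 ∧ 0 < height b p ∧
      ∀ m ∈ S, lineVal a p.1 ≤ lineVal m p.1 ∨ lineVal m p.1 ≤ lineVal b p.1 := by
    intro p hp
    obtain ⟨⟨ℓ, hℓ, hℓ'⟩, ⟨k, hk, hk'⟩⟩ := hab p hp
    obtain ⟨a, ha, hamin⟩ := Finset.exists_min_image (S.filter (fun ℓ => height ℓ p < 0))
      (fun ℓ => lineVal ℓ p.1) ⟨ℓ, by simp [hℓ, hℓ']⟩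
    obtain ⟨b, hb, hbmax⟩ := Finset.exists_max_image (S.filter (fun ℓ => 0 < height ℓ p))
      (fun ℓ => lineVal ℓ p.1) ⟨k, by simp [hk, hk']⟩
    rw [Finset.mem_filter] at ha hb
    refine ⟨a, b, ha.1, hb.1, ha.2, hb.2, fun m hm => ?_⟩
    rcases lt_or_gt_of_ne (hS.off m hm p hp) with h | h
    · exact Or.inl (hamin m (by simp [hm, h]))
    · exact Or.inr (hbmax m (by simp [hm, h]))
  choose! a b h using this
  exact ⟨a, b, h⟩

/-- Each point has a key recording its last event, of which there are quadratically many. -/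
theorem exists_event_key (S Y : Finset (ℝ × ℝ)) (a b : ℝ × ℝ → ℝ × ℝ)
    (hab : ∀ p ∈ Y, a p ∈ S ∧ b p ∈ S) :
    ∃ key : ℝ × ℝ → Bool × (ℝ × ℝ) × Option (ℝ × ℝ),
      (∀ p ∈ Y, key p ∈ (Finset.univ : Finset Bool) ×ˢ S ×ˢ Finset.insertNone S) ∧
      ∀ p ∈ Y, ∀ q ∈ Y, key p = key q → p.1 < q.1 → (a p = a q ∨ b p = b q) ∧
        ∀ c, (c = a q ∨ c = b q) → ∀ d ∈ S, c.1 ≠ d.1 →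
          ¬ (p.1 ≤ (cross c d).1 ∧ (cross c d).1 < q.1) := by
  classical
  -- An event of `p` is a crossing, to the left of `p`, of one of its two bounding lines with a line
  -- of `S`; the Boolean tells which bounding line. The key records the rightmost event, and `a p`
  -- with `none` if there is no event.
  let ev : ℝ × ℝ → Finset (Bool × (ℝ × ℝ)) := fun p =>
    ((Finset.univ : Finset Bool) ×ˢ S).filter (fun e =>
      (cond e.1 (a p) (b p)).1 ≠ e.2.1 ∧ (cross (cond e.1 (a p) (b p)) e.2).1 < p.1)
  have hkey : ∀ p, ∃ k : Bool × (ℝ × ℝ) × Option (ℝ × ℝ),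
      (ev p = ∅ ∧ k = (true, a p, none)) ∨
      (∃ e ∈ ev p, (∀ e' ∈ ev p, (cross (cond e'.1 (a p) (b p)) e'.2).1 ≤
        (cross (cond e.1 (a p) (b p)) e.2).1) ∧ k = (e.1, cond e.1 (a p) (b p), some e.2)) := by
    intro p
    rcases (ev p).eq_empty_or_nonempty with h | h
    · exact ⟨_, Or.inl ⟨h, rfl⟩⟩
    · obtain ⟨e, he, hmax⟩ := Finset.exists_max_image (ev p)
        (fun e => (cross (cond e.1 (a p) (b p)) e.2).1) h
      exact ⟨_, Or.inr ⟨e, he, hmax, rfl⟩⟩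
  choose key hkey using hkey
  refine ⟨key, ?_, ?_⟩
  · intro p hp
    rcases hkey p with ⟨-, h⟩ | ⟨e, he, -, h⟩
    · rw [h]; simp [(hab p hp).1]
    · rw [h]
      have := (Finset.mem_product.1 (Finset.mem_filter.1 he).1).2
      rcases e with ⟨t, d⟩
      cases t <;> simp_all
  · intro p hp q hq hpq hlt
    have hmem : ∀ c, (c = a q ∨ c = b q) → ∀ d ∈ S, c.1 ≠ d.1 → (cross c d).1 < q.1 →
        ∃ e ∈ ev q, cond e.1 (a q) (b q) = c ∧ e.2 = d := by
      rintro c (rfl | rfl) d hd h1 h2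
      · exact ⟨(true, d), by simp [ev, hd, h1, h2], rfl, rfl⟩
      · exact ⟨(false, d), by simp [ev, hd, h1, h2], rfl, rfl⟩
    rcases hkey p with ⟨h0, h⟩ | ⟨e, he, hmax, h⟩ <;> rcases hkey q with ⟨h0', h'⟩ | ⟨e', he', hmax', h'⟩
    · rw [h, h'] at hpq
      refine ⟨Or.inl (by simpa using hpq), fun c hc d hd hne hcr => ?_⟩
      obtain ⟨e, he, -⟩ := hmem c hc d hd hne hcr.2
      rw [h0'] at he; simp at he
    · rw [h, h'] at hpq; simp at hpq
    · rw [h, h'] at hpq; simp at hpq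
    · rw [h, h'] at hpq
      simp only [Prod.mk.injEq, Option.some.injEq] at hpq
      obtain ⟨k1, k2, k3⟩ := hpq
      refine ⟨?_, fun c hc d hd hne hcr => ?_⟩
      · rw [← k1] at k2
        cases he1 : e.1
        · right; simpa [he1] using k2
        · left; simpa [he1] using k2
      · obtain ⟨f, hf, f1, f2⟩ := hmem c hc d hd hne hcr.2
        have := hmax' f hf
        rw [f1, f2, ← k2, ← k3] at this
        have h3 := (Finset.mem_filter.1 he).2.2
        linarith [hcr.1]

/-- Without crossing in between, the order of two lines does not change. -/
theorem lineVal_lt_of_no_cross {c d : ℝ × ℝ} {x x' : ℝ} (hx : x < x')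
    (hno : c.1 ≠ d.1 → ¬ (x ≤ (cross c d).1 ∧ (cross c d).1 < x')) (hne : lineVal c x' ≠ lineVal d x') :
    (lineVal c x < lineVal d x → lineVal c x' < lineVal d x') ∧
    (lineVal d x < lineVal c x → lineVal d x' < lineVal c x') := by
  constructor
  · intro h
    by_contra hcon
    have h2 : lineVal d x' < lineVal c x' := lt_of_le_of_ne (not_lt.1 hcon) (Ne.symm hne)
    obtain ⟨h3, h4, h5, -⟩ := cross_between hx h h2
    exact hno h3.ne' ⟨h4.le, h5⟩
  · intro h
    by_contra hcon
    have h2 : lineVal c x' < lineVal d x' := lt_of_le_of_ne (not_lt.1 hcon) hne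
    obtain ⟨h3, h4, h5, -⟩ := cross_between hx h h2
    rw [cross_fst_comm] at h4 h5
    exact hno h3.ne ⟨h4.le, h5⟩

/-- Points with the same key lie in a common trapezoid not met by the lines of `S`. -/
theorem exists_trapezoid_key {S Y : Finset (ℝ × ℝ)}
    (hab : ∀ p ∈ Y, (∃ ℓ ∈ S, height ℓ p < 0) ∧ ∃ ℓ ∈ S, 0 < height ℓ p)
    (hS : NoTies S Y) (hinj : Set.InjOn Prod.fst (Y : Set (ℝ × ℝ))) :
    ∃ key : ℝ × ℝ → Bool × (ℝ × ℝ) × Option (ℝ × ℝ),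
      (∀ p ∈ Y, key p ∈ (Finset.univ : Finset Bool) ×ˢ S ×ˢ Finset.insertNone S) ∧
      ∀ p₀ ∈ Y, ∃ a b : ℝ × ℝ, (∀ p ∈ Y, key p = key p₀ → height a p < 0 ∧ 0 < height b p) ∧
        ∀ m ∈ S, (∀ p ∈ Y, key p = key p₀ → lineVal a p.1 ≤ lineVal m p.1) ∨
          (∀ p ∈ Y, key p = key p₀ → lineVal m p.1 ≤ lineVal b p.1) := by
  obtain ⟨a, b, hAB⟩ := exists_above_below hab hS
  obtain ⟨key, hkey, hsame⟩ := exists_event_key S Y a b (fun p hp => ⟨(hAB p hp).1, (hAB p hp).2.1⟩)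
  have hlt : ∀ p ∈ Y, lineVal (b p) p.1 < lineVal (a p) p.1 := by
    intro p hp
    have h1 := (hAB p hp).2.2.1
    have h2 := (hAB p hp).2.2.2.1
    simp only [height] at h1 h2; linarith
  -- Between `p` and `q` no line of `S` crosses a bounding line of `q`. If `p` and `q` shared only
  -- one bounding line, the other bounding line of `p` would therefore run strictly between the two
  -- bounding lines of `q` at the abscissa of `q`.
  have main : ∀ p ∈ Y, ∀ q ∈ Y, key p = key q → p.1 < q.1 → a p = a q ∧ b p = b q ∧
      ∀ m ∈ S, (lineVal (a p) p.1 ≤ lineVal m p.1 ↔ lineVal (a q) q.1 ≤ lineVal m q.1) := by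
    intro p hp q hq hpq hx
    obtain ⟨hor, hno⟩ := hsame p hp q hq hpq hx
    obtain ⟨ap, bp, ap', bp', mp⟩ := hAB p hp
    obtain ⟨aq, bq, aq', bq', mq⟩ := hAB q hq
    have hp1 := hlt p hp
    have hq1 := hlt q hq
    have na : ∀ d ∈ S, d ≠ a q → (lineVal d p.1 < lineVal (a q) p.1 ↔
        lineVal d q.1 < lineVal (a q) q.1) := by
      intro d hd hne
      obtain ⟨h1, h2⟩ := lineVal_lt_of_no_cross hx (hno (a q) (Or.inl rfl) d hd)
        (hS.val _ aq _ hd hne.symm q hq)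
      have h3 := hS.val _ aq _ hd hne.symm p hp
      refine ⟨h2, fun h => ?_⟩
      by_contra hcon
      have := h1 (lt_of_le_of_ne (not_lt.1 hcon) h3)
      linarith
    have nb : ∀ d ∈ S, d ≠ b q → (lineVal (b q) p.1 < lineVal d p.1 ↔
        lineVal (b q) q.1 < lineVal d q.1) := by
      intro d hd hne
      obtain ⟨h1, h2⟩ := lineVal_lt_of_no_cross hx (hno (b q) (Or.inr rfl) d hd)
        (hS.val _ bq _ hd hne.symm q hq)
      have h3 := hS.val _ bq _ hd hne.symm p hp
      refine ⟨h1, fun h => ?_⟩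
      by_contra hcon
      have := h2 (lt_of_le_of_ne (not_lt.1 hcon) (Ne.symm h3))
      linarith
    have hEq : a p = a q ∧ b p = b q := by
      rcases hor with h | h
      · refine ⟨h, ?_⟩
        by_contra hne
        have e1 : lineVal (b q) p.1 < lineVal (a q) p.1 :=
          (na _ bq (by rintro h; rw [h] at hq1; exact lt_irrefl _ hq1)).2 hq1
        have e2 : lineVal (b q) p.1 < lineVal (b p) p.1 := by
          refine lt_of_le_of_ne ((mp _ bq).resolve_left ?_) (hS.val _ bq _ bp (Ne.symm hne) p hp)
          rw [h]; exact not_le.2 e1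
        have e3 : lineVal (b p) q.1 < lineVal (a q) q.1 :=
          (na _ bp (by rintro h'; rw [h', h] at hp1; exact lt_irrefl _ hp1)).1 (by rw [← h]; exact hp1)
        have e4 := (mq _ bp).resolve_left (not_le.2 e3)
        have e5 := (nb _ bp hne).1 e2
        linarith
      · refine ⟨?_, h⟩
        by_contra hne
        have e1 : lineVal (b q) p.1 < lineVal (a q) p.1 :=
          (nb _ aq (by rintro h; rw [h] at hq1; exact lt_irrefl _ hq1)).2 hq1
        have e2 : lineVal (a p) p.1 < lineVal (a q) p.1 := by
          refine lt_of_le_of_ne ((mp _ aq).resolve_right ?_) (hS.val _ ap _ aq hne p hp)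
          rw [h]; exact not_le.2 e1
        have e3 : lineVal (b q) q.1 < lineVal (a p) q.1 :=
          (nb _ ap (by rintro h'; rw [h', h] at hp1; exact lt_irrefl _ hp1)).1 (by rw [← h]; exact hp1)
        have e4 := (mq _ ap).resolve_right (not_le.2 e3)
        have e5 := (na _ ap hne).1 e2
        linarith
    refine ⟨hEq.1, hEq.2, fun m hm => ?_⟩
    by_cases hma : m = a q
    · simp [hma, hEq.1]
    · rw [hEq.1, ← not_lt, ← not_lt, na m hm hma]
  have main' : ∀ p ∈ Y, ∀ q ∈ Y, key p = key q → a p = a q ∧ b p = b q ∧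
      ∀ m ∈ S, (lineVal (a p) p.1 ≤ lineVal m p.1 ↔ lineVal (a q) q.1 ≤ lineVal m q.1) := by
    intro p hp q hq hpq
    rcases lt_trichotomy p.1 q.1 with h | h | h
    · exact main p hp q hq hpq h
    · have := hinj hp hq h
      subst this; simp
    · obtain ⟨h1, h2, h3⟩ := main q hq p hp hpq.symm h
      exact ⟨h1.symm, h2.symm, fun m hm => (h3 m hm).symm⟩
  refine ⟨key, hkey, fun p₀ h₀ => ⟨a p₀, b p₀, fun p hp hk => ?_, fun m hm => ?_⟩⟩
  · obtain ⟨h1, h2, -⟩ := main' p hp p₀ h₀ hk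
    rw [← h1, ← h2]
    exact ⟨(hAB p hp).2.2.1, (hAB p hp).2.2.2.1⟩
  · by_cases h : lineVal (a p₀) p₀.1 ≤ lineVal m p₀.1
    · left
      intro p hp hk
      obtain ⟨h1, h2, h3⟩ := main' p hp p₀ h₀ hk
      rw [← h1]
      exact (h3 m hm).2 h
    · right
      intro p hp hk
      obtain ⟨h1, h2, h3⟩ := main' p hp p₀ h₀ hk
      rw [← h2]
      exact ((hAB p hp).2.2.2.2 m hm).resolve_left (mt (h3 m hm).1 h)

/-- The line `ℓ` strictly separates two points of `c`. -/
def Crosses (ℓ : ℝ × ℝ) (c : Finset (ℝ × ℝ)) : Prop :=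
  (∃ p ∈ c, 0 < height ℓ p) ∧ ∃ p ∈ c, height ℓ p < 0

theorem Crosses.mono {ℓ : ℝ × ℝ} {c d : Finset (ℝ × ℝ)} (h : Crosses ℓ c) (hcd : c ⊆ d) :
    Crosses ℓ d := by
  obtain ⟨⟨p, hp, hp'⟩, q, hq, hq'⟩ := h
  exact ⟨⟨p, hcd hp, hp'⟩, q, hcd hq, hq'⟩

open Classical in
/-- The lines of `𝓛` having `u` strictly below and `v` strictly above. -/
noncomputable def sepRange (𝓛 : Finset (ℝ × ℝ)) (u v : ℝ × ℝ) : Finset (ℝ × ℝ) :=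
  𝓛.filter (fun ℓ => height ℓ u < 0 ∧ 0 < height ℓ v)

theorem mem_sepRange {𝓛 : Finset (ℝ × ℝ)} {u v ℓ : ℝ × ℝ} :
    ℓ ∈ sepRange 𝓛 u v ↔ ℓ ∈ 𝓛 ∧ height ℓ u < 0 ∧ 0 < height ℓ v := by
  simp [sepRange]

/-- With lines regarded as points of the dual plane, these ranges are intersections of two
half-planes, whence the exponent 3 + 3. -/
theorem exists_sepRanges (𝓛 : Finset (ℝ × ℝ)) : ∃ 𝒜 : Finset (Finset (ℝ × ℝ)),
    𝒜.card ≤ (𝓛.card + 1) ^ 6 ∧ ∀ u v, sepRange 𝓛 u v ∈ 𝒜 := by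
  obtain ⟨𝒜, h1, h2⟩ := (polyGrowth_halfPlanes.inter polyGrowth_halfPlanes) 𝓛
  refine ⟨𝒜, h1, fun u v => ?_⟩
  obtain ⟨T, hT, hT'⟩ := h2 _ ⟨_, ⟨u.1, 1, -u.2, rfl⟩, _, ⟨-v.1, -1, v.2, rfl⟩, rfl⟩
  convert hT
  ext ℓ
  rw [hT', sepRange, Finset.mem_filter]
  refine and_congr_right fun _ => ?_
  simp only [height, lineVal, Set.mem_inter_iff, Set.mem_ofPred_eq]
  constructor <;> rintro ⟨h1, h2⟩ <;> constructor <;> linarith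

/-- The class lies in the trapezoid bounded by `a`, `b` and the verticals through its extreme
points. A line cutting it strictly separates the ends of one of its two diagonals; the four ranges
are the diagonals with both orientations. -/
theorem crosses_trapezoid {𝓛 c : Finset (ℝ × ℝ)} {a b : ℝ × ℝ} {p₁ p₂ : ℝ × ℝ}
    (h1 : p₁ ∈ c) (h2 : p₂ ∈ c) (h12 : ∀ p ∈ c, p₁.1 ≤ p.1 ∧ p.1 ≤ p₂.1)
    (hc : ∀ p ∈ c, height a p < 0 ∧ 0 < height b p) {ℓ : ℝ × ℝ} (hℓ : ℓ ∈ 𝓛) (hcr : Crosses ℓ c) :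
    ℓ ∈ sepRange 𝓛 (p₁.1, lineVal a p₁.1) (p₂.1, lineVal b p₂.1) ∨
    ℓ ∈ sepRange 𝓛 (p₂.1, lineVal b p₂.1) (p₁.1, lineVal a p₁.1) ∨
    ℓ ∈ sepRange 𝓛 (p₁.1, lineVal b p₁.1) (p₂.1, lineVal a p₂.1) ∨
    ℓ ∈ sepRange 𝓛 (p₂.1, lineVal a p₂.1) (p₁.1, lineVal b p₁.1) := by
  classical
  obtain ⟨⟨p, hp, hp'⟩, q, hq, hq'⟩ := hcr
  simp only [mem_sepRange, hℓ, true_and]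
  simp only [height] at *
  have e1 : lineVal b p₁.1 < lineVal a p₁.1 := by linarith [(hc _ h1).1, (hc _ h1).2]
  have e2 : lineVal b p₂.1 < lineVal a p₂.1 := by linarith [(hc _ h2).1, (hc _ h2).2]
  have f1 : lineVal ℓ p₁.1 < lineVal a p₁.1 ∨ lineVal ℓ p₂.1 < lineVal a p₂.1 := by
    by_contra hcon
    push Not at hcon
    have := lineVal_interp hcon.1 hcon.2 (h12 p hp).1 (h12 p hp).2
    linarith [(hc _ hp).1]
  have f2 : lineVal b p₁.1 < lineVal ℓ p₁.1 ∨ lineVal b p₂.1 < lineVal ℓ p₂.1 := by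
    by_contra hcon
    push Not at hcon
    have := lineVal_interp hcon.1 hcon.2 (h12 q hq).1 (h12 q hq).2
    linarith [(hc _ hq).2]
  by_contra hcon
  simp only [not_or, not_and, not_lt] at hcon
  obtain ⟨g1, g2, g3, g4⟩ := hcon
  rcases f1 with f1 | f1
  · have k1 : lineVal ℓ p₂.1 ≤ lineVal b p₂.1 := by
      by_contra hcon; linarith [g2 (by linarith)]
    have k2 : lineVal ℓ p₁.1 ≤ lineVal b p₁.1 := by
      by_contra hcon; linarith [g3 (by linarith)]
    rcases f2 with f2 | f2 <;> linarith
  · have k1 : lineVal ℓ p₁.1 ≤ lineVal b p₁.1 := by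
      by_contra hcon; linarith [g3 (by linarith)]
    have k2 : lineVal ℓ p₂.1 ≤ lineVal b p₂.1 := by
      by_contra hcon; linarith [g2 (by linarith)]
    rcases f2 with f2 | f2 <;> linarith

open Classical in
/-- A large class of points crossed by lines of small total weight. -/
theorem exists_light_class {𝓛 Y : Finset (ℝ × ℝ)} (h𝓛 : 𝓛.Nonempty) (hY : Y.Nonempty)
    (hT : NoTies 𝓛 Y) (hinj : Set.InjOn Prod.fst (Y : Set (ℝ × ℝ))) (w : ℝ × ℝ → ℝ)
    (hw : ∀ ℓ ∈ 𝓛, 0 < w ℓ) (s : ℕ) (hs : 0 < s) :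
    ∃ c ⊆ Y, Y.card ≤ 2 * (s + 2) * (s + 3) * c.card ∧
      ∑ ℓ ∈ 𝓛.filter (fun ℓ => Crosses ℓ c), w ℓ ≤
        4 * ((6 * Real.log (𝓛.card + 1) + 1) / s) * ∑ ℓ ∈ 𝓛, w ℓ := by
  set Λ : ℝ := 6 * Real.log (𝓛.card + 1) + 1 with hΛ
  have hlog : 0 ≤ Real.log ((𝓛.card : ℝ) + 1) := Real.log_nonneg (by linarith [(Nat.cast_nonneg 𝓛.card : (0:ℝ) ≤ _)])
  have hs0 : (0:ℝ) < s := by exact_mod_cast hs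
  set W := ∑ ℓ ∈ 𝓛, w ℓ with hW
  have hW0 : 0 < W := Finset.sum_pos hw h𝓛
  -- For `s < Λ` the bound exceeds the total weight, so `Y` itself serves.
  rcases lt_or_ge (s : ℝ) Λ with hlt | hge
  · refine ⟨Y, subset_rfl, ?_, ?_⟩
    · have : 1 ≤ 2 * (s + 2) * (s + 3) := by nlinarith
      nlinarith
    · have h1 : ∑ ℓ ∈ 𝓛.filter (fun ℓ => Crosses ℓ Y), w ℓ ≤ W :=
        Finset.sum_le_sum_of_subset_of_nonneg (Finset.filter_subset _ _) (fun ℓ hℓ _ => (hw ℓ hℓ).le)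
      have h2 : 1 ≤ Λ / s := by rw [le_div_iff₀ hs0]; linarith
      nlinarith
  have hδ1 : Λ / s ≤ 1 := by rw [div_le_one hs0]; exact hge
  obtain ⟨𝒜, h𝒜, hmem⟩ := exists_sepRanges 𝓛
  -- There are at most `(|𝓛| + 1)^6` ranges and `(1 - Λ/s)^s ≤ exp (-Λ)`; `Λ` is chosen so that
  -- fewer than one heavy range remains without a line of `S`.
  obtain ⟨S, hS, hSc, hSb⟩ := exists_hitting 𝓛 h𝓛 w hw (Λ / s) hδ1
    (𝒜.filter (fun R => R ⊆ 𝓛 ∧ Λ / s * W ≤ ∑ ℓ ∈ R, w ℓ)) (fun R hR => (Finset.mem_filter.1 hR).2) s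
  have hzero : ∀ R ∈ 𝒜, R ⊆ 𝓛 → Disjoint S R → ∑ ℓ ∈ R, w ℓ ≤ Λ / s * W := by
    intro R hR hR𝓛 hdis
    by_contra hcon
    push Not at hcon
    have h1 : (1:ℝ) ≤ (((𝒜.filter (fun R => R ⊆ 𝓛 ∧ Λ / s * W ≤ ∑ ℓ ∈ R, w ℓ)).filter
        (fun R => Disjoint S R)).card : ℝ) := by
      exact_mod_cast Finset.card_pos.2 ⟨R, by simp [hR, hR𝓛, hdis, hcon.le]⟩
    have h2 : ((𝒜.filter (fun R => R ⊆ 𝓛 ∧ Λ / s * W ≤ ∑ ℓ ∈ R, w ℓ)).card : ℝ) ≤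
        ((𝓛.card : ℝ) + 1) ^ 6 := by
      exact_mod_cast (Finset.card_filter_le _ _).trans h𝒜
    have h3 : (1 - Λ / s) ^ s ≤ Real.exp (-Λ) := by
      calc (1 - Λ / s) ^ s ≤ (Real.exp (-(Λ / s))) ^ s := by
            refine pow_le_pow_left₀ (by linarith) ?_ _
            linarith [Real.add_one_le_exp (-(Λ / s))]
        _ = Real.exp (-Λ) := by
            rw [← Real.exp_nat_mul]; congr 1; field_simp
    have h4 : ((𝓛.card : ℝ) + 1) ^ 6 * Real.exp (-Λ) < 1 := by
      have : Real.exp (-Λ) = (((𝓛.card : ℝ) + 1) ^ 6)⁻¹ * Real.exp (-1) := by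
        rw [hΛ, neg_add, Real.exp_add]
        congr 1
        rw [Real.exp_neg, mul_comm, ← Real.rpow_natCast, Real.rpow_def_of_pos (by positivity)]
        norm_num
      rw [this, ← mul_assoc, mul_inv_cancel₀ (by positivity), one_mul]
      rw [Real.exp_lt_one_iff]; norm_num
    have h5 : (0:ℝ) ≤ (1 - Λ / s) ^ s := pow_nonneg (by linarith) _
    have := h1.trans hSb
    have h6 := mul_le_mul h2 h3 h5 (by positivity)
    linarith
  -- add two far horizontal lines
  obtain ⟨M, hM⟩ : ∃ M : ℝ, ∀ p ∈ Y, |p.2| < M ∧ ∀ ℓ ∈ 𝓛, |lineVal ℓ p.1| < M := by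
    obtain ⟨M, hM⟩ := (Y.finite_toSet.image (fun p => |p.2|)).bddAbove
    obtain ⟨N, hN⟩ := ((Y ×ˢ 𝓛).finite_toSet.image (fun z => |lineVal z.2 z.1.1|)).bddAbove
    refine ⟨max M N + 1, fun p hp => ⟨?_, fun ℓ hℓ => ?_⟩⟩
    · have := hM ⟨p, hp, rfl⟩
      have h2 := le_max_left M N
      simp only at this
      linarith
    · have := hN ⟨(p, ℓ), by simpa using ⟨hp, hℓ⟩, rfl⟩
      have h2 := le_max_right M N
      simp only at this
      linarith
  have hM0 : 0 < M := by
    obtain ⟨p, hp⟩ := hY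
    exact (abs_nonneg _).trans_lt (hM p hp).1
  set S' : Finset (ℝ × ℝ) := insert (0, M) (insert (0, -M) S) with hS'
  have hvM : ∀ x, lineVal (0, M) x = M := fun x => by simp [lineVal]
  have hvM' : ∀ x, lineVal (0, -M) x = -M := fun x => by simp [lineVal]
  have hab : ∀ p ∈ Y, (∃ ℓ ∈ S', height ℓ p < 0) ∧ ∃ ℓ ∈ S', 0 < height ℓ p := by
    intro p hp
    have := abs_lt.1 (hM p hp).1
    refine ⟨⟨(0, M), by simp [hS'], ?_⟩, ⟨(0, -M), by simp [hS'], ?_⟩⟩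
    · rw [height, hvM]; linarith
    · rw [height, hvM']; linarith
  have hTS : NoTies S' Y := by
    constructor
    · intro ℓ hℓ p hp
      have := abs_lt.1 (hM p hp).1
      rw [hS', Finset.mem_insert, Finset.mem_insert] at hℓ
      rcases hℓ with rfl | rfl | hℓ
      · rw [height, hvM]; linarith
      · rw [height, hvM']; linarith
      · exact hT.off ℓ (hS hℓ) p hp
    · intro ℓ hℓ m hm hne p hp
      have hb : ∀ k ∈ S, -M < lineVal k p.1 ∧ lineVal k p.1 < M := fun k hk =>
        abs_lt.1 ((hM p hp).2 k (hS hk))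
      rw [hS', Finset.mem_insert, Finset.mem_insert] at hℓ hm
      rcases hℓ with rfl | rfl | hℓ <;> rcases hm with rfl | rfl | hm
      · exact absurd rfl hne
      · rw [hvM, hvM']; linarith
      · rw [hvM]; exact (hb m hm).2.ne'
      · rw [hvM, hvM']; linarith
      · exact absurd rfl hne
      · rw [hvM']; exact (hb m hm).1.ne
      · rw [hvM]; exact (hb ℓ hℓ).2.ne
      · rw [hvM']; exact (hb ℓ hℓ).1.ne'
      · exact hT.val ℓ (hS hℓ) m (hS hm) hne p hp
  obtain ⟨key, hkey, htrap⟩ := exists_trapezoid_key hab hTS hinj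
  have hS'c : S'.card ≤ s + 2 :=
    (Finset.card_insert_le _ _).trans (by
      have := Finset.card_insert_le ((0:ℝ), -M) S
      omega)
  set KS := (Finset.univ : Finset Bool) ×ˢ S' ×ˢ Finset.insertNone S' with hKS
  have hKSc : KS.card ≤ 2 * (s + 2) * (s + 3) := by
    rw [hKS, Finset.card_product, Finset.card_product, Finset.card_insertNone]
    simp only [Finset.card_univ, Fintype.card_bool]
    nlinarith [Nat.mul_le_mul hS'c (show S'.card + 1 ≤ s + 3 by omega)]
  have hKSne : KS.Nonempty := by
    obtain ⟨p, hp⟩ := hY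
    exact ⟨_, hkey p hp⟩
  obtain ⟨k, hk, hbig⟩ := Finset.exists_le_card_fiber_of_nsmul_le_card_of_maps_to
    (s := Y) (t := KS) (f := key) (b := (Y.card : ℝ) / KS.card) hkey hKSne (by
      have : (0:ℝ) < KS.card := by exact_mod_cast Finset.card_pos.2 hKSne
      rw [nsmul_eq_mul]; field_simp; exact le_rfl)
  have hKSpos : (0:ℝ) < KS.card := by exact_mod_cast Finset.card_pos.2 hKSne
  rw [div_le_iff₀ hKSpos] at hbig
  have hbig' : Y.card ≤ (Y.filter (fun p => key p = k)).card * KS.card := by exact_mod_cast hbig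
  set c := Y.filter (fun p => key p = k) with hc
  have hYpos := Finset.card_pos.2 hY
  have hcne : c.Nonempty := by
    rw [← Finset.card_pos]
    by_contra h0
    have : c.card = 0 := by omega
    rw [this] at hbig'; omega
  refine ⟨c, Finset.filter_subset _ _, ?_, ?_⟩
  · nlinarith [Nat.mul_le_mul_left c.card hKSc]
  obtain ⟨p₀, hp₀⟩ := hcne
  obtain ⟨a, b, hin, hm⟩ := htrap p₀ (Finset.mem_filter.1 hp₀).1
  have hck : ∀ p ∈ c, p ∈ Y ∧ key p = key p₀ := fun p hp =>
    ⟨(Finset.mem_filter.1 hp).1, ((Finset.mem_filter.1 hp).2).trans (Finset.mem_filter.1 hp₀).2.symm⟩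
  obtain ⟨p₁, hp₁, hmin⟩ := c.exists_min_image Prod.fst ⟨p₀, hp₀⟩
  obtain ⟨p₂, hp₂, hmax⟩ := c.exists_max_image Prod.fst ⟨p₀, hp₀⟩
  have hlt : ∀ p ∈ c, lineVal b p.1 < lineVal a p.1 := by
    intro p hp
    obtain ⟨h1, h2⟩ := hin p (hck p hp).1 (hck p hp).2
    simp only [height] at h1 h2; linarith
  -- Over the class every line of `S` stays weakly above `a` or weakly below `b`, so it separates
  -- the ends of no diagonal. The four ranges thus avoid `S` and are light.
  have hdis : ∀ p ∈ c, ∀ q ∈ c, Disjoint S (sepRange 𝓛 (p.1, lineVal a p.1) (q.1, lineVal b q.1)) ∧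
      Disjoint S (sepRange 𝓛 (q.1, lineVal b q.1) (p.1, lineVal a p.1)) := by
    intro p hp q hq
    have hp' := hck p hp
    have hq' := hck q hq
    have key2 : ∀ m ∈ S, (lineVal a p.1 ≤ lineVal m p.1 ∧ lineVal b q.1 ≤ lineVal m q.1) ∨
        (lineVal m p.1 ≤ lineVal a p.1 ∧ lineVal m q.1 ≤ lineVal b q.1) := by
      intro m hmS
      rcases hm m (by simp [hS', hmS]) with h | h
      · exact Or.inl ⟨h p hp'.1 hp'.2, (hlt q hq).le.trans (h q hq'.1 hq'.2)⟩
      · exact Or.inr ⟨(h p hp'.1 hp'.2).trans (hlt p hp).le, h q hq'.1 hq'.2⟩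
    constructor
    · rw [Finset.disjoint_left]
      intro m hmS hmr
      rw [mem_sepRange] at hmr
      simp only [height] at hmr
      rcases key2 m hmS with h | h <;> linarith [h.1, h.2, hmr.2.1, hmr.2.2]
    · rw [Finset.disjoint_left]
      intro m hmS hmr
      rw [mem_sepRange] at hmr
      simp only [height] at hmr
      rcases key2 m hmS with h | h <;> linarith [h.1, h.2, hmr.2.1, hmr.2.2]
  have hb : ∀ u v, Disjoint S (sepRange 𝓛 u v) → ∑ ℓ ∈ sepRange 𝓛 u v, w ℓ ≤ Λ / s * W :=
    fun u v h => hzero _ (hmem u v) (Finset.filter_subset _ _) h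
  have hsub : 𝓛.filter (fun ℓ => Crosses ℓ c) ⊆
      (sepRange 𝓛 (p₁.1, lineVal a p₁.1) (p₂.1, lineVal b p₂.1) ∪
      sepRange 𝓛 (p₂.1, lineVal b p₂.1) (p₁.1, lineVal a p₁.1)) ∪
      (sepRange 𝓛 (p₁.1, lineVal b p₁.1) (p₂.1, lineVal a p₂.1) ∪
      sepRange 𝓛 (p₂.1, lineVal a p₂.1) (p₁.1, lineVal b p₁.1)) := by
    intro ℓ hℓ
    rw [Finset.mem_filter] at hℓ
    have := crosses_trapezoid hp₁ hp₂ (fun p hp => ⟨hmin p hp, hmax p hp⟩)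
      (fun p hp => hin p (hck p hp).1 (hck p hp).2) hℓ.1 hℓ.2
    simp only [Finset.mem_union]
    tauto
  have hun : ∀ A B : Finset (ℝ × ℝ), A ⊆ 𝓛 → B ⊆ 𝓛 →
      ∑ ℓ ∈ A ∪ B, w ℓ ≤ ∑ ℓ ∈ A, w ℓ + ∑ ℓ ∈ B, w ℓ := by
    intro A B hA hB
    rw [← Finset.sum_union_inter]
    have : 0 ≤ ∑ ℓ ∈ A ∩ B, w ℓ :=
      Finset.sum_nonneg fun ℓ hℓ => (hw ℓ (hA (Finset.mem_inter.1 hℓ).1)).le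
    linarith
  have hss : ∀ u v, sepRange 𝓛 u v ⊆ 𝓛 := fun u v => Finset.filter_subset _ _
  refine (Finset.sum_le_sum_of_subset_of_nonneg hsub (fun ℓ hℓ _ => (hw ℓ ?_).le)).trans ?_
  · simp only [Finset.mem_union] at hℓ
    rcases hℓ with (h | h) | (h | h) <;> exact hss _ _ h
  · have d1 := hdis p₁ hp₁ p₂ hp₂
    have d2 := hdis p₂ hp₂ p₁ hp₁
    have := hb _ _ d1.1
    have := hb _ _ d1.2
    have := hb _ _ d2.1
    have := hb _ _ d2.2
    have u1 := hun _ _ (hss (p₁.1, lineVal a p₁.1) (p₂.1, lineVal b p₂.1))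
      (hss (p₂.1, lineVal b p₂.1) (p₁.1, lineVal a p₁.1))
    have u2 := hun _ _ (hss (p₁.1, lineVal b p₁.1) (p₂.1, lineVal a p₂.1))
      (hss (p₂.1, lineVal a p₂.1) (p₁.1, lineVal b p₁.1))
    have u3 := hun _ _ (Finset.union_subset (hss (p₁.1, lineVal a p₁.1) (p₂.1, lineVal b p₂.1))
      (hss (p₂.1, lineVal b p₂.1) (p₁.1, lineVal a p₁.1)))
      (Finset.union_subset (hss (p₁.1, lineVal b p₁.1) (p₂.1, lineVal a p₂.1))
      (hss (p₂.1, lineVal a p₂.1) (p₁.1, lineVal b p₁.1)))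
    linarith

theorem NoTies.mono {𝓛 Y Z : Finset (ℝ × ℝ)} (h : NoTies 𝓛 Y) (hZ : Z ⊆ Y) : NoTies 𝓛 Z :=
  ⟨fun ℓ hℓ p hp => h.off ℓ hℓ p (hZ hp), fun ℓ hℓ m hm hne p hp => h.val ℓ hℓ m hm hne p (hZ hp)⟩

open Classical in
/-- The number of classes crossed by a line. -/
noncomputable def crossNum (𝒞 : Finset (Finset (ℝ × ℝ))) (ℓ : ℝ × ℝ) : ℕ :=
  (𝒞.filter (fun c => Crosses ℓ c)).card

/-- Discrete version of integrating `1/√v`: removing one class lowers `v` by 1 and multiplies the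
total weight by at most `1 + 32Λ/√v`, and the product of these factors telescopes. -/
theorem sqrt_step {v Λ : ℝ} (hv : 1 ≤ v) (hΛ : 0 ≤ Λ) :
    (1 + 32 * Λ / √v) * Real.exp (64 * Λ * √(v - 1)) ≤ Real.exp (64 * Λ * √v) := by
  have hv0 : 0 < √v := Real.sqrt_pos.2 (by linarith)
  have h1 : 1 / (2 * √v) ≤ √v - √(v - 1) := by
    rw [div_le_iff₀ (by positivity)]
    have e1 := Real.mul_self_sqrt (show 0 ≤ v by linarith)
    have e2 := Real.mul_self_sqrt (show 0 ≤ v - 1 by linarith)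
    nlinarith [sq_nonneg (√v - √(v - 1))]
  have h2 : 1 + 32 * Λ / √v ≤ Real.exp (32 * Λ / √v) := by
    linarith [Real.add_one_le_exp (32 * Λ / √v)]
  calc _ ≤ Real.exp (32 * Λ / √v) * Real.exp (64 * Λ * √(v - 1)) := by gcongr
    _ = Real.exp (32 * Λ / √v + 64 * Λ * √(v - 1)) := (Real.exp_add _ _).symm
    _ ≤ _ := by
      refine Real.exp_le_exp.2 ?_
      have h3 : 64 * Λ * (1 / (2 * √v)) ≤ 64 * Λ * (√v - √(v - 1)) := by gcongr
      have h4 : 64 * Λ * (1 / (2 * √v)) = 32 * Λ / √v := by field_simp; ring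
      linarith

open Classical in
/-- Partition by reweighting. -/
theorem exists_partition_weighted {𝓛 : Finset (ℝ × ℝ)} (h𝓛 : 𝓛.Nonempty) (s₀ : ℕ) (hs₀ : 0 < s₀)
    (Y : Finset (ℝ × ℝ)) (hT : NoTies 𝓛 Y) (hinj : Set.InjOn Prod.fst (Y : Set (ℝ × ℝ)))
    (w : ℝ × ℝ → ℝ) (hw : ∀ ℓ ∈ 𝓛, 0 < w ℓ) :
    ∃ 𝒞 : Finset (Finset (ℝ × ℝ)), (∀ c ∈ 𝒞, c ⊆ Y ∧ c.card = s₀) ∧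
      (∀ c ∈ 𝒞, ∀ d ∈ 𝒞, c ≠ d → Disjoint c d) ∧
      (Y.filter (fun p => ∀ c ∈ 𝒞, p ∉ c)).card < 64 * s₀ ∧
      ∑ ℓ ∈ 𝓛, w ℓ * 2 ^ crossNum 𝒞 ℓ ≤
        (∑ ℓ ∈ 𝓛, w ℓ) * Real.exp (64 * (6 * Real.log (𝓛.card + 1) + 1) * √(Y.card / s₀)) := by
  set Λ : ℝ := 6 * Real.log (𝓛.card + 1) + 1 with hΛ
  have hlog : 0 ≤ Real.log ((𝓛.card : ℝ) + 1) :=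
    Real.log_nonneg (by linarith [(Nat.cast_nonneg 𝓛.card : (0:ℝ) ≤ _)])
  have hΛ0 : 0 ≤ Λ := by linarith
  have hs₀' : (0:ℝ) < s₀ := by exact_mod_cast hs₀
  induction Y using Finset.strongInduction generalizing w with
  | H Y ih =>
    rcases lt_or_ge Y.card (64 * s₀) with hsmall | hbig
    · refine ⟨∅, by simp, by simp, by simpa using hsmall, ?_⟩
      have : ∀ ℓ, crossNum ∅ ℓ = 0 := fun ℓ => by simp [crossNum]
      simp only [this, pow_zero, mul_one]
      have h0 : 0 ≤ ∑ ℓ ∈ 𝓛, w ℓ := Finset.sum_nonneg fun ℓ hℓ => (hw ℓ hℓ).le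
      refine le_mul_of_one_le_right h0 (Real.one_le_exp (by positivity))
    set v : ℝ := Y.card / s₀ with hv
    have hv64 : 64 ≤ v := by
      rw [hv, le_div_iff₀ hs₀']; exact_mod_cast hbig
    have hsq : 8 ≤ √v := by
      rw [show (8:ℝ) = √64 by rw [show (64:ℝ) = 8 ^ 2 by norm_num, Real.sqrt_sq (by norm_num)]]
      exact Real.sqrt_le_sqrt hv64
    -- This `s` satisfies `2(s+2)(s+3) ≤ v`, so the light class has at least `s₀` points and can be
    -- trimmed to exactly `s₀`. The threshold 64 guarantees `s ≥ 2` and `√v ≤ 8s`.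
    set s : ℕ := ⌊√v / 4⌋₊ with hs
    have hs1 : (s : ℝ) ≤ √v / 4 := Nat.floor_le (by positivity)
    have hs2 : √v / 4 < s + 1 := Nat.lt_floor_add_one _
    have hs2' : 2 ≤ s := Nat.le_floor (by push_cast; linarith)
    have hs2r : (2:ℝ) ≤ s := by exact_mod_cast hs2'
    have hYne : Y.Nonempty := Finset.card_pos.1 (by omega)
    obtain ⟨c₁, hc₁, hcard, hwt⟩ := exists_light_class h𝓛 hYne hT hinj w hw s (by omega)
    have hc₁s : s₀ ≤ c₁.card := by
      have e1 : ((2 * (s + 2) * (s + 3) : ℕ) : ℝ) ≤ v := by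
        push_cast
        have := Real.mul_self_sqrt (show 0 ≤ v by linarith)
        nlinarith
      have e2 : (Y.card : ℝ) ≤ ((2 * (s + 2) * (s + 3) : ℕ) : ℝ) * c₁.card := by exact_mod_cast hcard
      have e3 : (Y.card : ℝ) = v * s₀ := by rw [hv]; field_simp
      have e4 : v * s₀ ≤ v * c₁.card := by
        rw [← e3]; refine e2.trans ?_; exact mul_le_mul_of_nonneg_right e1 (Nat.cast_nonneg _)
      exact_mod_cast le_of_mul_le_mul_left e4 (by linarith)
    obtain ⟨c, hcc, hcs⟩ := Finset.exists_subset_card_eq hc₁s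
    have hcY : c ⊆ Y := hcc.trans hc₁
    have hcne : c.Nonempty := Finset.card_pos.1 (by omega)
    have hss : Y \ c ⊂ Y := Finset.sdiff_ssubset hcY hcne
    -- Doubling at each crossed class turns the final weight of a line into its initial weight times
    -- `2 ^ crossNum`.
    set w' : ℝ × ℝ → ℝ := fun ℓ => if Crosses ℓ c then 2 * w ℓ else w ℓ with hw'
    obtain ⟨𝒞, h1, h2, h3, h4⟩ := ih (Y \ c) hss (hT.mono hss.1)
      (hinj.mono (by exact_mod_cast hss.1)) w' (fun ℓ hℓ => by
        have := hw ℓ hℓ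
        simp only [hw']; split_ifs <;> linarith)
    have hcn : c ∉ 𝒞 := by
      intro h
      obtain ⟨p, hp⟩ := hcne
      exact (Finset.mem_sdiff.1 ((h1 c h).1 hp)).2 hp
    refine ⟨insert c 𝒞, ?_, ?_, ?_, ?_⟩
    · intro d hd
      rcases Finset.mem_insert.1 hd with rfl | hd
      · exact ⟨hcY, hcs⟩
      · exact ⟨(h1 d hd).1.trans hss.1, (h1 d hd).2⟩
    · have hdj : ∀ d ∈ 𝒞, Disjoint c d := fun d hd =>
        Finset.disjoint_left.2 fun p hp hp' => (Finset.mem_sdiff.1 ((h1 d hd).1 hp')).2 hp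
      intro d hd e he hne
      rcases Finset.mem_insert.1 hd with rfl | hd' <;> rcases Finset.mem_insert.1 he with rfl | he'
      · exact absurd rfl hne
      · exact hdj e he'
      · exact (hdj d hd').symm
      · exact h2 d hd' e he' hne
    · refine lt_of_le_of_lt (Finset.card_le_card ?_) h3
      intro p hp
      simp only [Finset.mem_filter, Finset.mem_insert, forall_eq_or_imp, Finset.mem_sdiff] at hp ⊢
      exact ⟨⟨hp.1, hp.2.1⟩, hp.2.2⟩
    · have hcr : ∀ ℓ, w ℓ * 2 ^ crossNum (insert c 𝒞) ℓ = w' ℓ * 2 ^ crossNum 𝒞 ℓ := by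
        intro ℓ
        simp only [crossNum, Finset.filter_insert, hw']
        split_ifs with h
        · rw [Finset.card_insert_of_notMem (by simp [hcn]), pow_succ]; ring
        · rfl
      simp only [hcr]
      refine h4.trans ?_
      have hW' : ∑ ℓ ∈ 𝓛, w' ℓ ≤ (∑ ℓ ∈ 𝓛, w ℓ) * (1 + 32 * Λ / √v) := by
        have e1 : ∑ ℓ ∈ 𝓛, w' ℓ = ∑ ℓ ∈ 𝓛, w ℓ + ∑ ℓ ∈ 𝓛.filter (fun ℓ => Crosses ℓ c), w ℓ := by
          rw [Finset.sum_filter, ← Finset.sum_add_distrib]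
          refine Finset.sum_congr rfl fun ℓ _ => ?_
          simp only [hw']; split_ifs <;> ring
        have e2 : ∑ ℓ ∈ 𝓛.filter (fun ℓ => Crosses ℓ c), w ℓ ≤
            ∑ ℓ ∈ 𝓛.filter (fun ℓ => Crosses ℓ c₁), w ℓ := by
          refine Finset.sum_le_sum_of_subset_of_nonneg ?_
            (fun ℓ hℓ _ => (hw ℓ (Finset.mem_filter.1 hℓ).1).le)
          intro ℓ hℓ
          rw [Finset.mem_filter] at hℓ ⊢
          exact ⟨hℓ.1, hℓ.2.mono hcc⟩
        have e3 : 4 * (Λ / s) ≤ 32 * Λ / √v := by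
          have : √v ≤ 8 * s := by linarith
          rw [← mul_div_assoc, div_le_div_iff₀ (by linarith) (by linarith)]
          nlinarith
        have h0 : 0 ≤ ∑ ℓ ∈ 𝓛, w ℓ := Finset.sum_nonneg fun ℓ hℓ => (hw ℓ hℓ).le
        have e4 := mul_le_mul_of_nonneg_right e3 h0
        rw [e1]
        linarith
      have hYc : ((Y \ c).card : ℝ) / s₀ = v - 1 := by
        rw [Finset.card_sdiff_of_subset hcY, Nat.cast_sub (Finset.card_le_card hcY), hcs, hv]
        field_simp
      rw [hYc]
      have h0 : 0 ≤ ∑ ℓ ∈ 𝓛, w ℓ := Finset.sum_nonneg fun ℓ hℓ => (hw ℓ hℓ).le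
      calc _ ≤ (∑ ℓ ∈ 𝓛, w ℓ) * (1 + 32 * Λ / √v) * Real.exp (64 * Λ * √(v - 1)) := by gcongr
        _ = (∑ ℓ ∈ 𝓛, w ℓ) * ((1 + 32 * Λ / √v) * Real.exp (64 * Λ * √(v - 1))) := by ring
        _ ≤ _ := by
          gcongr
          exact sqrt_step (by linarith) hΛ0

/-- Partition of a point set into classes of equal size such that every test line crosses few. -/
theorem exists_partition_lines {𝓛 : Finset (ℝ × ℝ)} (h𝓛 : 𝓛.Nonempty) (s₀ : ℕ) (hs₀ : 0 < s₀)
    (Y : Finset (ℝ × ℝ)) (hT : NoTies 𝓛 Y) (hinj : Set.InjOn Prod.fst (Y : Set (ℝ × ℝ))) :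
    ∃ 𝒞 : Finset (Finset (ℝ × ℝ)), (∀ c ∈ 𝒞, c ⊆ Y ∧ c.card = s₀) ∧
      (∀ c ∈ 𝒞, ∀ d ∈ 𝒞, c ≠ d → Disjoint c d) ∧
      (Y.filter (fun p => ∀ c ∈ 𝒞, p ∉ c)).card < 64 * s₀ ∧
      ∀ ℓ ∈ 𝓛, (crossNum 𝒞 ℓ : ℝ) ≤
        2 * (Real.log 𝓛.card + 64 * (6 * Real.log (𝓛.card + 1) + 1) * √(Y.card / s₀)) := by
  obtain ⟨𝒞, h1, h2, h3, h4⟩ := exists_partition_weighted h𝓛 s₀ hs₀ Y hT hinj (fun _ => 1)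
    (fun _ _ => one_pos)
  refine ⟨𝒞, h1, h2, h3, fun ℓ hℓ => ?_⟩
  simp only [one_mul, Finset.sum_const, nsmul_eq_mul, mul_one] at h4
  have h5 : (2:ℝ) ^ crossNum 𝒞 ℓ ≤ ∑ ℓ ∈ 𝓛, (2:ℝ) ^ crossNum 𝒞 ℓ :=
    Finset.single_le_sum (f := fun ℓ => (2:ℝ) ^ crossNum 𝒞 ℓ) (fun _ _ => by positivity) hℓ
  have hpos : (0:ℝ) < 𝓛.card := by exact_mod_cast Finset.card_pos.2 h𝓛
  have h6 := Real.log_le_log (by positivity) (h5.trans h4)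
  rw [Real.log_pow, Real.log_mul hpos.ne' (Real.exp_pos _).ne', Real.log_exp] at h6
  -- The factor 2 in the claim pays for `log 2 > 1/2`.
  have h7 := Real.log_two_gt_d9
  have h8 : (0:ℝ) ≤ crossNum 𝒞 ℓ := Nat.cast_nonneg _
  nlinarith

/-! ### Test lines: shifts without ties and cells in the dual plane. -/

theorem exists_lt_abs (F : Finset ℝ) : ∃ t : ℝ, 0 < t ∧ ∀ z ∈ F, z ≠ 0 → t < |z| := by
  induction F using Finset.induction_on with
  | empty => exact ⟨1, one_pos, by simp⟩
  | insert a F _ ih =>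
    obtain ⟨t, ht, h⟩ := ih
    by_cases ha : a = 0
    · refine ⟨t, ht, fun z hz hz0 => ?_⟩
      rcases Finset.mem_insert.1 hz with rfl | hz
      · exact absurd ha hz0
      · exact h z hz hz0
    · have : 0 < |a| := abs_pos.2 ha
      refine ⟨min t (|a| / 2), by positivity, fun z hz hz0 => ?_⟩
      rcases Finset.mem_insert.1 hz with rfl | hz
      · exact (min_le_right _ _).trans_lt (by linarith)
      · exact (min_le_left _ _).trans_lt (h z hz hz0)

/-- Small distinct vertical shifts of finitely many lines, up and down, without ties. -/
theorem exists_shift (Q X : Finset (ℝ × ℝ)) : ∃ sh : ℝ × ℝ → Bool → ℝ × ℝ,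
    NoTies ((Q ×ˢ (Finset.univ : Finset Bool)).image (fun z => sh z.1 z.2)) X ∧
    ∀ ℓ ∈ Q, (∀ x, lineVal ℓ x < lineVal (sh ℓ true) x ∧ lineVal (sh ℓ false) x < lineVal ℓ x) ∧
      ∀ p ∈ X, (height (sh ℓ true) p < 0 → height ℓ p ≤ 0) ∧
        (0 < height (sh ℓ false) p → 0 ≤ height ℓ p) := by
  classical
  obtain ⟨t, ht, hF⟩ := exists_lt_abs ((Q ×ˢ X).image (fun z => height z.1 z.2) ∪
    (Q ×ˢ Q ×ˢ X).image (fun z => lineVal z.1 z.2.2.1 - lineVal z.2.1 z.2.2.1))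
  have hF1 : ∀ ℓ ∈ Q, ∀ p ∈ X, height ℓ p ≠ 0 → t < |height ℓ p| := fun ℓ hℓ p hp =>
    hF _ (Finset.mem_union_left _ (Finset.mem_image.2 ⟨(ℓ, p), by simp [hℓ, hp], rfl⟩))
  have hF2 : ∀ ℓ ∈ Q, ∀ m ∈ Q, ∀ p ∈ X, lineVal ℓ p.1 - lineVal m p.1 ≠ 0 →
      t < |lineVal ℓ p.1 - lineVal m p.1| := fun ℓ hℓ m hm p hp =>
    hF _ (Finset.mem_union_right _ (Finset.mem_image.2 ⟨(ℓ, m, p), by simp [hℓ, hm, hp], rfl⟩))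
  obtain ⟨idx, hidx⟩ := Set.countable_iff_exists_injOn.1 Q.countable_toSet
  obtain ⟨N, hN⟩ : ∃ N : ℕ, ∀ ℓ ∈ Q, idx ℓ ≤ N :=
    ⟨Q.sup idx, fun ℓ hℓ => Finset.le_sup (f := idx) hℓ⟩
  -- The shifts are distinct nonzero multiples of `u` of size at most `t/2`, and `t` is smaller than
  -- every nonzero height and every nonzero gap of two lines over a point. So ties are broken and no
  -- strict inequality is reversed.
  let e : ℝ × ℝ → Bool → ℝ := fun ℓ b => if b then (idx ℓ + 1 : ℝ) else -(idx ℓ + 1 : ℝ)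
  let u : ℝ := t / (2 * (N + 1))
  have hu : 0 < u := by positivity
  have he0 : ∀ ℓ b, e ℓ b ≠ 0 := by
    intro ℓ b
    have : (0:ℝ) < idx ℓ + 1 := by positivity
    cases b <;> simp [e] <;> linarith
  have heb : ∀ ℓ ∈ Q, ∀ b, |e ℓ b| ≤ N + 1 := by
    intro ℓ hℓ b
    have h1 : (idx ℓ : ℝ) ≤ N := by exact_mod_cast hN ℓ hℓ
    have h2 : (0:ℝ) ≤ idx ℓ := by positivity
    rw [abs_le]
    cases b <;> simp only [e, Bool.false_eq_true, if_true, if_false] <;> constructor <;> linarith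
  have heinj : ∀ ℓ ∈ Q, ∀ m ∈ Q, ∀ b b', e ℓ b = e m b' → ℓ = m ∧ b = b' := by
    intro ℓ hℓ m hm b b' h
    have h1 : (0:ℝ) ≤ idx ℓ := by positivity
    have h2 : (0:ℝ) ≤ idx m := by positivity
    cases b <;> cases b' <;> simp [e] at h ⊢
    · exact hidx hℓ hm (by exact_mod_cast h)
    · linarith
    · linarith
    · exact hidx hℓ hm (by exact_mod_cast h)
  have hue : ∀ ℓ ∈ Q, ∀ b, |u * e ℓ b| ≤ t / 2 := by
    intro ℓ hℓ b
    rw [abs_mul, abs_of_pos hu]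
    calc u * |e ℓ b| ≤ u * (N + 1) := by gcongr; exact heb ℓ hℓ b
      _ = t / 2 := by simp only [u]; field_simp
  let sh : ℝ × ℝ → Bool → ℝ × ℝ := fun ℓ b => (ℓ.1, ℓ.2 + u * e ℓ b)
  have hv : ∀ ℓ b x, lineVal (sh ℓ b) x = lineVal ℓ x + u * e ℓ b := by
    intro ℓ b x; simp [sh, lineVal]; ring
  have hh : ∀ ℓ b p, height (sh ℓ b) p = height ℓ p - u * e ℓ b := by
    intro ℓ b p; simp only [height, hv]; ring
  refine ⟨sh, ⟨?_, ?_⟩, ?_⟩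
  · intro k hk p hp
    obtain ⟨⟨ℓ, b⟩, hz, rfl⟩ := Finset.mem_image.1 hk
    have hℓ : ℓ ∈ Q := (Finset.mem_product.1 hz).1
    simp only [hh]
    by_cases h0 : height ℓ p = 0
    · rw [h0, zero_sub, neg_ne_zero]
      exact mul_ne_zero hu.ne' (he0 ℓ b)
    · intro hcon
      have h1 := hF1 ℓ hℓ p hp h0
      have h2 := hue ℓ hℓ b
      rw [sub_eq_zero.1 hcon] at h1
      linarith
  · intro k hk k' hk' hne p hp
    obtain ⟨⟨ℓ, b⟩, hz, rfl⟩ := Finset.mem_image.1 hk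
    obtain ⟨⟨m, b'⟩, hz', rfl⟩ := Finset.mem_image.1 hk'
    have hℓ : ℓ ∈ Q := (Finset.mem_product.1 hz).1
    have hm : m ∈ Q := (Finset.mem_product.1 hz').1
    simp only [hv] at *
    intro hcon
    by_cases h0 : lineVal ℓ p.1 - lineVal m p.1 = 0
    · have : u * e ℓ b = u * e m b' := by linarith
      obtain ⟨rfl, rfl⟩ := heinj ℓ hℓ m hm b b' (mul_left_cancel₀ hu.ne' this)
      exact hne rfl
    · have h1 := hF2 ℓ hℓ m hm p hp h0
      have h2 := abs_le.1 (hue ℓ hℓ b)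
      have h3 := abs_le.1 (hue m hm b')
      rw [lt_abs] at h1
      rcases h1 with h1 | h1 <;> linarith
  · intro ℓ hℓ
    have hi : (0:ℝ) < idx ℓ + 1 := by positivity
    have et : 0 < u * e ℓ true := by simp only [e, if_true]; positivity
    have ef : u * e ℓ false < 0 := by
      simp only [e, Bool.false_eq_true, if_false]; nlinarith
    refine ⟨fun x => ⟨by rw [hv]; linarith, by rw [hv]; linarith⟩, fun p hp => ⟨fun h => ?_, fun h => ?_⟩⟩
    · rw [hh] at h
      by_contra hcon
      push Not at hcon
      have h1 := hF1 ℓ hℓ p hp hcon.ne'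
      rw [abs_of_pos hcon] at h1
      have h2 := abs_le.1 (hue ℓ hℓ true)
      linarith
    · rw [hh] at h
      by_contra hcon
      push Not at hcon
      have h1 := hF1 ℓ hℓ p hp hcon.ne
      rw [abs_of_neg hcon] at h1
      have h2 := abs_le.1 (hue ℓ hℓ false)
      linarith

/-- Lines on the same weak side as `ℓ` of all points of `A`. -/
def lineCell (A : Finset (ℝ × ℝ)) (ℓ : ℝ × ℝ) : Set (ℝ × ℝ) :=
  {m | ∀ a ∈ A, (0 ≤ height ℓ a → 0 ≤ height m a) ∧ (height ℓ a ≤ 0 → height m a ≤ 0)}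

theorem height_combo_line (a ℓ m : ℝ × ℝ) {s t : ℝ} (h : s + t = 1) :
    height (s • ℓ + t • m) a = s * height ℓ a + t * height m a := by
  simp only [height, lineVal, Prod.fst_add, Prod.snd_add, Prod.smul_fst, Prod.smul_snd, smul_eq_mul]
  linear_combination (-a.2) * h

theorem convex_lineCell (A : Finset (ℝ × ℝ)) (ℓ : ℝ × ℝ) : Convex ℝ (lineCell A ℓ) := by
  intro m hm k hk s t hs ht hst a ha
  rw [height_combo_line _ _ _ hst]
  refine ⟨fun h => ?_, fun h => ?_⟩
  · have := (hm a ha).1 h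
    have := (hk a ha).1 h
    positivity
  · have := (hm a ha).2 h
    have := (hk a ha).2 h
    nlinarith

theorem continuous_height_left (a : ℝ × ℝ) : Continuous fun m => height m a := by
  unfold height lineVal; fun_prop

theorem isClosed_lineCell (A : Finset (ℝ × ℝ)) (ℓ : ℝ × ℝ) : IsClosed (lineCell A ℓ) := by
  have : lineCell A ℓ = ⋂ a ∈ A, ({m | 0 ≤ height ℓ a → 0 ≤ height m a} ∩
      {m | height ℓ a ≤ 0 → height m a ≤ 0}) := by
    ext m; simp [lineCell]
  rw [this]
  refine isClosed_biInter fun a _ => IsClosed.inter ?_ ?_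
  · by_cases h : 0 ≤ height ℓ a
    · simpa [h] using isClosed_le continuous_const (continuous_height_left a)
    · simp [h]
  · by_cases h : height ℓ a ≤ 0
    · simpa [h] using isClosed_le (continuous_height_left a) continuous_const
    · simp [h]

/-- Four points on two vertical walls keep the values of all lines of the cell at these walls in
`[-M, M]`, which bounds slope and intercept. -/
theorem isCompact_lineCell {A : Finset (ℝ × ℝ)} {ℓ : ℝ × ℝ} {x₁ x₂ M : ℝ} (hx : x₁ < x₂)
    (h1 : (x₁, M) ∈ A) (h2 : (x₁, -M) ∈ A) (h3 : (x₂, M) ∈ A) (h4 : (x₂, -M) ∈ A)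
    (l1 : |lineVal ℓ x₁| ≤ M) (l2 : |lineVal ℓ x₂| ≤ M) : IsCompact (lineCell A ℓ) := by
  refine Metric.isCompact_of_isClosed_isBounded (isClosed_lineCell A ℓ) ?_
  rw [abs_le] at l1 l2
  set D := 2 * M / (x₂ - x₁) with hD
  have hx' : 0 < x₂ - x₁ := by linarith
  refine (Metric.isBounded_Icc ((-D, -M - D * |x₁|) : ℝ × ℝ) (D, M + D * |x₁|)).subset ?_
  intro m hm
  have e1 := (hm _ h1).1 (by simp only [height]; linarith)
  have e2 := (hm _ h2).2 (by simp only [height]; linarith)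
  have e3 := (hm _ h3).1 (by simp only [height]; linarith)
  have e4 := (hm _ h4).2 (by simp only [height]; linarith)
  simp only [height] at e1 e2 e3 e4
  have hs : m.1 * (x₂ - x₁) = lineVal m x₂ - lineVal m x₁ := by simp only [lineVal]; ring
  have hs1 : m.1 ≤ D := by rw [hD, le_div_iff₀ hx']; linarith
  have hs2 : -D ≤ m.1 := by rw [hD, neg_le, ← sub_nonneg, sub_neg_eq_add]; rw [div_add' _ _ _ hx'.ne']; apply div_nonneg _ hx'.le; linarith
  have hc : m.2 = lineVal m x₁ - m.1 * x₁ := by simp only [lineVal]; ring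
  have habs : |m.1 * x₁| ≤ D * |x₁| := by
    rw [abs_mul]; gcongr; exact abs_le.2 ⟨hs2, hs1⟩
  rw [abs_le] at habs
  refine ⟨⟨hs2, ?_⟩, ⟨hs1, ?_⟩⟩
  · show -M - D * |x₁| ≤ m.2
    rw [hc]; linarith
  · show m.2 ≤ M + D * |x₁|
    rw [hc]; linarith

theorem eq_through {m a b : ℝ × ℝ} (h : a.1 ≠ b.1) (ha : height m a = 0) (hb : height m b = 0) :
    m = through a b := by
  have hne : b.1 - a.1 ≠ 0 := sub_ne_zero.2 h.symm
  simp only [height, lineVal] at ha hb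
  have h1 : m.1 = (b.2 - a.2) / (b.1 - a.1) := by
    rw [eq_div_iff hne]; linarith
  refine Prod.ext h1 ?_
  simp only [through, ← h1]; linarith

-- If the points of `A` on `m` have only one abscissa `x₀`, or there are none, then small rotations
-- of `m` about its point over `x₀` stay in the cell in both directions, and `m` is not extreme.
open Classical in
theorem extremePoints_lineCell (A : Finset (ℝ × ℝ)) (ℓ : ℝ × ℝ) :
    (lineCell A ℓ).extremePoints ℝ ⊆ ((A ×ˢ A).image (fun z => through z.1 z.2) : Finset _) := by
  intro m hm
  rw [mem_extremePoints] at hm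
  obtain ⟨hmC, hext⟩ := hm
  by_contra hcon
  have hact : ∀ a ∈ A, ∀ b ∈ A, height m a = 0 → height m b = 0 → a.1 = b.1 := by
    intro a ha b hb h1 h2
    by_contra hne
    refine hcon ?_
    rw [eq_through hne h1 h2]
    exact Finset.mem_coe.2 (Finset.mem_image.2 ⟨(a, b), by simp [ha, hb], rfl⟩)
  obtain ⟨x₀, hx₀⟩ : ∃ x₀, ∀ a ∈ A, height m a = 0 → a.1 = x₀ := by
    by_cases h : ∃ a ∈ A, height m a = 0
    · obtain ⟨a, ha, h1⟩ := h
      exact ⟨a.1, fun b hb h2 => hact b hb a ha h2 h1⟩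
    · exact ⟨0, fun a ha h1 => absurd ⟨a, ha, h1⟩ h⟩
  obtain ⟨t, ht, hF⟩ := exists_lt_abs (A.image (fun a => height m a))
  obtain ⟨N, hN⟩ := (A.finite_toSet.image (fun a => |a.1 - x₀|)).bddAbove
  set d : ℝ := t / (|N| + 1) with hd
  have hd0 : 0 < d := by positivity
  have hdb : ∀ a ∈ A, d * |a.1 - x₀| ≤ t := by
    intro a ha
    have h1 : |a.1 - x₀| ≤ N := hN ⟨a, ha, rfl⟩
    have h2 : N ≤ |N| := le_abs_self N
    calc d * |a.1 - x₀| ≤ d * (|N| + 1) := by gcongr; linarith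
      _ = t := by rw [hd]; field_simp
  have hin : ∀ σ : ℝ, |σ| = 1 → (m.1 + σ * d, m.2 - σ * d * x₀) ∈ lineCell A ℓ := by
    intro σ hσ a ha
    have hh : height (m.1 + σ * d, m.2 - σ * d * x₀) a = height m a - σ * d * (a.1 - x₀) := by
      simp only [height, lineVal]; ring
    rw [hh]
    by_cases h0 : height m a = 0
    · rw [hx₀ a ha h0, h0]; simp
    · have h1 := hF _ (Finset.mem_image_of_mem _ ha) h0
      have h2 : |σ * d * (a.1 - x₀)| ≤ t := by
        rw [abs_mul, abs_mul, hσ, one_mul, abs_of_pos hd0]; exact hdb a ha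
      rw [abs_le] at h2
      refine ⟨fun h => ?_, fun h => ?_⟩
      · have h3 := (hmC a ha).1 h
        rw [abs_of_nonneg h3] at h1
        linarith
      · have h3 := (hmC a ha).2 h
        rw [abs_of_nonpos h3] at h1
        linarith
  have h1 := hext _ (hin 1 (by simp)) _ (hin (-1) (by simp)) (by
    rw [openSegment_eq_image]
    refine ⟨1/2, ⟨by norm_num, by norm_num⟩, ?_⟩
    ext <;> simp <;> ring)
  have := congrArg Prod.fst h1.1
  simp at this
  exact hd0.ne' this

-- By Krein–Milman and Carathéodory, `ℓ` is a convex combination of at most three extreme lines of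
-- its cell; over each `x` one of these is weakly above `ℓ` and one weakly below. Thus lines from a
-- fixed finite set replace an arbitrary line.
open Classical in
theorem exists_three_lines {A : Finset (ℝ × ℝ)} {ℓ : ℝ × ℝ} {x₁ x₂ M : ℝ} (hx : x₁ < x₂)
    (h1 : (x₁, M) ∈ A) (h2 : (x₁, -M) ∈ A) (h3 : (x₂, M) ∈ A) (h4 : (x₂, -M) ∈ A)
    (l1 : |lineVal ℓ x₁| ≤ M) (l2 : |lineVal ℓ x₂| ≤ M) :
    ∃ t ⊆ (A ×ˢ A).image (fun z => through z.1 z.2), t.card ≤ 3 ∧ (∀ m ∈ t, m ∈ lineCell A ℓ) ∧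
      ∀ x, (∃ m ∈ t, lineVal ℓ x ≤ lineVal m x) ∧ ∃ m ∈ t, lineVal m x ≤ lineVal ℓ x := by
  have hcomp := isCompact_lineCell hx h1 h2 h3 h4 l1 l2
  have hKM := closure_convexHull_extremePoints hcomp (convex_lineCell A ℓ)
  have hfin : ((lineCell A ℓ).extremePoints ℝ).Finite :=
    (Finset.finite_toSet _).subset (extremePoints_lineCell A ℓ)
  rw [(hfin.isClosed_convexHull ℝ).closure_eq] at hKM
  have hℓ : ℓ ∈ lineCell A ℓ := fun a _ => ⟨id, id⟩
  rw [← hKM, convexHull_eq_union] at hℓ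
  simp only [Set.mem_iUnion] at hℓ
  obtain ⟨t, ht, hind, hmem⟩ := hℓ
  refine ⟨t, fun m hm => Finset.mem_coe.1 (extremePoints_lineCell A ℓ (ht hm)), ?_, fun m hm => (ht hm).1, ?_⟩
  · have := hind.card_le_finrank_succ
    have h2 : Module.finrank ℝ (vectorSpan ℝ (Set.range ((↑) : t → ℝ × ℝ))) ≤ 2 := by
      refine (Submodule.finrank_le _).trans ?_
      simp
    rw [Fintype.card_coe] at this
    omega
  · intro x
    constructor
    · by_contra hcon
      push Not at hcon
      have := convexHull_min (s := (t : Set (ℝ × ℝ))) (t := {m | 0 < (-x) * m.1 + (-1) * m.2 + lineVal ℓ x})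
        (fun m hm => by
          have := hcon m hm
          simp only [Set.mem_ofPred_eq, lineVal] at *; linarith) (convex_halfPlane _ _ _) hmem
      simp only [Set.mem_ofPred_eq, lineVal] at this; linarith
    · by_contra hcon
      push Not at hcon
      have := convexHull_min (s := (t : Set (ℝ × ℝ))) (t := {m | 0 < x * m.1 + 1 * m.2 + -lineVal ℓ x})
        (fun m hm => by
          have := hcon m hm
          simp only [Set.mem_ofPred_eq, lineVal] at *; linarith) (convex_halfPlane _ _ _) hmem
      simp only [Set.mem_ofPred_eq, lineVal] at this; linarith

/-- Distinct abscissae and no three points on a (non-vertical) line. -/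
structure GenPos (X : Finset (ℝ × ℝ)) : Prop where
  inj : Set.InjOn Prod.fst (X : Set (ℝ × ℝ))
  col : ∀ ℓ, ∀ Y ⊆ X, (∀ p ∈ Y, height ℓ p = 0) → Y.card ≤ 2

theorem GenPos.mono {X Y : Finset (ℝ × ℝ)} (h : GenPos X) (hY : Y ⊆ X) : GenPos Y :=
  ⟨h.inj.mono (by exact_mod_cast hY), fun ℓ Z hZ hz => h.col ℓ Z (hZ.trans hY) hz⟩

/-- Open strips between two lines. -/
def strips : Set (Set (ℝ × ℝ)) := {R | ∃ m k, R = {p | height m p < 0 ∧ 0 < height k p}}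

theorem polyGrowth_strips : PolyGrowth strips 6 := by
  refine (polyGrowth_halfPlanes.inter polyGrowth_halfPlanes).mono ?_
  rintro _ ⟨m, k, rfl⟩
  refine ⟨_, ⟨m.1, -1, m.2, rfl⟩, _, ⟨-k.1, 1, -k.2, rfl⟩, ?_⟩
  ext p
  simp only [height, lineVal, Set.mem_inter_iff, Set.mem_ofPred_eq]
  constructor <;> rintro ⟨h1, h2⟩ <;> constructor <;> linarith

-- All lines of `t` lie on the same weak side of each net point as `ℓ`, so an open strip below one
-- of them and above another contains no net point and hence few points. There are at most nine
-- strips, and by general position two points on each of three lines.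
open Classical in
theorem card_region_le {X A A' t : Finset (ℝ × ℝ)} (hX : GenPos X) (hA : A ⊆ A') {δ : ℝ}
    (hδ : 0 ≤ δ)
    (hnet : ∀ R ∈ strips, ∀ Y ⊆ X, (∀ y ∈ Y, y ∈ R) → Y.Nonempty → δ * X.card ≤ Y.card →
      ∃ a ∈ A, a ∈ R) {ℓ : ℝ × ℝ} (ht : t.card ≤ 3) (hcell : ∀ m ∈ t, m ∈ lineCell A' ℓ) :
    ((X.filter (fun p => (∃ m ∈ t, height m p ≤ 0) ∧ ∃ k ∈ t, 0 ≤ height k p)).card : ℝ) ≤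
      9 * (δ * X.card) + 6 := by
  have hsub : X.filter (fun p => (∃ m ∈ t, height m p ≤ 0) ∧ ∃ k ∈ t, 0 ≤ height k p) ⊆
      (t ×ˢ t).biUnion (fun z => X.filter (fun p => height z.1 p < 0 ∧ 0 < height z.2 p)) ∪
      t.biUnion (fun m => X.filter (fun p => height m p = 0)) := by
    intro p hp
    rw [Finset.mem_filter] at hp
    obtain ⟨hpX, ⟨m, hm, h1⟩, k, hk, h2⟩ := hp
    simp only [Finset.mem_union, Finset.mem_biUnion, Finset.mem_filter, Finset.mem_product]
    rcases h1.lt_or_eq with h1 | h1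
    · rcases h2.lt_or_eq with h2 | h2
      · exact Or.inl ⟨(m, k), ⟨hm, hk⟩, hpX, h1, h2⟩
      · exact Or.inr ⟨k, hk, hpX, h2.symm⟩
    · exact Or.inr ⟨m, hm, hpX, h1⟩
  have h1 := (Finset.card_le_card hsub).trans (Finset.card_union_le _ _)
  have hstrip : ∀ z ∈ t ×ˢ t,
      ((X.filter (fun p => height z.1 p < 0 ∧ 0 < height z.2 p)).card : ℝ) ≤ δ * X.card := by
    intro z hz
    rw [Finset.mem_product] at hz
    by_contra hcon
    push Not at hcon
    obtain ⟨a, ha, hm, hk⟩ := hnet _ ⟨z.1, z.2, rfl⟩ _ (Finset.filter_subset _ _)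
      (fun y hy => (Finset.mem_filter.1 hy).2) (by
        rw [← Finset.card_pos]
        have : (0:ℝ) < ((X.filter (fun p => height z.1 p < 0 ∧ 0 < height z.2 p)).card : ℝ) :=
          lt_of_le_of_lt (by positivity) hcon
        exact_mod_cast this) hcon.le
    rcases le_total 0 (height ℓ a) with h | h
    · exact absurd ((hcell _ hz.1 a (hA ha)).1 h) (not_le.2 hm)
    · exact absurd ((hcell _ hz.2 a (hA ha)).2 h) (not_le.2 hk)
  have h2 : (((t ×ˢ t).biUnion (fun z => X.filter (fun p => height z.1 p < 0 ∧ 0 < height z.2 p))).card : ℝ)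
      ≤ 9 * (δ * X.card) := by
    calc _ ≤ ∑ z ∈ t ×ˢ t, ((X.filter (fun p => height z.1 p < 0 ∧ 0 < height z.2 p)).card : ℝ) := by
          exact_mod_cast Finset.card_biUnion_le
      _ ≤ ∑ z ∈ t ×ˢ t, δ * X.card := Finset.sum_le_sum hstrip
      _ = ((t.card * t.card : ℕ) : ℝ) * (δ * X.card) := by simp [Finset.card_product]
      _ ≤ 9 * (δ * X.card) := by
          gcongr
          exact_mod_cast (Nat.mul_le_mul ht ht)
  have h3 : (t.biUnion (fun m => X.filter (fun p => height m p = 0))).card ≤ 6 := by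
    refine Finset.card_biUnion_le.trans ?_
    calc _ ≤ ∑ m ∈ t, 2 := Finset.sum_le_sum fun m _ =>
          hX.col m _ (Finset.filter_subset _ _) (fun p hp => (Finset.mem_filter.1 hp).2)
      _ ≤ 6 := by simp; omega
  have h1' : ((X.filter (fun p => (∃ m ∈ t, height m p ≤ 0) ∧ ∃ k ∈ t, 0 ≤ height k p)).card : ℝ) ≤
      ((t ×ˢ t).biUnion (fun z => X.filter (fun p => height z.1 p < 0 ∧ 0 < height z.2 p))).card +
      (t.biUnion (fun m => X.filter (fun p => height m p = 0))).card := by exact_mod_cast h1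
  have h3' : ((t.biUnion (fun m => X.filter (fun p => height m p = 0))).card : ℝ) ≤ 6 := by
    exact_mod_cast h3
  linarith

/-- The points a convex set has to avoid in order to be covered by nine segments. -/
noncomputable def badPoints (𝓛 : Finset (ℝ × ℝ)) : Finset (ℝ × ℝ) := by
  classical
  exact (𝓛 ×ˢ 𝓛).image (fun z => cross z.1 z.2) ∪
    (Fintype.piFinset (fun _ : Fin 5 => 𝓛)).image
      (fun ℓ => diagCross (ℓ 0) (ℓ 1) (ℓ 2) (ℓ 3) (ℓ 4))

theorem card_badPoints_le (𝓛 : Finset (ℝ × ℝ)) :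
    (badPoints 𝓛).card ≤ 𝓛.card ^ 2 + 𝓛.card ^ 5 := by
  classical
  rw [badPoints]
  refine (Finset.card_union_le _ _).trans (Nat.add_le_add ?_ ?_)
  · refine Finset.card_image_le.trans ?_
    rw [Finset.card_product, sq]
  · refine Finset.card_image_le.trans ?_
    rw [Fintype.card_piFinset]; simp

theorem cross_mem_badPoints {𝓛 : Finset (ℝ × ℝ)} {ℓ m : ℝ × ℝ} (h : ℓ ∈ 𝓛) (h' : m ∈ 𝓛) :
    cross ℓ m ∈ badPoints 𝓛 := by
  classical
  rw [badPoints]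
  exact Finset.mem_union_left _ (Finset.mem_image.2 ⟨(ℓ, m), by simp [h, h'], rfl⟩)

theorem diagCross_mem_badPoints {𝓛 : Finset (ℝ × ℝ)} {ℓ : Fin 5 → ℝ × ℝ} (h : ∀ i, ℓ i ∈ 𝓛) :
    diagCross (ℓ 0) (ℓ 1) (ℓ 2) (ℓ 3) (ℓ 4) ∈ badPoints 𝓛 := by
  classical
  rw [badPoints]
  exact Finset.mem_union_right _ (Finset.mem_image.2 ⟨ℓ, by simpa using h, rfl⟩)

theorem height_through_segment {L w y : ℝ × ℝ} (h : L.1 ≠ w.1) (hy : y ∈ segment ℝ L w) :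
    height (through L w) y = 0 := by
  obtain ⟨a, b, _, _, hab, rfl⟩ := hy
  rw [height_combo _ _ _ hab, height, height, lineVal_through_left, lineVal_through_right h]
  ring

/-! ### Partitions for which a convex set touches few classes. -/

open Classical in
/-- The classes touched along one segment: they are crossed by one of six test lines or lie in a
small region. -/
theorem card_touched_segment_le {X A A' : Finset (ℝ × ℝ)} (hX : GenPos X) (hA : A ⊆ A') {δ : ℝ}
    (hδ : 0 ≤ δ)
    (hnet : ∀ R ∈ strips, ∀ Y ⊆ X, (∀ y ∈ Y, y ∈ R) → Y.Nonempty → δ * X.card ≤ Y.card →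
      ∃ a ∈ A, a ∈ R) {x₁ x₂ M : ℝ} (hx : x₁ < x₂)
    (h1 : (x₁, M) ∈ A') (h2 : (x₁, -M) ∈ A') (h3 : (x₂, M) ∈ A') (h4 : (x₂, -M) ∈ A')
    {sh : ℝ × ℝ → Bool → ℝ × ℝ} {𝓛 : Finset (ℝ × ℝ)}
    (h𝓛 : 𝓛 = (((A' ×ˢ A').image (fun z => through z.1 z.2)) ×ˢ (Finset.univ : Finset Bool)).image
      (fun z => sh z.1 z.2)) (hT : NoTies 𝓛 X)
    (hsh : ∀ ℓ ∈ (A' ×ˢ A').image (fun z => through z.1 z.2),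
      (∀ x, lineVal ℓ x < lineVal (sh ℓ true) x ∧ lineVal (sh ℓ false) x < lineVal ℓ x) ∧
      ∀ p ∈ X, (height (sh ℓ true) p < 0 → height ℓ p ≤ 0) ∧
        (0 < height (sh ℓ false) p → 0 ≤ height ℓ p))
    {𝒞 : Finset (Finset (ℝ × ℝ))} {s₀ : ℕ} (hs₀ : 0 < s₀) (h𝒞 : ∀ c ∈ 𝒞, c ⊆ X ∧ c.card = s₀)
    (hdisj : ∀ c ∈ 𝒞, ∀ d ∈ 𝒞, c ≠ d → Disjoint c d) {κ : ℝ} (hκ : ∀ ℓ ∈ 𝓛, (crossNum 𝒞 ℓ : ℝ) ≤ κ)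
    {L w : ℝ × ℝ} (hLw : L.1 ≠ w.1) (l1 : |lineVal (through L w) x₁| ≤ M)
    (l2 : |lineVal (through L w) x₂| ≤ M) :
    ((𝒞.filter (fun c => ∃ q ∈ c, CoveredBy 𝓛 L w q)).card : ℝ) ≤
      6 * κ + (9 * (δ * X.card) + 6) / s₀ := by
  set ℓ := through L w with hℓ
  obtain ⟨t, htQ, ht3, hcell, hval⟩ := exists_three_lines hx h1 h2 h3 h4 l1 l2
  set Reg := X.filter (fun p => (∃ m ∈ t, height m p ≤ 0) ∧ ∃ k ∈ t, 0 ≤ height k p) with hReg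
  have hRegc : (Reg.card : ℝ) ≤ 9 * (δ * X.card) + 6 := card_region_le hX hA hδ hnet ht3 hcell
  have hmem : ∀ m ∈ t, ∀ b, sh m b ∈ 𝓛 := fun m hm b => by
    rw [h𝓛]; exact Finset.mem_image.2 ⟨(m, b), Finset.mem_product.2 ⟨htQ hm, Finset.mem_univ _⟩, rfl⟩
  -- The segment lies on `ℓ`. A class touched along it and crossed by no shifted line stays with `q`
  -- below the upward shift of a line `m` weakly above `ℓ` at `y`, and above the downward shift of a
  -- line `k` weakly below. The shifts being tiny, the class lies in the region between the three
  -- lines.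
  have hsub : 𝒞.filter (fun c => ∃ q ∈ c, CoveredBy 𝓛 L w q) ⊆
      (t ×ˢ (Finset.univ : Finset Bool)).biUnion
        (fun z => 𝒞.filter (fun c => Crosses (sh z.1 z.2) c)) ∪ 𝒞.filter (fun c => c ⊆ Reg) := by
    intro c hc
    rw [Finset.mem_filter] at hc
    obtain ⟨hc𝒞, q, hq, y, hy, hside⟩ := hc
    rw [Finset.mem_union, Finset.mem_biUnion]
    by_contra hcon
    simp only [not_or, not_exists, not_and, Finset.mem_filter, hc𝒞, true_and] at hcon
    obtain ⟨hncr, hnreg⟩ := hcon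
    apply hnreg
    have hy0 : height ℓ y = 0 := height_through_segment hLw hy
    have hcX := (h𝒞 c hc𝒞).1
    obtain ⟨⟨m, hm, hm'⟩, k, hk, hk'⟩ := hval y.1
    have a1 : height (sh m true) q < 0 := by
      have e1 : ¬ 0 < height (sh m true) y := by
        have := ((hsh m (htQ hm)).1 y.1).1
        simp only [height] at hy0 ⊢; linarith
      rw [hside _ (hmem m hm true)] at e1
      exact lt_of_le_of_ne (not_lt.1 e1) (hT.off _ (hmem m hm true) q (hcX hq))
    have a2 : 0 < height (sh k false) q := by
      rw [← hside _ (hmem k hk false)]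
      have := ((hsh k (htQ hk)).1 y.1).2
      simp only [height] at hy0 ⊢; linarith
    intro p hp
    rw [hReg, Finset.mem_filter]
    refine ⟨hcX hp, ⟨m, hm, ?_⟩, k, hk, ?_⟩
    · refine ((hsh m (htQ hm)).2 p (hcX hp)).1 ?_
      have e1 : ¬ 0 < height (sh m true) p := fun h =>
        hncr (m, true) (by simp [hm]) ⟨⟨p, hp, h⟩, q, hq, a1⟩
      exact lt_of_le_of_ne (not_lt.1 e1) (hT.off _ (hmem m hm true) p (hcX hp))
    · refine ((hsh k (htQ hk)).2 p (hcX hp)).2 ?_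
      have e1 : ¬ height (sh k false) p < 0 := fun h =>
        hncr (k, false) (by simp [hk]) ⟨⟨q, hq, a2⟩, p, hp, h⟩
      exact lt_of_le_of_ne (not_lt.1 e1) (Ne.symm (hT.off _ (hmem k hk false) p (hcX hp)))
  have c1 := (Finset.card_le_card hsub).trans (Finset.card_union_le _ _)
  have c2 : (((t ×ˢ (Finset.univ : Finset Bool)).biUnion
        (fun z => 𝒞.filter (fun c => Crosses (sh z.1 z.2) c))).card : ℝ) ≤ 6 * κ := by
    calc _ ≤ ∑ z ∈ t ×ˢ (Finset.univ : Finset Bool), (crossNum 𝒞 (sh z.1 z.2) : ℝ) := by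
          exact_mod_cast Finset.card_biUnion_le
      _ ≤ ∑ z ∈ t ×ˢ (Finset.univ : Finset Bool), κ :=
          Finset.sum_le_sum fun z hz => hκ _ (hmem _ (Finset.mem_product.1 hz).1 _)
      _ = ((t.card * 2 : ℕ) : ℝ) * κ := by simp [Finset.card_product]
      _ ≤ 6 * κ := by
          have hκ0 : 0 ≤ κ := by
            obtain ⟨⟨m, hm, -⟩, -⟩ := hval 0
            exact (Nat.cast_nonneg _).trans (hκ _ (hmem m hm true))
          gcongr
          exact_mod_cast (Nat.mul_le_mul_right 2 ht3)
  have c3 : ((𝒞.filter (fun c => c ⊆ Reg)).card : ℝ) ≤ (9 * (δ * X.card) + 6) / s₀ := by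
    rw [le_div_iff₀ (by exact_mod_cast hs₀)]
    refine le_trans ?_ hRegc
    have e1 : ((𝒞.filter (fun c => c ⊆ Reg)).biUnion id).card =
        ∑ c ∈ 𝒞.filter (fun c => c ⊆ Reg), c.card :=
      Finset.card_biUnion fun c hc d hd hne =>
        hdisj c (Finset.mem_filter.1 hc).1 d (Finset.mem_filter.1 hd).1 hne
    have e2 : ∑ c ∈ 𝒞.filter (fun c => c ⊆ Reg), c.card = (𝒞.filter (fun c => c ⊆ Reg)).card * s₀ := by
      rw [Finset.sum_congr rfl (fun c hc => (h𝒞 c (Finset.mem_filter.1 hc).1).2)]; simp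
    have e3 : ((𝒞.filter (fun c => c ⊆ Reg)).biUnion id).card ≤ Reg.card :=
      Finset.card_le_card (Finset.biUnion_subset.2 fun c hc => (Finset.mem_filter.1 hc).2)
    rw [e1, e2] at e3
    exact_mod_cast e3
  have c1' : ((𝒞.filter (fun c => ∃ q ∈ c, CoveredBy 𝓛 L w q)).card : ℝ) ≤
    (((t ×ˢ (Finset.univ : Finset Bool)).biUnion
        (fun z => 𝒞.filter (fun c => Crosses (sh z.1 z.2) c))).card : ℝ) +
        ((𝒞.filter (fun c => c ⊆ Reg)).card : ℝ) := by exact_mod_cast c1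
  linarith

theorem abs_lineVal_through_le {L w : ℝ × ℝ} {x₂ Y₀ g : ℝ} (hL : |L.2| ≤ Y₀) (hw : |w.2| ≤ Y₀)
    (hg : 0 < g) (hgw : g ≤ w.1 - L.1) (hx : L.1 ≤ x₂) :
    |lineVal (through L w) x₂| ≤ Y₀ + 2 * Y₀ / g * (x₂ - L.1) := by
  rw [lineVal_sub _ L.1, lineVal_through_left]
  refine (abs_add_le _ _).trans (add_le_add hL ?_)
  rw [abs_mul, abs_of_nonneg (sub_nonneg.2 hx)]
  refine mul_le_mul_of_nonneg_right ?_ (sub_nonneg.2 hx)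
  have h0 : 0 ≤ Y₀ := (abs_nonneg _).trans hL
  simp only [through, abs_div]
  rw [abs_of_pos (show 0 < w.1 - L.1 by linarith)]
  refine div_le_div₀ (by linarith) ?_ hg hgw
  rw [abs_le] at *
  constructor <;> linarith

open Classical in
/-- Partition of a point set such that a convex set crossing the slab and avoiding few given points
touches few classes. -/
theorem exists_partition_convex {X : Finset (ℝ × ℝ)} (hX : GenPos X) {x₁ x₂ : ℝ}
    (hx : x₁ < x₂) (hXx : ∀ p ∈ X, x₁ < p.1 ∧ p.1 < x₂) (Y₀ : ℝ) {δ : ℝ} (hδ : 0 ≤ δ) {sA kA : ℕ}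
    (hk : 2 * ((kA : ℝ) + 1) ≤ δ * sA) (hs : 2 * (2 * sA + 1) ^ 6 < 2 ^ kA) {s₀ : ℕ} (hs₀ : 0 < s₀)
    {N : ℕ} (hN : N = 2 * (sA + 4) ^ 2) :
    ∃ (𝒞 : Finset (Finset (ℝ × ℝ))) (Z : Finset (ℝ × ℝ)), Z.card ≤ N ^ 2 + N ^ 5 ∧
      (∀ c ∈ 𝒞, c ⊆ X ∧ c.card = s₀) ∧ (∀ c ∈ 𝒞, ∀ d ∈ 𝒞, c ≠ d → Disjoint c d) ∧
      (X.filter (fun p => ∀ c ∈ 𝒞, p ∉ c)).card < 64 * s₀ ∧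
      ∀ K : Set (ℝ × ℝ), Convex ℝ K → (∀ p ∈ K, |p.2| ≤ Y₀) → (∀ z ∈ Z, z ∉ K) →
        (∃ L ∈ K, L.1 = x₁) → (∃ R ∈ K, R.1 = x₂) →
        ((𝒞.filter (fun c => ∃ q ∈ c, q ∈ K)).card : ℝ) ≤
          9 * (6 * (2 * (Real.log N + 64 * (6 * Real.log (N + 1) + 1) * √(X.card / s₀))) +
            (9 * (δ * X.card) + 6) / s₀) := by
  obtain ⟨A, hAX, hAc, hnet⟩ := polyGrowth_strips.exists_net δ sA kA hk hs X
  -- `g` bounds from below the horizontal distance of the left wall from the points and from the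
  -- right wall. It controls the slopes of the lines `through L w`, and `M` then bounds their values
  -- at both walls.
  obtain ⟨g, hg, hgF⟩ := exists_lt_abs (X.image (fun p => p.1 - x₁) ∪ {x₂ - x₁})
  have hgX : ∀ p ∈ X, g ≤ p.1 - x₁ := by
    intro p hp
    have h1 := (hXx p hp).1
    have := hgF (p.1 - x₁) (by simp only [Finset.mem_union, Finset.mem_image]; exact Or.inl ⟨p, hp, rfl⟩) (by linarith)
    rw [abs_of_pos (by linarith)] at this
    exact this.le
  have hgx : g ≤ x₂ - x₁ := by
    have := hgF (x₂ - x₁) (by simp) (by linarith)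
    rw [abs_of_pos (by linarith)] at this
    exact this.le
  set M : ℝ := Y₀ + 2 * Y₀ / g * (x₂ - x₁) with hM
  set A' : Finset (ℝ × ℝ) := A ∪ {(x₁, M), (x₁, -M), (x₂, M), (x₂, -M)} with hA'
  have hA'c : A'.card ≤ sA + 4 := by
    refine (Finset.card_union_le _ _).trans (Nat.add_le_add hAc ?_)
    exact Finset.card_le_four
  obtain ⟨sh, hT, hsh⟩ := exists_shift ((A' ×ˢ A').image (fun z => through z.1 z.2)) X
  set 𝓛 := (((A' ×ˢ A').image (fun z => through z.1 z.2)) ×ˢ (Finset.univ : Finset Bool)).image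
      (fun z => sh z.1 z.2) with h𝓛
  have h𝓛c : 𝓛.card ≤ N := by
    refine Finset.card_image_le.trans ?_
    rw [Finset.card_product, Finset.card_univ, Fintype.card_bool, hN, mul_comm]
    refine Nat.mul_le_mul_left 2 (Finset.card_image_le.trans ?_)
    rw [Finset.card_product, sq]
    exact Nat.mul_le_mul hA'c hA'c
  have hA'ne : (x₁, M) ∈ A' := by simp [hA']
  have h𝓛ne : 𝓛.Nonempty :=
    ⟨_, Finset.mem_image.2 ⟨(through (x₁, M) (x₁, M), true), Finset.mem_product.2
      ⟨Finset.mem_image.2 ⟨((x₁, M), (x₁, M)), Finset.mem_product.2 ⟨hA'ne, hA'ne⟩, rfl⟩,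
        Finset.mem_univ _⟩, rfl⟩⟩
  obtain ⟨𝒞, c1, c2, c3, c4⟩ := exists_partition_lines h𝓛ne s₀ hs₀ X hT hX.inj
  refine ⟨𝒞, badPoints 𝓛, ?_, c1, c2, c3, ?_⟩
  · exact (card_badPoints_le 𝓛).trans
      (Nat.add_le_add (Nat.pow_le_pow_left h𝓛c 2) (Nat.pow_le_pow_left h𝓛c 5))
  have hcpos : (0:ℝ) < 𝓛.card := by exact_mod_cast Finset.card_pos.2 h𝓛ne
  have hcN : (𝓛.card : ℝ) ≤ N := by exact_mod_cast h𝓛c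
  set κ := 2 * (Real.log N + 64 * (6 * Real.log (N + 1) + 1) * √(X.card / s₀)) with hκ
  have c4' : ∀ ℓ ∈ 𝓛, (crossNum 𝒞 ℓ : ℝ) ≤ κ := by
    intro ℓ hℓ
    refine (c4 ℓ hℓ).trans ?_
    have e1 := Real.log_le_log hcpos hcN
    have e2 := Real.log_le_log (by linarith : (0:ℝ) < 𝓛.card + 1) (by linarith : (𝓛.card : ℝ) + 1 ≤ N + 1)
    rw [hκ]
    gcongr
  intro K hK hKY hKZ ⟨L, hL, hL1⟩ ⟨R, hR, hR2⟩
  subst hL1 hR2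
  have hY0 : 0 ≤ Y₀ := (abs_nonneg _).trans (hKY L hL)
  obtain ⟨W, hW9, hWX, hWc⟩ := exists_nine_segments hK
    (fun ℓ hℓ m hm _ h => hKZ _ (cross_mem_badPoints hℓ hm) h)
    (fun ℓ hℓ h => hKZ _ (diagCross_mem_badPoints hℓ) h) hL hR (X.filter (· ∈ K))
    (fun q hq => by
      rw [Finset.mem_filter] at hq
      exact ⟨hq.2, hXx q hq.1⟩)
  have hsub : 𝒞.filter (fun c => ∃ q ∈ c, q ∈ K) ⊆
      W.biUnion (fun w => 𝒞.filter (fun c => ∃ q ∈ c, CoveredBy 𝓛 L w q)) := by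
    intro c hc
    rw [Finset.mem_filter] at hc
    obtain ⟨hc, q, hq, hqK⟩ := hc
    obtain ⟨w, hw, hcov⟩ := hWc q (by simp [(c1 c hc).1 hq, hqK])
    exact Finset.mem_biUnion.2 ⟨w, hw, Finset.mem_filter.2 ⟨hc, q, hq, hcov⟩⟩
  set bound := 6 * κ + (9 * (δ * X.card) + 6) / s₀ with hbound
  have hseg : ∀ w ∈ W, ((𝒞.filter (fun c => ∃ q ∈ c, CoveredBy 𝓛 L w q)).card : ℝ) ≤ bound := by
    intro w hw
    have hwg : g ≤ w.1 - L.1 ∧ |w.2| ≤ Y₀ := by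
      rcases hWX w hw with rfl | hw
      · exact ⟨hgx, hKY _ hR⟩
      · rw [Finset.mem_filter] at hw
        exact ⟨hgX w hw.1, hKY _ hw.2⟩
    have hMY : Y₀ ≤ M := by
      rw [hM]
      have : 0 ≤ 2 * Y₀ / g * (R.1 - L.1) := mul_nonneg (by positivity) (by linarith)
      linarith
    refine card_touched_segment_le hX (A := A) (A' := A') (M := M) Finset.subset_union_left hδ hnet hx
      (by simp [hA']) (by simp [hA']) (by simp [hA']) (by simp [hA']) h𝓛 hT hsh hs₀ c1 c2 c4'
      (L := L) (w := w) (by linarith [hwg.1]) ?_ ?_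
    · rw [lineVal_through_left]; exact (hKY L hL).trans hMY
    · exact abs_lineVal_through_le (hKY L hL) hwg.2 hg hwg.1 hx.le
  have hb0 : 0 ≤ bound := by
    have : 0 ≤ κ := by
      obtain ⟨ℓ, hℓ⟩ := h𝓛ne
      exact (Nat.cast_nonneg _).trans (c4' ℓ hℓ)
    have h2 : 0 ≤ (9 * (δ * X.card) + 6) / s₀ :=
      div_nonneg (add_nonneg (mul_nonneg (by norm_num) (mul_nonneg hδ (Nat.cast_nonneg _)))
        (by norm_num)) (Nat.cast_nonneg _)
    rw [hbound]; linarith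
  clear_value bound
  calc _ ≤ ((W.biUnion (fun w => 𝒞.filter (fun c => ∃ q ∈ c, CoveredBy 𝓛 L w q))).card : ℝ) := by
        exact_mod_cast Finset.card_le_card hsub
    _ ≤ ∑ w ∈ W, ((𝒞.filter (fun c => ∃ q ∈ c, CoveredBy 𝓛 L w q)).card : ℝ) := by
        exact_mod_cast Finset.card_biUnion_le
    _ ≤ ∑ w ∈ W, bound := Finset.sum_le_sum hseg
    _ = W.card * bound := by simp
    _ ≤ 9 * bound := by gcongr; exact_mod_cast hW9

open Classical in
/-- A partition into classes plus a small rest, encoded by a colouring. -/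
theorem exists_colouring (X : Finset (ℝ × ℝ)) (𝒞 : Finset (Finset (ℝ × ℝ))) {s₀ : ℕ} (hs₀ : 0 < s₀)
    (h1 : ∀ c ∈ 𝒞, c.card = s₀)
    (h3 : (X.filter (fun p => ∀ c ∈ 𝒞, p ∉ c)).card < 64 * s₀) :
    ∃ cls : ℝ × ℝ → ℕ, (X.image cls).card ≤ 𝒞.card + 64 ∧
      (∀ k, (X.filter (fun p => cls p = k)).card ≤ s₀) ∧
      ∀ Y ⊆ X, (Y.image cls).card ≤ (𝒞.filter (fun c => ∃ q ∈ c, q ∈ Y)).card + 64 := by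
  set E := X.filter (fun p => ∀ c ∈ 𝒞, p ∉ c) with hE
  obtain ⟨e, he⟩ : ∃ e : ℝ × ℝ → ℕ, Set.InjOn e E ∧ ∀ p ∈ E, e p < E.card := by
    refine ⟨fun p => if h : p ∈ E then (E.equivFin ⟨p, h⟩ : ℕ) else 0, ?_, ?_⟩
    · intro p hp q hq hpq
      simp only [Finset.mem_coe.1 hp, Finset.mem_coe.1 hq, dif_pos] at hpq
      have := E.equivFin.injective (Fin.ext hpq)
      simpa using this
    · intro p hp
      simp only [hp, dif_pos]
      exact (E.equivFin ⟨p, hp⟩).2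
  obtain ⟨he1, he2⟩ := he
  obtain ⟨code, hcode⟩ := Set.countable_iff_exists_injOn.1 𝒞.countable_toSet
  -- Classes receive colours from 64 on. The rest has fewer than `64 * s₀` points and is cut, by an
  -- enumeration, into blocks of at most `s₀` points with colours below 64.
  have hcl : ∀ p, ∃ k : ℕ, (∃ c ∈ 𝒞, p ∈ c ∧ k = code c + 64) ∨ ((∀ c ∈ 𝒞, p ∉ c) ∧ k = e p / s₀) := by
    intro p
    by_cases h : ∃ c ∈ 𝒞, p ∈ c
    · obtain ⟨c, hc, hp⟩ := h
      exact ⟨_, Or.inl ⟨c, hc, hp, rfl⟩⟩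
    · push Not at h
      exact ⟨_, Or.inr ⟨h, rfl⟩⟩
  choose cls hcls using hcl
  have hlt : ∀ p ∈ E, e p / s₀ < 64 := fun p hp => by
    rw [Nat.div_lt_iff_lt_mul hs₀]; exact (he2 p hp).trans h3
  have htouch : ∀ Y ⊆ X, (Y.image cls).card ≤ (𝒞.filter (fun c => ∃ q ∈ c, q ∈ Y)).card + 64 := by
    intro Y hY
    have hsub : Y.image cls ⊆ (𝒞.filter (fun c => ∃ q ∈ c, q ∈ Y)).image (fun c => code c + 64) ∪
        Finset.range 64 := by
      intro k hk
      obtain ⟨p, hp, rfl⟩ := Finset.mem_image.1 hk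
      rw [Finset.mem_union]
      rcases hcls p with ⟨c, hc, hpc, h⟩ | ⟨hn, h⟩
      · left; rw [h]
        exact Finset.mem_image.2 ⟨c, Finset.mem_filter.2 ⟨hc, p, hpc, hp⟩, rfl⟩
      · right; rw [h, Finset.mem_range]
        exact hlt p (Finset.mem_filter.2 ⟨hY hp, hn⟩)
    refine (Finset.card_le_card hsub).trans ((Finset.card_union_le _ _).trans ?_)
    rw [Finset.card_range]
    exact Nat.add_le_add_right Finset.card_image_le _
  refine ⟨cls, ?_, ?_, htouch⟩
  · exact (htouch X subset_rfl).trans (Nat.add_le_add_right (Finset.card_filter_le _ _) _)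
  · intro k
    rcases (X.filter (fun p => cls p = k)).eq_empty_or_nonempty with h0 | ⟨p, hp⟩
    · rw [h0]; simp
    rw [Finset.mem_filter] at hp
    rcases hcls p with ⟨c, hc, hpc, h⟩ | ⟨hn, h⟩
    · rw [← h1 c hc]
      refine Finset.card_le_card fun q hq => ?_
      rw [Finset.mem_filter] at hq
      rcases hcls q with ⟨d, hd, hqd, h'⟩ | ⟨hn', h'⟩
      · have : code c = code d := by omega
        rw [hcode hc hd this]; exact hqd
      · have := hlt q (Finset.mem_filter.2 ⟨hq.1, hn'⟩)
        omega
    · have hk64 := hlt p (Finset.mem_filter.2 ⟨hp.1, hn⟩)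
      have hmaps : ∀ q ∈ X.filter (fun p => cls p = k), q ∈ E ∧ e q / s₀ = k := by
        intro q hq
        rw [Finset.mem_filter] at hq
        rcases hcls q with ⟨d, hd, hqd, h'⟩ | ⟨hn', h'⟩
        · omega
        · exact ⟨Finset.mem_filter.2 ⟨hq.1, hn'⟩, by omega⟩
      calc (X.filter (fun p => cls p = k)).card ≤ (Finset.Ico (s₀ * k) (s₀ * k + s₀)).card := by
            refine Finset.card_le_card_of_injOn e ?_ ?_
            · intro q hq
              obtain ⟨hqE, hqk⟩ := hmaps q hq
              rw [Finset.coe_Ico, Set.mem_Ico]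
              constructor
              · rw [← hqk]; exact Nat.mul_div_le _ _
              · rw [← hqk]
                have := Nat.lt_mul_div_succ (e q) hs₀
                rw [Nat.mul_succ] at this; exact this
            · intro q hq q' hq' hqq
              exact he1 (hmaps q hq).1 (hmaps q' hq').1 hqq
        _ = s₀ := by simp

theorem eventually_const_mul_log_le (E η : ℝ) (hη : 0 < η) :
    ∀ᶠ r : ℕ in Filter.atTop, E * (1 + Real.log r) ≤ (r : ℝ) ^ η := by
  have h1 : (fun x : ℝ => E * (1 + Real.log x)) =o[Filter.atTop] fun x => x ^ η := by
    refine Asymptotics.IsLittleO.const_mul_left ?_ E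
    refine Asymptotics.IsLittleO.add ?_ (isLittleO_log_rpow_atTop hη)
    refine Asymptotics.isLittleO_const_left.2 (Or.inr ?_)
    exact tendsto_norm_atTop_atTop.comp (tendsto_rpow_atTop hη)
  have h2 := (h1.bound one_pos)
  have h3 := tendsto_natCast_atTop_atTop (R := ℝ) |>.eventually h2
  filter_upwards [h3] with r hr
  rw [one_mul, Real.norm_of_nonneg (show (0:ℝ) ≤ (r:ℝ) ^ η by positivity)] at hr
  exact (le_abs_self _).trans hr

/-- The numerical bound for the number of touched classes. -/
theorem touched_bound {C : ℝ} (hC : 0 < C) : ∃ E : ℝ, ∀ (r s N n s₀ : ℕ), 1 ≤ r → 0 < s₀ →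
    (s : ℝ) ≤ C * r → N = 2 * (s + 4) ^ 2 → n ≤ 2 * r * s₀ →
    9 * (6 * (2 * (Real.log N + 64 * (6 * Real.log (N + 1) + 1) * √(n / s₀))) +
            (9 * (1 / √r * n) + 6) / s₀) + 64 ≤ E * (√r * (1 + Real.log r)) := by
  -- `D * r ^ 2` dominates `N + 1`, so both logarithms are at most `G * (1 + log r)`.
  set D : ℝ := 3 * (C + 4) ^ 2 with hD
  have hD1 : 1 ≤ D := by rw [hD]; nlinarith
  set G : ℝ := Real.log D + 2 with hG
  have hG2 : 2 ≤ G := by have := Real.log_nonneg hD1; linarith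
  refine ⟨64 + 9 * (12 * (G + 896 * G) + 24), fun r s N n s₀ hr hs₀ hs hN hn => ?_⟩
  have hr1 : (1:ℝ) ≤ r := by exact_mod_cast hr
  have hs0 : (1:ℝ) ≤ s₀ := by exact_mod_cast hs₀
  have hsq1 : 1 ≤ √(r:ℝ) := Real.one_le_sqrt.2 hr1
  have hlr : 0 ≤ Real.log r := Real.log_nonneg hr1
  have hNr : (N : ℝ) = 2 * (s + 4) ^ 2 := by rw [hN]; push_cast; ring
  have hN1 : (1:ℝ) ≤ N := by
    rw [hNr]; have : (0:ℝ) ≤ s := by positivity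
    nlinarith
  have hl : Real.log (N + 1) ≤ G * (1 + Real.log r) := by
    have h1 : (N : ℝ) + 1 ≤ D * r ^ 2 := by
      rw [hNr, hD]
      have h2 : (s:ℝ) + 4 ≤ (C + 4) * r := by nlinarith
      have h3 : ((s:ℝ) + 4) ^ 2 ≤ ((C + 4) * r) ^ 2 := by
        have : (0:ℝ) ≤ s := by positivity
        gcongr
      have h4 : 1 ≤ ((C + 4) * r) ^ 2 := one_le_pow₀ (by nlinarith)
      nlinarith
    have h2 := Real.log_le_log (by linarith) h1
    rw [Real.log_mul (by linarith) (by positivity), Real.log_pow] at h2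
    push_cast at h2
    nlinarith [Real.log_nonneg hD1]
  have hl' : Real.log N ≤ G * (1 + Real.log r) :=
    (Real.log_le_log (by linarith) (by linarith)).trans hl
  have hl0 : 0 ≤ Real.log ((N:ℝ) + 1) := Real.log_nonneg (by linarith)
  have hnr : (n : ℝ) ≤ 2 * r * s₀ := by exact_mod_cast hn
  have hsqrt : √((n : ℝ) / s₀) ≤ 2 * √(r:ℝ) := by
    rw [show 2 * √(r:ℝ) = √(4 * r) by
      rw [Real.sqrt_mul (by norm_num), show (4:ℝ) = 2 ^ 2 by norm_num, Real.sqrt_sq (by norm_num)]]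
    apply Real.sqrt_le_sqrt
    rw [div_le_iff₀ (by linarith)]
    nlinarith
  have hfrac : (9 * (1 / √(r:ℝ) * n) + 6) / s₀ ≤ 18 * √(r:ℝ) + 6 := by
    rw [div_le_iff₀ (by linarith)]
    have h1 : 1 / √(r:ℝ) * n ≤ 2 * √(r:ℝ) * s₀ := by
      have : 1 / √(r:ℝ) * n ≤ 1 / √(r:ℝ) * (2 * r * s₀) := by gcongr
      refine this.trans (le_of_eq ?_)
      have h2 := Real.mul_self_sqrt (show (0:ℝ) ≤ r by linarith)
      field_simp
      nlinarith
    nlinarith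
  set u := √(r:ℝ) * (1 + Real.log r) with hu
  have hT1 : 1 ≤ 1 + Real.log r := by linarith
  have hu1 : 1 + Real.log r ≤ u := by rw [hu]; nlinarith
  have hu2 : √(r:ℝ) ≤ u := by rw [hu]; nlinarith
  have hmid : (6 * Real.log (N + 1) + 1) * √((n : ℝ) / s₀) ≤ 7 * (G * (1 + Real.log r)) * (2 * √(r:ℝ)) := by
    have : (1:ℝ) ≤ G * (1 + Real.log r) := by nlinarith
    gcongr
    linarith
  have hmid' : 7 * (G * (1 + Real.log r)) * (2 * √(r:ℝ)) = 14 * G * u := by rw [hu]; ring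
  have hGu : G * (1 + Real.log r) ≤ G * u := by gcongr
  nlinarith

open Classical in
/-- One level of the partition: few classes are touched by convex sets crossing the slab. -/
theorem exists_one_level (η : ℝ) (hη : 0 < η) : ∃ r B : ℕ, 2 ≤ r ∧
    (2 * r + 64 : ℝ) ≤ (r : ℝ) ^ (1 + η) ∧
    ∀ (X : Finset (ℝ × ℝ)), GenPos X → ∀ x₁ x₂ : ℝ, x₁ < x₂ → (∀ p ∈ X, x₁ < p.1 ∧ p.1 < x₂) →
    ∀ Y₀ : ℝ, ∃ (cls : ℝ × ℝ → ℕ) (Z : Finset (ℝ × ℝ)), Z.card ≤ B ∧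
      ((X \ Z).image cls).card ≤ 2 * r + 64 ∧
      (∀ k, ((X \ Z).filter (fun p => cls p = k)).card * r ≤ X.card) ∧
      ∀ K : Set (ℝ × ℝ), Convex ℝ K → (∀ p ∈ K, |p.2| ≤ Y₀) → (∀ z ∈ Z, z ∉ K) →
        (∃ L ∈ K, L.1 = x₁) → (∃ R ∈ K, R.1 = x₂) →
        ((((X \ Z).filter (· ∈ K)).image cls).card : ℝ) ≤ (r : ℝ) ^ (1 / 2 + η) := by
  obtain ⟨C, hC, hpar⟩ := exists_net_parameters 6 1 one_pos
  obtain ⟨E, hE⟩ := touched_bound hC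
  obtain ⟨r, hr1, hr2, hr3⟩ := ((eventually_const_mul_log_le E η hη).and
    ((eventually_const_mul_log_le 66 η hη).and (Filter.eventually_ge_atTop 2))).exists
  have hr0 : (0:ℝ) < r := by exact_mod_cast (by omega : 0 < r)
  have hr1' : (1:ℝ) ≤ r := by exact_mod_cast (by omega : 1 ≤ r)
  have hlr : 0 ≤ Real.log r := Real.log_nonneg hr1'
  -- With `δ = 1/√r` the classes inside a region number about `δ * r = √r`, matching the crossing
  -- number. The net parameter `η = 1` gives `s ≤ C / δ ^ 2 = C * r`.
  obtain ⟨s, k, hs, hk1, hk2⟩ := hpar (1 / √r) (by positivity) (by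
    rw [div_le_one (by positivity)]; exact Real.one_le_sqrt.2 hr1')
  have hsC : (s : ℝ) ≤ C * r := by
    refine hs.trans (le_of_eq ?_)
    congr 1
    rw [one_div, Real.inv_rpow (by positivity), ← Real.rpow_neg (by positivity), Real.sqrt_eq_rpow,
      ← Real.rpow_mul hr0.le]
    norm_num
  set N := 2 * (s + 4) ^ 2 with hN
  refine ⟨r, N ^ 2 + N ^ 5 + r, hr3, ?_, ?_⟩
  · rw [Real.rpow_add hr0, Real.rpow_one]
    nlinarith
  intro X hX x₁ x₂ hx hXx Y₀
  rcases lt_or_ge X.card r with hsmall | hbig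
  -- Fewer than `r` points are simply put into the exceptional set, which is why `r` is added to the
  -- bound `B`.
  · refine ⟨fun _ => 0, X, by omega, by simp, by simp, fun K _ _ _ _ _ => ?_⟩
    simp; positivity
  set s₀ := X.card / r with hs₀
  have hs₀pos : 0 < s₀ := Nat.div_pos hbig (by omega)
  obtain ⟨𝒞, Z, hZ, c1, c2, c3, c4⟩ := exists_partition_convex hX hx hXx Y₀
    (show (0:ℝ) ≤ 1 / √r by positivity) hk1 hk2 hs₀pos hN
  obtain ⟨cls, d1, d2, d3⟩ := exists_colouring X 𝒞 hs₀pos (fun c hc => (c1 c hc).2) c3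
  have hn : X.card ≤ 2 * r * s₀ := by
    have h1 := Nat.lt_mul_div_succ X.card (show 0 < r by omega)
    rw [← hs₀] at h1
    nlinarith
  have h𝒞c : 𝒞.card ≤ 2 * r := by
    have e1 : (𝒞.biUnion id).card = ∑ c ∈ 𝒞, c.card := Finset.card_biUnion c2
    rw [Finset.sum_congr rfl (fun c hc => (c1 c hc).2), Finset.sum_const, smul_eq_mul] at e1
    have e2 : (𝒞.biUnion id).card ≤ X.card :=
      Finset.card_le_card (Finset.biUnion_subset.2 fun c hc => (c1 c hc).1)
    rw [e1] at e2
    exact Nat.le_of_mul_le_mul_right (e2.trans hn) hs₀pos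
  refine ⟨cls, Z, by omega, ?_, ?_, ?_⟩
  · exact (Finset.card_le_card (Finset.image_subset_image Finset.sdiff_subset)).trans (by omega)
  · intro k
    have h1 : ((X \ Z).filter (fun p => cls p = k)).card ≤ s₀ :=
      (Finset.card_le_card (Finset.filter_subset_filter _ Finset.sdiff_subset)).trans (d2 k)
    exact (Nat.mul_le_mul_right r h1).trans (Nat.div_mul_le_self _ _)
  · intro K hK hKY hKZ hL hR
    have h1 := d3 ((X \ Z).filter (· ∈ K)) ((Finset.filter_subset _ _).trans Finset.sdiff_subset)
    have h2 : (𝒞.filter (fun c => ∃ q ∈ c, q ∈ (X \ Z).filter (· ∈ K))).card ≤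
        (𝒞.filter (fun c => ∃ q ∈ c, q ∈ K)).card := by
      refine Finset.card_le_card fun c hc => ?_
      rw [Finset.mem_filter] at hc ⊢
      obtain ⟨hc, q, hq, hq'⟩ := hc
      exact ⟨hc, q, hq, (Finset.mem_filter.1 hq').2⟩
    have h3 := c4 K hK hKY hKZ hL hR
    have h4 := hE r s N X.card s₀ (by omega) hs₀pos hsC hN hn
    have h5 : ((((X \ Z).filter (· ∈ K)).image cls).card : ℝ) ≤
        (𝒞.filter (fun c => ∃ q ∈ c, q ∈ K)).card + 64 := by exact_mod_cast h1.trans (by omega)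
    rw [Real.rpow_add hr0, ← Real.sqrt_eq_rpow]
    have h6 : √(r:ℝ) * (E * (1 + Real.log r)) ≤ √(r:ℝ) * (r:ℝ) ^ η := by gcongr
    linarith

open Classical in
/-- Iterating the partition. -/
theorem exists_iterated_partition (η : ℝ) (hη : 0 < η) : ∃ r B : ℕ, 2 ≤ r ∧
    (2 * r + 64 : ℝ) ≤ (r : ℝ) ^ (1 + η) ∧
    ∀ (t : ℕ) (X : Finset (ℝ × ℝ)), GenPos X → ∀ x₁ x₂ : ℝ, x₁ < x₂ →
    (∀ p ∈ X, x₁ < p.1 ∧ p.1 < x₂) →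
    ∀ Y₀ : ℝ, ∃ (cls : ℝ × ℝ → ℕ) (Z : Finset (ℝ × ℝ)), Z.card ≤ B * (2 * r + 65) ^ t ∧
      ((X \ Z).image cls).card ≤ (2 * r + 64) ^ t ∧
      (∀ k, ((X \ Z).filter (fun p => cls p = k)).card * r ^ t ≤ X.card) ∧
      ∀ K : Set (ℝ × ℝ), Convex ℝ K → (∀ p ∈ K, |p.2| ≤ Y₀) → (∀ z ∈ Z, z ∉ K) →
        (∃ L ∈ K, L.1 = x₁) → (∃ R ∈ K, R.1 = x₂) →
        ((((X \ Z).filter (· ∈ K)).image cls).card : ℝ) ≤ ((r : ℝ) ^ (1 / 2 + η)) ^ t := by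
  obtain ⟨r, B, hr, hr', hone⟩ := exists_one_level η hη
  refine ⟨r, B, hr, hr', fun t X hX x₁ x₂ hx hXx Y₀ => ?_⟩
  induction t with
  | zero =>
    refine ⟨fun _ => 0, ∅, by simp, ?_, fun k => ?_, fun K _ _ _ _ _ => ?_⟩
    · simp only [pow_zero]
      exact (Finset.card_le_card (t := {0}) (fun x hx => by simp at hx ⊢; omega)).trans (by simp)
    · rw [pow_zero, mul_one]
      exact (Finset.card_filter_le _ _).trans (Finset.card_le_card Finset.sdiff_subset)
    · simp only [pow_zero]
      exact_mod_cast (Finset.card_le_card (t := {0}) (fun x hx => by simp at hx ⊢; omega)).trans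
        (by simp)
  | succ t ih =>
    obtain ⟨cls, Z, hZ, hcl, hfib, htouch⟩ := ih
    set Xk : ℕ → Finset (ℝ × ℝ) := fun k => (X \ Z).filter (fun p => cls p = k) with hXk
    have hXkX : ∀ k, Xk k ⊆ X := fun k => (Finset.filter_subset _ _).trans Finset.sdiff_subset
    have hstep : ∀ k, ∃ (cl : ℝ × ℝ → ℕ) (Z' : Finset (ℝ × ℝ)), Z'.card ≤ B ∧
      ((Xk k \ Z').image cl).card ≤ 2 * r + 64 ∧
      (∀ j, ((Xk k \ Z').filter (fun p => cl p = j)).card * r ≤ (Xk k).card) ∧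
      ∀ K : Set (ℝ × ℝ), Convex ℝ K → (∀ p ∈ K, |p.2| ≤ Y₀) → (∀ z ∈ Z', z ∉ K) →
        (∃ L ∈ K, L.1 = x₁) → (∃ R ∈ K, R.1 = x₂) →
        ((((Xk k \ Z').filter (· ∈ K)).image cl).card : ℝ) ≤ (r : ℝ) ^ (1 / 2 + η) := fun k =>
      hone (Xk k) (hX.mono (hXkX k)) x₁ x₂ hx (fun p hp => hXx p (hXkX k hp)) Y₀
    choose cl Z' s1 s2 s3 s4 using hstep
    set I := (X \ Z).image cls with hI
    -- Every class is partitioned again and the new colour pairs the old one with the inner one. A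
    -- convex set touches at most `r ^ (1/2 + η)` parts of each touched class, so the counts
    -- multiply.
    set cls' : ℝ × ℝ → ℕ := fun p => Nat.pair (cls p) (cl (cls p) p) with hcls'
    set W := Z ∪ I.biUnion Z' with hW
    have hmem : ∀ p ∈ X \ W, cls p ∈ I ∧ p ∈ Xk (cls p) \ Z' (cls p) := by
      intro p hp
      simp only [hW, Finset.mem_sdiff, Finset.mem_union, Finset.mem_biUnion, not_or, not_exists,
        not_and] at hp
      have hI' : cls p ∈ I := Finset.mem_image.2 ⟨p, by simp [hp.1, hp.2.1], rfl⟩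
      refine ⟨hI', ?_⟩
      simp only [hXk, Finset.mem_sdiff, Finset.mem_filter]
      exact ⟨⟨⟨hp.1, hp.2.1⟩, trivial⟩, hp.2.2 _ hI'⟩
    have himg : ∀ (J : Finset ℕ) (T : ℕ → Finset ℕ) (Y : Finset (ℝ × ℝ)),
        (∀ p ∈ Y, cls p ∈ J ∧ cl (cls p) p ∈ T (cls p)) →
        (Y.image cls').card ≤ ∑ k ∈ J, (T k).card := by
      intro J T Y h
      have : Y.image cls' ⊆ J.biUnion (fun k => (T k).image (fun j => Nat.pair k j)) := by
        intro x hx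
        obtain ⟨p, hp, rfl⟩ := Finset.mem_image.1 hx
        exact Finset.mem_biUnion.2 ⟨cls p, (h p hp).1, Finset.mem_image.2 ⟨_, (h p hp).2, rfl⟩⟩
      exact (Finset.card_le_card this).trans (Finset.card_biUnion_le.trans
        (Finset.sum_le_sum fun k _ => Finset.card_image_le))
    refine ⟨cls', W, ?_, ?_, ?_, ?_⟩
    · have h1 : (I.biUnion Z').card ≤ I.card * B := by
        refine Finset.card_biUnion_le.trans ?_
        rw [← smul_eq_mul]
        exact Finset.sum_le_card_nsmul _ _ _ (fun k _ => s1 k)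
      have h2 : I.card ≤ (2 * r + 65) ^ t := hcl.trans (Nat.pow_le_pow_left (by omega) t)
      have h3 := (Finset.card_union_le Z (I.biUnion Z')).trans (Nat.add_le_add hZ h1)
      refine h3.trans ?_
      rw [pow_succ]
      have h4 := Nat.mul_le_mul_right B h2
      have h5 : B * (2 * r + 65) ^ t * 2 ≤ B * (2 * r + 65) ^ t * (2 * r + 65) :=
        Nat.mul_le_mul_left _ (by omega)
      nlinarith
    · refine (himg I (fun k => (Xk k \ Z' k).image (cl k)) _ (fun p hp =>
        ⟨(hmem p hp).1, Finset.mem_image_of_mem _ (hmem p hp).2⟩)).trans ?_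
      rw [pow_succ]
      refine (Finset.sum_le_card_nsmul _ _ _ (fun k _ => s2 k)).trans ?_
      rw [smul_eq_mul]
      exact Nat.mul_le_mul_right _ hcl
    · intro j
      have hsub : (X \ W).filter (fun p => cls' p = j) ⊆
          (Xk (Nat.unpair j).1 \ Z' (Nat.unpair j).1).filter
            (fun p => cl (Nat.unpair j).1 p = (Nat.unpair j).2) := by
        intro p hp
        rw [Finset.mem_filter] at hp ⊢
        have hj : Nat.unpair j = (cls p, cl (cls p) p) := by rw [← hp.2, hcls']; simp
        rw [hj]
        exact ⟨(hmem p hp.1).2, rfl⟩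
      have h1 := Nat.mul_le_mul_right r (Finset.card_le_card hsub)
      have h2 := h1.trans (s3 _ _)
      have h3 := hfib (Nat.unpair j).1
      calc _ = ((X \ W).filter (fun p => cls' p = j)).card * r * r ^ t := by rw [pow_succ]; ring
        _ ≤ (Xk (Nat.unpair j).1).card * r ^ t := Nat.mul_le_mul_right _ h2
        _ ≤ _ := h3
    · intro K hK hKY hKZ hL hR
      have hZK : ∀ z ∈ Z, z ∉ K := fun z hz => hKZ z (Finset.mem_union_left _ hz)
      have hZK' : ∀ k ∈ I, ∀ z ∈ Z' k, z ∉ K := fun k hk z hz =>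
        hKZ z (Finset.mem_union_right _ (Finset.mem_biUnion.2 ⟨k, hk, hz⟩))
      set J := ((X \ Z).filter (· ∈ K)).image cls with hJ
      have hJI : J ⊆ I := Finset.image_subset_image (Finset.filter_subset _ _)
      have h1 := himg J (fun k => ((Xk k \ Z' k).filter (· ∈ K)).image (cl k))
        ((X \ W).filter (· ∈ K)) (fun p hp => by
          rw [Finset.mem_filter] at hp
          obtain ⟨e1, e2⟩ := hmem p hp.1
          refine ⟨Finset.mem_image.2 ⟨p, ?_, rfl⟩, Finset.mem_image.2 ⟨p, ?_, rfl⟩⟩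
          · have := (Finset.mem_filter.1 (Finset.mem_sdiff.1 e2).1).1
            exact Finset.mem_filter.2 ⟨this, hp.2⟩
          · exact Finset.mem_filter.2 ⟨e2, hp.2⟩)
      have h2 := htouch K hK hKY hZK hL hR
      calc _ ≤ ∑ k ∈ J, ((((Xk k \ Z' k).filter (· ∈ K)).image (cl k)).card : ℝ) := by
            exact_mod_cast h1
        _ ≤ ∑ k ∈ J, (r : ℝ) ^ (1 / 2 + η) :=
            Finset.sum_le_sum fun k hk => s4 k K hK hKY (hZK' k (hJI hk)) hL hR
        _ = J.card * (r : ℝ) ^ (1 / 2 + η) := by simp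
        _ ≤ _ := by rw [pow_succ]; gcongr

/-! ### Piercing intervals and linear programming duality. -/

open Classical in
/-- Finitely many weighted points on a line: few points pierce all heavy intervals. -/
theorem exists_stabbing {ι : Type*} (V : Finset ι) (y : ι → ℝ) (ν : ι → ℝ) (hν : ∀ v ∈ V, 0 ≤ ν v)
    (δ : ℝ) (hδ : 0 < δ) :
    ∃ N : Finset ℝ, (N.card : ℝ) ≤ (∑ v ∈ V, ν v) / δ ∧ ∀ I : Set ℝ, I.OrdConnected →
      δ ≤ ∑ v ∈ V.filter (fun v => y v ∈ I), ν v → ∃ z ∈ N, z ∈ I := by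
  induction V using Finset.strongInduction with
  | H V ih =>
    rcases lt_or_ge (∑ v ∈ V, ν v) δ with hlt | hge
    · refine ⟨∅, by simpa using div_nonneg (Finset.sum_nonneg hν) hδ.le, fun I _ hI => ?_⟩
      have : ∑ v ∈ V.filter (fun v => y v ∈ I), ν v ≤ ∑ v ∈ V, ν v :=
        Finset.sum_le_sum_of_subset_of_nonneg (Finset.filter_subset _ _) (fun v hv _ => hν v hv)
      linarith
    have hVne : V.Nonempty := by
      by_contra h
      rw [Finset.not_nonempty_iff_eq_empty] at h
      rw [h] at hge; simp at hge; linarith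
    have hex : (V.filter (fun a => δ ≤ ∑ v ∈ V.filter (fun v => y v ≤ y a), ν v)).Nonempty := by
      obtain ⟨a, ha, hmax⟩ := V.exists_max_image y hVne
      refine ⟨a, Finset.mem_filter.2 ⟨ha, ?_⟩⟩
      rw [Finset.filter_true_of_mem (fun v hv => hmax v hv)]
      exact hge
    -- Greedy sweep: `y a` is the first position where the accumulated mass reaches `δ`. That mass
    -- pays for the point, and a heavy interval missing it lies entirely to its right.
    obtain ⟨a, ha, hmin⟩ := Finset.exists_min_image _ y hex
    rw [Finset.mem_filter] at ha
    have hss : V.filter (fun v => y a < y v) ⊂ V :=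
      Finset.filter_ssubset.2 ⟨a, ha.1, lt_irrefl _⟩
    obtain ⟨N, hN, hN'⟩ := ih _ hss (fun v hv => hν v (Finset.mem_filter.1 hv).1)
    refine ⟨insert (y a) N, ?_, ?_⟩
    · have h1 : ((insert (y a) N).card : ℝ) ≤ N.card + 1 := by
        exact_mod_cast Finset.card_insert_le _ _
      have h2 := Finset.sum_filter_add_sum_filter_not V (fun v => y v ≤ y a) ν
      simp only [not_le] at h2
      have h3 : (∑ v ∈ V.filter (fun v => y a < y v), ν v) / δ + 1 ≤ (∑ v ∈ V, ν v) / δ := by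
        rw [← h2, add_div]
        have : 1 ≤ (∑ v ∈ V.filter (fun v => y v ≤ y a), ν v) / δ := by
          rw [le_div_iff₀ hδ]; linarith [ha.2]
        linarith
      linarith
    · intro I hI hw
      by_cases haI : y a ∈ I
      · exact ⟨y a, by simp, haI⟩
      by_cases hleft : ∃ z ∈ I, z < y a
      · exfalso
        obtain ⟨z, hz, hza⟩ := hleft
        have hall : ∀ x ∈ I, x < y a := by
          intro x hx
          by_contra hcon
          exact haI (hI.out hz hx ⟨hza.le, not_lt.1 hcon⟩)
        have hne : (V.filter (fun v => y v ∈ I)).Nonempty := by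
          by_contra h
          rw [Finset.not_nonempty_iff_eq_empty] at h
          rw [h] at hw; simp at hw; linarith
        obtain ⟨b, hb, hbmax⟩ := Finset.exists_max_image _ y hne
        rw [Finset.mem_filter] at hb
        have h1 : δ ≤ ∑ v ∈ V.filter (fun v => y v ≤ y b), ν v := by
          refine hw.trans (Finset.sum_le_sum_of_subset_of_nonneg ?_
            (fun v hv _ => hν v (Finset.mem_filter.1 hv).1))
          intro v hv
          exact Finset.mem_filter.2 ⟨(Finset.mem_filter.1 hv).1, hbmax v hv⟩
        have h2 := hmin b (Finset.mem_filter.2 ⟨hb.1, h1⟩)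
        exact absurd (hall _ hb.2) (not_lt.2 h2)
      · push Not at hleft
        obtain ⟨z, hz, hzI⟩ := hN' I hI (by
          refine hw.trans (le_of_eq (Finset.sum_congr ?_ fun _ _ => rfl))
          ext v
          simp only [Finset.mem_filter]
          constructor
          · rintro ⟨h1, h2⟩
            refine ⟨⟨h1, lt_of_le_of_ne (hleft _ h2) ?_⟩, h2⟩
            intro h; exact haI (h ▸ h2)
          · rintro ⟨⟨h1, _⟩, h2⟩; exact ⟨h1, h2⟩)
        exact ⟨z, by simp [hz], hzI⟩

open Classical in
/-- Linear programming duality for piercing. -/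
theorem exists_weights_or_measure {ι κ : Type*} [Fintype ι] [Nonempty κ] (inc : κ → ι → Prop)
    (T : ℝ) (hT : 0 < T) :
    (∃ (V : Finset κ) (ν : κ → ℝ), (∀ v ∈ V, 0 ≤ ν v) ∧ ∑ v ∈ V, ν v = 1 ∧
      ∀ S, 1 / T ≤ ∑ v ∈ V.filter (fun v => inc v S), ν v) ∨
    (∃ μ : ι → ℝ, (∀ S, 0 ≤ μ S) ∧ ∑ S, μ S = 1 ∧
      ∀ v, ∑ S ∈ Finset.univ.filter (fun S => inc v S), μ S ≤ 1 / T) := by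
  let chi : κ → ι → ℝ := fun v S => if inc v S then 1 else 0
  have hfin : (Set.range chi).Finite := by
    refine Set.Finite.subset (Set.Finite.pi' (fun _ : ι => (Set.toFinite ({0, 1} : Set ℝ)))) ?_
    rintro _ ⟨v, rfl⟩ S
    by_cases h : inc v S <;> simp [chi, h]
  let U : Set (ι → ℝ) := {x | ∀ S, 1 / T ≤ x S}
  -- There are only finitely many incidence vectors, so their hull is compact. If it meets the
  -- closed orthant `U`, it yields weights. Otherwise a functional strictly separates the two; its
  -- coefficients are nonnegative because `U` is unbounded upwards, and normalising them gives `μ`.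
  by_cases hmeet : (convexHull ℝ (Set.range chi) ∩ U).Nonempty
  · left
    obtain ⟨x, hx, hxU⟩ := hmeet
    rw [← hfin.coe_toFinset] at hx
    obtain ⟨w, hw0, hw1, hwx⟩ := Finset.mem_convexHull'.1 hx
    have hrep : ∀ a ∈ hfin.toFinset, ∃ v, chi v = a := fun a ha => by simpa using ha
    choose! rep hrep using hrep
    have hinj : Set.InjOn rep (hfin.toFinset : Set (ι → ℝ)) := by
      intro a ha b hb hab
      rw [← hrep a ha, ← hrep b hb, hab]
    refine ⟨hfin.toFinset.image rep, fun v => w (chi v), ?_, ?_, ?_⟩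
    · intro v hv
      exact hw0 _ (by simp)
    · rw [Finset.sum_image hinj, ← hw1]
      exact Finset.sum_congr rfl fun a ha => by rw [hrep a ha]
    · intro S
      refine (hxU S).trans (le_of_eq ?_)
      rw [Finset.sum_filter, Finset.sum_image hinj, ← hwx, Finset.sum_apply]
      refine Finset.sum_congr rfl fun a ha => ?_
      rw [hrep a ha]
      have h1 := congrFun (hrep a ha) S
      simp only [Pi.smul_apply, smul_eq_mul, ← h1, chi]
      split_ifs <;> simp
  · right
    have hdisj : Disjoint (convexHull ℝ (Set.range chi)) U :=
      Set.disjoint_iff_inter_eq_empty.2 (Set.not_nonempty_iff_eq_empty.1 hmeet)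
    have hUc : Convex ℝ U := by
      intro x hx y hy a b ha hb hab S
      have h1 := mul_le_mul_of_nonneg_left (hx S) ha
      have h2 := mul_le_mul_of_nonneg_left (hy S) hb
      have h3 : 1 / T = a * (1 / T) + b * (1 / T) := by rw [← add_mul, hab, one_mul]
      simp only [Pi.add_apply, Pi.smul_apply, smul_eq_mul]
      linarith
    have hUcl : IsClosed U := by
      simp only [U, Set.ofPred_forall]
      exact isClosed_iInter fun S => isClosed_le continuous_const (continuous_apply S)
    obtain ⟨f, u, u', hfa, huu, hfb⟩ := geometric_hahn_banach_compact_closed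
      (convex_convexHull ℝ (Set.range chi)) (hfin.isCompact_convexHull ℝ) hUc hUcl hdisj
    let c : ι → ℝ := fun S => f (Pi.single S 1)
    have hf : ∀ x, f x = ∑ S, x S * c S := by
      intro x
      conv_lhs => rw [pi_eq_sum_univ' x]
      simp [c, map_sum]
    have hc0 : ∀ S, 0 ≤ c S := by
      intro S
      by_contra hneg
      push Not at hneg
      let B : ℝ := f (fun _ => 1 / T)
      have hB : ∀ s : ℝ, 0 ≤ s → u' < B + s * c S := by
        intro s hs
        have := hfb ((fun _ => 1 / T) + s • Pi.single S 1) (by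
          intro S'
          simp only [Pi.add_apply, Pi.smul_apply, smul_eq_mul]
          have : 0 ≤ s * (Pi.single S (1:ℝ) : ι → ℝ) S' := by
            refine mul_nonneg hs ?_
            rw [Pi.single_apply]; split_ifs <;> norm_num
          linarith)
        simpa [B, c] using this
      have h1 := hB ((|B| + |u'|) / (- c S)) (by apply div_nonneg (by positivity); linarith)
      have h2 : (|B| + |u'|) / (- c S) * c S = -(|B| + |u'|) := by
        field_simp [hneg.ne]
      rw [h2] at h1
      have := le_abs_self B
      have := neg_abs_le u'
      linarith
    obtain ⟨v₀⟩ := ‹Nonempty κ›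
    have hmax : ∀ v, f (chi v) < u := fun v => hfa _ (subset_convexHull _ _ ⟨v, rfl⟩)
    have hsum : u' < (1 / T) * ∑ S, c S := by
      have := hfb (fun _ => 1 / T) (fun _ => le_rfl)
      rwa [hf, ← Finset.mul_sum] at this
    have hu0 : 0 < u := by
      refine lt_of_le_of_lt ?_ (hmax v₀)
      rw [hf]
      refine Finset.sum_nonneg fun S _ => mul_nonneg ?_ (hc0 S)
      simp only [chi]; split_ifs <;> norm_num
    have hpos : 0 < ∑ S, c S := by
      have h1 : 0 < (1 / T) * ∑ S, c S := by linarith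
      exact pos_of_mul_pos_right h1 (by positivity)
    refine ⟨fun S => c S / ∑ S, c S, fun S => div_nonneg (hc0 S) hpos.le, ?_, fun v => ?_⟩
    · rw [← Finset.sum_div, div_self hpos.ne']
    · rw [← Finset.sum_div, div_le_iff₀ hpos]
      have h1 := hmax v
      rw [hf] at h1
      have h2 : ∑ S ∈ Finset.univ.filter (fun S => inc v S), c S = ∑ S, chi v S * c S := by
        rw [Finset.sum_filter]
        refine Finset.sum_congr rfl fun S _ => ?_
        simp only [chi]; split_ifs <;> simp
      rw [h2]; linarith

open Classical in
/-- Either few points on `m` vertical lines pierce every member of a finite family, or some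
probability measure on the family gives small mass to the members through any point. -/
theorem exists_piercing_or_measure {ι : Type*} [Fintype ι] (m : ℕ) (hm : 0 < m)
    (I : ι → Fin m → Set ℝ) (hI : ∀ S j, (I S j).OrdConnected) (T : ℝ) (hT : 0 < T) :
    (∃ N : Fin m → Finset ℝ, (∀ j, ((N j).card : ℝ) ≤ m * T) ∧ ∀ S, ∃ j, ∃ z ∈ N j, z ∈ I S j) ∨
    (∃ μ : ι → ℝ, (∀ S, 0 ≤ μ S) ∧ ∑ S, μ S = 1 ∧
      ∀ j y, ∑ S ∈ Finset.univ.filter (fun S => y ∈ I S j), μ S ≤ 1 / T) := by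
  have : Nonempty (Fin m) := ⟨⟨0, hm⟩⟩
  have hm' : (0:ℝ) < m := by exact_mod_cast hm
  rcases exists_weights_or_measure (fun (v : Fin m × ℝ) (S : ι) => v.2 ∈ I S v.1) T hT with
    ⟨V, ν, hν, hs, hV⟩ | ⟨μ, h0, h1, h2⟩
  · left
    have hst := fun j => exists_stabbing (V.filter (fun v => v.1 = j)) Prod.snd ν
      (fun v hv => hν v (Finset.mem_filter.1 hv).1) (1 / (m * T)) (by positivity)
    choose N hN hN' using hst
    refine ⟨N, fun j => (hN j).trans ?_, fun S => ?_⟩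
    · rw [div_le_iff₀ (by positivity), mul_one_div_cancel (by positivity), ← hs]
      exact Finset.sum_le_sum_of_subset_of_nonneg (Finset.filter_subset _ _) (fun v hv _ => hν v hv)
    -- One of the `m` lines carries a `1/m` share of the weight `1/T` seen by `S`.
    · by_contra hcon
      push Not at hcon
      have hlt : ∀ j, ∑ v ∈ (V.filter (fun v => v.1 = j)).filter (fun v => v.2 ∈ I S j), ν v
          < 1 / (m * T) := by
        intro j
        by_contra h
        push Not at h
        obtain ⟨z, hz, hz'⟩ := hN' j _ (hI S j) h
        exact hcon j z hz hz'
      have h1 := hV S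
      have h2 : ∑ v ∈ V.filter (fun v => v.2 ∈ I S v.1), ν v =
          ∑ j, ∑ v ∈ (V.filter (fun v => v.1 = j)).filter (fun v => v.2 ∈ I S j), ν v := by
        rw [← Finset.sum_fiberwise (V.filter (fun v => v.2 ∈ I S v.1)) Prod.fst]
        refine Finset.sum_congr rfl fun j _ => Finset.sum_congr ?_ fun _ _ => rfl
        ext v
        simp only [Finset.mem_filter]
        constructor
        · rintro ⟨⟨a, b⟩, rfl⟩; exact ⟨⟨a, rfl⟩, b⟩
        · rintro ⟨⟨a, rfl⟩, b⟩; exact ⟨⟨a, b⟩, rfl⟩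
      have h3 : ∑ j : Fin m, ∑ v ∈ (V.filter (fun v => v.1 = j)).filter (fun v => v.2 ∈ I S j), ν v
          < ∑ _j : Fin m, 1 / (m * T) :=
        Finset.sum_lt_sum_of_nonempty Finset.univ_nonempty fun j _ => hlt j
      rw [Finset.sum_const, Finset.card_univ, Fintype.card_fin, nsmul_eq_mul] at h3
      have h4 : (m:ℝ) * (1 / (m * T)) = 1 / T := by field_simp
      linarith
  · right
    exact ⟨μ, h0, h1, fun j y => h2 (j, y)⟩

/-! ### Trapezoids, axes of pairs, and the wall net. -/

/-- The part of the vertical slab `x₁ ≤ x ≤ x₂` above the line `ℓ` and below the line `m`. -/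
def trap (x₁ x₂ : ℝ) (ℓ m : ℝ × ℝ) : Set (ℝ × ℝ) :=
  {p | (x₁ ≤ p.1 ∧ p.1 ≤ x₂) ∧ (0 ≤ height ℓ p ∧ height m p ≤ 0)}

/-- All slab trapezoids. -/
def traps : Set (Set (ℝ × ℝ)) := {R | ∃ x₁ x₂ ℓ m, R = trap x₁ x₂ ℓ m}

/-- A trapezoid is an intersection of four complements of open half-planes, each of exponent 3. -/
theorem polyGrowth_traps : PolyGrowth traps 12 := by
  have h := polyGrowth_halfPlanes.compl
  refine ((h.inter h).inter (h.inter h)).mono ?_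
  rintro _ ⟨x₁, x₂, ℓ, m, rfl⟩
  refine ⟨_, ⟨{p | x₁ ≤ p.1}, ⟨-1, 0, x₁, ?_⟩, {p | p.1 ≤ x₂}, ⟨1, 0, -x₂, ?_⟩, rfl⟩, _,
    ⟨{p | 0 ≤ height ℓ p}, ⟨ℓ.1, -1, ℓ.2, ?_⟩, {p | height m p ≤ 0}, ⟨-m.1, 1, -m.2, ?_⟩, rfl⟩, rfl⟩
  all_goals
    ext p
    simp only [height, lineVal, Set.mem_compl_iff, Set.mem_ofPred_eq, not_le]
    constructor <;> intro h <;> linarith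

theorem trap_subset {K : Set (ℝ × ℝ)} (hK : Convex ℝ K) {a b c d : ℝ × ℝ} (ha : a ∈ K) (hb : b ∈ K)
    (hc : c ∈ K) (hd : d ∈ K) {x₁ x₂ : ℝ} (h1 : a.1 ≤ x₁) (h2 : x₂ ≤ b.1) (h3 : c.1 ≤ x₁)
    (h4 : x₂ ≤ d.1) {ℓ m : ℝ × ℝ} (la : a.2 ≤ lineVal ℓ a.1) (lb : b.2 ≤ lineVal ℓ b.1)
    (mc : lineVal m c.1 ≤ c.2) (md : lineVal m d.1 ≤ d.2) : trap x₁ x₂ ℓ m ⊆ K := by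
  rintro z ⟨⟨z1, z2⟩, z3, z4⟩
  simp only [height] at z3 z4
  exact mem_of_chords hK ha hb hc hd (h1.trans z1) (z2.trans h2) (h3.trans z1) (z2.trans h4) ℓ m
    la lb (by linarith) mc md (by linarith)

open Classical in
/-- Few pairs of points of a convex set have their axis below a point outside their slab. -/
theorem card_axis_below_le {K : Set (ℝ × ℝ)} (hK : Convex ℝ K) {P V : Finset (ℝ × ℝ)} {τ : ℕ}
    (hτ : ∀ x₁ x₂ ℓ m, trap x₁ x₂ ℓ m ⊆ K → (P.filter (· ∈ trap x₁ x₂ ℓ m)).card ≤ τ)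
    (hinj : Set.InjOn Prod.fst (P : Set (ℝ × ℝ))) {u v w : ℝ × ℝ} (hu : u ∈ K) (hv : v ∈ K)
    (hw : w ∈ K) (huw : u.1 ≤ w.1) (hwv : w.1 ≤ v.1) (huv : u.1 < v.1) (hVP : V ⊆ P)
    (hV : ∀ p ∈ V, p ∈ K ∧ u.1 ≤ p.1 ∧ p.1 ≤ v.1 ∧ 0 ≤ height (through u v) p)
    (hside : (∀ p ∈ V, p.1 < w.1) ∨ (∀ p ∈ V, w.1 < p.1))
    {G : Finset ((ℝ × ℝ) × (ℝ × ℝ))} (hG : G ⊆ V ×ˢ V) (hne : ∀ e ∈ G, e.1 ≠ e.2) :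
    (G.filter (fun e => lineVal (through e.1 e.2) w.1 < w.2)).card ≤ 2 * τ * V.card := by
  -- `F p` collects the points above the chord `uv` and below the segment `pw`, a trapezoid inside
  -- `K`. If the axis of two points passes below `w`, the one nearer to `w` lies below the segment
  -- from the other to `w`, hence in the `F` of the other. The factor 2 accounts for the order of
  -- the pair.
  let F : ℝ × ℝ → Finset (ℝ × ℝ) := fun p =>
    P.filter (· ∈ trap (min p.1 w.1) (max p.1 w.1) (through u v) (through p w))
  have hF : ∀ p ∈ V, (F p).card ≤ τ := by
    intro p hp
    obtain ⟨pK, pu, pv, -⟩ := hV p hp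
    have hpw : p.1 ≠ w.1 := by
      rcases hside with h | h
      · exact (h p hp).ne
      · exact (h p hp).ne'
    refine hτ _ _ _ _ ?_
    rcases hside with h | h
    · have h' := h p hp
      rw [min_eq_left h'.le, max_eq_right h'.le]
      exact trap_subset hK hu hv pK hw pu hwv le_rfl le_rfl (lineVal_through_left _ _).ge
        (lineVal_through_right huv.ne).ge (lineVal_through_left _ _).le
        (lineVal_through_right hpw).le
    · have h' := h p hp
      rw [min_eq_right h'.le, max_eq_left h'.le]
      exact trap_subset hK hu hv hw pK huw pv le_rfl le_rfl (lineVal_through_left _ _).ge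
        (lineVal_through_right huv.ne).ge (lineVal_through_right hpw).le
        (lineVal_through_left _ _).le
  have hmem : ∀ a ∈ V, ∀ b ∈ V, ∀ ℓ, lineVal ℓ a.1 = a.2 → lineVal ℓ b.1 = b.2 →
      lineVal ℓ w.1 < w.2 → (a.1 < b.1 ∧ b.1 < w.1 ∨ w.1 < b.1 ∧ b.1 < a.1) → b ∈ F a := by
    intro a ha b hb ℓ la lb lw hord
    obtain ⟨-, -, -, hb4⟩ := hV b hb
    refine Finset.mem_filter.2 ⟨hVP hb, ⟨?_, ?_⟩, hb4, ?_⟩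
    · rcases hord with h | h
      · exact min_le_of_left_le h.1.le
      · exact min_le_of_right_le h.1.le
    · rcases hord with h | h
      · exact le_max_of_le_right h.2.le
      · exact le_max_of_le_left h.2.le
    · have haw : a.1 ≠ w.1 := by rcases hord with h | h <;> intro h' <;> linarith
      have e1 := lineVal_through_left a w
      have e2 := lineVal_through_right haw
      simp only [height, ← lb]
      rw [sub_nonpos]
      rcases hord with h | h
      · exact lineVal_interp (a := a.1) (b := w.1) (by linarith) (by linarith) h.1.le h.2.le
      · exact lineVal_interp (a := w.1) (b := a.1) (by linarith) (by linarith) h.1.le h.2.le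
  have hsub : G.filter (fun e => lineVal (through e.1 e.2) w.1 < w.2) ⊆
      V.biUnion (fun p => (F p).image (fun p' => (p, p'))) ∪
      V.biUnion (fun p => (F p).image (fun p' => (p', p))) := by
    rintro ⟨a, b⟩ he
    obtain ⟨heG, hlt⟩ := Finset.mem_filter.1 he
    obtain ⟨ha, hb⟩ := Finset.mem_product.1 (hG heG)
    simp only at ha hb hlt
    have hab : a.1 ≠ b.1 := fun h => hne _ heG (hinj (hVP ha) (hVP hb) h)
    have la := lineVal_through_left a b
    have lb := lineVal_through_right hab
    simp only [Finset.mem_union, Finset.mem_biUnion, Finset.mem_image]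
    have hcase : (a.1 < b.1 ∧ b.1 < w.1 ∨ w.1 < b.1 ∧ b.1 < a.1) ∨
        (b.1 < a.1 ∧ a.1 < w.1 ∨ w.1 < a.1 ∧ a.1 < b.1) := by
      rcases hside with h | h <;> rcases lt_or_gt_of_ne hab with h' | h'
      · exact Or.inl (Or.inl ⟨h', h b hb⟩)
      · exact Or.inr (Or.inl ⟨h', h a ha⟩)
      · exact Or.inr (Or.inr ⟨h a ha, h'⟩)
      · exact Or.inl (Or.inr ⟨h b hb, h'⟩)
    rcases hcase with h | h
    · exact Or.inl ⟨a, ha, b, hmem a ha b hb _ la lb hlt h, rfl⟩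
    · exact Or.inr ⟨b, hb, a, hmem b hb a ha _ lb la hlt h, rfl⟩
  have hcard : ∀ f : ℝ × ℝ → ℝ × ℝ → (ℝ × ℝ) × (ℝ × ℝ),
      (V.biUnion (fun p => (F p).image (f p))).card ≤ V.card * τ := fun f =>
    Finset.card_biUnion_le_card_mul _ _ _ fun p hp => Finset.card_image_le.trans (hF p hp)
  have h1 := hcard (fun p p' => (p, p'))
  have h2 := hcard (fun p p' => (p', p))
  refine (Finset.card_le_card hsub).trans ((Finset.card_union_le _ _).trans ?_)
  calc _ ≤ V.card * τ + V.card * τ := add_le_add h1 h2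
    _ = _ := by ring

/-- The segment from `q` to a point of the last wall crosses an earlier wall inside the convex
set. -/
theorem fan_mem {K : Set (ℝ × ℝ)} (hK : Convex ℝ K) {q p ℓ : ℝ × ℝ} {x z β b : ℝ} (hq : q ∈ K)
    (hp : p ∈ K) (hβ : (z, β) ∈ K) (h1 : q.1 ≤ x) (h2 : x ≤ p.1) (h3 : p.1 ≤ z) (hqz : q.1 < z)
    (hℓp : lineVal ℓ p.1 = p.2) (hℓq : q.2 ≤ lineVal ℓ q.1) (hb : β ≤ b) (hb' : b ≤ lineVal ℓ z) :
    (x, lineVal (through q (z, b)) x) ∈ K := by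
  have e1 := lineVal_through_left q (z, b)
  have e2 : lineVal (through q (z, b)) z = b :=
    lineVal_through_right (p := q) (q := (z, b)) hqz.ne
  -- The line from `q` to `(z, b)` runs above the chord from `q` to `(z, β)`. It passes below `p`,
  -- since `ℓ` is above it at `q` and at `z`. So its point over `x` lies between two chords of `K`.
  refine mem_of_chords (z := (x, lineVal (through q (z, b)) x)) hK hq hβ hq hp h1 (h2.trans h3) h1
    h2 _ (through q (z, b)) e1.ge (by simp only [e2]; exact hb) le_rfl e1.le ?_ le_rfl
  rw [← hℓp]
  exact lineVal_interp (a := q.1) (b := z) (by rw [e1]; exact hℓq) (by rw [e2]; exact hb')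
    (h1.trans h2) h3

/-- Disjoint equal groups inside the classes of a partition with few classes. -/
theorem exists_groups {α : Type*} [DecidableEq α] (U : Finset α) (cls : α → ℕ) {k g : ℕ}
    (hg : 0 < g) (himg : (U.image cls).card ≤ k) (m : ℕ) (hU : m * g + k * g ≤ U.card) :
    ∃ V ⊆ U, ∃ G ⊆ V ×ˢ V, V.card = m * g ∧ G.card = m * (g * g - g) ∧
      ∀ e ∈ G, e.1 ≠ e.2 ∧ cls e.1 = cls e.2 := by
  induction m with
  | zero => exact ⟨∅, by simp, ∅, by simp, by simp, by simp, by simp⟩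
  | succ m ih =>
    obtain ⟨V, hV, G, hG, hVc, hGc, hGe⟩ := ih (by nlinarith)
    have hc : (U \ V).card = U.card - m * g := by rw [Finset.card_sdiff_of_subset hV, hVc]
    have hc1 : k * g + g ≤ (U \ V).card := by
      rw [hc]; have : (m + 1) * g = m * g + g := by ring
      omega
    have hne : (U \ V).Nonempty := Finset.card_pos.1 (by omega)
    have himg' : ((U \ V).image cls).card * g ≤ (U \ V).card := by
      have : ((U \ V).image cls).card ≤ k :=
        (Finset.card_le_card (Finset.image_subset_image Finset.sdiff_subset)).trans himg
      nlinarith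
    -- More than `k * g` points remain in at most `k` classes, so some class still has `g` of them.
    obtain ⟨y, -, hy⟩ := Finset.exists_le_card_fiber_of_mul_le_card_of_maps_to
      (fun a ha => Finset.mem_image_of_mem cls ha) (hne.image cls) himg'
    obtain ⟨W, hW, hWc⟩ := Finset.exists_subset_card_eq hy
    have hWm : ∀ a ∈ W, (a ∈ U ∧ a ∉ V) ∧ cls a = y := fun a ha => by
      have := Finset.mem_filter.1 (hW ha)
      exact ⟨Finset.mem_sdiff.1 this.1, this.2⟩
    have hdisj : Disjoint V W := Finset.disjoint_right.2 fun a ha => (hWm a ha).1.2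
    refine ⟨V ∪ W, Finset.union_subset hV fun a ha => (hWm a ha).1.1, G ∪ W.offDiag, ?_, ?_, ?_, ?_⟩
    · refine Finset.union_subset (hG.trans ?_) ?_
      · exact Finset.product_subset_product Finset.subset_union_left Finset.subset_union_left
      · intro e he
        rw [Finset.mem_offDiag] at he
        simp [he.1, he.2.1]
    · rw [Finset.card_union_of_disjoint hdisj, hVc, hWc]; ring
    · rw [Finset.card_union_of_disjoint, hGc, Finset.offDiag_card, hWc]
      · ring
      · rw [Finset.disjoint_left]
        intro e he he'
        exact Finset.disjoint_left.1 hdisj (Finset.mem_product.1 (hG he)).1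
          (Finset.mem_offDiag.1 he').1
    · intro e he
      rcases Finset.mem_union.1 he with he | he
      · exact hGe e he
      · rw [Finset.mem_offDiag] at he
        exact ⟨he.2.2, by rw [(hWm _ he.1).2, (hWm _ he.2.1).2]⟩

open Classical in
/-- One averaging step: if most pairs see many heights, so do most pairs of the preceding slab, by a
larger factor. -/
theorem averaging_step {ι E Ω : Type*} [Fintype ι] (μ : ι → ℝ) (hμ : ∀ K, 0 ≤ μ K)
    (hμ1 : ∑ K, μ K = 1) (β : ι → ℝ) (α : E → ℝ) (y : Ω → ℝ) (B : Finset Ω) (E₀ : Finset E)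
    (G G' : ι → Finset E) (hGE : ∀ K, G K ⊆ E₀) {g : ℝ} (hg : 0 < g) (hGc : ∀ K, ((G K).card : ℝ) = g)
    (hGc' : ∀ K, ((G' K).card : ℝ) = g) (good : ι → E → E → Prop)
    (hα : ∀ K, ∀ e ∈ G K, ∀ e' ∈ G' K, good K e e' → α e' ≤ α e) {T : ℝ} (hT : 0 < T)
    (hmass : ∀ e ∈ E₀, ∀ b ∈ B, ∃ 𝒦 : Finset ι, ∑ K ∈ 𝒦, μ K ≤ 1 / T ∧
      ∀ K, e ∈ G K → ∀ e' ∈ G' K, good K e e' → β K ≤ y b → y b ≤ α e' → K ∈ 𝒦) {η : ℝ}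
    (hbad : ∀ K, ∃ N : Finset (E × E), (N.card : ℝ) ≤ η * (g * g) ∧
      ∀ e ∈ G K, ∀ e' ∈ G' K, ¬ good K e e' → (e, e') ∈ N)
    {A lam κ : ℝ} (hA : 0 < A) (hlam : 0 ≤ lam) (hκ : (E₀.card : ℝ) * lam ≤ κ * T * g) :
    ∑ K, μ K * (((G K).filter (fun e =>
        ((B.filter (fun b => β K ≤ y b ∧ y b ≤ α e)).card : ℝ) < lam * A)).card : ℝ) ≤
      ∑ K, μ K * (((G' K).filter (fun e =>
        ((B.filter (fun b => β K ≤ y b ∧ y b ≤ α e)).card : ℝ) < A)).card : ℝ) + (η + κ) * g := by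
  -- `φ K e` counts the heights between the bottom of `K` and the axis of `e`. `W K` consists of the
  -- pairs with few heights that have a good partner with many. A pair of `G K` with few heights
  -- outside `W K` has only bad partners and partners with few heights.
  set φ : ι → E → ℝ := fun K e => ((B.filter (fun b => β K ≤ y b ∧ y b ≤ α e)).card : ℝ) with hφ
  set W : ι → Finset E := fun K => (G K).filter (fun e => φ K e < lam * A ∧
    ∃ e' ∈ G' K, good K e e' ∧ A ≤ φ K e') with hWdef
  have hpt : ∀ K, (((G K).filter (fun e => φ K e < lam * A)).card : ℝ) ≤
      (W K).card + (((G' K).filter (fun e => φ K e < A)).card : ℝ) + η * g := by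
    intro K
    obtain ⟨Bd, hBd, hBd'⟩ := hbad K
    set N := (G K).filter (fun e => ∀ e' ∈ G' K, good K e e' → φ K e' < A) with hN
    set D := (G' K).filter (fun e => φ K e < A) with hD
    have h1 : (G K).filter (fun e => φ K e < lam * A) ⊆ W K ∪ N := by
      intro e he
      obtain ⟨he1, he2⟩ := Finset.mem_filter.1 he
      by_cases h : ∃ e' ∈ G' K, good K e e' ∧ A ≤ φ K e'
      · exact Finset.mem_union_left _ (Finset.mem_filter.2 ⟨he1, he2, h⟩)
      · push Not at h
        exact Finset.mem_union_right _ (Finset.mem_filter.2 ⟨he1, h⟩)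
    have h2 : N ×ˢ (G' K \ D) ⊆ Bd := by
      rintro ⟨e, e'⟩ hz
      obtain ⟨hz1, hz2⟩ := Finset.mem_product.1 hz
      obtain ⟨hz3, hz4⟩ := Finset.mem_filter.1 hz1
      obtain ⟨hz5, hz6⟩ := Finset.mem_sdiff.1 hz2
      refine hBd' e hz3 e' hz5 fun hgood => hz6 ?_
      exact Finset.mem_filter.2 ⟨hz5, hz4 e' hz5 hgood⟩
    have h3 : ((N.card * (G' K \ D).card : ℕ) : ℝ) ≤ η * (g * g) := by
      refine le_trans ?_ hBd
      rw [← Finset.card_product]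
      exact_mod_cast Finset.card_le_card h2
    have h4 : ((G' K \ D).card : ℝ) = g - D.card := by
      rw [Finset.card_sdiff_of_subset (Finset.filter_subset _ _),
        Nat.cast_sub (Finset.card_le_card (Finset.filter_subset _ _)), hGc']
    have h5 : (N.card : ℝ) ≤ g := by
      rw [← hGc K]; exact_mod_cast Finset.card_le_card (Finset.filter_subset _ _)
    have h6 : (((G K).filter (fun e => φ K e < lam * A)).card : ℝ) ≤ (W K).card + N.card := by
      exact_mod_cast (Finset.card_le_card h1).trans (Finset.card_union_le _ _)
    have h7 : (N.card : ℝ) ≤ D.card + η * g := by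
      push_cast at h3
      rw [h4] at h3
      have h8 : (0:ℝ) ≤ D.card := by positivity
      have : (N.card : ℝ) * g ≤ (D.card + η * g) * g := by nlinarith
      exact le_of_mul_le_mul_right this hg
    linarith
  have hWE : ∀ e ∈ E₀, ∑ K ∈ Finset.univ.filter (fun K => e ∈ W K), μ K ≤ lam / T := by
    intro e he
    set 𝒲 := Finset.univ.filter (fun K => e ∈ W K) with h𝒲
    rcases 𝒲.eq_empty_or_nonempty with h0 | hne
    · rw [h0]; simp; positivity
    -- For fixed `e`, the member with the lowest bottom has the largest window below the axis, and
    -- even this window holds fewer than `lam * A` heights. Every member of `𝒲` has at least `A`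
    -- heights in it, and one height serves mass at most `1/T`; double counting bounds the mass of
    -- `𝒲` by `lam/T`.
    obtain ⟨K₀, hK₀, hmin⟩ := 𝒲.exists_min_image β hne
    have hW : ∀ K ∈ 𝒲, e ∈ G K ∧ φ K e < lam * A ∧ ∃ e' ∈ G' K, good K e e' ∧ A ≤ φ K e' := by
      intro K hK
      simpa [hWdef, h𝒲] using hK
    set B₀ := B.filter (fun b => β K₀ ≤ y b ∧ y b ≤ α e) with hB₀
    have hB₀c : (B₀.card : ℝ) < lam * A := (hW K₀ hK₀).2.1
    set I : ι → Ω → Prop := fun K b => e ∈ G K ∧ ∃ e' ∈ G' K, good K e e' ∧ β K ≤ y b ∧ y b ≤ α e'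
    have hlow : ∀ K ∈ 𝒲, A ≤ ((B₀.filter (fun b => I K b)).card : ℝ) := by
      intro K hK
      obtain ⟨h1, -, e', he', hgood, hA'⟩ := hW K hK
      refine hA'.trans ?_
      refine Nat.cast_le.2 (Finset.card_le_card fun b hb => ?_)
      obtain ⟨hb1, hb2, hb3⟩ := Finset.mem_filter.1 hb
      refine Finset.mem_filter.2 ⟨Finset.mem_filter.2 ⟨hb1, (hmin K hK).trans hb2,
        hb3.trans (hα K e h1 e' he' hgood)⟩, h1, e', he', hgood, hb2, hb3⟩
    have hdc : A * ∑ K ∈ 𝒲, μ K ≤ lam * A * (1 / T) := by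
      calc A * ∑ K ∈ 𝒲, μ K ≤ ∑ K ∈ 𝒲, ∑ b ∈ B₀.filter (fun b => I K b), μ K := by
            rw [Finset.mul_sum]
            refine Finset.sum_le_sum fun K hK => ?_
            rw [Finset.sum_const, nsmul_eq_mul]
            exact mul_le_mul_of_nonneg_right (hlow K hK) (hμ K)
        _ = ∑ b ∈ B₀, ∑ K ∈ 𝒲.filter (fun K => I K b), μ K := by
            simp only [Finset.sum_filter]
            rw [Finset.sum_comm]
        _ ≤ ∑ b ∈ B₀, 1 / T := by
            refine Finset.sum_le_sum fun b hb => ?_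
            obtain ⟨𝒦, h𝒦, h𝒦'⟩ := hmass e he b (Finset.mem_filter.1 hb).1
            refine le_trans ?_ h𝒦
            refine Finset.sum_le_sum_of_subset_of_nonneg ?_ fun K _ _ => hμ K
            intro K hK
            obtain ⟨h1, e', h2, h3, h4, h5⟩ := (Finset.mem_filter.1 hK).2
            exact h𝒦' K h1 e' h2 h3 h4 h5
        _ = B₀.card * (1 / T) := by rw [Finset.sum_const, nsmul_eq_mul]
        _ ≤ _ := by gcongr
    have : A * ∑ K ∈ 𝒲, μ K ≤ A * (lam / T) := hdc.trans (le_of_eq (by ring))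
    exact le_of_mul_le_mul_left this hA
  have hWsum : ∑ K, μ K * ((W K).card : ℝ) ≤ κ * g := by
    calc ∑ K, μ K * ((W K).card : ℝ) = ∑ K, ∑ e ∈ E₀, if e ∈ W K then μ K else 0 := by
          refine Finset.sum_congr rfl fun K _ => ?_
          rw [← Finset.sum_filter, Finset.sum_const, nsmul_eq_mul, mul_comm]
          congr 3
          ext e
          simp only [Finset.mem_filter]
          exact ⟨fun h => ⟨hGE K (Finset.mem_filter.1 h).1, h⟩, fun h => h.2⟩
      _ = ∑ e ∈ E₀, ∑ K ∈ Finset.univ.filter (fun K => e ∈ W K), μ K := by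
          rw [Finset.sum_comm]
          simp only [Finset.sum_filter]
      _ ≤ ∑ e ∈ E₀, lam / T := Finset.sum_le_sum hWE
      _ = E₀.card * lam / T := by rw [Finset.sum_const, nsmul_eq_mul]; ring
      _ ≤ κ * g := by rw [div_le_iff₀ hT]; linarith
  calc _ ≤ ∑ K, μ K * ((W K).card + (((G' K).filter (fun e => φ K e < A)).card : ℝ) + η * g) :=
        Finset.sum_le_sum fun K _ => mul_le_mul_of_nonneg_left (hpt K) (hμ K)
    _ = ∑ K, μ K * ((W K).card : ℝ) + ∑ K, μ K * (((G' K).filter (fun e => φ K e < A)).card : ℝ) +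
        (∑ K, μ K) * (η * g) := by
        rw [Finset.sum_mul, ← Finset.sum_add_distrib, ← Finset.sum_add_distrib]
        exact Finset.sum_congr rfl fun K _ => by ring
    _ ≤ _ := by rw [hμ1]; linarith

theorem lineVal_extrap {ℓ m : ℝ × ℝ} {a b x : ℝ} (ha : lineVal ℓ a ≤ lineVal m a)
    (hb : lineVal m b ≤ lineVal ℓ b) (hab : a < b) (hx : b ≤ x) : lineVal m x ≤ lineVal ℓ x := by
  rw [lineVal_sub m b x, lineVal_sub ℓ b x]
  have hs : m.1 ≤ ℓ.1 := by
    rw [lineVal_sub m a b, lineVal_sub ℓ a b] at hb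
    by_contra h
    push Not at h
    nlinarith [mul_pos (sub_pos.2 h) (sub_pos.2 hab)]
  nlinarith [mul_nonneg (sub_nonneg.2 hs) (sub_nonneg.2 hx)]

theorem chord_mem {K : Set (ℝ × ℝ)} (hK : Convex ℝ K) {a b : ℝ × ℝ} (ha : a ∈ K) (hb : b ∈ K) {x : ℝ}
    (hab : a.1 < b.1) (h1 : a.1 ≤ x) (h2 : x ≤ b.1) : (x, lineVal (through a b) x) ∈ K :=
  mem_of_chords (z := (x, lineVal (through a b) x)) hK ha hb ha hb h1 h2 h1 h2 (through a b)
    (through a b) (lineVal_through_left _ _).ge (lineVal_through_right hab.ne).ge le_rfl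
    (lineVal_through_left _ _).le (lineVal_through_right hab.ne).le le_rfl

theorem ordConnected_section {K : Set (ℝ × ℝ)} (hK : Convex ℝ K) (x : ℝ) :
    {y : ℝ | (x, y) ∈ K}.OrdConnected :=
  ⟨fun _ h1 _ h2 _ h => mem_of_vertical hK h1 h2 h.1 h.2⟩

/-- Top point of a compact set on a vertical line. -/
theorem exists_top {K : Set (ℝ × ℝ)} (hK : IsCompact K) {x y₀ : ℝ} (h : (x, y₀) ∈ K) :
    ∃ y, (x, y) ∈ K ∧ ∀ y', (x, y') ∈ K → y' ≤ y := by
  have hc : IsCompact (K ∩ {p | p.1 = x}) :=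
    hK.inter_right (isClosed_eq continuous_fst continuous_const)
  obtain ⟨p, ⟨hp, hpx⟩, hmax⟩ := hc.exists_isMaxOn ⟨(x, y₀), h, rfl⟩ continuous_snd.continuousOn
  have hpx' : p.1 = x := hpx
  refine ⟨p.2, by rw [← hpx']; exact hp, fun y' hy' => hmax ⟨hy', rfl⟩⟩

/-- Bottom point of a compact set on a vertical line. -/
theorem exists_bottom {K : Set (ℝ × ℝ)} (hK : IsCompact K) {x y₀ : ℝ} (h : (x, y₀) ∈ K) :
    ∃ y, (x, y) ∈ K ∧ ∀ y', (x, y') ∈ K → y ≤ y' := by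
  have hc : IsCompact (K ∩ {p | p.1 = x}) :=
    hK.inter_right (isClosed_eq continuous_fst continuous_const)
  obtain ⟨p, ⟨hp, hpx⟩, hmin⟩ := hc.exists_isMinOn ⟨(x, y₀), h, rfl⟩ continuous_snd.continuousOn
  have hpx' : p.1 = x := hpx
  refine ⟨p.2, by rw [← hpx']; exact hp, fun y' hy' => hmin ⟨hy', rfl⟩⟩

open Classical in
/-- A family of point sets, rich above a chord in each of `R` consecutive slabs, is pierced by few
points on the walls of the slabs. -/
theorem exists_wall_net {P : Finset (ℝ × ℝ)} (hinj : Set.InjOn Prod.fst (P : Set (ℝ × ℝ))) {R : ℕ}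
    (hR : 0 < R) {ζ : ℕ → ℝ} (hζ : StrictMonoOn ζ (Set.Iic R)) (cls : ℕ → ℝ × ℝ → ℕ)
    (Y : ℕ → Finset (ℝ × ℝ)) {k g τ s : ℕ} (hk : 0 < k) (hg : 2 ≤ g) (hs : 0 < s) {T E₁ η κ lam : ℝ}
    (hT : 0 < T) (hκ0 : 0 ≤ κ) (hlam : 0 < lam) (𝓕 : Finset (Finset (ℝ × ℝ))) (h𝓕 : ∀ S ∈ 𝓕, S ⊆ P)
    (hτ : ∀ S ∈ 𝓕, ∀ x₁ x₂ ℓ m, trap x₁ x₂ ℓ m ⊆ convexHull ℝ (S : Set (ℝ × ℝ)) →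
      (P.filter (· ∈ trap x₁ x₂ ℓ m)).card ≤ τ)
    (hY : ∀ S ∈ 𝓕, ∀ j < R, S.filter (fun p => ζ j < p.1 ∧ p.1 < ζ (j + 1)) ⊆ Y j)
    (himg : ∀ S ∈ 𝓕, ∀ j < R,
      ((S.filter (fun p => ζ j < p.1 ∧ p.1 < ζ (j + 1))).image (cls j)).card ≤ k)
    (hE : ∀ j < R, (((Y j ×ˢ Y j).filter (fun e => cls j e.1 = cls j e.2)).card : ℝ) ≤ E₁)
    (hup : ∀ S ∈ 𝓕, ∃ u v : ℝ × ℝ, u ∈ convexHull ℝ (S : Set (ℝ × ℝ)) ∧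
      v ∈ convexHull ℝ (S : Set (ℝ × ℝ)) ∧ u.1 = ζ 0 ∧ v.1 = ζ R ∧
      (∀ y, (ζ R, y) ∈ convexHull ℝ (S : Set (ℝ × ℝ)) → y ≤ v.2) ∧
      ∀ j < R, k * g + k * g ≤ (S.filter (fun p => (ζ j < p.1 ∧ p.1 < ζ (j + 1)) ∧
        0 < height (through u v) p)).card)
    (hright : ∀ S ∈ 𝓕, s ≤ (S.filter (fun p => ζ R < p.1)).card)
    (hη : (4 * τ * (k * g) : ℝ) ≤ η * (k * (g * g - g) : ℕ))
    (hκ : E₁ * lam ≤ κ * T * (k * (g * g - g) : ℕ)) (hsmall : R * (η + κ) < 1)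
    (hbig : ((P.card * P.card : ℕ) : ℝ) < lam ^ (R - 1) * ((k * g * s : ℕ) : ℝ)) :
    ∃ Q : Finset (ℝ × ℝ), (Q.card : ℝ) ≤ R * (R * T) ∧
      ∀ S ∈ 𝓕, ∃ q ∈ Q, q ∈ convexHull ℝ (S : Set (ℝ × ℝ)) := by
  have hmono : ∀ i j, i ≤ j → j ≤ R → ζ i ≤ ζ j := fun i j hij hj =>
    hζ.monotoneOn (Set.mem_Iic.2 (hij.trans hj)) (Set.mem_Iic.2 hj) hij
  have h0R : ζ 0 < ζ R := hζ (Set.mem_Iic.2 hR.le) (Set.mem_Iic.2 le_rfl) hR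
  rcases exists_piercing_or_measure (ι := 𝓕) R hR
    (fun S j => {y | (ζ j, y) ∈ convexHull ℝ ((S : Finset (ℝ × ℝ)) : Set (ℝ × ℝ))})
    (fun S j => ordConnected_section (convex_convexHull ℝ _) _) T hT with
    ⟨N, hN, hN'⟩ | ⟨μ, hμ0, hμ1, hμ⟩
  · refine ⟨Finset.univ.biUnion (fun j : Fin R => (N j).image (fun y => (ζ j, y))), ?_, ?_⟩
    · have h1 : ((Finset.univ.biUnion (fun j : Fin R => (N j).image (fun y => (ζ j, y)))).card : ℝ) ≤
          ∑ j : Fin R, ((N j).card : ℝ) := by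
        refine (Nat.cast_le.2 Finset.card_biUnion_le).trans ?_
        push_cast
        exact Finset.sum_le_sum fun j _ => Nat.cast_le.2 Finset.card_image_le
      refine h1.trans ((Finset.sum_le_sum fun j _ => hN j).trans ?_)
      simp
    · intro S hS
      obtain ⟨j, z, hz, hzI⟩ := hN' ⟨S, hS⟩
      exact ⟨(ζ j, z), by simp only [Finset.mem_biUnion, Finset.mem_image]
                          exact ⟨j, Finset.mem_univ _, z, hz, rfl⟩, hzI⟩
  -- The measure is refuted by `hind`: averaged over `μ`, all but an `(i + 1) * (η + κ)` share of
  -- the pairs in slab `R - 1 - i` have at least `lam ^ i * A` heights between the bottom of the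
  -- hull on the last wall and their axis. In slab 0 this is more than the `|P|²` heights available.
  exfalso
  have hup' : ∀ S : 𝓕, ∃ u v : ℝ × ℝ, u ∈ convexHull ℝ (S.1 : Set (ℝ × ℝ)) ∧
      v ∈ convexHull ℝ (S.1 : Set (ℝ × ℝ)) ∧ u.1 = ζ 0 ∧ v.1 = ζ R ∧
      (∀ y, (ζ R, y) ∈ convexHull ℝ (S.1 : Set (ℝ × ℝ)) → y ≤ v.2) ∧
      ∀ j < R, k * g + k * g ≤ (S.1.filter (fun p => (ζ j < p.1 ∧ p.1 < ζ (j + 1)) ∧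
        0 < height (through u v) p)).card := fun S => hup S.1 S.2
  choose u v hu hv hu1 hv1 hvtop hUc using hup'
  set K : 𝓕 → Set (ℝ × ℝ) := fun S => convexHull ℝ (S.1 : Set (ℝ × ℝ)) with hKdef
  have hKc : ∀ S, Convex ℝ (K S) := fun S => convex_convexHull ℝ _
  have hSK : ∀ (S : 𝓕), ∀ p ∈ S.1, p ∈ K S := fun S p hp => subset_convexHull ℝ _ hp
  have hβ : ∀ S : 𝓕, ∃ β, (ζ R, β) ∈ K S ∧ ∀ y, (ζ R, y) ∈ K S → β ≤ y := by
    intro S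
    refine exists_bottom (y₀ := (v S).2) ?_ ?_
    · exact (Finset.finite_toSet S.1).isCompact_convexHull ℝ
    · rw [← hv1 S]; exact hv S
  choose β hβK hβmin using hβ
  have hgr : ∀ (S : 𝓕) (j : ℕ), ∃ V G, j < R → (V ⊆ S.1.filter (fun p =>
      (ζ j < p.1 ∧ p.1 < ζ (j + 1)) ∧ 0 < height (through (u S) (v S)) p) ∧ G ⊆ V ×ˢ V ∧
      V.card = k * g ∧ G.card = k * (g * g - g) ∧ ∀ e ∈ G, e.1 ≠ e.2 ∧ cls j e.1 = cls j e.2) := by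
    intro S j
    by_cases hj : j < R
    · obtain ⟨V, h1, G, h2, h3⟩ := exists_groups (S.1.filter (fun p =>
        (ζ j < p.1 ∧ p.1 < ζ (j + 1)) ∧ 0 < height (through (u S) (v S)) p)) (cls j)
        (show 0 < g by omega) (k := k) ((Finset.card_le_card (Finset.image_subset_image (by
          intro p hp
          rw [Finset.mem_filter] at hp ⊢
          exact ⟨hp.1, hp.2.1⟩))).trans (himg S.1 S.2 j hj)) k (hUc S j hj)
      exact ⟨V, G, fun _ => ⟨h1, h2, h3⟩⟩
    · exact ⟨∅, ∅, fun h => absurd h hj⟩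
  choose V G hVG using hgr
  have hVm : ∀ S j, j < R → ∀ p ∈ V S j, p ∈ S.1 ∧ (ζ j < p.1 ∧ p.1 < ζ (j + 1)) ∧
      0 < height (through (u S) (v S)) p := fun S j hj p hp => by
    simpa using (hVG S j hj).1 hp
  have hVP : ∀ S j, j < R → V S j ⊆ P := fun S j hj p hp => h𝓕 S.1 S.2 (hVm S j hj p hp).1
  have hGm : ∀ S j, j < R → ∀ e ∈ G S j, e.1 ∈ V S j ∧ e.2 ∈ V S j ∧ e.1 ≠ e.2 ∧ e.1.1 ≠ e.2.1 ∧
      cls j e.1 = cls j e.2 := by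
    intro S j hj e he
    obtain ⟨h1, h2⟩ := Finset.mem_product.1 ((hVG S j hj).2.1 he)
    have h3 := (hVG S j hj).2.2.2.2 e he
    exact ⟨h1, h2, h3.1, fun h => h3.1 (hinj (hVP S j hj h1) (hVP S j hj h2) h), h3.2⟩
  set gG : ℕ := k * (g * g - g) with hgG
  have hgG0 : 0 < gG := Nat.mul_pos hk (Nat.sub_pos_of_lt (by nlinarith))
  have hgG0' : (0:ℝ) < gG := by exact_mod_cast hgG0
  have hGc : ∀ S j, j < R → ((G S j).card : ℝ) = gG := fun S j hj => by
    rw [(hVG S j hj).2.2.2.1]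
  have hη0 : 0 ≤ η := by
    by_contra h
    push Not at h
    have : (0:ℝ) ≤ 4 * τ * (k * g) := by positivity
    nlinarith
  have hslab : ∀ S j, j < R → ∀ p ∈ V S j, p ∈ K S ∧ (u S).1 ≤ p.1 ∧ p.1 ≤ (v S).1 ∧
      0 ≤ height (through (u S) (v S)) p := by
    intro S j hj p hp
    obtain ⟨h1, h2, h3⟩ := hVm S j hj p hp
    refine ⟨hSK S p h1, ?_, ?_, h3.le⟩
    · rw [hu1]; exact (hmono 0 j (Nat.zero_le _) hj.le).trans h2.1.le
    · rw [hv1]; exact h2.2.le.trans (hmono (j + 1) R hj le_rfl)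
  have haxis : ∀ S j, j < R → ∀ w ∈ K S, (u S).1 ≤ w.1 → w.1 ≤ (v S).1 →
      ((∀ p ∈ V S j, p.1 < w.1) ∨ (∀ p ∈ V S j, w.1 < p.1)) →
      (((G S j).filter (fun e => lineVal (through e.1 e.2) w.1 < w.2)).card : ℝ) ≤
        2 * τ * (k * g) := by
    intro S j hj w hw h1 h2 hside
    have := card_axis_below_le (hKc S) (hτ S.1 S.2) hinj (hu S) (hv S) hw h1 h2
      (by rw [hu1, hv1]; exact h0R) (hVP S j hj) (hslab S j hj) hside (hVG S j hj).2.1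
      (fun e he => (hGm S j hj e he).2.2.1)
    rw [(hVG S j hj).2.2.1] at this
    exact_mod_cast this
  set B : Finset ((ℝ × ℝ) × (ℝ × ℝ)) := (P ×ˢ P) with hB
  set y : (ℝ × ℝ) × (ℝ × ℝ) → ℝ := fun e => lineVal (through e.1 e.2) (ζ R) with hy
  set A : ℝ := ((k * g * s : ℕ) : ℝ) with hAdef
  have hA : 0 < A := by
    have : 0 < k * g * s := Nat.mul_pos (Nat.mul_pos hk (by omega)) hs
    rw [hAdef]
    exact_mod_cast this
  have hind : ∀ i, i < R → ∑ S, μ S * (((G S (R - 1 - i)).filter (fun e =>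
      ((B.filter (fun b => β S ≤ y b ∧ y b ≤ y e)).card : ℝ) < lam ^ i * A)).card : ℝ) ≤
      (i + 1) * (η + κ) * gG := by
    intro i
    induction i with
    | zero =>
      intro _
      have hR1 : R - 1 < R := by omega
      have hpt : ∀ S, (((G S (R - 1)).filter (fun e =>
          ((B.filter (fun b => β S ≤ y b ∧ y b ≤ y e)).card : ℝ) < A)).card : ℝ) ≤ η * gG := by
        intro S
        -- Most axes of the last slab pass weakly above the top `v` of the hull on the last wall.
        -- Below `v` lie the crossings of that wall with all segments from the chosen points of the
        -- slab to the points right of the wall, at least `k * g * s` in number.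
        have h1 := haxis S (R - 1) hR1 (v S) (hv S) (by rw [hu1, hv1]; exact h0R.le) le_rfl
          (Or.inl fun p hp => by
            have := (hVm S (R - 1) hR1 p hp).2.1.2
            rwa [Nat.sub_add_cancel hR, ← hv1 S] at this)
        refine le_trans (le_trans (Nat.cast_le.2 (Finset.card_le_card ?_)) h1) ?_
        · intro e he
          obtain ⟨he1, he2⟩ := Finset.mem_filter.1 he
          refine Finset.mem_filter.2 ⟨he1, ?_⟩
          by_contra hcon
          push Not at hcon
          refine absurd he2 (not_lt.2 ?_)
          have hsub : V S (R - 1) ×ˢ S.1.filter (fun p => ζ R < p.1) ⊆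
              B.filter (fun b => β S ≤ y b ∧ y b ≤ y e) := by
            rintro ⟨a, b⟩ hab
            obtain ⟨ha, hb⟩ := Finset.mem_product.1 hab
            obtain ⟨hb1, hb2⟩ := Finset.mem_filter.1 hb
            obtain ⟨ha1, ha2, -⟩ := hVm S (R - 1) hR1 a ha
            have ha3 : a.1 < ζ R := by rw [Nat.sub_add_cancel hR] at ha2; exact ha2.2
            have hmem : (ζ R, y (a, b)) ∈ K S :=
              chord_mem (hKc S) (hSK S a ha1) (hSK S b hb1) (ha3.trans hb2) ha3.le hb2.le
            refine Finset.mem_filter.2 ⟨Finset.mem_product.2 ⟨h𝓕 S.1 S.2 ha1, h𝓕 S.1 S.2 hb1⟩,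
              hβmin S _ hmem, (hvtop S _ hmem).trans ?_⟩
            rw [hv1] at hcon
            exact hcon
          have hc := Finset.card_le_card hsub
          rw [Finset.card_product, (hVG S (R - 1) hR1).2.2.1] at hc
          have hc' : k * g * s ≤ (B.filter (fun b => β S ≤ y b ∧ y b ≤ y e)).card :=
            le_trans (Nat.mul_le_mul le_rfl (hright S.1 S.2)) hc
          rw [hAdef]
          exact_mod_cast hc'
        · have : (0:ℝ) ≤ 2 * τ * (k * g) := by positivity
          linarith
      simp only [pow_zero, one_mul, Nat.sub_zero, Nat.cast_zero, zero_add]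
      calc _ ≤ ∑ S, μ S * (η * gG) :=
            Finset.sum_le_sum fun S _ => mul_le_mul_of_nonneg_left (hpt S) (hμ0 S)
        _ = η * gG := by rw [← Finset.sum_mul, hμ1, one_mul]
        _ ≤ (η + κ) * gG := by nlinarith
    | succ i ih =>
      intro hi
      have hprev := ih (by omega)
      obtain ⟨j, hj⟩ : ∃ j, j = R - 1 - (i + 1) := ⟨_, rfl⟩
      have hj1 : R - 1 - i = j + 1 := by omega
      rw [← hj]
      rw [hj1] at hprev
      have hjR : j + 1 < R := by omega
      have hjR' : j < R := by omega
      have hord : ∀ S, ∀ q ∈ V S j, ∀ p ∈ V S (j + 1), q.1 < ζ (j + 1) ∧ ζ (j + 1) < p.1 ∧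
          p.1 < ζ R := fun S q hq p hp =>
        ⟨(hVm S j hjR' q hq).2.1.2, (hVm S (j + 1) hjR p hp).2.1.1,
          (hVm S (j + 1) hjR p hp).2.1.2.trans_le (hmono (j + 1 + 1) R hjR le_rfl)⟩
      -- A pair `e` and a pair `e'` of the next slab are good partners if each axis passes weakly
      -- above the first point of the other. Then the axis of `e` is weakly above that of `e'` on
      -- the last wall.
      have hstep := averaging_step μ hμ0 hμ1 β y y B
        ((Y j ×ˢ Y j).filter (fun e => cls j e.1 = cls j e.2)) (fun S => G S j)
        (fun S => G S (j + 1)) ?_ hgG0' (fun S => hGc S j hjR') (fun S => hGc S (j + 1) hjR)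
        (fun _ e e' => e.1.2 ≤ lineVal (through e'.1 e'.2) e.1.1 ∧
          e'.1.2 ≤ lineVal (through e.1 e.2) e'.1.1) ?_ hT ?_ (η := η) ?_
        (A := lam ^ i * A) (lam := lam) (κ := κ) (by positivity) hlam.le ?_
      · have e1 : lam * (lam ^ i * A) = lam ^ (i + 1) * A := by ring
        rw [e1] at hstep
        refine hstep.trans ?_
        push_cast
        linarith
      · intro S e he
        obtain ⟨h1, h2, -, -, h3⟩ := hGm S j hjR' e he
        have hVY : ∀ p ∈ V S j, p ∈ Y j := fun p hp => hY S.1 S.2 j hjR' (by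
          rw [Finset.mem_filter]
          exact ⟨(hVm S j hjR' p hp).1, (hVm S j hjR' p hp).2.1⟩)
        exact Finset.mem_filter.2 ⟨Finset.mem_product.2 ⟨hVY _ h1, hVY _ h2⟩, h3⟩
      · rintro S e he e' he' ⟨g1, g2⟩
        have he2 := (hGm S j hjR' e he).1
        have he3 := (hGm S (j + 1) hjR e' he').1
        obtain ⟨o1, o2, o3⟩ := hord S _ he2 _ he3
        refine lineVal_extrap (a := e.1.1) (b := e'.1.1) ?_ ?_ (o1.trans o2) o3.le
        · rw [lineVal_through_left]; exact g1
        · rw [lineVal_through_left]; exact g2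
      · intro e _ b _
        -- For fixed `e` and `b`, the line from `e.1` to the height of `b` on the last wall meets
        -- the wall between the two slabs in one point, which by `fan_mem` lies in every hull
        -- concerned.
        refine ⟨_, hμ ⟨j + 1, hjR⟩ (lineVal (through e.1 (ζ R, y b)) (ζ (j + 1))), ?_⟩
        rintro S he e' he' ⟨g1, -⟩ b1 b2
        have he2 := (hGm S j hjR' e he).1
        have he3 := (hGm S (j + 1) hjR e' he').1
        obtain ⟨o1, o2, o3⟩ := hord S _ he2 _ he3
        refine Finset.mem_filter.2 ⟨Finset.mem_univ _, ?_⟩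
        exact fan_mem (hKc S) (hslab S j hjR' _ he2).1 (hslab S (j + 1) hjR _ he3).1 (hβK S) o1.le
          o2.le o3.le (by linarith) (lineVal_through_left _ _) g1 b1 b2
      · intro S
        refine ⟨(G S j).biUnion (fun e => ((G S (j + 1)).filter (fun e' =>
              lineVal (through e'.1 e'.2) e.1.1 < e.1.2)).image (fun e' => (e, e'))) ∪
            (G S (j + 1)).biUnion (fun e' => ((G S j).filter (fun e =>
              lineVal (through e.1 e.2) e'.1.1 < e'.1.2)).image (fun e => (e, e'))), ?_, ?_⟩
        swap
        · intro e he e' he' hz2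
          simp only [Finset.mem_union, Finset.mem_biUnion, Finset.mem_image, Finset.mem_filter]
          rw [not_and_or, not_le, not_le] at hz2
          rcases hz2 with h | h
          · exact Or.inl ⟨e, he, e', ⟨he', h⟩, rfl⟩
          · exact Or.inr ⟨e', he', e, ⟨he, h⟩, rfl⟩
        have hb1 : ∀ e ∈ G S j, (((G S (j + 1)).filter (fun e' =>
            lineVal (through e'.1 e'.2) e.1.1 < e.1.2)).card : ℝ) ≤ 2 * τ * (k * g) := by
          intro e he
          have he2 := (hGm S j hjR' e he).1
          obtain ⟨s1, s2, s3, -⟩ := hslab S j hjR' _ he2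
          exact haxis S (j + 1) hjR e.1 s1 s2 s3 (Or.inr fun p hp => by
            have := hord S _ he2 p hp
            linarith)
        have hb2 : ∀ e' ∈ G S (j + 1), (((G S j).filter (fun e =>
            lineVal (through e.1 e.2) e'.1.1 < e'.1.2)).card : ℝ) ≤ 2 * τ * (k * g) := by
          intro e' he'
          have he2 := (hGm S (j + 1) hjR e' he').1
          obtain ⟨s1, s2, s3, -⟩ := hslab S (j + 1) hjR _ he2
          exact haxis S j hjR' e'.1 s1 s2 s3 (Or.inl fun p hp => by
            have := hord S p hp _ he2
            linarith)
        refine (Nat.cast_le.2 (Finset.card_union_le _ _)).trans ?_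
        push_cast
        have hc1 : (((G S j).biUnion (fun e => ((G S (j + 1)).filter (fun e' =>
            lineVal (through e'.1 e'.2) e.1.1 < e.1.2)).image (fun e' => (e, e')))).card : ℝ) ≤
            gG * (2 * τ * (k * g)) := by
          refine (Nat.cast_le.2 Finset.card_biUnion_le).trans ?_
          push_cast
          refine (Finset.sum_le_sum fun e he => (Nat.cast_le.2 Finset.card_image_le).trans
            (hb1 e he)).trans ?_
          rw [Finset.sum_const, nsmul_eq_mul, hGc S j hjR']
        have hc2 : (((G S (j + 1)).biUnion (fun e' => ((G S j).filter (fun e =>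
            lineVal (through e.1 e.2) e'.1.1 < e'.1.2)).image (fun e => (e, e')))).card : ℝ) ≤
            gG * (2 * τ * (k * g)) := by
          refine (Nat.cast_le.2 Finset.card_biUnion_le).trans ?_
          push_cast
          refine (Finset.sum_le_sum fun e he => (Nat.cast_le.2 Finset.card_image_le).trans
            (hb2 e he)).trans ?_
          rw [Finset.sum_const, nsmul_eq_mul, hGc S (j + 1) hjR]
        have hc3 := mul_le_mul_of_nonneg_left hη hgG0'.le
        linarith
      · exact (mul_le_mul_of_nonneg_right (hE j hjR') hlam.le).trans hκ
  have hfin := hind (R - 1) (by omega)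
  have hall : ∀ S, (((G S (R - 1 - (R - 1))).filter (fun e =>
      ((B.filter (fun b => β S ≤ y b ∧ y b ≤ y e)).card : ℝ) < lam ^ (R - 1) * A)).card : ℝ) = gG := by
    intro S
    rw [Finset.filter_true_of_mem, hGc S _ (by omega)]
    intro e _
    refine lt_of_le_of_lt ?_ hbig
    have : (B.filter (fun b => β S ≤ y b ∧ y b ≤ y e)).card ≤ P.card * P.card := by
      rw [← Finset.card_product]; exact Finset.card_le_card (Finset.filter_subset _ _)
    exact_mod_cast this
  simp only [hall] at hfin
  rw [← Finset.sum_mul, hμ1, one_mul] at hfin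
  have hRc : ((R - 1 : ℕ) : ℝ) + 1 = R := by
    rw [Nat.cast_sub hR]; push_cast; ring
  rw [hRc] at hfin
  nlinarith

/-! ### The net for rich sets and the choice of parameters. -/

/-- Conclusion of the iterated partition theorem for given constants. -/
def PartitionProperty (r B : ℕ) (p : ℝ) : Prop :=
  ∀ (t : ℕ) (X : Finset (ℝ × ℝ)), GenPos X → ∀ x₁ x₂ : ℝ, x₁ < x₂ →
    (∀ p ∈ X, x₁ < p.1 ∧ p.1 < x₂) → ∀ Y₀ : ℝ, ∃ (cls : ℝ × ℝ → ℕ) (Z : Finset (ℝ × ℝ)),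
      Z.card ≤ B * (2 * r + 65) ^ t ∧
      (∀ k, ((X \ Z).filter (fun p => cls p = k)).card * r ^ t ≤ X.card) ∧
      ∀ K : Set (ℝ × ℝ), Convex ℝ K → (∀ p ∈ K, |p.2| ≤ Y₀) → (∀ z ∈ Z, z ∉ K) →
        (∃ L ∈ K, L.1 = x₁) → (∃ R ∈ K, R.1 = x₂) → ∀ S ⊆ X \ Z, (∀ p ∈ S, p ∈ K) →
        ((S.image cls).card : ℝ) ≤ ((r : ℝ) ^ p) ^ t

/-- One more factor `r ^ η` absorbs the passage from `2r + 64` to `2r + 65`, so the exceptional sets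
stay almost linear in `r ^ t`. -/
theorem exists_partitionProperty (η : ℝ) (hη : 0 < η) : ∃ r B : ℕ, 2 ≤ r ∧
    (2 * r + 65 : ℝ) ≤ (r : ℝ) ^ (1 + 2 * η) ∧ PartitionProperty r B (1 / 2 + η) := by
  classical
  obtain ⟨r, B, hr, hr', h⟩ := exists_iterated_partition η hη
  have hr0 : (0:ℝ) < r := by positivity
  refine ⟨r, B, hr, ?_, ?_⟩
  · have h1 : (2:ℝ) ≤ (r:ℝ) ^ η := by
      have : (r:ℝ) * 2 ≤ r * (r:ℝ) ^ η := by
        rw [Real.rpow_add hr0, Real.rpow_one] at hr'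
        linarith
      exact le_of_mul_le_mul_left this hr0
    have h2 : (r:ℝ) ^ (1 + 2 * η) = (r:ℝ) ^ (1 + η) * (r:ℝ) ^ η := by
      rw [← Real.rpow_add hr0]; congr 1; ring
    rw [h2]
    nlinarith
  · intro t X hX x₁ x₂ hx hX' Y₀
    obtain ⟨cls, Z, h1, -, h2, h3⟩ := h t X hX x₁ x₂ hx hX' Y₀
    refine ⟨cls, Z, h1, ?_, fun K hK hb hZ hL hR S hS hSK => ?_⟩
    · intro k
      convert h2 k
    · refine le_trans (Nat.cast_le.2 (Finset.card_le_card ?_)) (h3 K hK hb hZ hL hR)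
      refine Finset.image_subset_image fun p hp => ?_
      exact Finset.mem_filter.2 ⟨hS hp, hSK p hp⟩

open Classical in
/-- Pairs of points in a common class are few. -/
theorem card_same_class_le (Y : Finset (ℝ × ℝ)) (cls : ℝ × ℝ → ℕ) {M n : ℕ} (hM : 0 < M)
    (hn : Y.card ≤ n) (h : ∀ k, (Y.filter (fun p => cls p = k)).card * M ≤ n) :
    (((Y ×ˢ Y).filter (fun e => cls e.1 = cls e.2)).card : ℝ) ≤ (n * n : ℝ) / M := by
  rw [le_div_iff₀ (by exact_mod_cast hM)]
  have h1 : (Y ×ˢ Y).filter (fun e => cls e.1 = cls e.2) ⊆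
      Y.biUnion (fun a => (Y.filter (fun p => cls p = cls a)).image (fun b => (a, b))) := by
    rintro ⟨a, b⟩ he
    simp only [Finset.mem_filter, Finset.mem_product] at he
    simp only [Finset.mem_biUnion, Finset.mem_image, Finset.mem_filter]
    exact ⟨a, he.1.1, b, ⟨he.1.2, he.2.symm⟩, rfl⟩
  have h2 : ((Y ×ˢ Y).filter (fun e => cls e.1 = cls e.2)).card * M ≤ n * n := by
    refine (Nat.mul_le_mul_right M ((Finset.card_le_card h1).trans Finset.card_biUnion_le)).trans ?_
    rw [Finset.sum_mul]
    refine (Finset.sum_le_sum (g := fun _ => n) fun a _ =>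
      (Nat.mul_le_mul_right M Finset.card_image_le).trans (h (cls a))).trans ?_
    rw [Finset.sum_const, smul_eq_mul]
    exact Nat.mul_le_mul_right n hn
  exact_mod_cast h2

/-- The sets which have many points right of the last wall, and many points above the chord between
their intersections with the extreme walls in every slab. -/
def RichAbove (ζ : ℕ → ℝ) (R : ℕ) (a b : ℝ) (S : Finset (ℝ × ℝ)) : Prop := by
  classical
  exact (∃ u v : ℝ × ℝ, u ∈ convexHull ℝ (S : Set (ℝ × ℝ)) ∧
      v ∈ convexHull ℝ (S : Set (ℝ × ℝ)) ∧ u.1 = ζ 0 ∧ v.1 = ζ R ∧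
      (∀ y, (ζ R, y) ∈ convexHull ℝ (S : Set (ℝ × ℝ)) → y ≤ v.2) ∧
      ∀ j < R, a ≤ ((S.filter (fun p => (ζ j < p.1 ∧ p.1 < ζ (j + 1)) ∧
        0 < height (through u v) p)).card : ℝ)) ∧
    b ≤ ((S.filter (fun p => ζ R < p.1)).card : ℝ)

-- Three nets are united: one for trapezoids with more than `τ` points, the exceptional points of
-- the partitions of the `R` slabs, and the wall net for the sets whose hulls avoid the first two.
-- These avoidances provide the trapezoid and class bounds that `exists_wall_net` requires.
open Classical in
theorem exists_rich_net {r B : ℕ} {p : ℝ} (hr : 2 ≤ r) (hpart : PartitionProperty r B p)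
    {P : Finset (ℝ × ℝ)} (hP : GenPos P) {R : ℕ} (hR : 0 < R) {ζ : ℕ → ℝ}
    (hζ : StrictMonoOn ζ (Set.Iic R)) {t k g τ s sN kN : ℕ} {T η κ lam δ : ℝ} (hk : 0 < k)
    (hkt : ((r : ℝ) ^ p) ^ t < k + 1) (hg : 2 ≤ g) (hs : 0 < s) (hT : 0 < T) (hκ0 : 0 ≤ κ)
    (hlam : 0 < lam) (hδ : δ * P.card ≤ τ + 1) (hkN : 2 * ((kN : ℝ) + 1) ≤ δ * sN)
    (hsN : 2 * (2 * sN + 1) ^ 12 < 2 ^ kN) (hη : (4 * τ * (k * g) : ℝ) ≤ η * (k * (g * g - g) : ℕ))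
    (hκ : (P.card * P.card : ℝ) / (r ^ t : ℕ) * lam ≤ κ * T * (k * (g * g - g) : ℕ))
    (hsmall : R * (η + κ) < 1)
    (hbig : ((P.card * P.card : ℕ) : ℝ) < lam ^ (R - 1) * ((k * g * s : ℕ) : ℝ)) :
    ∃ Q : Finset (ℝ × ℝ), (Q.card : ℝ) ≤ sN + R * (B * (2 * r + 65) ^ t) + R * (R * T) ∧
      ∀ S ⊆ P, RichAbove ζ R ((k * g + k * g : ℕ) : ℝ) (s : ℝ) S →
        ∃ q ∈ Q, q ∈ convexHull ℝ (S : Set (ℝ × ℝ)) := by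
  have hstep : ∀ j < R, ζ j < ζ (j + 1) := fun j hj =>
    hζ (Set.mem_Iic.2 hj.le) (Set.mem_Iic.2 hj) (Nat.lt_succ_self j)
  have hmono : ∀ i j, i ≤ j → j ≤ R → ζ i ≤ ζ j := fun i j hij hj =>
    hζ.monotoneOn (Set.mem_Iic.2 (hij.trans hj)) (Set.mem_Iic.2 hj) hij
  obtain ⟨N, hNP, hNc, hN⟩ := polyGrowth_traps.exists_net δ sN kN hkN hsN P
  set X : ℕ → Finset (ℝ × ℝ) := fun j => P.filter (fun p => ζ j < p.1 ∧ p.1 < ζ (j + 1)) with hX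
  obtain ⟨Y₀, hY₀⟩ : ∃ Y₀ : ℝ, ∀ p ∈ P, |p.2| ≤ Y₀ :=
    ⟨∑ p ∈ P, |p.2|, fun p hp => Finset.single_le_sum (f := fun p : ℝ × ℝ => |p.2|)
      (fun _ _ => abs_nonneg _) hp⟩
  have hpt : ∀ j, ∃ (cls : ℝ × ℝ → ℕ) (Z : Finset (ℝ × ℝ)), j < R → (
      Z.card ≤ B * (2 * r + 65) ^ t ∧
      (∀ k, ((X j \ Z).filter (fun p => cls p = k)).card * r ^ t ≤ (X j).card) ∧
      ∀ K : Set (ℝ × ℝ), Convex ℝ K → (∀ p ∈ K, |p.2| ≤ Y₀) → (∀ z ∈ Z, z ∉ K) →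
        (∃ L ∈ K, L.1 = ζ j) → (∃ R ∈ K, R.1 = ζ (j + 1)) → ∀ S ⊆ X j \ Z, (∀ p ∈ S, p ∈ K) →
        ((S.image cls).card : ℝ) ≤ ((r : ℝ) ^ p) ^ t) := by
    intro j
    by_cases hj : j < R
    · obtain ⟨cls, Z, h1, h2, h3⟩ := hpart t (X j) (hP.mono (Finset.filter_subset _ _)) (ζ j)
        (ζ (j + 1)) (hstep j hj) (fun p hp => (Finset.mem_filter.1 hp).2) Y₀
      exact ⟨cls, Z, fun _ => ⟨h1, h2, h3⟩⟩
    · exact ⟨fun _ => 0, ∅, fun h => absurd h hj⟩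
  choose cls Z hZ using hpt
  set 𝓕 := P.powerset.filter (fun S => RichAbove ζ R ((k * g + k * g : ℕ) : ℝ) (s : ℝ) S ∧
    (∀ z ∈ N, z ∉ convexHull ℝ (S : Set (ℝ × ℝ))) ∧
    ∀ j < R, ∀ z ∈ Z j, z ∉ convexHull ℝ (S : Set (ℝ × ℝ))) with h𝓕
  have h𝓕m : ∀ S ∈ 𝓕, S ⊆ P ∧ RichAbove ζ R ((k * g + k * g : ℕ) : ℝ) (s : ℝ) S ∧
    (∀ z ∈ N, z ∉ convexHull ℝ (S : Set (ℝ × ℝ))) ∧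
    ∀ j < R, ∀ z ∈ Z j, z ∉ convexHull ℝ (S : Set (ℝ × ℝ)) := fun S hS => by
    simpa [h𝓕] using hS
  have hSY : ∀ S ∈ 𝓕, ∀ j < R, S.filter (fun p => ζ j < p.1 ∧ p.1 < ζ (j + 1)) ⊆ X j \ Z j := by
    intro S hS j hj q hq
    obtain ⟨h1, -, -, h2⟩ := h𝓕m S hS
    obtain ⟨hq1, hq2⟩ := Finset.mem_filter.1 hq
    exact Finset.mem_sdiff.2 ⟨Finset.mem_filter.2 ⟨h1 hq1, hq2⟩,
      fun h => h2 j hj q h (subset_convexHull ℝ _ hq1)⟩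
  have hwall_net := exists_wall_net hP.inj hR hζ cls (fun j => X j \ Z j) (τ := τ)
    (E₁ := (P.card * P.card : ℝ) / (r ^ t : ℕ)) hk hg hs hT hκ0 hlam 𝓕
    (fun S hS => (h𝓕m S hS).1) ?_ hSY ?_ ?_ ?_ ?_ hη hκ hsmall hbig
  · obtain ⟨W, hW, hW'⟩ := hwall_net
    refine ⟨N ∪ (Finset.range R).biUnion Z ∪ W, ?_, ?_⟩
    · have h1 : (N ∪ (Finset.range R).biUnion Z ∪ W).card ≤ N.card +
          ((Finset.range R).biUnion Z).card + W.card :=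
        (Finset.card_union_le _ _).trans (Nat.add_le_add_right (Finset.card_union_le _ _) _)
      have h2 : ((Finset.range R).biUnion Z).card ≤ R * (B * (2 * r + 65) ^ t) := by
        have := Finset.card_biUnion_le_card_mul (Finset.range R) Z (B * (2 * r + 65) ^ t)
          (fun j hj => (hZ j (Finset.mem_range.1 hj)).1)
        simpa using this
      have h3 : ((N ∪ (Finset.range R).biUnion Z ∪ W).card : ℝ) ≤ N.card +
          ((Finset.range R).biUnion Z).card + W.card := by exact_mod_cast h1
      have h4 : (((Finset.range R).biUnion Z).card : ℝ) ≤ R * (B * (2 * r + 65) ^ t) := by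
        exact_mod_cast h2
      have h5 : (N.card : ℝ) ≤ sN := by exact_mod_cast hNc
      linarith
    · intro S hS hrich
      by_cases hSF : S ∈ 𝓕
      · obtain ⟨q, hq, hqS⟩ := hW' S hSF
        exact ⟨q, Finset.mem_union_right _ hq, hqS⟩
      · by_contra hcon
        push Not at hcon
        refine hSF (Finset.mem_filter.2 ⟨Finset.mem_powerset.2 hS, hrich, fun z hz => ?_,
          fun j hj z hz => ?_⟩)
        · exact hcon z (Finset.mem_union_left _ (Finset.mem_union_left _ hz))
        · exact hcon z (Finset.mem_union_left _ (Finset.mem_union_right _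
            (Finset.mem_biUnion.2 ⟨j, Finset.mem_range.2 hj, hz⟩)))
  · intro S hS x₁ x₂ ℓ m hsub
    by_contra hcon
    push Not at hcon
    obtain ⟨a, ha, haR⟩ := hN _ ⟨x₁, x₂, ℓ, m, rfl⟩ (P.filter (· ∈ trap x₁ x₂ ℓ m))
      (Finset.filter_subset _ _) (fun y hy => (Finset.mem_filter.1 hy).2)
      (Finset.card_pos.1 (by omega)) (hδ.trans (by exact_mod_cast hcon))
    exact (h𝓕m S hS).2.2.1 a ha (hsub haR)
  · intro S hS j hj
    obtain ⟨hSP, ⟨⟨u, v, hu, hv, hu1, hv1, -⟩, -⟩, -, hZS⟩ := h𝓕m S hS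
    have huv : u.1 < v.1 := by
      rw [hu1, hv1]; exact hζ (Set.mem_Iic.2 hR.le) (Set.mem_Iic.2 le_rfl) hR
    have hwall : ∀ i ≤ R, ∃ L ∈ convexHull ℝ (S : Set (ℝ × ℝ)), L.1 = ζ i := fun i hi =>
      ⟨_, chord_mem (convex_convexHull ℝ _) hu hv huv (by rw [hu1]; exact hmono 0 i (Nat.zero_le _) hi)
        (by rw [hv1]; exact hmono i R hi le_rfl), rfl⟩
    have hbd : ∀ q ∈ convexHull ℝ (S : Set (ℝ × ℝ)), |q.2| ≤ Y₀ := by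
      have hsub : convexHull ℝ (S : Set (ℝ × ℝ)) ⊆ {q | |q.2| ≤ Y₀} := by
        refine convexHull_min (fun q hq => hY₀ q (hSP hq)) ?_
        have : {q : ℝ × ℝ | |q.2| ≤ Y₀} = (LinearMap.snd ℝ ℝ ℝ) ⁻¹' (Set.Icc (-Y₀) Y₀) := by
          ext q; simp [abs_le]
        rw [this]
        exact (convex_Icc _ _).linear_preimage _
      exact fun q hq => hsub hq
    have := (hZ j hj).2.2 _ (convex_convexHull ℝ (S : Set (ℝ × ℝ))) hbd (hZS j hj) (hwall j hj.le)
      (hwall (j + 1) hj) _ (hSY S hS j hj)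
      (fun q hq => subset_convexHull ℝ _ (Finset.mem_filter.1 hq).1)
    have h2 := this.trans_lt hkt
    have h3 : ((S.filter (fun p => ζ j < p.1 ∧ p.1 < ζ (j + 1))).image (cls j)).card < k + 1 := by
      exact_mod_cast h2
    omega
  · intro j hj
    refine card_same_class_le _ _ (pow_pos (by omega) t) ?_ fun i => ?_
    · exact Finset.card_le_card (Finset.sdiff_subset.trans (Finset.filter_subset _ _))
    · exact ((hZ j hj).2.1 i).trans (Finset.card_le_card (Finset.filter_subset _ _))
  · intro S hS
    obtain ⟨-, ⟨⟨u, v, hu, hv, hu1, hv1, hvt, hc⟩, -⟩, -⟩ := h𝓕m S hS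
    refine ⟨u, v, hu, hv, hu1, hv1, hvt, fun j hj => ?_⟩
    exact Nat.cast_le.1 (hc j hj)
  · intro S hS
    exact Nat.cast_le.1 (h𝓕m S hS).2.1.2

theorem RichAbove.mono {ζ : ℕ → ℝ} {R : ℕ} {a b a' b' : ℝ} {S : Finset (ℝ × ℝ)} (h : RichAbove ζ R a b S)
    (ha : a' ≤ a) (hb : b' ≤ b) : RichAbove ζ R a' b' S := by
  obtain ⟨⟨u, v, h1, h2, h3, h4, h5, h6⟩, h7⟩ := h
  exact ⟨⟨u, v, h1, h2, h3, h4, h5, fun j hj => ha.trans (h6 j hj)⟩, hb.trans h7⟩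

/-- With `M ≈ x ^ (1 + γ/2)` and `k ≈ M ^ (1/2 + γ/32)`, these say in turn: the groups are not too
small; the growth factor is at least about `x ^ (γ/8)`; the trapezoid net is small enough; so are
the exceptional sets of the partition. -/
theorem rich_exponents {γ : ℝ} (hγ : 0 < γ) (hγ1 : γ ≤ 1) :
    γ / 2 + (1 + (1 + γ / 2) * (1 / 2 + γ / 32)) ≤ 3 / 2 + γ ∧
    γ / 8 + 2 ≤ 3 / 2 + (1 + γ / 2) * (1 - (1 / 2 + γ / 32)) ∧
    (1 + (1 + γ / 2) * (1 / 2 + γ / 32)) * (1 + γ / 8) ≤ 3 / 2 + γ ∧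
    (1 + γ / 2) * (1 + 2 * (γ / 32)) ≤ 3 / 2 + γ := by
  have h2 : γ * γ ≤ γ := by nlinarith
  have h3 : γ * (γ * γ) ≤ γ := by nlinarith
  refine ⟨?_, ?_, ?_, ?_⟩ <;> ring_nf <;> nlinarith

set_option maxHeartbeats 1000000 in
/-- The net for rich sets has size `O(x ^ (3/2 + γ))`, where `x` is the inverse density. -/
theorem exists_rich_net_bound (γ : ℝ) (hγ : 0 < γ) (hγ1 : γ ≤ 1) : ∃ R : ℕ, 0 < R ∧
    ∀ c : ℝ, 0 < c → c ≤ 1 → ∃ B x₀ : ℝ, 0 < B ∧ 1 ≤ x₀ ∧ ∀ x : ℝ, x₀ ≤ x →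
      ∀ P : Finset (ℝ × ℝ), GenPos P → x ^ (3 / 2 + γ) ≤ P.card → ∀ ζ : ℕ → ℝ,
        StrictMonoOn ζ (Set.Iic R) → ∃ Q : Finset (ℝ × ℝ), (Q.card : ℝ) ≤ B * x ^ (3 / 2 + γ) ∧
          ∀ S ⊆ P, RichAbove ζ R (c * P.card / x) (c * P.card / x) S →
            ∃ q ∈ Q, q ∈ convexHull ℝ (S : Set (ℝ × ℝ)) := by
  obtain ⟨ex1, ex2, ex3, ex4⟩ := rich_exponents hγ hγ1
  obtain ⟨r, B, hr, hr65, hpart⟩ := exists_partitionProperty (γ / 32) (by positivity)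
  obtain ⟨Cn, hCn, hnet⟩ := exists_net_parameters 12 (γ / 8) (by positivity)
  have hr0 : (0:ℝ) < r := by positivity
  have hr1 : (1:ℝ) < r := by exact_mod_cast (show 1 < r by omega)
  -- `R'` growth steps by `x ^ (γ/8)` give `x ^ 3`, which beats the ratio of order `x ^ 2` between
  -- all `n ^ 2` heights and the initial `k * g * s`.
  obtain ⟨R', hR'⟩ := exists_nat_ge (24 / γ)
  refine ⟨R' + 1, Nat.succ_pos _, fun c hc hc1 => ?_⟩
  set R : ℝ := ((R' + 1 : ℕ) : ℝ) with hRdef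
  have hR1 : 1 ≤ R := by rw [hRdef]; push_cast; linarith [Nat.cast_nonneg (α := ℝ) R']
  clear_value R
  have hR0 : 0 < R := by linarith
  set c5 : ℝ := c ^ 2 / (128 * R) with hc5
  have hc50 : 0 < c5 := by positivity
  clear_value c5
  set p : ℝ := 1 / 2 + γ / 32 with hp
  have hpl : p ≤ 1 := by rw [hp]; linarith
  have hp0 : 0 < p := by rw [hp]; positivity
  clear_value p
  have hev : ∀ᶠ x : ℝ in Filter.atTop, 8 * r / c ≤ x ^ (γ / 2) ∧ 8 / (c5 ^ R' * c ^ 2) < x := by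
    exact ((tendsto_rpow_atTop (by positivity)).eventually_ge_atTop _).and
      (Filter.eventually_gt_atTop _)
  obtain ⟨x₀, hx₀⟩ := Filter.eventually_atTop.1 hev
  set D : ℝ := Cn * (128 * R * r / c) ^ (1 + γ / 8) + R * (B * r ^ 2) + R * R with hD
  have hD0 : 0 < D := by positivity
  clear_value D
  refine ⟨D, max 1 x₀, hD0, le_max_left _ _, fun x hx P hP hn ζ hζ => ?_⟩
  have hx1 : 1 ≤ x := (le_max_left _ _).trans hx
  have hx0 : 0 < x := by linarith
  obtain ⟨hxa, hxb⟩ := hx₀ x ((le_max_right _ _).trans hx)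
  set n : ℝ := (P.card : ℝ) with hndef
  clear_value n
  have hn0 : 0 < n := lt_of_lt_of_le (by positivity) hn
  obtain ⟨t', ht1, ht2⟩ := exists_nat_pow_near (x := x ^ (1 + γ / 2)) (y := (r:ℝ))
    (Real.one_le_rpow hx1 (by positivity)) hr1
  set t := t' + 1 with ht
  set M : ℝ := (r:ℝ) ^ t with hM
  have hM1 : x ^ (1 + γ / 2) ≤ M := ht2.le
  have hM2 : M ≤ r * x ^ (1 + γ / 2) := by
    rw [hM, ht, pow_succ, mul_comm]
    exact mul_le_mul_of_nonneg_left ht1 hr0.le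
  have hM0 : 0 < M := by positivity
  have hM1' : 1 ≤ M := le_trans (Real.one_le_rpow hx1 (by positivity)) hM1
  have hMp : ((r:ℝ) ^ p) ^ t = M ^ p := Real.rpow_pow_comm hr0.le p t
  have hMe : ∀ e : ℝ, ((r:ℝ) ^ e) ^ t = M ^ e := fun e => Real.rpow_pow_comm hr0.le e t
  clear_value M t
  set k : ℕ := ⌊M ^ p⌋₊ with hk
  have hMp1 : 1 ≤ M ^ p := Real.one_le_rpow hM1' hp0.le
  have hk1 : 1 ≤ k := Nat.le_floor (by simpa using hMp1)
  have hkM : (k:ℝ) ≤ M ^ p := Nat.floor_le (by positivity)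
  have hkM' : M ^ p < k + 1 := Nat.lt_floor_add_one _
  clear_value k
  have hk0 : (0:ℝ) < k := by exact_mod_cast hk1
  have hkx : (k:ℝ) ≤ r * x ^ ((1 + γ / 2) * p) := by
    calc (k:ℝ) ≤ M ^ p := hkM
      _ ≤ (r * x ^ (1 + γ / 2)) ^ p := Real.rpow_le_rpow hM0.le hM2 hp0.le
      _ = (r:ℝ) ^ p * x ^ ((1 + γ / 2) * p) := by
          rw [Real.mul_rpow hr0.le (by positivity), ← Real.rpow_mul hx0.le]
      _ ≤ r * x ^ ((1 + γ / 2) * p) := by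
          gcongr
          calc (r:ℝ) ^ p ≤ (r:ℝ) ^ (1:ℝ) := Real.rpow_le_rpow_of_exponent_le hr1.le hpl
            _ = r := Real.rpow_one _
  set G : ℝ := c * n / (2 * x * k) with hG
  have hG4 : 4 ≤ G := by
    rw [hG, le_div_iff₀ (by positivity)]
    have h1 : 2 * x * k ≤ 2 * r * x ^ (1 + (1 + γ / 2) * p) := by
      rw [Real.rpow_add hx0, Real.rpow_one]
      calc 2 * x * (k:ℝ) ≤ 2 * x * (r * x ^ ((1 + γ / 2) * p)) := by gcongr
        _ = _ := by ring
    have h2 : x ^ (γ / 2) * x ^ (1 + (1 + γ / 2) * p) ≤ x ^ (3 / 2 + γ) := by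
      rw [← Real.rpow_add hx0]
      exact Real.rpow_le_rpow_of_exponent_le hx1 ex1
    have h3 : 8 * r ≤ c * x ^ (γ / 2) := by
      rw [div_le_iff₀ hc] at hxa; linarith
    have h4 : 0 < x ^ (1 + (1 + γ / 2) * p) := by positivity
    calc 4 * (2 * x * k) ≤ 8 * r * x ^ (1 + (1 + γ / 2) * p) := by linarith
      _ ≤ c * x ^ (γ / 2) * x ^ (1 + (1 + γ / 2) * p) := mul_le_mul_of_nonneg_right h3 h4.le
      _ ≤ c * n := by rw [mul_assoc]; exact mul_le_mul_of_nonneg_left (h2.trans hn) hc.le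
  have hG0 : 0 < G := by linarith
  clear_value G
  set g : ℕ := ⌊G⌋₊ with hg
  have hgG : (g:ℝ) ≤ G := Nat.floor_le hG0.le
  have hgG' : G < g + 1 := Nat.lt_floor_add_one G
  have hg2 : 2 ≤ g := Nat.le_floor (by push_cast; linarith)
  clear_value g
  have hkG : G * k = c * n / (2 * x) := by rw [hG]; field_simp
  have hgg : ((k * (g * g - g) : ℕ) : ℝ) = k * (g * (g - 1)) := by
    rw [Nat.cast_mul, Nat.cast_sub (Nat.le_mul_self g)]; push_cast; ring
  have hgg' : G ^ 2 / 8 ≤ g * ((g:ℝ) - 1) := by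
    have e1 : G / 2 ≤ g := by linarith
    have e2 : G / 4 ≤ (g:ℝ) - 1 := by linarith
    have := mul_le_mul e1 e2 (by positivity) (by positivity)
    calc G ^ 2 / 8 = G / 2 * (G / 4) := by ring
      _ ≤ _ := this
  set s : ℕ := ⌊c * n / x⌋₊ with hs
  have hs1 : (s:ℝ) ≤ c * n / x := Nat.floor_le (by positivity)
  have hs8 : 8 ≤ c * n / x := by
    have h1 : c * n / x = 2 * (G * k) := by rw [hkG]; field_simp
    have h2 : (1:ℝ) ≤ k := by exact_mod_cast hk1
    have h3 : (4:ℝ) * 1 ≤ G * k := mul_le_mul hG4 h2 zero_le_one hG0.le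
    rw [h1]; linarith
  have hs2 : c * n / (2 * x) ≤ s := by
    have h1 : c * n / (2 * x) = c * n / x / 2 := by field_simp
    have h2 : c * n / x < s + 1 := Nat.lt_floor_add_one _
    rw [h1]; linarith
  have hs0 : 0 < s := Nat.floor_pos.2 (by linarith)
  clear_value s
  -- `τ` is a small share of the group size, making bad partners rare (`η = 1/(4R)`); `δ` below is
  -- chosen so that the trapezoid net takes care of more than `τ` points.
  set τ : ℕ := ⌊((g:ℝ) - 1) / (16 * R)⌋₊ with hτ
  have hτ1 : (τ:ℝ) ≤ ((g:ℝ) - 1) / (16 * R) := Nat.floor_le (div_nonneg (by linarith) (by positivity))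
  have hτ2 : ((g:ℝ) - 1) / (16 * R) < τ + 1 := Nat.lt_floor_add_one _
  clear_value τ
  set δ : ℝ := c / (128 * R * x * k) with hδ
  clear_value δ
  have hδ0 : 0 < δ := by rw [hδ]; positivity
  have hδ1 : δ ≤ 1 := by
    rw [hδ, div_le_one (by positivity)]
    have h1 : (1:ℝ) ≤ k := by exact_mod_cast hk1
    have h3 : 1 ≤ R * x * k :=
      one_le_mul_of_one_le_of_one_le (one_le_mul_of_one_le_of_one_le hR1 hx1) h1
    linarith
  obtain ⟨sN, kN, hsN, hkN, hsN'⟩ := hnet δ hδ0 hδ1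
  set T : ℝ := x ^ ((3:ℝ) / 2) with hT
  clear_value T
  have hT0 : 0 < T := by rw [hT]; positivity
  -- This gives equality in the mass count with `κ = 1/(4R)`, comparing `n ^ 2 / M` same-class pairs
  -- with the `k * g * (g - 1)` pairs of one set. As `k * g ≈ n/x` and `k ≈ √M`, it is about `T * √M
  -- / x ^ 2`.
  set lam : ℝ := T * (k * (g * ((g:ℝ) - 1))) * M / (4 * R * n ^ 2) with hlam
  clear_value lam
  have hgpos : 0 < g * ((g:ℝ) - 1) := lt_of_lt_of_le (by positivity) hgg'
  have hlam0 : 0 < lam := by rw [hlam]; positivity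
  have hlamlow : c5 * x ^ (γ / 8) ≤ lam := by
    have h1 : T * (k * (G ^ 2 / 8)) * M / (4 * R * n ^ 2) ≤ lam := by
      rw [hlam]; gcongr
    have h2 : T * (k * (G ^ 2 / 8)) * M / (4 * R * n ^ 2) = c5 * (T * M / (x ^ 2 * k)) := by
      rw [hG, hc5]; field_simp; ring
    have h3 : x ^ (γ / 8) ≤ T * M / (x ^ 2 * k) := by
      rw [le_div_iff₀ (by positivity)]
      have h4 : (k:ℝ) * x ^ ((1 + γ / 2) * (1 - p)) ≤ M := by
        calc (k:ℝ) * x ^ ((1 + γ / 2) * (1 - p)) ≤ M ^ p * M ^ (1 - p) := by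
              rw [Real.rpow_mul hx0.le]
              have := Real.rpow_le_rpow (by positivity) hM1 (show 0 ≤ 1 - p by linarith)
              gcongr
          _ = M := by rw [← Real.rpow_add hM0]; simp
      have h5 : x ^ (γ / 8) * x ^ (2:ℝ) ≤ T * x ^ ((1 + γ / 2) * (1 - p)) := by
        rw [hT, ← Real.rpow_add hx0, ← Real.rpow_add hx0]
        exact Real.rpow_le_rpow_of_exponent_le hx1 ex2
      rw [Real.rpow_two] at h5
      calc x ^ (γ / 8) * (x ^ 2 * k) = x ^ (γ / 8) * x ^ 2 * k := by ring
        _ ≤ T * x ^ ((1 + γ / 2) * (1 - p)) * k := by gcongr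
        _ = T * (k * x ^ ((1 + γ / 2) * (1 - p))) := by ring
        _ ≤ T * M := by gcongr
    calc c5 * x ^ (γ / 8) ≤ c5 * (T * M / (x ^ 2 * k)) := by gcongr
      _ ≤ lam := h2 ▸ h1
  have hnets := exists_rich_net hr hpart hP (Nat.succ_pos R') hζ (t := t) (k := k) (g := g)
    (τ := τ) (s := s) (sN := sN) (kN := kN) (T := T) (η := 1 / (4 * R)) (κ := 1 / (4 * R))
    (lam := lam) (δ := δ) hk1 (by rw [hMp]; exact hkM') hg2 hs0 hT0 (by positivity)
    hlam0 ?_ hkN hsN' ?_ ?_ ?_ ?_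
  · obtain ⟨Q, hQ, hQ'⟩ := hnets
    rw [← hRdef] at hQ
    refine ⟨Q, hQ.trans ?_, fun S hS hrich => hQ' S hS (hrich.mono ?_ ?_)⟩
    · have e1 : (sN:ℝ) ≤ Cn * (128 * R * r / c) ^ (1 + γ / 8) * x ^ (3 / 2 + γ) := by
        refine hsN.trans ?_
        rw [mul_assoc]
        refine mul_le_mul_of_nonneg_left ?_ hCn.le
        have h1 : δ ^ (-1 - γ / 8) = (δ⁻¹) ^ (1 + γ / 8) := by
          rw [Real.inv_rpow hδ0.le, ← Real.rpow_neg hδ0.le]; congr 1; ring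
        have h2 : δ⁻¹ ≤ 128 * R * r / c * x ^ (1 + (1 + γ / 2) * p) := by
          rw [hδ, inv_div, Real.rpow_add hx0, Real.rpow_one]
          calc 128 * R * x * k / c ≤ 128 * R * x * (r * x ^ ((1 + γ / 2) * p)) / c := by gcongr
            _ = _ := by ring
        rw [h1]
        calc (δ⁻¹) ^ (1 + γ / 8) ≤ (128 * R * r / c * x ^ (1 + (1 + γ / 2) * p)) ^ (1 + γ / 8) :=
              Real.rpow_le_rpow (by positivity) h2 (by positivity)
          _ = (128 * R * r / c) ^ (1 + γ / 8) * x ^ ((1 + (1 + γ / 2) * p) * (1 + γ / 8)) := by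
              rw [Real.mul_rpow (by positivity) (by positivity), ← Real.rpow_mul hx0.le]
          _ ≤ _ := by
              gcongr
      have e2 : (2 * (r:ℝ) + 65) ^ t ≤ r ^ 2 * x ^ (3 / 2 + γ) := by
        calc (2 * (r:ℝ) + 65) ^ t ≤ ((r:ℝ) ^ (1 + 2 * (γ / 32))) ^ t := by gcongr
          _ = M ^ (1 + 2 * (γ / 32)) := hMe _
          _ ≤ (r * x ^ (1 + γ / 2)) ^ (1 + 2 * (γ / 32)) :=
              Real.rpow_le_rpow hM0.le hM2 (by positivity)
          _ = (r:ℝ) ^ (1 + 2 * (γ / 32)) * x ^ ((1 + γ / 2) * (1 + 2 * (γ / 32))) := by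
              rw [Real.mul_rpow hr0.le (by positivity), ← Real.rpow_mul hx0.le]
          _ ≤ (r:ℝ) ^ (2:ℝ) * x ^ (3 / 2 + γ) := by
              gcongr
              · exact hr1.le
              · linarith
          _ = _ := by rw [Real.rpow_two]
      have e3 : T ≤ x ^ (3 / 2 + γ) := hT ▸ Real.rpow_le_rpow_of_exponent_le hx1 (by linarith)
      have e4 : R * (B * (2 * (r:ℝ) + 65) ^ t) ≤ R * (B * (r ^ 2 * x ^ (3 / 2 + γ))) := by gcongr
      have e5 : R * (R * T) ≤ R * (R * x ^ (3 / 2 + γ)) := by gcongr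
      rw [hD]
      calc _ ≤ Cn * (128 * R * r / c) ^ (1 + γ / 8) * x ^ (3 / 2 + γ) +
            R * (B * (r ^ 2 * x ^ (3 / 2 + γ))) + R * (R * x ^ (3 / 2 + γ)) := by linarith
        _ = _ := by ring
    · push_cast
      have h1 : (k:ℝ) * g ≤ c * n / (2 * x) := by
        rw [← hkG, mul_comm]; gcongr
      have h2 : c * n / x = c * n / (2 * x) + c * n / (2 * x) := by field_simp; ring
      rw [h2]; linarith
    · exact hs1
  · rw [← hndef]
    calc δ * n = G / (64 * R) := by rw [hδ, hG]; field_simp; ring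
      _ ≤ ((g:ℝ) - 1) / (16 * R) := by
          rw [div_le_div_iff₀ (by positivity) (by positivity)]
          have : G / 4 * (64 * R) ≤ ((g:ℝ) - 1) * (64 * R) :=
            mul_le_mul_of_nonneg_right (by linarith) (by positivity)
          linarith
      _ ≤ τ + 1 := hτ2.le
  · rw [hgg]
    have h1 : 4 * (τ:ℝ) ≤ 1 / (4 * R) * ((g:ℝ) - 1) := by
      calc 4 * (τ:ℝ) ≤ 4 * (((g:ℝ) - 1) / (16 * R)) := by gcongr
        _ = _ := by field_simp; ring
    calc 4 * (τ:ℝ) * (k * g) ≤ 1 / (4 * R) * ((g:ℝ) - 1) * (k * g) := by gcongr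
      _ = _ := by ring
  · rw [hgg, hlam, ← hndef]
    push_cast
    rw [← hM]
    refine le_of_eq ?_
    field_simp
  · rw [← hRdef]
    have : R * (1 / (4 * R) + 1 / (4 * R)) = 1 / 2 := by field_simp; ring
    rw [this]; norm_num
  · have h1 : (c5 * x ^ (γ / 8)) ^ R' ≤ lam ^ R' := by gcongr
    have h2 : x ^ (3:ℝ) ≤ (x ^ (γ / 8)) ^ R' := by
      rw [← Real.rpow_natCast, ← Real.rpow_mul hx0.le]
      refine Real.rpow_le_rpow_of_exponent_le hx1 ?_
      rw [div_le_iff₀ hγ] at hR'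
      linarith
    have h3 : c * n / (4 * x) ≤ (k * g : ℝ) := by
      have : c * n / (4 * x) = k * (G / 2) := by rw [hG]; field_simp; ring
      rw [this]
      gcongr
      linarith
    have h4 : c * n / (4 * x) * (c * n / (2 * x)) ≤ (k * g : ℝ) * s := by gcongr
    have h5 : 1 < c5 ^ R' * c ^ 2 / 8 * x := by
      rw [div_lt_iff₀ (by positivity)] at hxb
      linarith
    rw [Nat.succ_sub_one]
    push_cast
    rw [← hndef]
    calc n * n = n ^ 2 * 1 := by ring
      _ < n ^ 2 * (c5 ^ R' * c ^ 2 / 8 * x) := by gcongr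
      _ = (c5 ^ R' * x ^ (3:ℝ)) * (c * n / (4 * x) * (c * n / (2 * x))) := by
          rw [show (3:ℝ) = ((3:ℕ):ℝ) by norm_num, Real.rpow_natCast]; field_simp; norm_num
      _ ≤ (c5 ^ R' * (x ^ (γ / 8)) ^ R') * (k * g * s) := by gcongr
      _ = (c5 * x ^ (γ / 8)) ^ R' * (k * g * s) := by rw [mul_pow]
      _ ≤ lam ^ R' * (k * g * s) := by gcongr

/-! ### Vertical slabs and the recursion. -/

/-- A vertical line with prescribed number of points on its left. -/
theorem exists_cut {P : Finset (ℝ × ℝ)} (hinj : Set.InjOn Prod.fst (P : Set (ℝ × ℝ))) (m : ℕ)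
    (hm : m ≤ P.card) : ∃ w : ℝ, (∀ p ∈ P, p.1 ≠ w) ∧ (P.filter (fun p => p.1 < w)).card = m := by
  have hgap : ∀ (F : Finset (ℝ × ℝ)) (a : ℝ), (∀ p ∈ F, a < p.1) → ∃ b, a < b ∧ ∀ p ∈ F, b < p.1 := by
    intro F a hF
    rcases F.eq_empty_or_nonempty with rfl | hne
    · exact ⟨a + 1, by linarith, by simp⟩
    · obtain ⟨q, hq, hmin⟩ := F.exists_min_image Prod.fst hne
      have := hF q hq
      exact ⟨(a + q.1) / 2, by linarith, fun p hp => by linarith [hmin p hp]⟩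
  induction m with
  | zero =>
    obtain ⟨a, ha⟩ : ∃ a : ℝ, ∀ p ∈ P, a < p.1 := by
      refine ⟨-(∑ p ∈ P, |p.1|) - 1, fun p hp => ?_⟩
      have h1 := Finset.single_le_sum (f := fun p : ℝ × ℝ => |p.1|) (fun _ _ => abs_nonneg _) hp
      have h2 := neg_abs_le p.1
      linarith
    refine ⟨a, fun p hp => (ha p hp).ne', ?_⟩
    rw [Finset.card_eq_zero, Finset.filter_eq_empty_iff]
    exact fun p hp => not_lt.2 (ha p hp).le
  | succ m ih =>
    obtain ⟨w, hw, hc⟩ := ih (by omega)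
    have hne : (P.filter (fun p => ¬ p.1 < w)).Nonempty := by
      have := Finset.card_filter_add_card_filter_not (s := P) (fun p => p.1 < w)
      exact Finset.card_pos.1 (by omega)
    obtain ⟨q, hq, hmin⟩ := Finset.exists_min_image _ Prod.fst hne
    obtain ⟨hqP, hqw⟩ := Finset.mem_filter.1 hq
    obtain ⟨b, hb, hb'⟩ := hgap (P.filter (fun p => q.1 < p.1)) q.1
      (fun p hp => (Finset.mem_filter.1 hp).2)
    have hcase : ∀ p ∈ P, p.1 < w ∨ p = q ∨ q.1 < p.1 := by
      intro p hp
      by_cases h : p.1 < w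
      · exact Or.inl h
      · rcases (hmin p (Finset.mem_filter.2 ⟨hp, h⟩)).lt_or_eq with h' | h'
        · exact Or.inr (Or.inr h')
        · exact Or.inr (Or.inl (hinj hp hqP h'.symm))
    have hiff : ∀ p ∈ P, p.1 < b ↔ p.1 < w ∨ p = q := by
      intro p hp
      rcases hcase p hp with h | rfl | h
      · exact iff_of_true (by linarith [not_lt.1 hqw]) (Or.inl h)
      · exact iff_of_true hb (Or.inr rfl)
      · refine iff_of_false (not_lt.2 (hb' p (Finset.mem_filter.2 ⟨hp, h⟩)).le) ?_
        rintro (h' | rfl)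
        · linarith [not_lt.1 hqw]
        · exact lt_irrefl _ h
    refine ⟨b, fun p hp => ?_, ?_⟩
    · by_cases h : q.1 < p.1
      · exact (hb' p (Finset.mem_filter.2 ⟨hp, h⟩)).ne'
      · exact ne_of_lt (by linarith [not_lt.1 h])
    · have : P.filter (fun p => p.1 < b) = insert q (P.filter (fun p => p.1 < w)) := by
        ext p
        simp only [Finset.mem_filter, Finset.mem_insert]
        constructor
        · rintro ⟨h1, h2⟩
          rcases (hiff p h1).1 h2 with h | h
          · exact Or.inr ⟨h1, h⟩
          · exact Or.inl h
        · rintro (rfl | ⟨h1, h2⟩)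
          · exact ⟨hqP, hb⟩
          · exact ⟨h1, (hiff p h1).2 (Or.inl h2)⟩
      have hnot : q ∉ P.filter (fun p => p.1 < w) := fun h => hqw (Finset.mem_filter.1 h).2
      rw [this, Finset.card_insert_of_notMem hnot, hc]

/-- Balanced vertical slabs. -/
theorem exists_walls {P : Finset (ℝ × ℝ)} (hinj : Set.InjOn Prod.fst (P : Set (ℝ × ℝ))) {m : ℕ}
    (hm : 0 < m) (hmP : m ≤ P.card) : ∃ w : ℕ → ℝ, StrictMonoOn w (Set.Iic m) ∧
      (∀ p ∈ P, ∃ i < m, w i < p.1 ∧ p.1 < w (i + 1)) ∧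
      ∀ i < m, (P.filter (fun p => w i < p.1 ∧ p.1 < w (i + 1))).card * m ≤ 2 * P.card := by
  set n := P.card with hn
  -- Wall `i` has `⌊i n / m⌋` points on its left. Because `m ≤ n` these numbers increase strictly,
  -- and consecutive ones differ by less than `n/m + 1 ≤ 2n/m`.
  have hcut : ∀ i, ∃ w : ℝ, i ≤ m →
      ((∀ p ∈ P, p.1 ≠ w) ∧ (P.filter (fun p => p.1 < w)).card = i * n / m) := by
    intro i
    by_cases hi : i ≤ m
    · obtain ⟨w, hw⟩ := exists_cut hinj (i * n / m) (Nat.div_le_of_le_mul (by nlinarith))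
      exact ⟨w, fun _ => hw⟩
    · exact ⟨0, fun h => absurd h hi⟩
  choose w hw using hcut
  refine ⟨w, ?_, ?_, ?_⟩
  · intro i hi j hj hij
    by_contra hcon
    push Not at hcon
    have h1 : (P.filter (fun p => p.1 < w j)).card ≤ (P.filter (fun p => p.1 < w i)).card := by
      refine Finset.card_le_card fun p hp => ?_
      rw [Finset.mem_filter] at hp ⊢
      exact ⟨hp.1, hp.2.trans_le hcon⟩
    rw [(hw i hi).2, (hw j hj).2] at h1
    have h2 : i * n + m ≤ j * n := by
      have : (i + 1) * n ≤ j * n := Nat.mul_le_mul_right n hij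
      nlinarith
    have h3 : (i * n + m) / m ≤ j * n / m := Nat.div_le_div_right h2
    rw [Nat.add_div_right _ hm] at h3
    omega
  · intro p hp
    have hlast : p.1 < w m := by
      have h1 := (hw m le_rfl).2
      rw [Nat.mul_div_cancel_left _ hm, hn] at h1
      have := Finset.filter_eq_self.1 (Finset.eq_of_subset_of_card_le (Finset.filter_subset _ _) h1.ge)
      exact this p hp
    have hfirst : ¬ p.1 < w 0 := by
      have h1 := (hw 0 (Nat.zero_le _)).2
      rw [Nat.zero_mul, Nat.zero_div, Finset.card_eq_zero, Finset.filter_eq_empty_iff] at h1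
      exact h1 hp
    have hex : ∃ j, p.1 < w j := ⟨m, hlast⟩
    classical
    have hj := Nat.find_spec hex
    have hjm : Nat.find hex ≤ m := Nat.find_min' hex hlast
    have hj0 : Nat.find hex ≠ 0 := fun h => hfirst (h ▸ hj)
    obtain ⟨i, hi⟩ := Nat.exists_eq_succ_of_ne_zero hj0
    have hi' : ¬ p.1 < w i := Nat.find_min hex (by omega)
    rw [hi] at hj
    refine ⟨i, by omega, lt_of_le_of_ne (not_lt.1 hi') ((hw i (by omega)).1 p hp).symm, hj⟩
  · intro i hi
    have h1 : (P.filter (fun p => w i < p.1 ∧ p.1 < w (i + 1))).card +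
        (P.filter (fun p => p.1 < w i)).card ≤ (P.filter (fun p => p.1 < w (i + 1))).card ∨
        w (i + 1) ≤ w i := by
      rcases lt_or_ge (w i) (w (i + 1)) with h | h
      · left
        rw [← Finset.card_union_of_disjoint]
        · refine Finset.card_le_card fun p hp => ?_
          simp only [Finset.mem_union, Finset.mem_filter] at hp ⊢
          rcases hp with hp | hp
          · exact ⟨hp.1, hp.2.2⟩
          · exact ⟨hp.1, hp.2.trans h⟩
        · rw [Finset.disjoint_left]
          intro p hp hp'
          exact lt_asymm (Finset.mem_filter.1 hp).2.1 (Finset.mem_filter.1 hp').2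
      · exact Or.inr h
    rcases h1 with h1 | h1
    · rw [(hw i hi.le).2, (hw (i + 1) hi).2] at h1
      have h2 := Nat.div_mul_le_self ((i + 1) * n) m
      have h3 := Nat.lt_div_mul_add hm (a := i * n)
      have h4 := Nat.mul_le_mul_right m h1
      rw [add_mul] at h4
      have h5 : (i + 1) * n = i * n + n := by ring
      omega
    · have : P.filter (fun p => w i < p.1 ∧ p.1 < w (i + 1)) = ∅ := by
        rw [Finset.filter_eq_empty_iff]
        rintro p - ⟨h2, h3⟩
        linarith
      rw [this]; simp

/-- Every finite set in general position has a weak net of size at most `N` for the density `1/x`. -/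
def NetBound (x N : ℝ) : Prop :=
  ∀ P : Finset (ℝ × ℝ), GenPos P → P.Nonempty → ∃ Q : Finset (ℝ × ℝ), (Q.card : ℝ) ≤ N ∧
    ∀ S ⊆ P, (P.card : ℝ) ≤ x * S.card → ∃ q ∈ Q, q ∈ convexHull ℝ (S : Set (ℝ × ℝ))

theorem netBound_of_lt_one {x N : ℝ} (hx : x < 1) (hN : 0 ≤ N) : NetBound x N := by
  intro P _ hne
  refine ⟨∅, by simpa using hN, fun S hS h => ?_⟩
  exfalso
  have h1 : (S.card : ℝ) ≤ P.card := by exact_mod_cast Finset.card_le_card hS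
  have h2 : (0:ℝ) < P.card := by exact_mod_cast hne.card_pos
  rcases (Nat.cast_nonneg (α := ℝ) S.card).eq_or_lt with h3 | h3
  · rw [← h3] at h; linarith
  · have := mul_lt_mul_of_pos_right hx h3
    linarith

open Classical in
/-- Splitting into slabs: a heavy set is pierced by a net of one of the slabs, or it is heavy in
many slabs. -/
theorem exists_slab_net {m k : ℕ} (hm : 0 < m) (hk : 0 < k) {x N : ℝ} (hx : 0 < x) (hN : 0 ≤ N)
    (hrec : NetBound (4 * k / m * x) N) {P : Finset (ℝ × ℝ)} (hP : GenPos P) (hne : P.Nonempty)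
    (hmP : m ≤ P.card) : ∃ w : ℕ → ℝ, StrictMonoOn w (Set.Iic m) ∧ ∃ Q : Finset (ℝ × ℝ),
      (Q.card : ℝ) ≤ m * N ∧ ∀ S ⊆ P, (P.card : ℝ) ≤ x * S.card →
        (∃ q ∈ Q, q ∈ convexHull ℝ (S : Set (ℝ × ℝ))) ∨
        k ≤ ((Finset.range m).filter (fun i => (P.card : ℝ) / (2 * x * m) ≤
          (S.filter (fun p => w i < p.1 ∧ p.1 < w (i + 1))).card)).card := by
  obtain ⟨w, hw, hcov, hbal⟩ := exists_walls hP.inj hm hmP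
  have hm0 : (0:ℝ) < m := by exact_mod_cast hm
  have hk0 : (0:ℝ) < k := by exact_mod_cast hk
  have hn0 : (0:ℝ) < P.card := by exact_mod_cast hne.card_pos
  have hnet : ∀ i : ℕ, ∃ Q : Finset (ℝ × ℝ), (Q.card : ℝ) ≤ N ∧
      ∀ S ⊆ P.filter (fun p => w i < p.1 ∧ p.1 < w (i + 1)), S.Nonempty →
        ((P.filter (fun p => w i < p.1 ∧ p.1 < w (i + 1))).card : ℝ) ≤ 4 * k / m * x * S.card →
        ∃ q ∈ Q, q ∈ convexHull ℝ (S : Set (ℝ × ℝ)) := by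
    intro i
    rcases (P.filter (fun p => w i < p.1 ∧ p.1 < w (i + 1))).eq_empty_or_nonempty with h | h
    · refine ⟨∅, by simpa using hN, fun S hS hSne _ => ?_⟩
      rw [h, Finset.subset_empty] at hS
      simp [hS] at hSne
    · obtain ⟨Q, hQ, hQ'⟩ := hrec _ (hP.mono (Finset.filter_subset _ _)) h
      exact ⟨Q, hQ, fun S hS _ hc => hQ' S hS hc⟩
  choose Q hQ hQ' using hnet
  refine ⟨w, hw, (Finset.range m).biUnion Q, ?_, fun S hS hc => ?_⟩
  · refine (Nat.cast_le.2 Finset.card_biUnion_le).trans ?_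
    push_cast
    refine (Finset.sum_le_sum fun i _ => hQ i).trans ?_
    simp
  · by_cases hpierce : ∃ q ∈ (Finset.range m).biUnion Q, q ∈ convexHull ℝ (S : Set (ℝ × ℝ))
    · exact Or.inl hpierce
    right
    by_contra hcon
    push Not at hcon
    set n : ℝ := (P.card : ℝ)
    set s : ℕ → Finset (ℝ × ℝ) := fun i => S.filter (fun p => w i < p.1 ∧ p.1 < w (i + 1)) with hs
    set U := (Finset.range m).filter (fun i => n / (2 * x * m) ≤ ((s i).card : ℝ)) with hU
    -- As the slab nets miss the hull, each slab holds fewer than `n/(2xk)` points of `S`. Fewer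
    -- than `k` slabs above the threshold contribute at most `n/(2x)`, and the thresholds of all `m`
    -- slabs add up to `n/(2x)`; together this is too little for `n/x ≤ |S|`.
    have hsmall : ∀ i < m, ((s i).card : ℝ) < n / (2 * x * k) := by
      intro i hi
      by_contra hbig
      push Not at hbig
      have hpos : 0 < n / (2 * x * k) := by positivity
      have hsne : (s i).Nonempty := by
        rw [← Finset.card_pos]
        have : (0:ℝ) < (s i).card := hpos.trans_le hbig
        exact_mod_cast this
      obtain ⟨q, hq, hqS⟩ := hQ' i (s i) (Finset.filter_subset_filter _ hS) hsne (by
        have h1 : ((P.filter (fun p => w i < p.1 ∧ p.1 < w (i + 1))).card : ℝ) * m ≤ 2 * n := by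
          have := hbal i hi
          have h := (Nat.cast_le (α := ℝ)).2 this
          push_cast at h
          exact h
        have h2 : ((P.filter (fun p => w i < p.1 ∧ p.1 < w (i + 1))).card : ℝ) ≤ 2 * n / m := by
          rwa [le_div_iff₀ hm0]
        refine h2.trans ?_
        calc 2 * n / m = 4 * k / m * x * (n / (2 * x * k)) := by field_simp; ring
          _ ≤ 4 * k / m * x * (s i).card := by gcongr)
      exact hpierce ⟨q, Finset.mem_biUnion.2 ⟨i, Finset.mem_range.2 hi, hq⟩,
        convexHull_mono (by exact_mod_cast Finset.filter_subset _ S) hqS⟩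
    have hcard : (S.card : ℝ) ≤ ∑ i ∈ Finset.range m, ((s i).card : ℝ) := by
      have : S ⊆ (Finset.range m).biUnion s := by
        intro p hp
        obtain ⟨i, hi, h⟩ := hcov p (hS hp)
        exact Finset.mem_biUnion.2 ⟨i, Finset.mem_range.2 hi, Finset.mem_filter.2 ⟨hp, h⟩⟩
      have := (Finset.card_le_card this).trans Finset.card_biUnion_le
      exact_mod_cast this
    have hlt : ∑ i ∈ Finset.range m, ((s i).card : ℝ) <
        ∑ i ∈ Finset.range m, (n / (2 * x * m) + if i ∈ U then n / (2 * x * k) else 0) := by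
      refine Finset.sum_lt_sum_of_nonempty ⟨0, Finset.mem_range.2 hm⟩ fun i hi => ?_
      have hpos : 0 < n / (2 * x * m) := by positivity
      split_ifs with h
      · linarith [hsmall i (Finset.mem_range.1 hi)]
      · have : ¬ n / (2 * x * m) ≤ ((s i).card : ℝ) := fun h' => h (Finset.mem_filter.2 ⟨hi, h'⟩)
        linarith
    rw [Finset.sum_add_distrib, Finset.sum_const, Finset.card_range, nsmul_eq_mul,
      ← Finset.sum_filter, Finset.sum_const, nsmul_eq_mul,
      Finset.filter_mem_eq_inter, Finset.inter_eq_right.2 (Finset.filter_subset _ _)] at hlt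
    have h1 : (m:ℝ) * (n / (2 * x * m)) = n / (2 * x) := by field_simp
    have h2 : (U.card : ℝ) * (n / (2 * x * k)) ≤ n / (2 * x) := by
      have : (U.card : ℝ) ≤ k := by exact_mod_cast hcon.le
      calc (U.card : ℝ) * (n / (2 * x * k)) ≤ k * (n / (2 * x * k)) := by gcongr
        _ = n / (2 * x) := by field_simp
    have h3 : n / (2 * x) + n / (2 * x) = n / x := by field_simp; ring
    have h4 : n / x ≤ S.card := by rw [div_le_iff₀ hx]; linarith
    linarith

theorem exists_mem_of_card_le {P S : Finset (ℝ × ℝ)} (hne : P.Nonempty) (hS : S ⊆ P) {x : ℝ}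
    (h : (P.card : ℝ) ≤ x * S.card) : ∃ q ∈ P, q ∈ convexHull ℝ (S : Set (ℝ × ℝ)) := by
  have hSne : S.Nonempty := by
    by_contra hcon
    rw [Finset.not_nonempty_iff_eq_empty] at hcon
    have : (0:ℝ) < P.card := by exact_mod_cast hne.card_pos
    rw [hcon] at h
    simp at h
    simp [h] at hne
  obtain ⟨q, hq⟩ := hSne
  exact ⟨q, hS hq, subset_convexHull ℝ _ hq⟩

open Classical in
/-- Weak nets of size depending only on the density exist. -/
theorem exists_netBound (k : ℕ) : ∃ N : ℝ, 0 ≤ N ∧ NetBound (2 ^ k / 2) N := by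
  induction k with
  | zero => exact ⟨0, le_rfl, netBound_of_lt_one (by norm_num) le_rfl⟩
  | succ k ih =>
    obtain ⟨N, hN, hrec⟩ := ih
    set x : ℝ := 2 ^ (k + 1) / 2 with hx
    have hx0 : 0 < x := by positivity
    refine ⟨16 + (16 * N + 17 * (32 * x) ^ 2), by positivity, fun P hP hne => ?_⟩
    rcases lt_or_ge P.card 16 with hlt | hge
    · refine ⟨P, ?_, fun S hS h => exists_mem_of_card_le hne hS h⟩
      have h1 : (P.card : ℝ) ≤ 16 := by exact_mod_cast hlt.le
      have h2 : 0 ≤ 16 * N + 17 * (32 * x) ^ 2 := by positivity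
      linarith
    -- With 16 slabs and `k = 2` the recursive parameter is exactly `x/2`. A set heavy in two slabs
    -- contains `a ^ 2` pairs whose segments cross a common wall, so its section there is a heavy
    -- interval among the `n ^ 2` heights of all pairs. This crude bound only starts the main
    -- recursion.
    have hrec' : NetBound (4 * (2:ℕ) / (16:ℕ) * x) N := by
      convert hrec using 1
      rw [hx, pow_succ]; push_cast; ring
    obtain ⟨w, hw, Q, hQ, hQ'⟩ := exists_slab_net (m := 16) (k := 2) (by norm_num) (by norm_num) hx0
      hN hrec' hP hne hge
    have hn0 : (0:ℝ) < P.card := by exact_mod_cast hne.card_pos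
    set a : ℝ := (P.card : ℝ) / (2 * x * (16:ℕ)) with ha
    have ha0 : 0 < a := by rw [ha]; positivity
    have hst := fun i : ℕ => exists_stabbing (P ×ˢ P) (fun e => lineVal (through e.1 e.2) (w i))
      (fun _ => 1) (fun _ _ => zero_le_one) (a ^ 2) (by positivity)
    choose M hM hM' using hst
    refine ⟨Q ∪ (Finset.range 17).biUnion (fun i => (M i).image (fun y => (w i, y))), ?_, ?_⟩
    · have h1 : (((Finset.range 17).biUnion (fun i => (M i).image (fun y => (w i, y)))).card : ℝ) ≤
          17 * (32 * x) ^ 2 := by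
        refine (Nat.cast_le.2 Finset.card_biUnion_le).trans ?_
        push_cast
        calc _ ≤ ∑ _i ∈ Finset.range 17, (32 * x) ^ 2 := by
              refine Finset.sum_le_sum fun i _ => (Nat.cast_le.2 Finset.card_image_le).trans
                ((hM i).trans (le_of_eq ?_))
              rw [Finset.sum_const, Finset.card_product, nsmul_eq_mul, ha]
              push_cast
              field_simp
              ring
          _ = _ := by simp
      have h2 := Nat.cast_le (α := ℝ).2 (Finset.card_union_le Q
        ((Finset.range 17).biUnion (fun i => (M i).image (fun y => (w i, y)))))
      push_cast at h2 hQ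
      linarith
    · intro S hS h
      rcases hQ' S hS h with ⟨q, hq, hqS⟩ | hU
      · exact ⟨q, Finset.mem_union_left _ hq, hqS⟩
      obtain ⟨i, j, hi, hj, hij⟩ := Finset.one_lt_card_iff.1 (show 1 < _ from hU)
      have key : ∀ i j, i < j → j < 16 →
          a ≤ ((S.filter (fun p => w i < p.1 ∧ p.1 < w (i + 1))).card : ℝ) →
          a ≤ ((S.filter (fun p => w j < p.1 ∧ p.1 < w (j + 1))).card : ℝ) →
          ∃ q ∈ (Finset.range 17).biUnion (fun i => (M i).image (fun y => (w i, y))),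
            q ∈ convexHull ℝ (S : Set (ℝ × ℝ)) := by
        intro i j hij hj hi1 hj1
        have hwij : w (i + 1) ≤ w j := hw.monotoneOn (Set.mem_Iic.2 (by omega))
          (Set.mem_Iic.2 (by omega)) hij
        have hcK := convex_convexHull ℝ (S : Set (ℝ × ℝ))
        obtain ⟨z, hz, hzI⟩ := hM' j _ (ordConnected_section hcK (w j)) (by
          rw [Finset.sum_const, nsmul_eq_mul, mul_one]
          have h1 : a ^ 2 ≤ ((S.filter (fun p => w i < p.1 ∧ p.1 < w (i + 1)) ×ˢ
              S.filter (fun p => w j < p.1 ∧ p.1 < w (j + 1))).card : ℝ) := by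
            rw [Finset.card_product, Nat.cast_mul, pow_two]
            exact mul_le_mul hi1 hj1 ha0.le (Nat.cast_nonneg _)
          refine h1.trans (Nat.cast_le.2 (Finset.card_le_card ?_))
          rintro ⟨p, q⟩ hpq
          simp only [Finset.mem_product, Finset.mem_filter] at hpq
          obtain ⟨⟨hp, hp1, hp2⟩, hq, hq1, hq2⟩ := hpq
          refine Finset.mem_filter.2 ⟨Finset.mem_product.2 ⟨hS hp, hS hq⟩, ?_⟩
          exact chord_mem hcK (subset_convexHull ℝ _ hp) (subset_convexHull ℝ _ hq)
            (by linarith) (by linarith) (by linarith))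
        refine ⟨(w j, z), Finset.mem_biUnion.2 ⟨j, Finset.mem_range.2 (by omega), ?_⟩, hzI⟩
        exact Finset.mem_image.2 ⟨z, hz, rfl⟩
      rw [Finset.mem_filter, Finset.mem_range] at hi hj
      have hres : ∃ q ∈ (Finset.range 17).biUnion (fun i => (M i).image (fun y => (w i, y))),
            q ∈ convexHull ℝ (S : Set (ℝ × ℝ)) := by
        rcases lt_or_gt_of_ne hij with hlt | hlt
        · exact key i j hlt hj.1 hi.2 hj.2
        · exact key j i hlt hi.1 hj.2 hi.2
      obtain ⟨q, hq, hqS⟩ := hres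
      exact ⟨q, Finset.mem_union_right _ hq, hqS⟩

open Classical in
/-- Choosing `R` of the slabs and merging yields a pattern for which the set is rich. -/
theorem exists_richAbove {w : ℕ → ℝ} {m : ℕ} (hw : StrictMonoOn w (Set.Iic m)) {S : Finset (ℝ × ℝ)}
    {i₁ i₂ : ℕ} (hi₂ : i₂ ≤ m) {𝒰 : Finset ℕ} (h𝒰 : ∀ i ∈ 𝒰, i₁ < i ∧ i < i₂) {R : ℕ} (hR : 0 < R)
    (hcard : R ≤ 𝒰.card) {u v : ℝ × ℝ} (hu : u ∈ convexHull ℝ (S : Set (ℝ × ℝ)))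
    (hv : v ∈ convexHull ℝ (S : Set (ℝ × ℝ))) (hu1 : u.1 = w (i₁ + 1)) (hv1 : v.1 = w i₂)
    (htop : ∀ y, (w i₂, y) ∈ convexHull ℝ (S : Set (ℝ × ℝ)) → y ≤ v.2) {a b : ℝ}
    (ha : ∀ i ∈ 𝒰, a ≤ ((S.filter (fun p => (w i < p.1 ∧ p.1 < w (i + 1)) ∧
      0 < height (through u v) p)).card : ℝ))
    (hb : b ≤ ((S.filter (fun p => w i₂ < p.1)).card : ℝ)) :
    ∃ σ : ℕ → ℕ, (∀ j, σ j ≤ m) ∧ (∀ j, σ j = σ (min j R)) ∧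
      StrictMonoOn (fun j => w (σ j)) (Set.Iic R) ∧ RichAbove (fun j => w (σ j)) R a b S := by
  obtain ⟨e, he, hemono⟩ : ∃ e : ℕ → ℕ, (∀ j < R, e j ∈ 𝒰) ∧ ∀ j, j + 1 < R → e j < e (j + 1) := by
    obtain ⟨𝒱, h𝒱, hc⟩ := Finset.exists_subset_card_eq hcard
    refine ⟨fun j => if h : j < R then 𝒱.orderEmbOfFin hc ⟨j, h⟩ else 0, fun j hj => ?_,
      fun j hj => ?_⟩
    · simp only [hj, dif_pos]
      exact h𝒱 (Finset.orderEmbOfFin_mem _ _ _)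
    · have hj' : j < R := by omega
      simp only [hj, hj', dif_pos]
      exact (𝒱.orderEmbOfFin hc).strictMono (by simp)
  -- The merged slab between walls `σ j` and `σ (j + 1)` contains the chosen slab `e j`, and the
  -- outer walls are those of the chord. Being constant from `R` on, `σ` is one of finitely many
  -- patterns.
  set σ : ℕ → ℕ := fun j => if j = 0 then i₁ + 1 else if j < R then e (j - 1) + 1 else i₂ with hσ
  have hσ0 : σ 0 = i₁ + 1 := by simp [hσ]
  have hσR : ∀ j, R ≤ j → σ j = i₂ := by
    intro j hj
    have h1 : j ≠ 0 := by omega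
    have h2 : ¬ j < R := by omega
    simp [hσ, h1, h2]
  have hlow : ∀ j < R, σ j ≤ e j := by
    intro j hj
    rcases Nat.eq_zero_or_pos j with rfl | h0
    · rw [hσ0]; exact (h𝒰 _ (he 0 hj)).1
    · obtain ⟨i, rfl⟩ : ∃ i, j = i + 1 := ⟨j - 1, by omega⟩
      have := hemono i hj
      simp [hσ, hj]; omega
  have hupp : ∀ j < R, e j + 1 ≤ σ (j + 1) := by
    intro j hj
    rcases Nat.lt_or_ge (j + 1) R with h | h
    · simp [hσ, h]
    · rw [hσR _ h]; exact (h𝒰 _ (he j hj)).2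
  have hle : ∀ j, σ j ≤ m := by
    intro j
    rcases Nat.lt_or_ge j R with h | h
    · exact (hlow j h).trans ((h𝒰 _ (he j h)).2.le.trans hi₂)
    · rw [hσR j h]; exact hi₂
  have hmono : ∀ i j, i ≤ j → j ≤ m → w i ≤ w j := fun i j hij hj =>
    hw.monotoneOn (Set.mem_Iic.2 (hij.trans hj)) (Set.mem_Iic.2 hj) hij
  have hσlt : ∀ d i, i + d + 1 ≤ R → σ i < σ (i + d + 1) := by
    intro d
    induction d with
    | zero => intro i hi; have := hlow i hi; have := hupp i hi; simp only [add_zero]; omega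
    | succ d ih =>
      intro i hi
      have h1 := ih i (by omega)
      have h2 := hlow (i + d + 1) (by omega)
      have h3 := hupp (i + d + 1) (by omega)
      have h4 : i + (d + 1) + 1 = i + d + 1 + 1 := by ring
      rw [h4]; omega
  refine ⟨σ, hle, ?_, ?_, ⟨u, v, hu, hv, ?_, ?_, ?_, ?_⟩, ?_⟩
  · intro j
    rcases le_total j R with h | h
    · rw [min_eq_left h]
    · rw [min_eq_right h, hσR j h, hσR R le_rfl]
  · intro i _ j hj hij
    obtain ⟨d, rfl⟩ := Nat.exists_eq_add_of_lt hij
    exact hw (Set.mem_Iic.2 (hle _)) (Set.mem_Iic.2 (hle _)) (hσlt d i hj)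
  · simp only [hσ0, hu1]
  · simp only [hσR R le_rfl, hv1]
  · simp only [hσR R le_rfl]; exact htop
  · intro j hj
    refine (ha _ (he j hj)).trans (Nat.cast_le.2 (Finset.card_le_card fun p hp => ?_))
    rw [Finset.mem_filter] at hp ⊢
    obtain ⟨h1, ⟨h2, h3⟩, h4⟩ := hp
    refine ⟨h1, ⟨?_, ?_⟩, h4⟩
    · exact (hmono _ _ (hlow j hj) (by have := hupp j hj; have := hle (j + 1); omega)).trans_lt h2
    · exact h3.trans_le (hmono _ _ (hupp j hj) (hle _))
  · simp only [hσR R le_rfl]; exact hb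

theorem mem_convexHull_reflect {S : Finset (ℝ × ℝ)} [DecidableEq (ℝ × ℝ)] {p : ℝ × ℝ} :
    p ∈ convexHull ℝ ((S.image reflect : Finset (ℝ × ℝ)) : Set (ℝ × ℝ)) ↔
      reflect p ∈ convexHull ℝ (S : Set (ℝ × ℝ)) := by
  have key : ∀ (A B : Set (ℝ × ℝ)), (∀ q ∈ A, reflect q ∈ B) → ∀ q ∈ convexHull ℝ A,
      reflect q ∈ convexHull ℝ B := by
    intro A B h q hq
    exact convexHull_min (t := {q | reflect q ∈ convexHull ℝ B})
      (fun q hq => subset_convexHull ℝ _ (h q hq)) (convex_reflect (convex_convexHull ℝ B)) hq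
  constructor
  · refine fun h => key _ _ (fun q hq => ?_) p h
    obtain ⟨r, hr, rfl⟩ := Finset.mem_image.1 (Finset.mem_coe.1 hq)
    rw [reflect_reflect]; exact hr
  · intro h
    have := key _ ((S.image reflect : Finset (ℝ × ℝ)) : Set (ℝ × ℝ)) (fun q hq =>
      Finset.mem_coe.2 (Finset.mem_image_of_mem reflect hq)) _ h
    rwa [reflect_reflect] at this

theorem height_reflect (ℓ p : ℝ × ℝ) : height ℓ (reflect p) = - height (-ℓ) p := by
  simp only [height, reflect, lineVal_neg]; ring

theorem GenPos.reflect {X : Finset (ℝ × ℝ)} [DecidableEq (ℝ × ℝ)] (h : GenPos X) :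
    GenPos (X.image reflect) := by
  have hinj : Function.Injective _root_.reflect := Function.LeftInverse.injective reflect_reflect
  constructor
  · intro p hp q hq hpq
    obtain ⟨p', hp', rfl⟩ := Finset.mem_image.1 (Finset.mem_coe.1 hp)
    obtain ⟨q', hq', rfl⟩ := Finset.mem_image.1 (Finset.mem_coe.1 hq)
    rw [h.inj hp' hq' hpq]
  · intro ℓ Y hY hz
    rw [← Finset.card_image_of_injective Y hinj]
    refine h.col (-ℓ) _ ?_ ?_
    · intro p hp
      obtain ⟨q, hq, rfl⟩ := Finset.mem_image.1 hp
      obtain ⟨r, hr, rfl⟩ := Finset.mem_image.1 (hY hq)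
      rwa [reflect_reflect]
    · intro p hp
      obtain ⟨q, hq, rfl⟩ := Finset.mem_image.1 hp
      rw [height_reflect, neg_neg, hz q hq, neg_zero]

open Classical in
/-- A set which is heavy in many slabs, and whose hull contains no large trapezoid, is rich above
its upper chord or rich below its lower chord for some pattern of walls. -/
theorem exists_rich_pattern {w : ℕ → ℝ} {m : ℕ} (hw : StrictMonoOn w (Set.Iic m))
    {P S : Finset (ℝ × ℝ)} (hS : S ⊆ P) {R : ℕ} (hR : 0 < R) {a : ℝ} (ha : 0 < a)
    (hused : 2 * R + 1 ≤ ((Finset.range m).filter (fun i => 4 * a ≤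
      ((S.filter (fun p => w i < p.1 ∧ p.1 < w (i + 1))).card : ℝ))).card)
    (htrap : ∀ x₁ x₂ ℓ k, trap x₁ x₂ ℓ k ⊆ convexHull ℝ (S : Set (ℝ × ℝ)) →
      ((P.filter (· ∈ trap x₁ x₂ ℓ k)).card : ℝ) ≤ 2 * a) :
    ∃ σ : ℕ → ℕ, (∀ j, σ j ≤ m) ∧ (∀ j, σ j = σ (min j R)) ∧
      StrictMonoOn (fun j => w (σ j)) (Set.Iic R) ∧ (RichAbove (fun j => w (σ j)) R a a S ∨
        RichAbove (fun j => w (σ j)) R a a (S.image reflect)) := by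
  set K := convexHull ℝ (S : Set (ℝ × ℝ)) with hK
  have hKc : Convex ℝ K := convex_convexHull ℝ _
  have hKcpt : IsCompact K := (Finset.finite_toSet S).isCompact_convexHull ℝ
  have hSK : ∀ p ∈ S, p ∈ K := fun p hp => subset_convexHull ℝ _ hp
  set s : ℕ → Finset (ℝ × ℝ) := fun i => S.filter (fun p => w i < p.1 ∧ p.1 < w (i + 1)) with hs
  set U := (Finset.range m).filter (fun i => 4 * a ≤ ((s i).card : ℝ)) with hU
  have hUne : U.Nonempty := Finset.card_pos.1 (by omega)
  set i₁ := U.min' hUne with hi₁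
  set i₂ := U.max' hUne with hi₂
  have hUm : ∀ i ∈ U, i < m ∧ 4 * a ≤ ((s i).card : ℝ) := fun i hi => by
    simpa [hU] using hi
  have h1U : i₁ ∈ U := U.min'_mem hUne
  have h2U : i₂ ∈ U := U.max'_mem hUne
  set I := (U.erase i₁).erase i₂ with hI
  have hIm : ∀ i ∈ I, i ∈ U ∧ i₁ < i ∧ i < i₂ := by
    intro i hi
    obtain ⟨h2, h⟩ := Finset.mem_erase.1 hi
    obtain ⟨h1, h⟩ := Finset.mem_erase.1 h
    exact ⟨h, lt_of_le_of_ne (U.min'_le i h) (Ne.symm h1), lt_of_le_of_ne (U.le_max' i h) h2⟩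
  have hIcard : 2 * R - 1 ≤ I.card := by
    have e1 := Finset.pred_card_le_card_erase (s := U) (a := i₁)
    have e2 := Finset.pred_card_le_card_erase (s := U.erase i₁) (a := i₂)
    rw [hI]; omega
  obtain ⟨i₃, hi₃⟩ : I.Nonempty := Finset.card_pos.1 (by omega)
  have h13 := (hIm i₃ hi₃).2
  have hi₂m : i₂ < m := (hUm _ h2U).1
  have hmono : ∀ i j, i ≤ j → j ≤ m → w i ≤ w j := fun i j hij hj =>
    hw.monotoneOn (Set.mem_Iic.2 (hij.trans hj)) (Set.mem_Iic.2 hj) hij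
  have hlt : w (i₁ + 1) < w i₂ :=
    hw (Set.mem_Iic.2 (by omega)) (Set.mem_Iic.2 hi₂m.le) (by omega)
  have hpt : ∀ i ∈ U, ∃ p ∈ S, w i < p.1 ∧ p.1 < w (i + 1) := by
    intro i hi
    have h1 := (hUm i hi).2
    have : (0:ℝ) < (s i).card := by linarith
    obtain ⟨p, hp⟩ := Finset.card_pos.1 (Nat.cast_pos.1 this)
    exact ⟨p, (Finset.mem_filter.1 hp).1, (Finset.mem_filter.1 hp).2⟩
  obtain ⟨p₁, hp₁, hp₁'⟩ := hpt i₁ h1U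
  obtain ⟨p₂, hp₂, hp₂'⟩ := hpt i₂ h2U
  have hc1 := chord_mem hKc (hSK _ hp₁) (hSK _ hp₂) (x := w (i₁ + 1)) (by linarith) (by linarith)
    (by linarith)
  have hc2 := chord_mem hKc (hSK _ hp₁) (hSK _ hp₂) (x := w i₂) (by linarith) (by linarith)
    (by linarith)
  obtain ⟨yu, hu, -⟩ := exists_top hKcpt hc1
  obtain ⟨yv, hv, hvt⟩ := exists_top hKcpt hc2
  obtain ⟨zu, hu', -⟩ := exists_bottom hKcpt hc1
  obtain ⟨zv, hv', hvb⟩ := exists_bottom hKcpt hc2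
  set u : ℝ × ℝ := (w (i₁ + 1), yu) with hudef
  set v : ℝ × ℝ := (w i₂, yv) with hvdef
  set u' : ℝ × ℝ := (w (i₁ + 1), zu) with hudef'
  set v' : ℝ × ℝ := (w i₂, zv) with hvdef'
  have huv : u.1 < v.1 := hlt
  have huv' : u'.1 < v'.1 := hlt
  -- The region between the lower and the upper chord is a trapezoid in the hull and holds at most
  -- `2 * a` points. So of the `4 * a` points of a middle slab, `a` lie above the upper chord or `a`
  -- below the lower one; `2R - 1` middle slabs yield `R` of one kind.
  have htr := htrap (w (i₁ + 1)) (w i₂) (through u' v') (through u v)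
    (trap_subset hKc hu' hv' hu hv le_rfl le_rfl le_rfl le_rfl (lineVal_through_left u' v').ge
      (lineVal_through_right huv'.ne).ge (lineVal_through_left u v).le
      (lineVal_through_right huv.ne).le)
  set up : ℕ → Finset (ℝ × ℝ) := fun i => S.filter (fun p => (w i < p.1 ∧ p.1 < w (i + 1)) ∧
      0 < height (through u v) p) with hup
  set lo : ℕ → Finset (ℝ × ℝ) := fun i => S.filter (fun p => (w i < p.1 ∧ p.1 < w (i + 1)) ∧
      height (through u' v') p < 0) with hlo
  have hsplit : ∀ i ∈ I, a ≤ ((up i).card : ℝ) ∨ a ≤ ((lo i).card : ℝ) := by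
    intro i hi
    obtain ⟨hiU, hi1, hi2⟩ := hIm i hi
    by_contra hcon
    push Not at hcon
    have hsub : s i ⊆ up i ∪ lo i ∪
        P.filter (· ∈ trap (w (i₁ + 1)) (w i₂) (through u' v') (through u v)) := by
      intro p hp
      obtain ⟨hpS, hp1⟩ := Finset.mem_filter.1 hp
      simp only [Finset.mem_union]
      by_cases h1 : 0 < height (through u v) p
      · exact Or.inl (Or.inl (Finset.mem_filter.2 ⟨hpS, hp1, h1⟩))
      by_cases h2 : height (through u' v') p < 0
      · exact Or.inl (Or.inr (Finset.mem_filter.2 ⟨hpS, hp1, h2⟩))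
      · refine Or.inr (Finset.mem_filter.2 ⟨hS hpS, ⟨?_, ?_⟩, not_lt.1 h2, not_lt.1 h1⟩)
        · exact (hmono _ _ hi1 (by omega)).trans hp1.1.le
        · exact hp1.2.le.trans (hmono _ _ hi2 hi₂m.le)
    have hc := (Finset.card_le_card hsub).trans ((Finset.card_union_le _ _).trans
      (Nat.add_le_add_right (Finset.card_union_le _ _) _))
    have hc' : ((s i).card : ℝ) ≤ (up i).card + (lo i).card +
        (P.filter (· ∈ trap (w (i₁ + 1)) (w i₂) (through u' v') (through u v))).card := by
      exact_mod_cast hc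
    have := (hUm i hiU).2
    linarith
  have hright : a ≤ ((S.filter (fun p => w i₂ < p.1)).card : ℝ) := by
    have h1 : ((s i₂).card : ℝ) ≤ ((S.filter (fun p => w i₂ < p.1)).card : ℝ) := by
      refine Nat.cast_le.2 (Finset.card_le_card fun p hp => ?_)
      rw [Finset.mem_filter] at hp ⊢
      exact ⟨hp.1, hp.2.1⟩
    have := (hUm i₂ h2U).2
    linarith
  have hcount : I.card ≤ (I.filter (fun i => a ≤ ((up i).card : ℝ))).card +
      (I.filter (fun i => a ≤ ((lo i).card : ℝ))).card := by
    refine (Finset.card_le_card fun i hi => ?_).trans (Finset.card_union_le _ _)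
    rcases hsplit i hi with h | h
    · exact Finset.mem_union_left _ (Finset.mem_filter.2 ⟨hi, h⟩)
    · exact Finset.mem_union_right _ (Finset.mem_filter.2 ⟨hi, h⟩)
  have hRcase : R ≤ (I.filter (fun i => a ≤ ((up i).card : ℝ))).card ∨
      R ≤ (I.filter (fun i => a ≤ ((lo i).card : ℝ))).card := by omega
  rcases hRcase with h | h
  · obtain ⟨σ, h1, h2, h3, h4⟩ := exists_richAbove hw hi₂m.le
      (fun i hi => (hIm i (Finset.mem_filter.1 hi).1).2) hR h hu hv rfl rfl hvt
      (fun i hi => (Finset.mem_filter.1 hi).2) hright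
    exact ⟨σ, h1, h2, h3, Or.inl h4⟩
  · have hinj : Function.Injective reflect := Function.LeftInverse.injective reflect_reflect
    have hcardr : ∀ (q q' : ℝ × ℝ → Prop) [DecidablePred q] [DecidablePred q'],
        (∀ p, q p → q' (reflect p)) → ((S.filter q).card : ℝ) ≤ ((S.image reflect).filter q').card := by
      intro q q' _ _ hqq
      rw [← Finset.card_image_of_injective (S.filter q) hinj]
      refine Nat.cast_le.2 (Finset.card_le_card fun p hp => ?_)
      obtain ⟨r, hr, rfl⟩ := Finset.mem_image.1 hp
      obtain ⟨hr1, hr2⟩ := Finset.mem_filter.1 hr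
      exact Finset.mem_filter.2 ⟨Finset.mem_image_of_mem _ hr1, hqq r hr2⟩
    have hlo' : ∀ i ∈ I.filter (fun i => a ≤ ((lo i).card : ℝ)), a ≤ (((S.image reflect).filter
        (fun p => (w i < p.1 ∧ p.1 < w (i + 1)) ∧
          0 < height (through (reflect u') (reflect v')) p)).card : ℝ) := by
      intro i hi
      refine (Finset.mem_filter.1 hi).2.trans (hcardr _ _ fun p hp => ⟨hp.1, ?_⟩)
      rw [through_reflect, height_reflect, neg_neg]
      linarith [hp.2]
    have hright' : a ≤ (((S.image reflect).filter (fun p => w i₂ < p.1)).card : ℝ) :=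
      hright.trans (hcardr _ _ fun p hp => hp)
    obtain ⟨σ, h1, h2, h3, h4⟩ := exists_richAbove (S := S.image reflect) (u := reflect u')
      (v := reflect v') hw hi₂m.le
      (fun i hi => (hIm i (Finset.mem_filter.1 hi).1).2) hR h
      (mem_convexHull_reflect.2 (by rw [reflect_reflect]; exact hu'))
      (mem_convexHull_reflect.2 (by rw [reflect_reflect]; exact hv')) rfl rfl
      (fun y hy => by
        have := hvb (-y) (mem_convexHull_reflect.1 hy)
        simp only [reflect, hvdef']; linarith)
      (a := a) (b := a) hlo' hright'
    exact ⟨σ, h1, h2, h3, Or.inr h4⟩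

set_option maxHeartbeats 400000 in
open Classical in
/-- The recursion for the size of weak nets. -/
theorem exists_netBound_step (γ : ℝ) (hγ : 0 < γ) (hγ1 : γ ≤ 1) : ∃ k : ℕ, 0 < k ∧ ∀ m : ℕ, 0 < m →
    ∃ B x₀ : ℝ, 0 < B ∧ 1 ≤ x₀ ∧ ∀ x : ℝ, x₀ ≤ x → ∀ N : ℝ, 0 ≤ N → NetBound (4 * k / m * x) N →
      NetBound x (m * N + B * x ^ (3 / 2 + γ)) := by
  obtain ⟨R, hR, hrich⟩ := exists_rich_net_bound γ hγ hγ1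
  -- Two extreme slabs and `2R - 1` between them. All choices of `R + 1` walls among `m + 1` are
  -- treated at once, for `P` and for its reflection; their number depends only on `R` and `m`.
  refine ⟨2 * R + 1, by omega, fun m hm => ?_⟩
  have hm0 : (0:ℝ) < m := by exact_mod_cast hm
  have hm1 : (1:ℝ) ≤ m := by exact_mod_cast hm
  obtain ⟨B, x₁, hB, hx₁, hnet⟩ := hrich (1 / (8 * m)) (by positivity)
    (by rw [div_le_one (by positivity)]; linarith)
  obtain ⟨Ct, hCt, hpar⟩ := exists_net_parameters 12 (1 / 2) (by norm_num)
  set F : Type := Fin (R + 1) → Fin (m + 1)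
  set L : ℝ := (Fintype.card F : ℝ) with hL
  have hL0 : 0 ≤ L := by positivity
  refine ⟨L * B + L * B + Ct * (4 * m) ^ ((3:ℝ) / 2) + 1, max x₁ m, by positivity,
    hx₁.trans (le_max_left _ _), fun x hx N hN hrec P hP hne => ?_⟩
  have hxx₁ : x₁ ≤ x := (le_max_left _ _).trans hx
  have hxm : (m:ℝ) ≤ x := (le_max_right _ _).trans hx
  have hx1 : 1 ≤ x := hx₁.trans hxx₁
  have hx0 : 0 < x := by linarith
  set X : ℝ := x ^ (3 / 2 + γ) with hX
  have hX0 : 0 < X := by positivity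
  -- A set with fewer than `X` points is its own net; otherwise `n` is large enough for `hnet`.
  rcases lt_or_ge (P.card : ℝ) X with hsmall | hn
  · refine ⟨P, ?_, fun S hS h => exists_mem_of_card_le hne hS h⟩
    have h1 : 0 ≤ m * N := by positivity
    have h2 : 0 ≤ (L * B + L * B + Ct * (4 * m) ^ ((3:ℝ) / 2)) * X := by positivity
    linarith
  have hmP : m ≤ P.card := by
    have : x ≤ X := by
      calc x = x ^ (1:ℝ) := (Real.rpow_one x).symm
        _ ≤ X := Real.rpow_le_rpow_of_exponent_le hx1 (by linarith)
    exact_mod_cast hxm.trans (this.trans hn)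
  have hn0 : (0:ℝ) < P.card := by exact_mod_cast hne.card_pos
  obtain ⟨w, hw, Q₁, hQ₁, hQ₁'⟩ := exists_slab_net hm (by omega) hx0 hN hrec hP hne hmP
  have hδ1 : 1 / (4 * x * m) ≤ 1 := by
    rw [div_le_one (by positivity)]
    have := one_le_mul_of_one_le_of_one_le hx1 hm1
    linarith
  obtain ⟨sN, kN, hsN, hkN, hsN'⟩ := hpar (1 / (4 * x * m)) (by positivity) hδ1
  obtain ⟨A, hAP, hAc, hA⟩ := polyGrowth_traps.exists_net _ sN kN hkN hsN' P
  set ζ : F → ℕ → ℝ := fun f j => w (f ⟨min j R, Nat.lt_succ_of_le (min_le_right _ _)⟩) with hζ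
  have hpat : ∀ P' : Finset (ℝ × ℝ), GenPos P' → P'.card = P.card → ∀ f : F,
      ∃ Q : Finset (ℝ × ℝ), (Q.card : ℝ) ≤ B * X ∧ (StrictMonoOn (ζ f) (Set.Iic R) →
        ∀ S ⊆ P', RichAbove (ζ f) R (P.card / (8 * x * m)) (P.card / (8 * x * m)) S →
          ∃ q ∈ Q, q ∈ convexHull ℝ (S : Set (ℝ × ℝ))) := by
    intro P' hP' hc f
    by_cases hf : StrictMonoOn (ζ f) (Set.Iic R)
    · obtain ⟨Q, h1, h2⟩ := hnet x hxx₁ P' hP' (by rw [hc]; exact hn) (ζ f) hf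
      refine ⟨Q, h1, fun _ S hS hr => h2 S hS ?_⟩
      have e : 1 / (8 * (m:ℝ)) * (P'.card : ℝ) / x = P.card / (8 * x * m) := by
        rw [hc]; field_simp
      rw [e]; exact hr
    · exact ⟨∅, by simpa using by positivity, fun h => absurd h hf⟩
  have hinj : Function.Injective reflect := Function.LeftInverse.injective reflect_reflect
  choose Q₂ hQ₂ hQ₂' using hpat P hP rfl
  choose Q₃ hQ₃ hQ₃' using hpat (P.image reflect) hP.reflect (Finset.card_image_of_injective _ hinj)
  have hun : ∀ T : F → Finset (ℝ × ℝ), (∀ f, ((T f).card : ℝ) ≤ B * X) →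
      ((Finset.univ.biUnion T).card : ℝ) ≤ L * (B * X) := by
    intro T hT
    refine (Nat.cast_le.2 Finset.card_biUnion_le).trans ?_
    push_cast
    refine (Finset.sum_le_sum fun f _ => hT f).trans ?_
    rw [Finset.sum_const, Finset.card_univ, nsmul_eq_mul]
  refine ⟨Q₁ ∪ Finset.univ.biUnion Q₂ ∪ (Finset.univ.biUnion Q₃).image reflect ∪ A, ?_, ?_⟩
  · have h1 : (Q₁ ∪ Finset.univ.biUnion Q₂ ∪ (Finset.univ.biUnion Q₃).image reflect ∪ A).card ≤
        Q₁.card + (Finset.univ.biUnion Q₂).card + (Finset.univ.biUnion Q₃).card + A.card := by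
      refine (Finset.card_union_le _ _).trans (Nat.add_le_add_right ?_ _)
      refine (Finset.card_union_le _ _).trans (Nat.add_le_add ?_ Finset.card_image_le)
      exact Finset.card_union_le _ _
    have h1' : ((Q₁ ∪ Finset.univ.biUnion Q₂ ∪ (Finset.univ.biUnion Q₃).image reflect ∪ A).card : ℝ) ≤
        Q₁.card + (Finset.univ.biUnion Q₂).card + (Finset.univ.biUnion Q₃).card + A.card := by
      exact_mod_cast h1
    have h2 := hun Q₂ hQ₂
    have h3 := hun Q₃ hQ₃
    have h4 : (A.card : ℝ) ≤ Ct * (4 * m) ^ ((3:ℝ) / 2) * X := by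
      have h5 : (A.card : ℝ) ≤ sN := by exact_mod_cast hAc
      refine h5.trans (hsN.trans ?_)
      rw [mul_assoc Ct]
      refine mul_le_mul_of_nonneg_left ?_ hCt.le
      have e1 : (1 / (4 * x * m)) ^ (-1 - (1:ℝ) / 2) = (4 * m * x) ^ ((3:ℝ) / 2) := by
        rw [one_div, Real.inv_rpow (by positivity), ← Real.rpow_neg (by positivity)]
        congr 1 <;> ring
      rw [e1, Real.mul_rpow (by positivity) hx0.le]
      have : x ^ ((3:ℝ) / 2) ≤ X := Real.rpow_le_rpow_of_exponent_le hx1 (by linarith)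
      gcongr
    calc _ ≤ m * N + L * (B * X) + L * (B * X) + Ct * (4 * m) ^ ((3:ℝ) / 2) * X := by linarith
      _ ≤ m * N + (L * B + L * B + Ct * (4 * m) ^ ((3:ℝ) / 2) + 1) * X := by
          have : (L * B + L * B + Ct * (4 * m) ^ ((3:ℝ) / 2) + 1) * X =
            L * (B * X) + L * (B * X) + Ct * (4 * m) ^ ((3:ℝ) / 2) * X + X := by ring
          rw [this]; linarith
  · intro S hS hheavy
    rcases hQ₁' S hS hheavy with ⟨q, hq, hqS⟩ | hused
    · exact ⟨q, by simp [hq], hqS⟩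
    by_contra hcon
    push Not at hcon
    set a : ℝ := P.card / (8 * x * m) with ha
    have ha0 : 0 < a := by rw [ha]; positivity
    have ha4 : (P.card : ℝ) / (2 * x * m) = 4 * a := by rw [ha]; field_simp; norm_num
    rw [ha4] at hused
    have htrap : ∀ x₁ x₂ ℓ k, trap x₁ x₂ ℓ k ⊆ convexHull ℝ (S : Set (ℝ × ℝ)) →
        ((P.filter (· ∈ trap x₁ x₂ ℓ k)).card : ℝ) ≤ 2 * a := by
      intro x₁ x₂ ℓ k hsub
      by_contra hbig
      push Not at hbig
      obtain ⟨q, hq, hqR⟩ := hA _ ⟨x₁, x₂, ℓ, k, rfl⟩ (P.filter (· ∈ trap x₁ x₂ ℓ k))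
        (Finset.filter_subset _ _) (fun y hy => (Finset.mem_filter.1 hy).2)
        (Finset.card_pos.1 (Nat.cast_pos.1 (lt_trans (by linarith : (0:ℝ) < 2 * a) hbig))) (by
          refine le_trans (le_of_eq ?_) hbig.le
          rw [ha]; field_simp; norm_num)
      exact hcon q (by simp [hq]) (hsub hqR)
    obtain ⟨σ, hσm, hσR, hσmono, hσ⟩ := exists_rich_pattern hw hS hR ha0 hused htrap
    set f : F := fun j => ⟨σ j, Nat.lt_succ_of_le (hσm _)⟩ with hf
    have hζf : ζ f = fun j => w (σ j) := by
      funext j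
      simp only [hζ, hf]
      rw [← hσR j]
    rw [← hζf] at hσmono hσ
    rcases hσ with hσ | hσ
    · obtain ⟨q, hq, hqS⟩ := hQ₂' f hσmono S hS hσ
      refine hcon q ?_ hqS
      simp only [Finset.mem_union, Finset.mem_biUnion]
      exact Or.inl (Or.inl (Or.inr ⟨f, Finset.mem_univ _, hq⟩))
    · obtain ⟨q, hq, hqS⟩ := hQ₃' f hσmono (S.image reflect) (Finset.image_subset_image hS) hσ
      refine hcon (reflect q) ?_ (mem_convexHull_reflect.1 hqS)
      simp only [Finset.mem_union, Finset.mem_image, Finset.mem_biUnion]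
      exact Or.inl (Or.inr ⟨q, ⟨f, Finset.mem_univ _, hq⟩, rfl⟩)

theorem NetBound.mono {x y N M : ℝ} (h : NetBound y N) (hxy : x ≤ y) (hNM : N ≤ M) : NetBound x M := by
  intro P hP hne
  obtain ⟨Q, hQ, hQ'⟩ := h P hP hne
  exact ⟨Q, hQ.trans hNM, fun S hS hc => hQ' S hS
    (hc.trans (mul_le_mul_of_nonneg_right hxy (Nat.cast_nonneg _)))⟩

/-- The bound for weak nets of sets in general position. -/
theorem exists_netBound_rpow (γ : ℝ) (hγ : 0 < γ) (hγ1 : γ ≤ 1) :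
    ∃ C : ℝ, 1 ≤ C ∧ ∀ x : ℝ, 1 ≤ x → NetBound x (C * x ^ (3 / 2 + γ)) := by
  obtain ⟨k, hk, hstep⟩ := exists_netBound_step γ hγ hγ1
  obtain ⟨e, he⟩ : ∃ e : ℝ, e = 3 / 2 + γ := ⟨_, rfl⟩
  rw [← he]
  rw [← he] at hstep
  have he0 : 3 / 2 ≤ e := by linarith
  have hk0 : (0:ℝ) < k := by exact_mod_cast hk
  -- Large enough for `m * (4k/m)^e ≤ 1/2`, which is possible because `e > 1`: the recursive nets
  -- use half of `C * x ^ e`, and the other half pays for `B * x ^ e`.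
  obtain ⟨m, hm⟩ := exists_nat_ge (max (8 * (k:ℝ)) ((2 * (4 * k : ℝ) ^ e) ^ 2))
  have hm8 : 8 * (k:ℝ) ≤ m := (le_max_left _ _).trans hm
  have hm2 : (2 * (4 * k : ℝ) ^ e) ^ 2 ≤ m := (le_max_right _ _).trans hm
  have hk1 : (1:ℝ) ≤ k := by exact_mod_cast hk
  have hm1 : (1:ℝ) ≤ m := by linarith
  have hm0 : (0:ℝ) < m := by linarith
  have hratio : (m:ℝ) * (4 * k / m : ℝ) ^ e ≤ 1 / 2 := by
    have h1 : 2 * (4 * k : ℝ) ^ e ≤ (m:ℝ) ^ (e - 1) := by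
      calc 2 * (4 * k : ℝ) ^ e = ((2 * (4 * k : ℝ) ^ e) ^ 2) ^ ((1:ℝ) / 2) := by
            rw [← Real.sqrt_eq_rpow, Real.sqrt_sq (by positivity)]
        _ ≤ (m:ℝ) ^ ((1:ℝ) / 2) := Real.rpow_le_rpow (by positivity) hm2 (by norm_num)
        _ ≤ (m:ℝ) ^ (e - 1) := Real.rpow_le_rpow_of_exponent_le hm1 (by linarith)
    have h2 : (m:ℝ) ^ e = m * (m:ℝ) ^ (e - 1) := by
      rw [Real.rpow_sub hm0, Real.rpow_one]; field_simp
    rw [Real.div_rpow (by positivity) hm0.le, h2]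
    have h3 : 0 < (m:ℝ) ^ (e - 1) := by positivity
    have h4 : (m:ℝ) * ((4 * k : ℝ) ^ e / (m * (m:ℝ) ^ (e - 1))) = (4 * k : ℝ) ^ e / (m:ℝ) ^ (e - 1) := by
      field_simp
    rw [h4, div_le_iff₀ h3]
    linarith
  obtain ⟨B, x₀, hB, hx₀, hrec⟩ := hstep m (by exact_mod_cast hm0)
  obtain ⟨j₀, hj₀⟩ := pow_unbounded_of_one_lt (2 * x₀) (by norm_num : (1:ℝ) < 2)
  obtain ⟨N₀, hN₀, hbase⟩ := exists_netBound j₀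
  obtain ⟨C, hC⟩ : ∃ C : ℝ, C = N₀ + 2 * B + 1 := ⟨_, rfl⟩
  have hC1 : 1 ≤ C := by linarith
  have hsmall : ∀ x, 1 ≤ x → x ≤ x₀ → NetBound x (C * x ^ e) := by
    intro x hx hxx
    refine hbase.mono (by linarith) ?_
    have : 1 ≤ x ^ e := Real.one_le_rpow hx (by linarith)
    nlinarith
  have hall : ∀ j : ℕ, ∀ x, 1 ≤ x → x ≤ x₀ * 2 ^ j → NetBound x (C * x ^ e) := by
    intro j
    induction j with
    | zero => intro x hx hxx; exact hsmall x hx (by simpa using hxx)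
    | succ j ih =>
      intro x hx hxx
      rcases le_or_gt x x₀ with h | h
      · exact hsmall x hx h
      have hx0 : 0 < x := by linarith
      have hq : 4 * (k:ℝ) / m ≤ 1 / 2 := by
        rw [div_le_iff₀ hm0]; linarith
      have hx' : 4 * (k:ℝ) / m * x ≤ x₀ * 2 ^ j := by
        rw [pow_succ] at hxx
        nlinarith
      have hpos : 0 ≤ C * (4 * (k:ℝ) / m * x) ^ e := by positivity
      have hnb : NetBound (4 * k / m * x) (C * (4 * (k:ℝ) / m * x) ^ e) := by
        rcases lt_or_ge (4 * (k:ℝ) / m * x) 1 with h1 | h1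
        · exact netBound_of_lt_one h1 hpos
        · exact ih _ h1 hx'
      refine (hrec x h.le _ hpos hnb).mono le_rfl ?_
      rw [Real.mul_rpow (by positivity) hx0.le]
      have hxe : 0 < x ^ e := by positivity
      calc (m:ℝ) * (C * ((4 * (k:ℝ) / m) ^ e * x ^ e)) + B * x ^ e
          = (C * (m * (4 * (k:ℝ) / m) ^ e) + B) * x ^ e := by ring
        _ ≤ (C * (1 / 2) + B) * x ^ e := by gcongr
        _ ≤ C * x ^ e := by gcongr; linarith
  refine ⟨C, hC1, fun x hx => ?_⟩
  obtain ⟨j, hj⟩ := pow_unbounded_of_one_lt x (by norm_num : (1:ℝ) < 2)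
  exact hall j x hx (hj.le.trans (by nlinarith [pow_pos (show (0:ℝ) < 2 by norm_num) j]))

/-! ### Removing general position, and the theorem. -/

theorem ne_zero_of_notMem_roots {A B C δ : ℝ} (hC : C ≠ 0)
    (h : δ ∉ (Polynomial.C A + Polynomial.C B * Polynomial.X +
      Polynomial.C C * Polynomial.X ^ 2 : Polynomial ℝ).roots.toFinset) :
    A + B * δ + C * δ ^ 2 ≠ 0 := by
  intro h0
  apply h
  rw [Multiset.mem_toFinset, Polynomial.mem_roots']
  refine ⟨fun hp => hC ?_, by simpa [Polynomial.IsRoot] using h0⟩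
  have := congrArg (fun p => Polynomial.coeff p 2) hp
  simpa [Polynomial.coeff_X, Polynomial.coeff_C] using this

/-- Points pushed along a parabola. -/
def perturb {n : ℕ} (a : Fin n → ℝ × ℝ) (δ : ℝ) (i : Fin n) : ℝ × ℝ :=
  ((a i).1 + δ * (i : ℝ), (a i).2 + δ * (i : ℝ) ^ 2)

open Classical in
/-- Small perturbations along a parabola are in general position. -/
theorem exists_genPos_perturb {n : ℕ} (a : Fin n → ℝ × ℝ) : ∃ t : ℝ, 0 < t ∧ ∀ δ, 0 < δ → δ ≤ t →
    Function.Injective (perturb a δ) ∧ GenPos (Finset.univ.image (perturb a δ)) := by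
  -- The orientation of three perturbed points is `A + B δ + C δ²`, where `C` is a Vandermonde
  -- product of the three indices, hence nonzero. Differences of abscissae are linear in `δ` with
  -- nonzero slope. So all small positive `δ` are admissible.
  let A : Fin n → Fin n → Fin n → ℝ := fun i j l =>
    ((a j).2 - (a i).2) * ((a l).1 - (a i).1) - ((a l).2 - (a i).2) * ((a j).1 - (a i).1)
  let B : Fin n → Fin n → Fin n → ℝ := fun i j l =>
    ((a j).2 - (a i).2) * ((l:ℝ) - i) + ((j:ℝ) ^ 2 - i ^ 2) * ((a l).1 - (a i).1) -
      ((a l).2 - (a i).2) * ((j:ℝ) - i) - ((l:ℝ) ^ 2 - i ^ 2) * ((a j).1 - (a i).1)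
  let C : Fin n → Fin n → Fin n → ℝ := fun i j l =>
    ((j:ℝ) ^ 2 - i ^ 2) * ((l:ℝ) - i) - ((l:ℝ) ^ 2 - i ^ 2) * ((j:ℝ) - i)
  let A' : Fin n → Fin n → ℝ := fun i j => (a j).1 - (a i).1
  obtain ⟨t, ht, hF⟩ := exists_lt_abs
    ((Finset.univ : Finset (Fin n × Fin n × Fin n)).biUnion (fun z =>
      (Polynomial.C (A z.1 z.2.1 z.2.2) + Polynomial.C (B z.1 z.2.1 z.2.2) * Polynomial.X +
        Polynomial.C (C z.1 z.2.1 z.2.2) * Polynomial.X ^ 2 : Polynomial ℝ).roots.toFinset) ∪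
     (Finset.univ : Finset (Fin n × Fin n)).image (fun z => - (A' z.1 z.2) / ((z.2:ℝ) - z.1)))
  refine ⟨t, ht, fun δ hδ hδt => ?_⟩
  have hnot := fun hmem => (not_lt.2 hδt) (by simpa [abs_of_pos hδ] using hF δ hmem hδ.ne')
  have hn1 := fun h => hnot (Finset.mem_union_left _ h)
  have hn2 := fun h => hnot (Finset.mem_union_right _ h)
  have hcast : ∀ i j : Fin n, i ≠ j → (i:ℝ) - j ≠ 0 := by
    intro i j hij h
    apply hij
    have : (i:ℝ) = j := by linarith
    exact Fin.ext (by exact_mod_cast this)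
  have hx : ∀ i j : Fin n, i ≠ j → (perturb a δ i).1 ≠ (perturb a δ j).1 := by
    intro i j hij h
    apply hn2
    refine Finset.mem_image.2 ⟨(i, j), Finset.mem_univ _, ?_⟩
    have h1 := hcast j i hij.symm
    simp only [A', perturb] at h ⊢
    rw [div_eq_iff h1]
    linarith
  have hdet : ∀ i j l : Fin n, i ≠ j → i ≠ l → j ≠ l →
      ((perturb a δ j).2 - (perturb a δ i).2) * ((perturb a δ l).1 - (perturb a δ i).1) -
        ((perturb a δ l).2 - (perturb a δ i).2) * ((perturb a δ j).1 - (perturb a δ i).1) ≠ 0 := by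
    intro i j l hij hil hjl
    have hC : C i j l ≠ 0 := by
      have e : C i j l = ((j:ℝ) - i) * ((l:ℝ) - i) * ((j:ℝ) - l) := by simp only [C]; ring
      rw [e]
      exact mul_ne_zero (mul_ne_zero (hcast j i hij.symm) (hcast l i hil.symm)) (hcast j l hjl)
    have := ne_zero_of_notMem_roots (A := A i j l) (B := B i j l) (δ := δ) hC (fun h => hn1
      (Finset.mem_biUnion.2 ⟨(i, j, l), Finset.mem_univ _, h⟩))
    convert this using 1
    simp only [perturb, A, B, C]
    ring
  refine ⟨fun i j hij => by_contra fun hne => hx i j hne (by rw [hij]), ⟨?_, ?_⟩⟩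
  · intro p hp q hq hpq
    obtain ⟨i, -, rfl⟩ := Finset.mem_image.1 (Finset.mem_coe.1 hp)
    obtain ⟨j, -, rfl⟩ := Finset.mem_image.1 (Finset.mem_coe.1 hq)
    by_contra hne
    exact hx i j (fun h => hne (by rw [h])) hpq
  · intro ℓ Y hY hz
    by_contra hcon
    push Not at hcon
    obtain ⟨p, hp, q, hq, r, hr, hpq, hpr, hqr⟩ := Finset.two_lt_card.1 hcon
    obtain ⟨i, -, rfl⟩ := Finset.mem_image.1 (hY hp)
    obtain ⟨j, -, rfl⟩ := Finset.mem_image.1 (hY hq)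
    obtain ⟨l, -, rfl⟩ := Finset.mem_image.1 (hY hr)
    refine hdet i j l (fun h => hpq (by rw [h])) (fun h => hpr (by rw [h]))
      (fun h => hqr (by rw [h])) ?_
    have e1 := hz _ hp
    have e2 := hz _ hq
    have e3 := hz _ hr
    simp only [height, lineVal] at e1 e2 e3
    have f1 : (perturb a δ j).2 - (perturb a δ i).2 =
      ℓ.1 * ((perturb a δ j).1 - (perturb a δ i).1) := by linarith
    have f2 : (perturb a δ l).2 - (perturb a δ i).2 =
      ℓ.1 * ((perturb a δ l).1 - (perturb a δ i).1) := by linarith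
    rw [f1, f2]; ring

open Classical in
/-- Weak nets for arbitrary indexed families of points, by perturbation and compactness. -/
theorem NetBound.exists_net {x N : ℝ} (hNB : NetBound x N) {n : ℕ} (hn : 0 < n) (a : Fin n → ℝ × ℝ) :
    ∃ Q : Finset (ℝ × ℝ), (Q.card : ℝ) ≤ N ∧ ∀ S : Finset (Fin n), (n : ℝ) ≤ x * S.card →
      ∃ q ∈ Q, q ∈ convexHull ℝ (a '' S) := by
  obtain ⟨t, ht, hpert⟩ := exists_genPos_perturb a
  let δ : ℕ → ℝ := fun k => t / (k + 1)
  have hδ0 : ∀ k, 0 < δ k := fun k => by positivity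
  have hδt : ∀ k, δ k ≤ t := fun k => div_le_self ht.le (by
    have : (0:ℝ) ≤ k := by positivity
    linarith)
  let b : ℕ → Fin n → ℝ × ℝ := fun k => perturb a (δ k)
  have hδlim : Filter.Tendsto δ Filter.atTop (nhds 0) := by
    have h1 := (tendsto_one_div_add_atTop_nhds_zero_nat (𝕜 := ℝ)).const_mul t
    rw [mul_zero] at h1
    refine h1.congr fun k => ?_
    simp only [δ]; ring
  have hblim : ∀ i, Filter.Tendsto (fun k => b k i) Filter.atTop (nhds (a i)) := by
    intro i
    have hc : Continuous fun s : ℝ => perturb a s i := by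
      unfold perturb
      fun_prop
    have h0 : perturb a 0 i = a i := by simp [perturb]
    have := (hc.tendsto 0).comp hδlim
    rwa [h0] at this
  have hNn : ∀ k, ∃ Q : Finset (ℝ × ℝ), (Q.card : ℝ) ≤ N ∧ ∀ S : Finset (Fin n),
      (n : ℝ) ≤ x * S.card → ∃ q ∈ Q, q ∈ convexHull ℝ (b k '' S) := by
    intro k
    obtain ⟨hinj, hgp⟩ := hpert (δ k) (hδ0 k) (hδt k)
    obtain ⟨Q, hQ, hQ'⟩ := hNB _ hgp ⟨_, Finset.mem_image_of_mem _ (Finset.mem_univ (⟨0, hn⟩ : Fin n))⟩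
    refine ⟨Q, hQ, fun S hS => ?_⟩
    obtain ⟨q, hq, hqS⟩ := hQ' (S.image (perturb a (δ k)))
      (Finset.image_subset_image (Finset.subset_univ _)) (by
        rw [Finset.card_image_of_injective _ hinj, Finset.card_image_of_injective _ hinj,
          Finset.card_univ, Fintype.card_fin]
        exact hS)
    refine ⟨q, hq, ?_⟩
    rwa [Finset.coe_image] at hqS
  choose Q hQ hQ' using hNn
  have hN0 : 0 ≤ N := (Nat.cast_nonneg _).trans (hQ 0)
  obtain ⟨M, hM⟩ : ∃ M : ℝ, ∀ k i, b k i ∈ Metric.closedBall (0 : ℝ × ℝ) M := by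
    have h1 : ∀ i, ∃ M : ℝ, ∀ k, ‖b k i‖ ≤ M := fun i => by
      obtain ⟨M, hM⟩ := (hblim i).norm.bddAbove_range
      exact ⟨M, fun k => hM ⟨k, rfl⟩⟩
    choose M hM using h1
    refine ⟨∑ i, |M i|, fun k i => ?_⟩
    rw [mem_closedBall_zero_iff]
    exact (hM i k).trans ((le_abs_self _).trans
      (Finset.single_le_sum (f := fun i => |M i|) (fun _ _ => abs_nonneg _) (Finset.mem_univ i)))
  have hM0 : 0 ≤ M := by
    have := hM 0 ⟨0, hn⟩
    rw [mem_closedBall_zero_iff] at this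
    exact (norm_nonneg _).trans this
  -- All nets are listed by the same `⌊N⌋` indices inside one ball containing the hulls; 0 stands in
  -- for missing points and for points outside the ball. Each index then has a limit along an
  -- ultrafilter.
  have henum : ∀ k, ∃ f : Fin ⌊N⌋₊ → ℝ × ℝ, (∀ i, f i ∈ Metric.closedBall (0 : ℝ × ℝ) M) ∧
      ∀ q ∈ Q k, q ∈ Metric.closedBall (0 : ℝ × ℝ) M → ∃ i, f i = q := by
    intro k
    have hc : (Q k).card ≤ ⌊N⌋₊ := Nat.le_floor (hQ k)
    refine ⟨fun i => if h : (i:ℕ) < (Q k).card then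
      (if ((Q k).equivFin.symm ⟨i, h⟩ : ℝ × ℝ) ∈ Metric.closedBall (0 : ℝ × ℝ) M then
        ((Q k).equivFin.symm ⟨i, h⟩ : ℝ × ℝ) else 0) else 0, fun i => ?_, fun q hq hqM => ?_⟩
    · have h0 : (0 : ℝ × ℝ) ∈ Metric.closedBall (0 : ℝ × ℝ) M := by simpa using hM0
      beta_reduce
      split_ifs with h1 h2
      · exact h2
      · exact h0
      · exact h0
    · refine ⟨⟨(Q k).equivFin ⟨q, hq⟩, lt_of_lt_of_le (Fin.is_lt _) hc⟩, ?_⟩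
      simp [hqM]
  choose f hfM hf using henum
  have hlim : ∀ i, ∃ q, Filter.Tendsto (fun k => f k i) (Filter.hyperfilter ℕ : Filter ℕ) (nhds q) := by
    intro i
    obtain ⟨q, -, hq⟩ := (isCompact_closedBall (0 : ℝ × ℝ) M).ultrafilter_le_nhds
      ((Filter.hyperfilter ℕ).map (fun k => f k i)) (by
        rw [Filter.le_principal_iff]
        exact Filter.mem_map.2 (Filter.univ_mem' fun k => hfM k i))
    exact ⟨q, hq⟩
  choose q hq using hlim
  refine ⟨Finset.univ.image q, ?_, fun S hS => ?_⟩
  · have h1 : (Finset.univ.image q).card ≤ ⌊N⌋₊ :=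
      Finset.card_image_le.trans (by simp)
    exact (Nat.cast_le.2 h1).trans (Nat.floor_le hN0)
  · have hev : ∀ᶠ k in (Filter.hyperfilter ℕ : Filter ℕ), ∃ i, f k i ∈ convexHull ℝ (b k '' S) := by
      refine Filter.Eventually.of_forall fun k => ?_
      obtain ⟨z, hz, hzS⟩ := hQ' k S hS
      have hzM : z ∈ Metric.closedBall (0 : ℝ × ℝ) M := by
        refine convexHull_min ?_ (convex_closedBall _ _) hzS
        rintro _ ⟨i, -, rfl⟩
        exact hM k i
      obtain ⟨i, hi⟩ := hf k z hz hzM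
      exact ⟨i, hi ▸ hzS⟩
    -- The ultrafilter selects one index that works for almost all `k`. If its limit were outside
    -- the hull of `a '' S`, a strictly separating functional would still separate for almost all
    -- `k`.
    obtain ⟨i, hi⟩ := Ultrafilter.eventually_exists_iff.1 hev
    refine ⟨q i, Finset.mem_image_of_mem _ (Finset.mem_univ _), ?_⟩
    by_contra hcon
    have hfin : (a '' (S : Set (Fin n))).Finite := (Finset.finite_toSet S).image a
    obtain ⟨φ, c, h1, h2⟩ := geometric_hahn_banach_closed_point (convex_convexHull ℝ _)
      (hfin.isClosed_convexHull ℝ) hcon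
    have hev1 : ∀ᶠ k in (Filter.hyperfilter ℕ : Filter ℕ), ∀ j ∈ S, φ (b k j) < c := by
      rw [Filter.eventually_all_finset]
      intro j hj
      have h3 : φ (a j) < c := h1 _ (subset_convexHull ℝ _ ⟨j, hj, rfl⟩)
      exact Nat.hyperfilter_le_atTop (((φ.continuous.tendsto _).comp (hblim j)).eventually
        (gt_mem_nhds h3))
    have hev2 : ∀ᶠ k in (Filter.hyperfilter ℕ : Filter ℕ), c < φ (f k i) :=
      ((φ.continuous.tendsto _).comp (hq i)).eventually (lt_mem_nhds h2)
    obtain ⟨k, hk1, hk2, hk3⟩ := (hi.and (hev1.and hev2)).exists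
    have hsub : convexHull ℝ (b k '' S) ⊆ {p | φ p < c} := by
      refine convexHull_min ?_ (convex_halfSpace_lt φ.toLinearMap.isLinear c)
      rintro _ ⟨j, hj, rfl⟩
      exact hk2 j hj
    exact lt_asymm hk3 (hsub hk1)

/-- A convex set contains the hull of its points of `P`, so it suffices to pierce hulls of heavy
subsets. -/
theorem NetBound.exists_isWeakNet {ε N : ℝ} (hε : 0 < ε) (hNB : NetBound (1 / ε) N)
    (P : Finset (EuclideanSpace ℝ (Fin 2))) (hP : P.Nonempty) :
    ∃ Q : Finset (EuclideanSpace ℝ (Fin 2)), (Q.card : ℝ) ≤ N ∧ IsWeakNet P ε Q := by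
  classical
  let L : ℝ × ℝ →ₗ[ℝ] EuclideanSpace ℝ (Fin 2) :=
    { toFun := fun p => !₂[p.1, p.2]
      map_add' := fun p q => by ext i; fin_cases i <;> simp
      map_smul' := fun c p => by ext i; fin_cases i <;> simp }
  let e := P.equivFin
  let a : Fin P.card → ℝ × ℝ := fun i =>
    ((e.symm i : EuclideanSpace ℝ (Fin 2)) 0, (e.symm i : EuclideanSpace ℝ (Fin 2)) 1)
  have hLa : ∀ i, L (a i) = e.symm i := fun i => by ext j; fin_cases j <;> simp [L, a]
  obtain ⟨Q, hQ, hQ'⟩ := hNB.exists_net hP.card_pos a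
  refine ⟨Q.image L, (Nat.cast_le.2 Finset.card_image_le).trans hQ, fun K hK hheavy => ?_⟩
  let S : Finset (Fin P.card) :=
    Finset.univ.filter fun i => (e.symm i : EuclideanSpace ℝ (Fin 2)) ∈ K
  have hS : ((P : Set (EuclideanSpace ℝ (Fin 2))) ∩ K).ncard ≤ S.card := by
    have hsub : (P : Set (EuclideanSpace ℝ (Fin 2))) ∩ K ⊆
        (S.image fun i => (e.symm i : EuclideanSpace ℝ (Fin 2)) : Finset _) := by
      rintro p ⟨hp, hpK⟩
      refine Finset.mem_coe.2 (Finset.mem_image.2 ⟨e ⟨p, hp⟩, ?_, by simp⟩)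
      simpa [S] using hpK
    refine (Set.ncard_le_ncard hsub (Finset.finite_toSet _)).trans ?_
    rw [Set.ncard_coe_finset]
    exact Finset.card_image_le
  have hle : (P.card : ℝ) ≤ 1 / ε * S.card := by
    have h1 : ε * (P.card : ℝ) ≤ S.card := le_trans hheavy (Nat.cast_le.2 hS)
    rw [one_div, ← div_eq_inv_mul, le_div_iff₀ hε]
    linarith
  obtain ⟨q, hq, hqS⟩ := hQ' S hle
  refine ⟨L q, Finset.mem_image_of_mem _ hq, ?_⟩
  have hmin : convexHull ℝ (a '' S) ⊆ L ⁻¹' K := by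
    refine convexHull_min ?_ (hK.linear_preimage L)
    rintro _ ⟨i, hi, rfl⟩
    rw [Set.mem_preimage, hLa]
    exact (Finset.mem_filter.1 (Finset.mem_coe.1 hi)).2
  exact hmin hqS

theorem isWeakNet_empty_of_one_lt {d : ℕ} {ε : ℝ} (hε : 1 < ε)
    (P : Finset (EuclideanSpace ℝ (Fin d))) (hP : P.Nonempty) : IsWeakNet P ε ∅ := by
  intro K _ hheavy
  exfalso
  have h1 : ((P : Set (EuclideanSpace ℝ (Fin d))) ∩ K).ncard ≤ P.card := by
    rw [← Set.ncard_coe_finset P]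
    exact Set.ncard_le_ncard Set.inter_subset_left (Finset.finite_toSet _)
  have h2 : (((P : Set (EuclideanSpace ℝ (Fin d))) ∩ K).ncard : ℝ) ≤ P.card := Nat.cast_le.2 h1
  have h3 : (0 : ℝ) < P.card := Nat.cast_pos.2 hP.card_pos
  have h4 : ε * (P.card : ℝ) ≤ P.card := le_trans hheavy h2
  nlinarith

/-- The witness is `⌊N⌋`; the bound `1 ≤ N` makes it positive, as the definition demands. -/
theorem weakNetNumber_le {d : ℕ} {ε N : ℝ} (hN : 1 ≤ N)
    (h : ∀ P : Finset (EuclideanSpace ℝ (Fin d)), P.Nonempty →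
      ∃ Q : Finset (EuclideanSpace ℝ (Fin d)), (Q.card : ℝ) ≤ N ∧ IsWeakNet P ε Q) :
    (weakNetNumber d ε : ENNReal) ≤ ENNReal.ofReal N := by
  have hle : weakNetNumber d ε ≤ (⌊N⌋₊ : ℕ∞) := by
    refine sInf_le ⟨?_, fun P hP => ?_⟩
    · exact_mod_cast Nat.floor_pos.2 hN
    · obtain ⟨Q, hQ, hQ'⟩ := h P hP
      exact ⟨Q, Nat.cast_le.2 (Nat.le_floor hQ), hQ'⟩
  refine (ENat.toENNReal_le.2 hle).trans ?_
  rw [ENat.toENNReal_coe, ← ENNReal.ofReal_natCast]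
  exact ENNReal.ofReal_le_ofReal (Nat.floor_le (zero_le_one.trans hN))

theorem theorem1 (γ : ℝ) (hγ : 0 < γ) :
    ∃ C : ℝ, 0 < C ∧
      (∀ ε : ℝ, 0 < ε → ε ≤ 1 →
        (weakNetNumber 2 ε : ENNReal) ≤ ENNReal.ofReal (C / ε ^ ((3 : ℝ) / 2 + γ))) ∧
      (∀ ε : ℝ, 0 < ε → ∀ P : Finset (EuclideanSpace ℝ (Fin 2)), P.Nonempty →
        ∃ Q : Finset (EuclideanSpace ℝ (Fin 2)),
          (Q.card : ℝ) ≤ C / ε ^ ((3 : ℝ) / 2 + γ) ∧ IsWeakNet P ε Q) := by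
  -- The recursion requires `γ ≤ 1`, and a smaller exponent only strengthens the bound for `ε ≤ 1`.
  -- For `ε > 1` nothing is heavy and the empty net suffices.
  obtain ⟨C, hC1, hC⟩ := exists_netBound_rpow (min γ 1) (lt_min hγ one_pos) (min_le_right _ _)
  have hC0 : 0 < C := one_pos.trans_le hC1
  have hnet : ∀ ε : ℝ, 0 < ε → ∀ P : Finset (EuclideanSpace ℝ (Fin 2)), P.Nonempty →
      ∃ Q : Finset (EuclideanSpace ℝ (Fin 2)),
        (Q.card : ℝ) ≤ C / ε ^ ((3 : ℝ) / 2 + γ) ∧ IsWeakNet P ε Q := by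
    intro ε hε P hP
    rcases le_or_gt ε 1 with h1 | h1
    · have hx : 1 ≤ 1 / ε := by rwa [le_div_iff₀ hε, one_mul]
      refine ((hC (1 / ε) hx).mono le_rfl ?_).exists_isWeakNet hε P hP
      calc C * (1 / ε) ^ ((3 : ℝ) / 2 + min γ 1) ≤ C * (1 / ε) ^ ((3 : ℝ) / 2 + γ) := by
            refine mul_le_mul_of_nonneg_left (Real.rpow_le_rpow_of_exponent_le hx ?_) hC0.le
            have := min_le_left γ 1
            linarith
        _ = C / ε ^ ((3 : ℝ) / 2 + γ) := by
            rw [one_div, Real.inv_rpow hε.le, ← div_eq_mul_inv]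
    · exact ⟨∅, by rw [Finset.card_empty, Nat.cast_zero]; positivity,
        isWeakNet_empty_of_one_lt h1 P hP⟩
  refine ⟨C, hC0, fun ε hε h1 => weakNetNumber_le ?_ (hnet ε hε), hnet⟩
  rw [le_div_iff₀ (Real.rpow_pos_of_pos hε _), one_mul]
  exact (Real.rpow_le_one hε.le h1 (by linarith)).trans hC1
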